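/- Let $\mathfrak g$ be a finite-dimensional complex semisimple Lie algebra with Cartan subalgebra $\mathfrak h$, simple roots $\alpha_1,\dots,\alpha_l$, coroots $H_1,\dots,H_l$ and triangular decomposition $\mathfrak g=\overline{\mathfrak n}\oplus\mathfrak h\oplus\mathfrak n$. Let $d_1,\dots,d_l$ be coprime positive integers symmetrizing the Cartan matrix $(a_{ij})$, and let $(\cdot,\cdot)$ be a nondegenerate invariant symmetric form on $\mathfrak g$ with $(H_i,H_j)=d_j^{-1}a_{ij}$. Let $G$ be the connected simply connected complex group with Lie algebra $\mathfrak g$, realized as a linear group; $H=\exp\mathfrak h$, $N=\exp\mathfrak n$, $\overline N=\exp\overline{\mathfrak n}$; and let $\mathcal G,\mathcal H,\mathcal N,\overline{\mathcal N}$ be the corresponding formal loop groups (points over $\mathbb C((z))$ and, functorially, over $R((z))$ for commutative $\mathbb C$-algebras $R$). Fix $0<|p|<1$ and put $(D_pg)(z)=g(pz)$; let $s=s_1\cdots s_l$ be a Coxeter element with a representative in $G$, $s(h)=shs^{-1}$. Put $\langle X,Y\rangle=\mathrm{Res}_{z=0}(X(z),Y(z))\,dz/z$ on $\mathfrak g((z))$,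 and $$r=P_{\overline{\mathfrak n}((z))}-P_{\mathfrak n((z))}+\frac{1+sD_p}{1-sD_p}P_{\mathfrak h((z))},\qquad r_\pm=\tfrac12(r\pm 1).$$ Let $\mathcal G_p'\subset\mathcal G$ consist of the $L$ admitting a twisted factorization $L=L_+^{D_p}L_-^{-1}$ with $L_\pm=h_\pm n_\pm$, $h_\pm\in\mathcal H$, $n_+\in\overline{\mathcal N}$, $n_-\in\mathcal N$, $h_-=s(h_+^{D_p})$. Let $C^\infty(\mathcal G_p')$ be the algebra of functions on $\mathcal G_p'$ in the formal sense: functions $\mathcal G_p'(R)\to R$ on all $R$-points, natural in $R$, that have at every point a left gradient $\nabla\varphi$ and a right gradient $\nabla'\varphi$ in the loop algebra, $\varphi(e^{\varepsilon\xi}L)=\varphi(L)+\varepsilon\langle\nabla\varphi(L),\xi\rangle$ and $\varphi(Le^{\varepsilon\xi})=\varphi(L)+\varepsilon\langle\nabla'\varphi(L),\xi\rangle$ with $\varepsilon^2=0$. Equip it with the bracket $$\{\varphi,\psi\}=\langle r\nabla\varphi,\nabla\psi\rangle+\langle r\nabla'\varphi,\nabla'\psi\rangle-2\langle D_pr_+\nabla'\varphi,\nabla\psi\rangle-2\langle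 r_-D_p^{-1}\nabla\varphi,\nabla'\psi\rangle .$$ Then $n_+$ depends only on $L$, so that $\mu_{\mathcal N}:\mathcal G_p'\to\overline{\mathcal N}$, $\mu_{\mathcal N}(L)=n_+$, is well defined. Let $F$ be the algebra generated by the matrix coefficients of $\mu_{\mathcal N}$, that is, by the functions $L\mapsto$ (coefficient of $z^k$ in $P(\mu_{\mathcal N}(L)(z))$) with $P$ a regular function on $\overline N$ and $k\in\mathbb Z$. (i) $F$ is a Poisson subalgebra of $C^\infty(\mathcal G_p')$: it is contained in $C^\infty(\mathcal G_p')$ and closed under $\{\cdot,\cdot\}$. (ii) Let $f=w_0u_l\cdots u_1w_0^{-1}\in\overline N$, where $w_0\in G$ represents the longest element of the Weyl group and $u_i\neq1$ lies in the one-parameter subgroup of the root $-w_0\alpha_i$. Then there is exactly one algebra homomorphism $\chi_f:F\to\mathbb C$ with $\chi_f(\mu_{\mathcal N})=f$, i.e. sending the matrix coefficient given by $P$ and $k$ to the coefficient of $z^k$ in the constant $P(f)$, and $\chi_f$ is a character of the Poisson algebra $F$: $\chi_f(\{\varphi,\psi\})=0$ for all $\varphi,\psi\in F$. Thus $(F,\chi_f)$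 is a system of first-class constraints. -/

import Mathlib

open scoped TensorProduct Matrix

noncomputable section

namespace DrinfeldSokolov

/-! ## Triangular decomposition of a complex semisimple Lie algebra -/

section Triangular

variable {𝔤 : Type*} [LieRing 𝔤] [LieAlgebra ℂ 𝔤] [FiniteDimensional ℂ 𝔤]
variable (H : LieSubalgebra ℂ 𝔤) [H.IsCartanSubalgebra]

/-- The sum of the weight spaces of the Cartan subalgebra `H` in `𝔤` for the weights in `S`. -/
def weightSum (S : Set (LieModule.Weight ℂ H 𝔤)) : Submodule ℂ 𝔤 :=
  ⨆ χ ∈ S, (LieModule.genWeightSpace 𝔤 (χ : H → ℂ)).toSubmodule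

theorem isCompl_weightSum (S : Set (LieModule.Weight ℂ H 𝔤)) :
    IsCompl (weightSum H S) (weightSum H Sᶜ) := by
  have hind : iSupIndep fun χ : LieModule.Weight ℂ H 𝔤 =>
      (LieModule.genWeightSpace 𝔤 (χ : H → ℂ)).toSubmodule :=
    LieSubmodule.iSupIndep_toSubmodule.mpr (LieModule.iSupIndep_genWeightSpace' ℂ H 𝔤)
  have htop : ⨆ χ : LieModule.Weight ℂ H 𝔤,
      (LieModule.genWeightSpace 𝔤 (χ : H → ℂ)).toSubmodule = ⊤ := by
    rw [← LieSubmodule.iSup_toSubmodule, LieModule.iSup_genWeightSpace_eq_top' ℂ H 𝔤,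
      LieSubmodule.top_toSubmodule]
  refine ⟨hind.disjoint_biSup_biSup disjoint_compl_right, codisjoint_iff.mpr (top_unique ?_)⟩
  rw [← htop]
  refine iSup_le fun χ => ?_
  by_cases h : χ ∈ S
  · exact le_sup_of_le_left (le_biSup (f := fun χ : LieModule.Weight ℂ H 𝔤 =>
      (LieModule.genWeightSpace 𝔤 (χ : H → ℂ)).toSubmodule) h)
  · exact le_sup_of_le_right (le_biSup (f := fun χ : LieModule.Weight ℂ H 𝔤 =>
      (LieModule.genWeightSpace 𝔤 (χ : H → ℂ)).toSubmodule) h)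

/-- The projection of `𝔤` onto the weight spaces with weights in `S`, along the other ones. -/
def weightProj (S : Set (LieModule.Weight ℂ H 𝔤)) : Module.End ℂ 𝔤 :=
  Submodule.projection _ _ (isCompl_weightSum H S)

theorem isCompl_cartan :
    IsCompl H.toSubmodule (weightSum H {χ | χ.IsNonZero}) := by
  have hz : weightSum H {χ | χ.IsNonZero}ᶜ = H.toSubmodule := by
    have h0 : (LieModule.genWeightSpace 𝔤 (0 : H → ℂ)).toSubmodule = H.toSubmodule := by
      have := LieAlgebra.zeroRootSubalgebra_eq_of_is_cartan ℂ 𝔤 H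
      have h2 := LieAlgebra.coe_zeroRootSubalgebra ℂ 𝔤 H
      rw [this] at h2
      exact h2.symm
    apply le_antisymm
    · refine iSup₂_le fun χ hχ => ?_
      have : (χ : H → ℂ) = 0 := by simpa using hχ
      rw [this, h0]
    · rw [← h0]
      by_cases hb : LieModule.genWeightSpace 𝔤 (0 : H → ℂ) = ⊥
      · rw [hb]; simp
      · exact le_biSup (f := fun χ : LieModule.Weight ℂ H 𝔤 =>
          (LieModule.genWeightSpace 𝔤 (χ : H → ℂ)).toSubmodule)
          (i := ⟨0, hb⟩) (by simp [LieModule.Weight.IsZero])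
  have := (isCompl_weightSum H {χ : LieModule.Weight ℂ H 𝔤 | χ.IsNonZero}).symm
  rwa [hz] at this

/-- The projection `P_𝔥` of `𝔤` onto the Cartan subalgebra along the sum of the root spaces. -/
def cartanProj : 𝔤 →ₗ[ℂ] H := Submodule.projectionOnto _ _ (isCompl_cartan H)

end Triangular


/-! ## Points of linear groups over commutative algebras, and loops -/

section Points

variable {m : ℕ}

/-- The value of a complex polynomial `P` in the `m²` matrix entries at a matrix `g` over `S`, where
the scalars are mapped to `S` by `j`. -/
def evalEntries {S : Type} [CommRing S] (j : ℂ →+* S) (g : Matrix (Fin m) (Fin m) S)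
    (P : MvPolynomial (Fin m × Fin m) ℂ) : S :=
  MvPolynomial.eval₂ j (fun ij => g ij.1 ij.2) P

/-- The points over a commutative `ℂ`-algebra `S` (with structure map `j`) of the Zariski closure of
a set `Γ` of complex matrices: the matrices over `S` that annihilate every complex polynomial
vanishing on `Γ`. -/
def zariskiPoints (Γ : Set (Matrix (Fin m) (Fin m) ℂ)) {S : Type} [CommRing S] (j : ℂ →+* S) :
    Set (Matrix (Fin m) (Fin m) S) :=
  {g | ∀ P : MvPolynomial (Fin m × Fin m) ℂ,
    (∀ γ ∈ Γ, evalEntries (RingHom.id ℂ) γ P = 0) → evalEntries j g P = 0}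

/-- The inclusion of the constants `ℂ → R((z))`. -/
def constHom (R : Type) [CommRing R] [Algebra ℂ R] : ℂ →+* LaurentSeries R :=
  HahnSeries.C.comp (algebraMap ℂ R)

/-- The points over `R` of the loop group of (the Zariski closure of) `Γ`, that is, the points of
`Γ` over the ring `R((z))`. -/
def loopPoints (Γ : Set (Matrix (Fin m) (Fin m) ℂ)) (R : Type) [CommRing R] [Algebra ℂ R] :
    Set (Matrix (Fin m) (Fin m) (LaurentSeries R)) :=
  zariskiPoints Γ (constHom R)

/-- The substitution `a(z) ↦ a(pz)` on `R((z))`. -/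
def shift (p : ℂ) {R : Type} [CommRing R] [Algebra ℂ R] (a : LaurentSeries R) : LaurentSeries R :=
  ⟨fun k => p ^ k • a.coeff k, a.isPWO_support'.mono fun k hk h => hk (by simp [h])⟩

/-- The automorphism `D_p`, `(D_p g)(z) = g(pz)`, on matrices of Laurent series. -/
def shiftMatrix (p : ℂ) {R : Type} [CommRing R] [Algebra ℂ R]
    (g : Matrix (Fin m) (Fin m) (LaurentSeries R)) : Matrix (Fin m) (Fin m) (LaurentSeries R) :=
  g.map (shift p)

/-- A complex matrix as a constant loop. -/
def constLoop (R : Type) [CommRing R] [Algebra ℂ R] (g : Matrix (Fin m) (Fin m) ℂ) :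
    Matrix (Fin m) (Fin m) (LaurentSeries R) :=
  g.map (constHom R)

/-- Extension of scalars of a loop along a homomorphism `R → S`. -/
def extendLoop {R S : Type} [CommRing R] [Algebra ℂ R] [CommRing S] [Algebra ℂ S] (j : R →ₐ[ℂ] S)
    (g : Matrix (Fin m) (Fin m) (LaurentSeries R)) : Matrix (Fin m) (Fin m) (LaurentSeries S) :=
  g.map fun a => HahnSeries.map a j

end Points

/-! ## The loop algebra `𝔤((z))` over a test algebra `R` -/

section LoopAlgebra

variable {𝔤 : Type*} [LieRing 𝔤] [LieAlgebra ℂ 𝔤]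

/-- `(R ⊗ 𝔤)((z))`. -/
abbrev LoopAlg (𝔤 : Type*) [LieRing 𝔤] [LieAlgebra ℂ 𝔤] (R : Type) [CommRing R] [Algebra ℂ R] :
    Type _ :=
  HahnSeries ℤ (R ⊗[ℂ] 𝔤)

/-- The operator `∑ Xₖ zᵏ ↦ ∑ Tₖ(Xₖ) zᵏ` on the loop algebra. -/
def modeOp (T : ℤ → Module.End ℂ 𝔤) {R : Type} [CommRing R] [Algebra ℂ R] (X : LoopAlg 𝔤 R) :
    LoopAlg 𝔤 R :=
  ⟨fun k => (T k).baseChange R (X.coeff k), X.isPWO_support'.mono fun k hk h => hk (by simp [h])⟩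

/-- The scalar product `⟨X, Y⟩ = Res_{z=0} (X(z), Y(z)) dz/z`. -/
def pairing (B : LinearMap.BilinForm ℂ 𝔤) {R : Type} [CommRing R] [Algebra ℂ R]
    (X Y : LoopAlg 𝔤 R) : R :=
  ∑ᶠ k : ℤ, LinearMap.BilinForm.baseChange R B (X.coeff k) (Y.coeff (-k))

theorem pairing_support_finite (B : LinearMap.BilinForm ℂ 𝔤) {R : Type} [CommRing R] [Algebra ℂ R]
    (X Y : LoopAlg 𝔤 R) :
    (Function.support fun k : ℤ =>
      LinearMap.BilinForm.baseChange R B (X.coeff k) (Y.coeff (-k))).Finite := by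
  have hfin := Set.AddAntidiagonal.finite_of_isPWO X.isPWO_support Y.isPWO_support (0 : ℤ)
  refine (hfin.image Prod.fst).subset fun k hk => ?_
  refine ⟨(k, -k), ⟨?_, ?_, by simp⟩, rfl⟩
  · intro h
    exact hk (by simp only [h, map_zero, LinearMap.zero_apply])
  · intro h
    exact hk (by simp only [h, map_zero])

theorem pairing_add_left (B : LinearMap.BilinForm ℂ 𝔤) {R : Type} [CommRing R] [Algebra ℂ R]
    (X X' Y : LoopAlg 𝔤 R) : pairing B (X + X') Y = pairing B X Y + pairing B X' Y := by
  unfold pairing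
  rw [← finsum_add_distrib (pairing_support_finite B X Y) (pairing_support_finite B X' Y)]
  exact finsum_congr fun k => by simp only [HahnSeries.coeff_add, map_add, LinearMap.add_apply]

theorem pairing_smul_left (B : LinearMap.BilinForm ℂ 𝔤) {R : Type} [CommRing R] [Algebra ℂ R]
    (c : R) (X Y : LoopAlg 𝔤 R) : pairing B (c • X) Y = c * pairing B X Y := by
  unfold pairing
  rw [mul_finsum' _ _ (pairing_support_finite B X Y)]
  exact finsum_congr fun k => by
    simp only [HahnSeries.coeff_smul, map_smul, LinearMap.smul_apply, smul_eq_mul]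

theorem pairing_zero_left (B : LinearMap.BilinForm ℂ 𝔤) {R : Type} [CommRing R] [Algebra ℂ R]
    (Y : LoopAlg 𝔤 R) : pairing B 0 Y = 0 := by
  unfold pairing
  simp

variable {m : ℕ} (ρ : 𝔤 →ₗ[ℂ] Matrix (Fin m) (Fin m) ℂ)

/-- The matrix over `R` of an element of `R ⊗ 𝔤` in the representation `ρ`. -/
def repMatrixOver (R : Type) [CommRing R] [Algebra ℂ R] :
    R ⊗[ℂ] 𝔤 →ₗ[R] Matrix (Fin m) (Fin m) R :=
  LinearMap.liftBaseChange R ((Algebra.linearMap ℂ R).mapMatrix ∘ₗ ρ)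

/-- The infinitesimal one-parameter group `e^{εξ} = 1 + εξ`, `ε² = 0`, generated by a loop `ξ`: a
matrix over `R[ε]((z))`. -/
def infinitesimal {R : Type} [CommRing R] [Algebra ℂ R] (ξ : LoopAlg 𝔤 R) :
    Matrix (Fin m) (Fin m) (LaurentSeries (DualNumber R)) :=
  1 + Matrix.of fun i j =>
    ⟨fun k => TrivSqZeroExt.inr (repMatrixOver ρ R (ξ.coeff k) i j),
      ξ.isPWO_support'.mono fun k hk h => hk (by simp [h])⟩

end LoopAlgebra

/-! ## The groups `G`, `H`, `N`, `N̄`, the Coxeter element -/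

section Groups

variable {𝔤 : Type*} [LieRing 𝔤] [LieAlgebra ℂ 𝔤] {m : ℕ}
variable (ρ : 𝔤 →ₗ[ℂ] Matrix (Fin m) (Fin m) ℂ)

/-- The connected linear Lie group with Lie algebra `ρ(𝔤)`. -/
def lieGroup : Subgroup (GL (Fin m) ℂ) :=
  Subgroup.closure
    {g | ∃ X : 𝔤, (g : Matrix (Fin m) (Fin m) ℂ) = NormedSpace.exp (ρ X)}

/-- The same group as a set of matrices. -/
def lieGroupSet : Set (Matrix (Fin m) (Fin m) ℂ) :=
  {g | ∃ g' ∈ lieGroup ρ, (g' : Matrix (Fin m) (Fin m) ℂ) = g}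

/-- `exp W` for a subspace `W` of `𝔤`. -/
def expSet (W : Submodule ℂ 𝔤) : Set (Matrix (Fin m) (Fin m) ℂ) :=
  {g | ∃ X ∈ W, g = NormedSpace.exp (ρ X)}

variable [FiniteDimensional ℂ 𝔤] [LieAlgebra.IsSemisimple ℂ 𝔤]
variable {H : LieSubalgebra ℂ 𝔤} [H.IsCartanSubalgebra]

/-- `g ∈ G` represents the transformation `w` of the Cartan subalgebra. -/
def Represents (g : GL (Fin m) ℂ) (w : H ≃ₗ[ℂ] H) : Prop :=
  g ∈ lieGroup ρ ∧ ∀ h : H,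
    (g : Matrix (Fin m) (Fin m) ℂ) * ρ (h : 𝔤) * (g⁻¹ : GL (Fin m) ℂ) =
      ρ (w h : 𝔤)

/-- The group generated by exponentials of `ρ(𝔤)` is simply connected: every integral weight is an
integral combination of weights of the representation `ρ`. -/
def IsSimplyConnectedRep (H : LieSubalgebra ℂ 𝔤) [H.IsCartanSubalgebra] : Prop :=
  ∀ χ : Module.Dual ℂ H,
    (∀ α : H.root, ∃ k : ℤ, χ ((LieAlgebra.IsKilling.rootSystem H).coroot α) = k) →
      χ ∈ AddSubgroup.closure
        {ν : Module.Dual ℂ H | ∃ v : Fin m → ℂ, v ≠ 0 ∧ ∀ h : H, ρ (h : 𝔤) *ᵥ v = ν h • v}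

variable (b : (LieAlgebra.IsKilling.rootSystem H).Base)

/-- The positive weights (roots) of `𝔤`. -/
def posWeights : Set (LieModule.Weight ℂ H 𝔤) := {χ | ∃ i : H.root, b.IsPos i ∧ χ = i.1}

/-- The negative weights (roots) of `𝔤`. -/
def negWeights : Set (LieModule.Weight ℂ H 𝔤) := {χ | ∃ i : H.root, ¬ b.IsPos i ∧ χ = i.1}

/-- The nilradical `𝔫` of the positive Borel subalgebra. -/
def nilPos : Submodule ℂ 𝔤 := weightSum H (posWeights b)

/-- The nilradical `𝔫̄` of the opposite Borel subalgebra. -/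
def nilNeg : Submodule ℂ 𝔤 := weightSum H (negWeights b)

variable {l : ℕ} (e : Fin l ≃ b.support)

/-- The Coxeter element `s = s₁ ⋯ s_l`, acting on the Cartan subalgebra. -/
def coxeter : H ≃ₗ[ℂ] H :=
  (List.ofFn fun i => (LieAlgebra.IsKilling.rootSystem H).coreflection (e i)).prod

/-- The Weyl group, acting on the Cartan subalgebra. -/
def weylGroup (H : LieSubalgebra ℂ 𝔤) [H.IsCartanSubalgebra] : Subgroup (H ≃ₗ[ℂ] H) :=
  Subgroup.closure (Set.range (LieAlgebra.IsKilling.rootSystem H).coreflection)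

/-- `w` is the longest element of the Weyl group: it maps all positive roots to negative ones. -/
def IsLongest (w : H ≃ₗ[ℂ] H) : Prop :=
  w ∈ weylGroup H ∧ ∀ i : H.root, b.IsPos i → ∃ j : H.root, b.IsPos j ∧
    ∀ h : H, (LieAlgebra.IsKilling.rootSystem H).root j h =
      -(LieAlgebra.IsKilling.rootSystem H).root i (w⁻¹ h)

end Groups

/-! ## The setting -/

/-- The data and the standing assumptions of the reduction for the semisimple Lie algebra `𝔤` of
rank `l` with Cartan subalgebra `H`. -/
structure Setting (𝔤 : Type*) [LieRing 𝔤] [LieAlgebra ℂ 𝔤] [FiniteDimensional ℂ 𝔤]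
    [LieAlgebra.IsSemisimple ℂ 𝔤] (H : LieSubalgebra ℂ 𝔤) [H.IsCartanSubalgebra] (l m : ℕ) where
  /-- a system of simple roots -/
  base : (LieAlgebra.IsKilling.rootSystem H).Base
  /-- the numbering `α₁, …, α_l` of the simple roots -/
  simple : Fin l ≃ base.support
  /-- the coprime positive integers symmetrizing the Cartan matrix -/
  d : Fin l → ℕ
  d_pos : ∀ i, 0 < d i
  d_coprime : 0 < l → Finset.univ.gcd d = 1
  d_symm : ∀ i j,
    (d i : ℂ) * (LieAlgebra.IsKilling.rootSystem H).pairing (simple j) (simple i) =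
      d j * (LieAlgebra.IsKilling.rootSystem H).pairing (simple i) (simple j)
  /-- the normalized nondegenerate invariant form `(·,·)` on `𝔤` -/
  form : LinearMap.BilinForm ℂ 𝔤
  form_symm : form.IsSymm
  form_nondegenerate : form.Nondegenerate
  form_invariant : ∀ X Y Z : 𝔤, form ⁅X, Y⁆ Z = form X ⁅Y, Z⁆
  form_coroot : ∀ i j,
    form ((LieAlgebra.IsKilling.rootSystem H).coroot (simple i) : 𝔤)
        ((LieAlgebra.IsKilling.rootSystem H).coroot (simple j) : 𝔤) =
      (d j : ℂ)⁻¹ * (LieAlgebra.IsKilling.rootSystem H).pairing (simple j) (simple i)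
  /-- a representation that realizes the simply connected group as a linear group -/
  ρ : 𝔤 →ₗ[ℂ] Matrix (Fin m) (Fin m) ℂ
  ρ_lie : ∀ X Y : 𝔤, ρ ⁅X, Y⁆ = ρ X * ρ Y - ρ Y * ρ X
  simply_connected : IsSimplyConnectedRep ρ H
  /-- the parameter of the loop automorphism `g(z) ↦ g(pz)` -/
  p : ℂ
  p_ne_zero : p ≠ 0
  p_norm_lt_one : ‖p‖ < 1
  /-- a representative in `G` of the Coxeter element `s = s₁ ⋯ s_l` -/
  sRep : GL (Fin m) ℂ
  sRep_represents : Represents ρ sRep (coxeter base simple)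

namespace Setting

variable {𝔤 : Type*} [LieRing 𝔤] [LieAlgebra ℂ 𝔤] [FiniteDimensional ℂ 𝔤]
  [LieAlgebra.IsSemisimple ℂ 𝔤] {H : LieSubalgebra ℂ 𝔤} [H.IsCartanSubalgebra] {l m : ℕ}
  (D : Setting 𝔤 H l m)

/-! ### The r-matrix -/

/-- The action of `θ = s · D_p` on the coefficient of `zᵏ` in `𝔥((z))`. -/
def theta (k : ℤ) : Module.End ℂ H := D.p ^ k • (coxeter D.base D.simple).toLinearMap

/-- The action of the r-matrix `P_𝔫̄ - P_𝔫 + ((1 + θ) / (1 - θ)) P_𝔥` on the coefficient of `zᵏ`. -/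
def rMode (k : ℤ) : Module.End ℂ 𝔤 :=
  weightProj H (negWeights D.base) - weightProj H (posWeights D.base) +
    H.toSubmodule.subtype ∘ₗ ((1 + D.theta k) * Ring.inverse (1 - D.theta k)) ∘ₗ cartanProj H

/-- The r-matrix `r` on the loop algebra. -/
def r {R : Type} [CommRing R] [Algebra ℂ R] : LoopAlg 𝔤 R → LoopAlg 𝔤 R := modeOp D.rMode

/-- `r₊ = (r + 1) / 2`. -/
def rPlus {R : Type} [CommRing R] [Algebra ℂ R] : LoopAlg 𝔤 R → LoopAlg 𝔤 R :=
  modeOp fun k => (2⁻¹ : ℂ) • (D.rMode k + 1)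

/-- `r₋ = (r - 1) / 2`. -/
def rMinus {R : Type} [CommRing R] [Algebra ℂ R] : LoopAlg 𝔤 R → LoopAlg 𝔤 R :=
  modeOp fun k => (2⁻¹ : ℂ) • (D.rMode k - 1)

/-- The automorphism `D_p` of the loop algebra. -/
def sigma {R : Type} [CommRing R] [Algebra ℂ R] : LoopAlg 𝔤 R → LoopAlg 𝔤 R :=
  modeOp fun k => D.p ^ k • (1 : Module.End ℂ 𝔤)

/-- The automorphism `D_p⁻¹` of the loop algebra. -/
def sigmaInv {R : Type} [CommRing R] [Algebra ℂ R] : LoopAlg 𝔤 R → LoopAlg 𝔤 R :=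
  modeOp fun k => D.p ^ (-k) • (1 : Module.End ℂ 𝔤)

/-! ### The twisted factorization and the manifold `𝒢'ₚ` -/

/-- `L = L₊^{D_p} L₋⁻¹` with `L₊ = h₊ n₊`, `L₋ = h₋ n₋`, where `h₊ ∈ ℋ`, `n₊ ∈ 𝒩̄`, `n₋ ∈ 𝒩` and
`h₋ = s(h₊^{D_p})`. -/
def IsFactorization {R : Type} [CommRing R] [Algebra ℂ R]
    (L hPlus nPlus nMinus : Matrix (Fin m) (Fin m) (LaurentSeries R)) : Prop :=
  hPlus ∈ loopPoints (expSet D.ρ H.toSubmodule) R ∧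
  nPlus ∈ loopPoints (expSet D.ρ (nilNeg D.base)) R ∧
  nMinus ∈ loopPoints (expSet D.ρ (nilPos D.base)) R ∧
  L = shiftMatrix D.p (hPlus * nPlus) *
    (constLoop R (D.sRep : Matrix (Fin m) (Fin m) ℂ) * shiftMatrix D.p hPlus *
      constLoop R ((D.sRep⁻¹ : GL (Fin m) ℂ) : Matrix (Fin m) (Fin m) ℂ) * nMinus)⁻¹

/-- The points over `R` of `𝒢'ₚ`: the elements of the loop group `𝒢` that admit a twisted
factorization. -/
def GPrime (R : Type) [CommRing R] [Algebra ℂ R] : Type :=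
  {L : Matrix (Fin m) (Fin m) (LaurentSeries R) // L ∈ loopPoints (lieGroupSet D.ρ) R ∧
    ∃ hPlus nPlus nMinus, D.IsFactorization L hPlus nPlus nMinus}

/-- The map `μ_𝒩 : 𝒢'ₚ → 𝒩̄`, `L ↦ n₊`. -/
def muN {R : Type} [CommRing R] [Algebra ℂ R] (L : D.GPrime R) :
    Matrix (Fin m) (Fin m) (LaurentSeries R) :=
  L.2.2.choose_spec.choose

/-! ### Functions on `𝒢'ₚ`, gradients and the Poisson bracket -/

/-- Families of functions `𝒢'ₚ(R) → R`, where `R` runs over all commutative `ℂ`-algebras. -/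
abbrev FunFamily : Type 1 := ∀ R : CommAlgCat.{0} ℂ, D.GPrime R → R

/-- The family is compatible with extension of scalars. -/
def IsNatural (φ : D.FunFamily) : Prop :=
  ∀ (R S : CommAlgCat.{0} ℂ) (j : R →ₐ[ℂ] S) (L : D.GPrime R) (L' : D.GPrime S),
    L'.1 = extendLoop j L.1 → φ S L' = j (φ R L)

/-- `X` is the left gradient `∇φ(L)`: `φ(e^{εξ} L) = φ(L) + ε ⟨X, ξ⟩` for all loops `ξ`. -/
def IsLeftGradient (φ : D.FunFamily) (R : CommAlgCat.{0} ℂ) (L : D.GPrime R) (X : LoopAlg 𝔤 R) :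
    Prop :=
  ∀ (ξ : LoopAlg 𝔤 R) (y : D.GPrime (DualNumber R)),
    y.1 = infinitesimal D.ρ ξ * extendLoop (TrivSqZeroExt.inlAlgHom ℂ R R) L.1 →
      φ (.of ℂ (DualNumber R)) y =
        TrivSqZeroExt.inl (φ R L) + TrivSqZeroExt.inr (pairing D.form X ξ)

/-- `X` is the right gradient `∇'φ(L)`: `φ(L e^{εξ}) = φ(L) + ε ⟨X, ξ⟩` for all loops `ξ`. -/
def IsRightGradient (φ : D.FunFamily) (R : CommAlgCat.{0} ℂ) (L : D.GPrime R) (X : LoopAlg 𝔤 R) :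
    Prop :=
  ∀ (ξ : LoopAlg 𝔤 R) (y : D.GPrime (DualNumber R)),
    y.1 = extendLoop (TrivSqZeroExt.inlAlgHom ℂ R R) L.1 * infinitesimal D.ρ ξ →
      φ (.of ℂ (DualNumber R)) y =
        TrivSqZeroExt.inl (φ R L) + TrivSqZeroExt.inr (pairing D.form X ξ)

/-- The left gradient `∇φ(L)`. -/
def leftGradient (φ : D.FunFamily) (R : CommAlgCat.{0} ℂ) (L : D.GPrime R) : LoopAlg 𝔤 R :=
  Classical.epsilon (D.IsLeftGradient φ R L)

/-- The right gradient `∇'φ(L)`. -/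
def rightGradient (φ : D.FunFamily) (R : CommAlgCat.{0} ℂ) (L : D.GPrime R) : LoopAlg 𝔤 R :=
  Classical.epsilon (D.IsRightGradient φ R L)

/-- The function algebra `C^∞(𝒢'ₚ)` of the formal loop manifold `𝒢'ₚ`: the functions on all
`R`-points, compatible with extension of scalars, that have left and right gradients in the loop
algebra at every point. -/
def smoothFunctions : Subalgebra ℂ D.FunFamily where
  carrier := {φ | D.IsNatural φ ∧ ∀ R L,
    (∃ X, D.IsLeftGradient φ R L X) ∧ ∃ X, D.IsRightGradient φ R L X}
  mul_mem' := by
    rintro φ ψ ⟨hφ, hφ'⟩ ⟨hψ, hψ'⟩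
    refine ⟨fun R S j L L' h => ?_, fun R L => ⟨?_, ?_⟩⟩
    · simp only [Pi.mul_apply, hφ R S j L L' h, hψ R S j L L' h, map_mul]
    · obtain ⟨X, hX⟩ := (hφ' R L).1
      obtain ⟨Y, hY⟩ := (hψ' R L).1
      refine ⟨φ R L • Y + ψ R L • X, fun ξ y hy => ?_⟩
      simp only [Pi.mul_apply, hX ξ y hy, hY ξ y hy, pairing_add_left, pairing_smul_left]
      ext <;> (simp; try ring)
    · obtain ⟨X, hX⟩ := (hφ' R L).2
      obtain ⟨Y, hY⟩ := (hψ' R L).2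
      refine ⟨φ R L • Y + ψ R L • X, fun ξ y hy => ?_⟩
      simp only [Pi.mul_apply, hX ξ y hy, hY ξ y hy, pairing_add_left, pairing_smul_left]
      ext <;> (simp; try ring)
  add_mem' := by
    rintro φ ψ ⟨hφ, hφ'⟩ ⟨hψ, hψ'⟩
    refine ⟨fun R S j L L' h => ?_, fun R L => ⟨?_, ?_⟩⟩
    · simp only [Pi.add_apply, hφ R S j L L' h, hψ R S j L L' h, map_add]
    · obtain ⟨X, hX⟩ := (hφ' R L).1
      obtain ⟨Y, hY⟩ := (hψ' R L).1
      refine ⟨X + Y, fun ξ y hy => ?_⟩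
      simp only [Pi.add_apply, hX ξ y hy, hY ξ y hy, pairing_add_left]
      ext <;> simp
    · obtain ⟨X, hX⟩ := (hφ' R L).2
      obtain ⟨Y, hY⟩ := (hψ' R L).2
      refine ⟨X + Y, fun ξ y hy => ?_⟩
      simp only [Pi.add_apply, hX ξ y hy, hY ξ y hy, pairing_add_left]
      ext <;> simp
  algebraMap_mem' := by
    intro c
    refine ⟨fun R S j L L' h => ?_, fun R L =>
      ⟨⟨0, fun ξ y hy => ?_⟩, ⟨0, fun ξ y hy => ?_⟩⟩⟩
    · simp [Pi.algebraMap_apply]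
    · rw [pairing_zero_left]
      simp only [Pi.algebraMap_apply]
      ext <;> simp [TrivSqZeroExt.algebraMap_eq_inl']
    · rw [pairing_zero_left]
      simp only [Pi.algebraMap_apply]
      ext <;> simp [TrivSqZeroExt.algebraMap_eq_inl']

/-- The gauge covariant Poisson bracket
`{φ, ψ} = ⟨r ∇φ, ∇ψ⟩ + ⟨r ∇'φ, ∇'ψ⟩ - 2 ⟨σ r₊ ∇'φ, ∇ψ⟩ - 2 ⟨r₋ σ⁻¹ ∇φ, ∇'ψ⟩` with `σ = D_p`. -/
def bracket (φ ψ : D.FunFamily) : D.FunFamily := fun R L =>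
  pairing D.form (D.r (D.leftGradient φ R L)) (D.leftGradient ψ R L) +
  pairing D.form (D.r (D.rightGradient φ R L)) (D.rightGradient ψ R L) -
  2 * pairing D.form (D.sigma (D.rPlus (D.rightGradient φ R L))) (D.leftGradient ψ R L) -
  2 * pairing D.form (D.rMinus (D.sigmaInv (D.leftGradient φ R L))) (D.rightGradient ψ R L)

/-! ### The constraints -/

/-- The matrix coefficient of `μ_𝒩` given by the regular function `P` on `N̄` (a polynomial in the
matrix entries) and `k ∈ ℤ`: the coefficient of `zᵏ` in `P(μ_𝒩(L)(z))`. -/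
def matrixCoeff (P : MvPolynomial (Fin m × Fin m) ℂ) (k : ℤ) : D.FunFamily := fun R L =>
  (evalEntries (constHom R) (D.muN L) P).coeff k

/-- The algebra `F` generated by the matrix coefficients of `μ_𝒩`. -/
def constraints : Subalgebra ℂ D.FunFamily :=
  Algebra.adjoin ℂ {φ | ∃ P k, φ = D.matrixCoeff P k}

theorem matrixCoeff_mem (P : MvPolynomial (Fin m × Fin m) ℂ) (k : ℤ) :
    D.matrixCoeff P k ∈ D.constraints :=
  Algebra.subset_adjoin ⟨P, k, rfl⟩

/-- `F` is a Poisson subalgebra of `C^∞(𝒢'ₚ)`: a subalgebra that is closed under the bracket. -/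
def IsPoissonSubalgebra (F : Subalgebra ℂ D.FunFamily) : Prop :=
  F ≤ D.smoothFunctions ∧ ∀ φ ∈ F, ∀ ψ ∈ F, D.bracket φ ψ ∈ F

/-- An algebra homomorphism `χ : F → ℂ` is a character of the Poisson algebra `F`: it vanishes on
all Poisson brackets. -/
def IsPoissonCharacter (F : Subalgebra ℂ D.FunFamily) (χ : F →ₐ[ℂ] ℂ) : Prop :=
  ∀ (φ ψ : F) (h : D.bracket φ.1 ψ.1 ∈ F), χ ⟨D.bracket φ.1 ψ.1, h⟩ = 0

/-- `(F, χ)` is a system of first-class constraints. -/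
def IsFirstClassSystem (F : Subalgebra ℂ D.FunFamily) (χ : F →ₐ[ℂ] ℂ) : Prop :=
  D.IsPoissonSubalgebra F ∧ D.IsPoissonCharacter F χ

/-- `f = w₀ u_l ⋯ u₁ w₀⁻¹`, where `w₀` is a representative of the longest element of the Weyl group
and `uᵢ ≠ 1` is an element of the one-parameter group of the root `-w₀(αᵢ)`. -/
def IsBasePoint (f : Matrix (Fin m) (Fin m) ℂ) : Prop :=
  ∃ (w : H ≃ₗ[ℂ] H) (wRep : GL (Fin m) ℂ) (x : Fin l → 𝔤),
    IsLongest D.base w ∧ Represents D.ρ wRep w ∧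
    (∀ i, x i ≠ 0 ∧ x i ∈ LieAlgebra.rootSpace H fun h : H =>
      -(LieAlgebra.IsKilling.rootSystem H).root (D.simple i) (w⁻¹ h)) ∧
    f = (wRep : Matrix (Fin m) (Fin m) ℂ) *
      (List.ofFn fun i => NormedSpace.exp (D.ρ (x i))).reverse.prod *
      ((wRep⁻¹ : GL (Fin m) ℂ) : Matrix (Fin m) (Fin m) ℂ)

end Setting

end DrinfeldSokolov

end

open scoped TensorProduct Matrix

set_option linter.unusedSectionVars false

noncomputable section

namespace DrinfeldSokolov

-- With this instance removed, the ℂ-algebra structure of R((z)) is the one given by constant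
-- series, definitionally equal to `constHom`. Loops can then be treated as points over an arbitrary
-- ℂ-algebra S, here S = R((z)).
attribute [-instance] HahnSeries.powerSeriesAlgebra

/-! ### Polynomials in the matrix entries -/

section Poly

variable {m : ℕ} {S : Type} [CommRing S] [Algebra ℂ S]

/-! The core is a closed formula for the bracket of two matrix coefficients. Let U = (1 - s)⁻¹P_𝔥, Q
= P_𝔫̄ + U and K = P_𝔫 + P_𝔥 - U. Then Q + K = 1, and K is the transpose of Q, since s is orthogonal
for the form.

Uniqueness of n₊. Two factorizations of the same L give n'⁻¹ a n = m'⁻¹ s(a) m with a in the torus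
(after the shift D_p). Comparing degrees for the height grading on matrices gives a = s(a) and n'⁻¹
a n = a (`eq_of_triangular`). Each root has the form χ - χ∘s with χ integral (`root_mem_coxImage`).
As G is simply connected, χ is a character of the torus, so every root is trivial on a, a commutes
with 𝔤 (`commute_of_sConj_eq`), and n = n'.

Gradients. An infinitesimal motion of L is written as D_p(Ad(h₊n₊)X). Its QX part is absorbed by L₊
and its KX part by L₋; the Cartan parts UX and sUX are exactly those that keep h₋ = s(h₊^{D_p})
(`infinitesimal_factorization`). Hence the point remains in 𝒢'ₚ and n₊ moves by Ad(n₊)QX - UX, an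
element of 𝔫̄ (`negS_varNeg`). If Z, with values in 𝔫, represents the differential of a matrix
coefficient on N̄, transposition gives ∇ = D_p Ad(h₊n₊)K Ad(n₊⁻¹)Z, and ∇' = Ad(L⁻¹)∇.

Bracket. The right gradient has no 𝔫̄-component and its Cartan part is s of the Cartan part of the
left one. For such pairs all terms with (1 - sD_p)⁻¹ cancel mode by mode (`mode_identity`), and the
bracket equals ⟨P_𝔫̄∇φ, ∇ψ⟩ - ⟨P_𝔫∇φ, ∇ψ⟩. Orthogonality of s makes the sum of these two pairings
vanish, which leaves -2⟨Z, Ad(n₊)K Ad(n₊⁻¹)Z'⟩ (`formS_negS_eq`). This depends on n₊ alone,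
polynomially, and is again a matrix coefficient (`bracket_matrixCoeff_eq`). The Leibniz rule extends
closedness to all of F.

Character. The constant loop f lies in 𝒢'ₚ with n₊ = f and trivial other factors, and χ_f is
evaluation there. It remains to see that Ad(f)K Ad(f⁻¹) maps 𝔫 into 𝔫 + 𝔥. Conjugation by w₀ turns
f⁻¹ into the product, in the order 1, …, l, of exponentials of root vectors for -αᵢ. Put A =
Ad(f⁻¹). Each such exponential acts on suitable elements of 𝔫 + 𝔥 as the simple reflection does on
the Cartan part. So for z in 𝔫 there is c in 𝔥 with A(z + c) = w + sc, w in 𝔫, whereas A c is c plus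
an element of 𝔫̄. The defining relation of U then gives K A z = w + sc = A(z + c), hence A⁻¹ K A z =
z + c (`projNeg_conj_opKC`).

Passage to R-points. All groups are Zariski closures of sets of complex matrices. Finitely many
polynomials take at an S-point the values of an S-linear combination of evaluations at elements of
the set (`exists_interpolation`). Linear relations, and relations bilinear in a point and its
adjugate, therefore pass from complex elements to all S-points. The remaining analytic input is that
the relevant vector fields are tangent to these closures, so that 1 + εX acts on points; for
unipotent groups this rests on the logarithmic derivative of exp. -/

/-- Evaluation of polynomials in the matrix entries at a matrix over a `ℂ`-algebra. -/
def evalAt (g : Matrix (Fin m) (Fin m) S) : MvPolynomial (Fin m × Fin m) ℂ →ₐ[ℂ] S :=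
  MvPolynomial.aeval fun ij => g ij.1 ij.2

theorem evalEntries_algebraMap (g : Matrix (Fin m) (Fin m) S)
    (P : MvPolynomial (Fin m × Fin m) ℂ) : evalEntries (algebraMap ℂ S) g P = evalAt g P := rfl

@[simp] theorem evalAt_X (g : Matrix (Fin m) (Fin m) S) (ij : Fin m × Fin m) :
    evalAt g (MvPolynomial.X ij) = g ij.1 ij.2 := by simp [evalAt]

theorem evalAt_C (g : Matrix (Fin m) (Fin m) S) (a : ℂ) :
    evalAt g (MvPolynomial.C a) = algebraMap ℂ S a := by simp [evalAt]

theorem map_evalAt {S' : Type} [CommRing S'] [Algebra ℂ S'] (φ : S →ₐ[ℂ] S')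
    (g : Matrix (Fin m) (Fin m) S) (P : MvPolynomial (Fin m × Fin m) ℂ) :
    φ (evalAt g P) = evalAt (g.map φ) P := by
  simp only [evalAt, ← AlgHom.comp_apply, MvPolynomial.comp_aeval]
  rfl

theorem evalAt_map_algebraMap (γ : Matrix (Fin m) (Fin m) ℂ)
    (P : MvPolynomial (Fin m × Fin m) ℂ) :
    evalAt (γ.map (algebraMap ℂ S)) P = algebraMap ℂ S (evalAt γ P) :=
  (map_evalAt (Algebra.ofId ℂ S) γ P).symm

/-- `P` vanishes on `Γ`. -/
def VanishesOn (Γ : Set (Matrix (Fin m) (Fin m) ℂ)) (P : MvPolynomial (Fin m × Fin m) ℂ) : Prop :=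
  ∀ γ ∈ Γ, evalAt γ P = 0

/-- The points over `S` of the Zariski closure of `Γ`. -/
abbrev pts (Γ : Set (Matrix (Fin m) (Fin m) ℂ)) (S : Type) [CommRing S] [Algebra ℂ S] :
    Set (Matrix (Fin m) (Fin m) S) := zariskiPoints Γ (algebraMap ℂ S)

theorem pts_mono {Γ Γ' : Set (Matrix (Fin m) (Fin m) ℂ)} (h : Γ ⊆ Γ') : pts Γ S ⊆ pts Γ' S :=
  fun _ hg P hP => hg P fun γ hγ => hP γ (h hγ)

theorem constHom_eq_algebraMap (R : Type) [CommRing R] [Algebra ℂ R] :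
    constHom R = algebraMap ℂ (LaurentSeries R) := rfl

theorem loopPoints_eq (Γ : Set (Matrix (Fin m) (Fin m) ℂ)) (R : Type) [CommRing R] [Algebra ℂ R] :
    loopPoints Γ R = pts Γ (LaurentSeries R) := by
  rw [loopPoints, constHom_eq_algebraMap]

theorem map_mem_pts {S' : Type} [CommRing S'] [Algebra ℂ S'] (φ : S →ₐ[ℂ] S')
    {Γ : Set (Matrix (Fin m) (Fin m) ℂ)} {g : Matrix (Fin m) (Fin m) S} (hg : g ∈ pts Γ S) :
    g.map φ ∈ pts Γ S' := fun P hP => by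
  have := hg P hP
  rw [evalEntries_algebraMap] at this ⊢
  rw [← map_evalAt, this, map_zero]

theorem map_algebraMap_mem_pts_of_mem_closure {Γ : Set (Matrix (Fin m) (Fin m) ℂ)}
    {γ : Matrix (Fin m) (Fin m) ℂ} (hγ : ∀ P, VanishesOn Γ P → evalAt γ P = 0) :
    γ.map (algebraMap ℂ S) ∈ pts Γ S := fun P hP => by
  rw [evalEntries_algebraMap, evalAt_map_algebraMap, hγ P hP, map_zero]

/-- Finitely many polynomials take at a point of the Zariski closure of `Γ` the values of a linear
combination of evaluations at elements of `Γ`. -/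
theorem exists_interpolation {Γ : Set (Matrix (Fin m) (Fin m) ℂ)} {g : Matrix (Fin m) (Fin m) S}
    (hg : g ∈ pts Γ S) (T : Finset (MvPolynomial (Fin m × Fin m) ℂ)) :
    ∃ c : Matrix (Fin m) (Fin m) ℂ →₀ S, (∀ γ ∈ c.support, γ ∈ Γ) ∧
      ∀ P ∈ T, evalAt g P = c.sum fun γ s => s * algebraMap ℂ S (evalAt γ P) := by
  classical
  let v : Matrix (Fin m) (Fin m) ℂ → (T → ℂ) := fun γ P => evalAt γ P.1
  -- A linear retraction of ℂ^T onto the span of the value vectors (P(γ))_P of the elements of Γ.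
  obtain ⟨π, hπ⟩ := LinearMap.exists_leftInverse_of_injective
    (Submodule.span ℂ (v '' Γ)).subtype (Submodule.ker_subtype _)
  have hmem : ∀ P : T, ∃ l : Matrix (Fin m) (Fin m) ℂ →₀ ℂ, l ∈ Finsupp.supported ℂ ℂ Γ ∧
      Finsupp.linearCombination ℂ v l = (π (Pi.single P 1)).1 := fun P =>
    (Finsupp.mem_span_image_iff_linearCombination ℂ).1 (π (Pi.single P 1)).2
  choose l hl hlv using hmem
  -- Since π fixes every value vector, the polynomial Q - ∑ P · π(e_P)_Q vanishes on Γ, hence at g.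
  -- As π(e_P) is a combination of value vectors, this is already the wanted expansion.
  have key : ∀ Q : T, evalAt g Q.1 =
      ∑ P : T, evalAt g P.1 * algebraMap ℂ S ((π (Pi.single P 1)).1 Q) := fun Q => by
    have h := hg (Q.1 - ∑ P : T, P.1 * MvPolynomial.C ((π (Pi.single P 1)).1 Q)) fun γ hγ => by
      change evalAt γ _ = 0
      have h1 := LinearMap.congr_fun hπ ⟨v γ, Submodule.subset_span ⟨γ, hγ, rfl⟩⟩
      have h2 := congrArg (fun w => w.1 Q) h1
      simp only [LinearMap.comp_apply, Submodule.subtype_apply, LinearMap.id_apply] at h2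
      have h3 : v γ = ∑ P : T, v γ P • (Pi.single P 1 : T → ℂ) := by
        ext P; simp [Pi.single_apply]
      rw [map_sub, map_sum, sub_eq_zero]
      change v γ Q = _
      rw [← h2, h3]
      simp only [map_sum, map_smul, Submodule.coe_sum, Submodule.coe_smul, Finset.sum_apply,
        Pi.smul_apply, smul_eq_mul, map_mul, evalAt_C]
      refine Finset.sum_congr rfl fun P _ => ?_
      rfl
    rw [evalEntries_algebraMap, map_sub, map_sum, sub_eq_zero] at h
    rw [h]
    exact Finset.sum_congr rfl fun P _ => by rw [map_mul, evalAt_C]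
  refine ⟨∑ P : T, (l P).mapRange (fun a => evalAt g P.1 * algebraMap ℂ S a) (by simp),
    fun γ hγ => ?_, fun Q hQ => ?_⟩
  · by_contra hn
    refine (Finsupp.mem_support_iff.1 hγ) ?_
    rw [Finsupp.finsetSum_apply]
    refine Finset.sum_eq_zero fun P _ => ?_
    have : l P γ = 0 := by
      by_contra h0
      exact hn ((Finsupp.mem_supported ℂ (l P)).1 (hl P) (Finsupp.mem_support_iff.2 h0))
    simp [this]
  · rw [← Finsupp.sum_finsetSum_index (by simp) (by intros; ring), key ⟨Q, hQ⟩]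
    refine Finset.sum_congr rfl fun P _ => ?_
    rw [Finsupp.sum_mapRange_index (by simp), ← hlv P, Finsupp.linearCombination_apply,
      Finsupp.sum, Finset.sum_apply, map_sum, Finset.mul_sum]
    refine Finset.sum_congr rfl fun γ _ => ?_
    rw [Pi.smul_apply, smul_eq_mul, map_mul, ← mul_assoc]

/-- The generic matrix. -/
abbrev genMat (m : ℕ) : Matrix (Fin m) (Fin m) (MvPolynomial (Fin m × Fin m) ℂ) :=
  Matrix.of fun i j => MvPolynomial.X (i, j)

@[simp] theorem genMat_map_evalAt (g : Matrix (Fin m) (Fin m) S) :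
    (genMat m).map (evalAt g) = g := by
  ext i j; simp

theorem adjugate_genMat_map_evalAt (g : Matrix (Fin m) (Fin m) S) :
    (genMat m).adjugate.map (evalAt g) = g.adjugate := by
  have := RingHom.map_adjugate (evalAt g).toRingHom (genMat m)
  simp only [RingHom.mapMatrix_apply] at this
  exact this.trans (congrArg _ (genMat_map_evalAt g))

theorem det_genMat_evalAt (g : Matrix (Fin m) (Fin m) S) :
    evalAt g (genMat m).det = g.det := by
  have := RingHom.map_det (evalAt g).toRingHom (genMat m)
  simp only [RingHom.mapMatrix_apply] at this
  exact this.trans (congrArg _ (genMat_map_evalAt g))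

/-- Substitution of a matrix of polynomials into a polynomial in the matrix entries. -/
def substMat (A : Matrix (Fin m) (Fin m) (MvPolynomial (Fin m × Fin m) ℂ))
    (P : MvPolynomial (Fin m × Fin m) ℂ) : MvPolynomial (Fin m × Fin m) ℂ := evalAt A P

theorem evalAt_substMat (g : Matrix (Fin m) (Fin m) S)
    (A : Matrix (Fin m) (Fin m) (MvPolynomial (Fin m × Fin m) ℂ))
    (P : MvPolynomial (Fin m × Fin m) ℂ) :
    evalAt g (substMat A P) = evalAt (A.map (evalAt g)) P :=
  map_evalAt (evalAt g) A P

/-- A polynomial over `S` in the matrix entries that vanishes on `Γ` vanishes on the points of its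
closure. -/
theorem eval_eq_zero_of_mem_pts {Γ : Set (Matrix (Fin m) (Fin m) ℂ)}
    {g : Matrix (Fin m) (Fin m) S} (hg : g ∈ pts Γ S) (Q : MvPolynomial (Fin m × Fin m) S)
    (h : ∀ γ ∈ Γ, MvPolynomial.eval (fun ij => algebraMap ℂ S (γ ij.1 ij.2)) Q = 0) :
    MvPolynomial.eval (fun ij => g ij.1 ij.2) Q = 0 := by
  classical
  -- Only the monomials of Q need to be interpolated; its coefficients over S come along linearly.
  obtain ⟨c, hc, hcP⟩ := exists_interpolation hg
    (Q.support.image fun d => MvPolynomial.monomial d (1 : ℂ))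
  have hmon : ∀ d ∈ Q.support, ∏ i ∈ d.support, g i.1 i.2 ^ d i =
      c.sum fun γ s => s * ∏ i ∈ d.support, (algebraMap ℂ S (γ i.1 i.2)) ^ d i := fun d hd => by
    have := hcP _ (Finset.mem_image_of_mem _ hd)
    simpa [evalAt, MvPolynomial.aeval_monomial, Finsupp.prod, map_prod] using this
  rw [MvPolynomial.eval_eq, Finset.sum_congr rfl fun d hd => by rw [hmon d hd]]
  simp only [Finsupp.sum, Finset.mul_sum]
  rw [Finset.sum_comm]
  refine Finset.sum_eq_zero fun γ hγ => ?_
  have := h γ (hc γ hγ)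
  rw [MvPolynomial.eval_eq] at this
  calc _ = c γ * ∑ d ∈ Q.support, Q.coeff d *
        ∏ i ∈ d.support, (algebraMap ℂ S (γ i.1 i.2)) ^ d i := by
          rw [Finset.mul_sum]; exact Finset.sum_congr rfl fun d _ => by ring
    _ = 0 := by rw [this, mul_zero]

/-- The points of the closure of a set that is closed under multiplication are closed under
multiplication. -/
theorem mul_mem_pts {Γ Γ' Γ'' : Set (Matrix (Fin m) (Fin m) ℂ)}
    (hΓ : ∀ γ ∈ Γ, ∀ γ' ∈ Γ', γ * γ' ∈ Γ'')
    {g g' : Matrix (Fin m) (Fin m) S} (hg : g ∈ pts Γ S) (hg' : g' ∈ pts Γ' S) :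
    g * g' ∈ pts Γ'' S := by
  -- One factor at a time: with γ complex, g' ↦ P(γ g') is a complex polynomial. Once g' is an
  -- S-point, g ↦ P(g g') has coefficients in S, which is the case covered by
  -- `eval_eq_zero_of_mem_pts`.
  have step : ∀ γ ∈ Γ, γ.map (algebraMap ℂ S) * g' ∈ pts Γ'' S := fun γ hγ P hP => by
    have := hg' (substMat (γ.map MvPolynomial.C * genMat m) P) fun γ' hγ' => by
      change evalAt γ' _ = 0
      rw [evalAt_substMat, Matrix.map_mul, genMat_map_evalAt]
      have h1 : (γ.map MvPolynomial.C).map (evalAt γ') = γ := by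
        ext i j; simp
      rw [h1]
      exact hP _ (hΓ γ hγ γ' hγ')
    rw [evalEntries_algebraMap, evalAt_substMat, Matrix.map_mul, genMat_map_evalAt] at this
    rw [evalEntries_algebraMap, ← this]
    congr 3
    ext i j; simp
  intro P hP
  let Q : MvPolynomial (Fin m × Fin m) S :=
    evalAt ((Matrix.of fun i j => (MvPolynomial.X (i, j) : MvPolynomial (Fin m × Fin m) S)) *
      g'.map MvPolynomial.C) P
  have hQ : ∀ h : Matrix (Fin m) (Fin m) S,
      MvPolynomial.eval (fun ij => h ij.1 ij.2) Q = evalAt (h * g') P := fun h => by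
    have := map_evalAt ((MvPolynomial.aeval (R := S) (fun ij : Fin m × Fin m =>
      h ij.1 ij.2)).restrictScalars ℂ) ((Matrix.of fun i j =>
        (MvPolynomial.X (i, j) : MvPolynomial (Fin m × Fin m) S)) * g'.map MvPolynomial.C) P
    rw [Matrix.map_mul] at this
    refine Eq.trans ?_ (this.trans ?_)
    · simp [Q, MvPolynomial.aeval_eq_eval]
    · congr 3 <;> (ext i j; simp)
  rw [evalEntries_algebraMap, ← hQ]
  refine eval_eq_zero_of_mem_pts hg Q fun γ hγ => ?_
  exact (hQ (γ.map (algebraMap ℂ S))).trans (step γ hγ P hP)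

/-- The adjugate replaces the inverse throughout: it is polynomial in the entries, and it is the
inverse on all groups in question because their determinant is 1. -/
theorem adjugate_mem_pts {Γ Γ' : Set (Matrix (Fin m) (Fin m) ℂ)}
    (hΓ : ∀ γ ∈ Γ, γ.adjugate ∈ Γ')
    {g : Matrix (Fin m) (Fin m) S} (hg : g ∈ pts Γ S) : g.adjugate ∈ pts Γ' S := fun P hP => by
  have := hg (substMat (genMat m).adjugate P) fun γ hγ => by
    change evalAt γ _ = 0
    rw [evalAt_substMat, adjugate_genMat_map_evalAt]
    exact hP _ (hΓ γ hγ)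
  rwa [evalEntries_algebraMap, evalAt_substMat, adjugate_genMat_map_evalAt] at this

theorem det_eq_one_of_mem_pts {Γ : Set (Matrix (Fin m) (Fin m) ℂ)}
    (hΓ : ∀ γ ∈ Γ, γ.det = 1) {g : Matrix (Fin m) (Fin m) S} (hg : g ∈ pts Γ S) : g.det = 1 := by
  have := hg ((genMat m).det - 1) fun γ hγ => by
    change evalAt γ _ = 0
    rw [map_sub, det_genMat_evalAt, hΓ γ hγ, map_one, sub_self]
  rwa [evalEntries_algebraMap, map_sub, det_genMat_evalAt, map_one, sub_eq_zero] at this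

/-- Points of the closure of `Γ` satisfy the linear relations over `S` valid on `Γ`. -/
theorem linear_eq_of_mem_pts {Γ : Set (Matrix (Fin m) (Fin m) ℂ)}
    {E : Type*} [AddCommGroup E] [Module S E] (F : Matrix (Fin m) (Fin m) S →ₗ[S] E) (e : E)
    (hF : ∀ γ ∈ Γ, F (γ.map (algebraMap ℂ S)) = e)
    {g : Matrix (Fin m) (Fin m) S} (hg : g ∈ pts Γ S) : F g = e := by
  classical
  -- The polynomial 1 is interpolated together with the entries, so the coefficients sum to 1 and
  -- inhomogeneous relations F = e survive as well.
  obtain ⟨c, hc, hcP⟩ := exists_interpolation hg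
    (insert 1 (Finset.univ.image fun ij : Fin m × Fin m => MvPolynomial.X ij))
  have h1 : (1 : S) = c.sum fun γ s => s := by
    simpa using hcP 1 (Finset.mem_insert_self _ _)
  have hgs : g = c.sum fun γ s => s • γ.map (algebraMap ℂ S) := by
    ext i j
    have := hcP (MvPolynomial.X (i, j)) (Finset.mem_insert_of_mem (by simp))
    simp only [evalAt_X] at this
    rw [this, Finsupp.sum, Finsupp.sum, Matrix.sum_apply]
    simp
  rw [hgs, Finsupp.sum, map_sum]
  calc _ = ∑ γ ∈ c.support, c γ • e := Finset.sum_congr rfl fun γ hγ => by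
          rw [map_smul, hF γ (hc γ hγ)]
    _ = e := by rw [← Finset.sum_smul, show ∑ γ ∈ c.support, c γ = 1 from h1.symm, one_smul]

end Poly

end DrinfeldSokolov

namespace DrinfeldSokolov

/-! ### One-parameter groups of matrices -/

section Flow

variable {m : ℕ}

open scoped Matrix.Norms.Operator in
theorem hasDerivAt_exp_mul (A Y : Matrix (Fin m) (Fin m) ℂ) (t : ℂ) :
    HasDerivAt (fun t : ℂ => NormedSpace.exp (t • A) * Y)
      (A * (NormedSpace.exp (t • A) * Y)) t := by
  have := (hasDerivAt_exp_smul_const' A t).mul_const Y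
  rwa [mul_assoc] at this

open scoped Matrix.Norms.Operator in
theorem hasDerivAt_exp_conj (A Y : Matrix (Fin m) (Fin m) ℂ) (t : ℂ) :
    HasDerivAt (fun t : ℂ => NormedSpace.exp (t • A) * Y * NormedSpace.exp (-(t • A)))
      (NormedSpace.exp (t • A) * (A * Y - Y * A) * NormedSpace.exp (-(t • A))) t := by
  have h1 := (hasDerivAt_exp_smul_const A t).mul_const Y
  have h2 := hasDerivAt_exp_smul_const' (-A) t
  have h3 := h1.mul h2
  simp only [smul_neg] at h3
  refine h3.congr_deriv ?_
  noncomm_ring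

theorem hasDerivAt_entry {f : ℂ → Matrix (Fin m) (Fin m) ℂ} {f' : Matrix (Fin m) (Fin m) ℂ} {t : ℂ}
    (hf : HasDerivAt f f' t) (i j : Fin m) : HasDerivAt (fun t => f t i j) (f' i j) t :=
  hasDerivAt_pi.1 (hasDerivAt_pi.1 hf i) j

theorem hasDerivAt_evalAt {f : ℂ → Matrix (Fin m) (Fin m) ℂ} {f' : Matrix (Fin m) (Fin m) ℂ}
    {t : ℂ} (hf : ∀ i j, HasDerivAt (fun t => f t i j) (f' i j) t)
    (P : MvPolynomial (Fin m × Fin m) ℂ) :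
    HasDerivAt (fun t => evalAt (f t) P)
      (∑ ij : Fin m × Fin m, f' ij.1 ij.2 * evalAt (f t) (MvPolynomial.pderiv ij P)) t := by
  classical
  induction P using MvPolynomial.induction_on with
  | C a => simpa [evalAt_C] using hasDerivAt_const t a
  | add P Q hP hQ =>
    simp only [map_add, mul_add, Finset.sum_add_distrib]
    exact hP.add hQ
  | mul_X P kl hP =>
    simp only [map_mul, evalAt_X]
    refine (hP.mul (hf kl.1 kl.2)).congr_deriv ?_
    simp only [MvPolynomial.pderiv_mul, MvPolynomial.pderiv_X, map_add, map_mul, evalAt_X, mul_add,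
      Finset.sum_add_distrib, Finset.sum_mul]
    congr 1
    · exact Finset.sum_congr rfl fun _ _ => by ring
    · rw [Finset.sum_eq_single kl]
      · simp; ring
      · intro b _ hb
        simp [hb.symm]
      · simp

/-- First-order Taylor expansion: in the product rule the term with both increments carries ε² = 0.
-/
theorem evalAt_add_smul_of_sq_zero {S : Type} [CommRing S] [Algebra ℂ S] {ε : S} (hε : ε * ε = 0)
    (g A : Matrix (Fin m) (Fin m) S) (P : MvPolynomial (Fin m × Fin m) ℂ) :
    evalAt (g + ε • A) P = evalAt g P +
      ε * ∑ ij : Fin m × Fin m, A ij.1 ij.2 * evalAt g (MvPolynomial.pderiv ij P) := by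
  classical
  induction P using MvPolynomial.induction_on with
  | C a => simp
  | add P Q hP hQ =>
    simp only [map_add, mul_add, Finset.sum_add_distrib, hP, hQ]
    ring
  | mul_X P kl hP =>
    have h2 : ∑ ij : Fin m × Fin m, A ij.1 ij.2 *
        evalAt g (MvPolynomial.pderiv ij (P * MvPolynomial.X kl)) =
        (∑ ij : Fin m × Fin m, A ij.1 ij.2 * evalAt g (MvPolynomial.pderiv ij P)) * g kl.1 kl.2 +
          A kl.1 kl.2 * evalAt g P := by
      simp only [MvPolynomial.pderiv_mul, MvPolynomial.pderiv_X, map_add, map_mul, evalAt_X,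
        mul_add, Finset.sum_add_distrib, Finset.sum_mul]
      congr 1
      · exact Finset.sum_congr rfl fun _ _ => by ring
      · rw [Finset.sum_eq_single kl]
        · simp
        · intro b _ hb
          simp [hb.symm]
        · simp
    rw [map_mul, hP, h2, map_mul, evalAt_X, evalAt_X, Matrix.add_apply, Matrix.smul_apply,
      smul_eq_mul]
    linear_combination (∑ ij : Fin m × Fin m, A ij.1 ij.2 *
      evalAt g (MvPolynomial.pderiv ij P)) * A kl.1 kl.2 * hε

/-- The derivative of a polynomial in the matrix entries along the vector field `g ↦ A g`. -/
def dirDeriv (A : Matrix (Fin m) (Fin m) ℂ) (P : MvPolynomial (Fin m × Fin m) ℂ) :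
    MvPolynomial (Fin m × Fin m) ℂ :=
  ∑ ij : Fin m × Fin m,
    (A.map (MvPolynomial.C (σ := Fin m × Fin m)) * genMat m :
      Matrix (Fin m) (Fin m) (MvPolynomial (Fin m × Fin m) ℂ)) ij.1 ij.2 * MvPolynomial.pderiv ij P

theorem evalAt_dirDeriv {S : Type} [CommRing S] [Algebra ℂ S] (g : Matrix (Fin m) (Fin m) S)
    (A : Matrix (Fin m) (Fin m) ℂ) (P : MvPolynomial (Fin m × Fin m) ℂ) :
    evalAt g (dirDeriv A P) = ∑ ij : Fin m × Fin m,
      (A.map (algebraMap ℂ S) * g) ij.1 ij.2 * evalAt g (MvPolynomial.pderiv ij P) := by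
  simp [dirDeriv, Matrix.mul_apply]

theorem hasDerivAt_evalAt_exp_mul (A γ : Matrix (Fin m) (Fin m) ℂ)
    (P : MvPolynomial (Fin m × Fin m) ℂ) (t : ℂ) :
    HasDerivAt (fun t : ℂ => evalAt (NormedSpace.exp (t • A) * γ) P)
      (evalAt (NormedSpace.exp (t • A) * γ) (dirDeriv A P)) t := by
  refine (hasDerivAt_evalAt (fun i j => hasDerivAt_entry (hasDerivAt_exp_mul A γ t) i j) P).congr_deriv ?_
  rw [evalAt_dirDeriv]
  simp

theorem iteratedDeriv_of_hasDerivAt {f : ℕ → ℂ → ℂ}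
    (hf : ∀ n t, HasDerivAt (f n) (f (n + 1) t) t) (n : ℕ) : iteratedDeriv n (f 0) = f n := by
  induction n with
  | zero => simp
  | succ n ih =>
    rw [iteratedDeriv_succ, ih]
    exact funext fun t => (hf n t).deriv

/-- A chain of successive derivatives makes `f 0` entire, with Taylor coefficients `f n 0 / n!` at
0. Evaluated at time 1, this converts infinitesimal information along t ↦ exp(tA) into information
about exp A. -/
theorem hasSum_taylor {f : ℕ → ℂ → ℂ} (hf : ∀ n t, HasDerivAt (f n) (f (n + 1) t) t) :
    HasSum (fun n : ℕ => ((n.factorial : ℂ))⁻¹ * f n 0) (f 0 1) := by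
  have h := Complex.hasSum_taylorSeries_of_entire (f := f 0)
    (fun t => (hf 0 t).differentiableAt) 0 1
  simpa [iteratedDeriv_of_hasDerivAt hf] using h

/-- The vector field `g ↦ A g` is tangent to the Zariski closure of `Γ`. -/
def TangentTo (Γ : Set (Matrix (Fin m) (Fin m) ℂ)) (A : Matrix (Fin m) (Fin m) ℂ) : Prop :=
  ∀ P, VanishesOn Γ P → VanishesOn Γ (dirDeriv A P)

/-- The function t ↦ P(exp(tA)γ) is identically zero, and its derivative at 0 is the value of
`dirDeriv A P` at γ. -/
theorem tangentTo_of_exp_mul_mem {Γ : Set (Matrix (Fin m) (Fin m) ℂ)}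
    {A : Matrix (Fin m) (Fin m) ℂ} (h : ∀ t : ℂ, ∀ γ ∈ Γ, NormedSpace.exp (t • A) * γ ∈ Γ) :
    TangentTo Γ A := fun P hP γ hγ => by
  have h1 := hasDerivAt_evalAt_exp_mul A γ P 0
  have h2 : (fun t : ℂ => evalAt (NormedSpace.exp (t • A) * γ) P) = fun _ => 0 :=
    funext fun t => hP _ (h t γ hγ)
  rw [h2] at h1
  simpa using h1.unique (hasDerivAt_const 0 0)

/-- Converse direction: tangency makes all iterated derivatives of P vanish on Γ, so the Taylor
series of t ↦ P(exp(tA)γ) at 0 is zero. -/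
theorem TangentTo.vanishesOn_exp_mul {Γ : Set (Matrix (Fin m) (Fin m) ℂ)}
    {A : Matrix (Fin m) (Fin m) ℂ} (h : TangentTo Γ A) {P : MvPolynomial (Fin m × Fin m) ℂ}
    (hP : VanishesOn Γ P) {γ : Matrix (Fin m) (Fin m) ℂ} (hγ : γ ∈ Γ) :
    evalAt (NormedSpace.exp A * γ) P = 0 := by
  have h1 := hasSum_taylor (f := fun n t => evalAt (NormedSpace.exp (t • A) * γ)
    ((dirDeriv A)^[n] P)) fun n t => by
      rw [Function.iterate_succ_apply']
      exact hasDerivAt_evalAt_exp_mul A γ _ t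
  have h2 : ∀ n : ℕ, VanishesOn Γ ((dirDeriv A)^[n] P) := fun n => by
    induction n with
    | zero => exact hP
    | succ n ih =>
      rw [Function.iterate_succ_apply']
      exact h _ ih
  have h3 : ∀ n : ℕ, evalAt γ ((dirDeriv A)^[n] P) = 0 := fun n => h2 n γ hγ
  simp only [zero_smul, NormedSpace.exp_zero, one_mul, h3, mul_zero, one_smul,
    Function.iterate_zero, id_eq] at h1
  exact h1.unique hasSum_zero

/-- Infinitesimal motions along tangent vector fields preserve the Zariski closure. -/
theorem infinitesimal_mul_mem_pts {S : Type} [CommRing S] [Algebra ℂ S]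
    {Γ : Set (Matrix (Fin m) (Fin m) ℂ)} {W : Set (Matrix (Fin m) (Fin m) ℂ)}
    (hW : ∀ A ∈ W, TangentTo Γ A) {ε : S} (hε : ε * ε = 0) {g A : Matrix (Fin m) (Fin m) S}
    (hg : g ∈ pts Γ S)
    (hA : A ∈ Submodule.span S ((fun A : Matrix (Fin m) (Fin m) ℂ => A.map (algebraMap ℂ S)) '' W)) :
    (1 + ε • A) * g ∈ pts Γ S := fun P hP => by
  -- The first-order term is S-linear in A, so it suffices to treat the complex generators, where it
  -- is the value at g of `dirDeriv A P`, a polynomial that vanishes on Γ.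
  have key : ∑ ij : Fin m × Fin m, (A * g) ij.1 ij.2 * evalAt g (MvPolynomial.pderiv ij P) = 0 := by
    induction hA using Submodule.span_induction with
    | mem A hA =>
      obtain ⟨A, hA, rfl⟩ := hA
      rw [← evalAt_dirDeriv]
      exact hg _ (hW A hA P hP)
    | zero => simp
    | add A B _ _ hA hB =>
      simp only [add_mul, Matrix.add_apply, Finset.sum_add_distrib, hA, hB, add_zero]
    | smul s A _ hA =>
      simp only [Matrix.smul_mul, Matrix.smul_apply, smul_eq_mul, mul_assoc, ← Finset.mul_sum, hA,
        mul_zero]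
  rw [evalEntries_algebraMap, add_mul, one_mul, Matrix.smul_mul, evalAt_add_smul_of_sq_zero hε, key,
    mul_zero, add_zero]
  exact hg P hP

end Flow

/-! ### Conjugation by exponentials -/

section Conj

variable {m : ℕ}

/-- The commutator with `A`. -/
def adMat (A : Matrix (Fin m) (Fin m) ℂ) : Module.End ℂ (Matrix (Fin m) (Fin m) ℂ) :=
  LinearMap.mulLeft ℂ A - LinearMap.mulRight ℂ A

@[simp] theorem adMat_apply (A Y : Matrix (Fin m) (Fin m) ℂ) : adMat A Y = A * Y - Y * A := rfl

theorem hasDerivAt_linear {f : ℂ → Matrix (Fin m) (Fin m) ℂ} {f' : Matrix (Fin m) (Fin m) ℂ}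
    {t : ℂ} (hf : HasDerivAt f f' t) (ℓ : Matrix (Fin m) (Fin m) ℂ →ₗ[ℂ] ℂ) :
    HasDerivAt (fun t => ℓ (f t)) (ℓ f') t := by
  have hℓ : ∀ M, ℓ M = ∑ i, ∑ j, M i j * ℓ (Matrix.single i j 1) := fun M => by
    conv_lhs => rw [Matrix.matrix_eq_sum_single M]
    simp only [map_sum]
    refine Finset.sum_congr rfl fun i _ => Finset.sum_congr rfl fun j _ => ?_
    rw [← smul_eq_mul, ← map_smul, Matrix.smul_single, smul_eq_mul, mul_one]
  rw [hℓ f', funext fun t => hℓ (f t)]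
  exact HasDerivAt.fun_sum fun i _ => HasDerivAt.fun_sum fun j _ =>
    (hasDerivAt_entry hf i j).mul_const _

/-- The expansion Ad(exp A) = exp(ad A), read through a linear functional so that only complex
series occur. -/
theorem hasSum_exp_conj (A Y : Matrix (Fin m) (Fin m) ℂ) (ℓ : Matrix (Fin m) (Fin m) ℂ →ₗ[ℂ] ℂ) :
    HasSum (fun n : ℕ => ((n.factorial : ℂ))⁻¹ * ℓ ((adMat A ^ n) Y))
      (ℓ (NormedSpace.exp A * Y * NormedSpace.exp (-A))) := by
  have := hasSum_taylor (f := fun n t => ℓ (NormedSpace.exp (t • A) * ((adMat A ^ n) Y) *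
    NormedSpace.exp (-(t • A)))) fun n t => by
      have := hasDerivAt_linear (hasDerivAt_exp_conj A ((adMat A ^ n) Y) t) ℓ
      rwa [pow_succ', Module.End.mul_apply, adMat_apply]
  simp only [zero_smul, NormedSpace.exp_zero, neg_zero, one_mul, mul_one, one_smul, pow_zero,
    Module.End.one_apply] at this
  exact this

/-- All terms of positive degree in the series of exp(ad A)Y lie in V'. A functional that vanishes
on V' but not on the sum would contradict uniqueness of the limit. -/
theorem exp_conj_sub_mem (A : Matrix (Fin m) (Fin m) ℂ)
    {V V' : Submodule ℂ (Matrix (Fin m) (Fin m) ℂ)} (hV : ∀ Y ∈ V, A * Y - Y * A ∈ V')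
    (hV' : V' ≤ V) {Y : Matrix (Fin m) (Fin m) ℂ} (hY : Y ∈ V) :
    NormedSpace.exp A * Y * NormedSpace.exp (-A) - Y ∈ V' := by
  have hmem : ∀ n : ℕ, (adMat A ^ (n + 1)) Y ∈ V' := fun n => by
    induction n with
    | zero => simpa using hV Y hY
    | succ n ih =>
      rw [pow_succ', Module.End.mul_apply]
      exact hV _ (hV' ih)
  by_contra hn
  obtain ⟨ℓ, hℓ, hℓV⟩ := Submodule.exists_le_ker_of_notMem hn
  have h1 := hasSum_exp_conj A Y ℓ
  have h2 : HasSum (fun n : ℕ => ((n.factorial : ℂ))⁻¹ * ℓ ((adMat A ^ n) Y)) (ℓ Y) := by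
    convert hasSum_single 0 fun n hn => ?_
    · simp
    · obtain ⟨n, rfl⟩ := Nat.exists_eq_succ_of_ne_zero hn
      rw [show ℓ ((adMat A ^ (n + 1)) Y) = 0 from hℓV (hmem n), mul_zero]
  refine hℓ ?_
  rw [map_sub, h1.unique h2, sub_self]

theorem exp_mul_exp_neg (A : Matrix (Fin m) (Fin m) ℂ) :
    NormedSpace.exp A * NormedSpace.exp (-A) = 1 := by
  rw [← Matrix.exp_add_of_commute _ _ (Commute.refl A).neg_right, add_neg_cancel, NormedSpace.exp_zero]

theorem exp_neg_mul_exp (A : Matrix (Fin m) (Fin m) ℂ) :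
    NormedSpace.exp (-A) * NormedSpace.exp A = 1 := by
  simpa using exp_mul_exp_neg (-A)

end Conj

/-! ### Determinants -/

section Det

variable {m : ℕ}

/-- The derivative of det(exp(tA)) at 0 is the trace of A, and multiplicativity carries its
vanishing to every t. -/
theorem det_exp_of_trace_eq_zero {A : Matrix (Fin m) (Fin m) ℂ} (hA : A.trace = 0) :
    (NormedSpace.exp A).det = 1 := by
  have hd : ∀ t, HasDerivAt (fun t : ℂ => (NormedSpace.exp (t • A)).det) 0 t := by
    have h0 : HasDerivAt (fun t : ℂ => (NormedSpace.exp (t • A)).det) 0 0 := by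
      have h1 := hasDerivAt_evalAt_exp_mul A 1 (genMat m).det 0
      simp only [det_genMat_evalAt, mul_one, zero_smul, NormedSpace.exp_zero] at h1
      have h2 : HasDerivAt (fun t : ℂ => (1 + t • A).det) (A.trace) 0 := by
        have h3 := ((1 + (Polynomial.X : Polynomial ℂ) • A.map Polynomial.C).det).hasDerivAt 0
        rw [Matrix.derivative_det_one_add_X_smul] at h3
        refine h3.congr_of_eventuallyEq (Filter.Eventually.of_forall fun t => ?_)
        change _ = Polynomial.eval t _
        have := RingHom.map_det (Polynomial.evalRingHom t)
          (1 + (Polynomial.X : Polynomial ℂ) • A.map Polynomial.C)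
        rw [Polynomial.coe_evalRingHom] at this
        rw [this]
        refine congrArg Matrix.det (Matrix.ext fun i j => ?_)
        simp only [RingHom.mapMatrix_apply, Matrix.map_apply, Matrix.add_apply, Matrix.smul_apply,
          smul_eq_mul, Polynomial.coe_evalRingHom, Polynomial.eval_add, Polynomial.eval_mul,
          Polynomial.eval_X, Polynomial.eval_C, Matrix.one_apply]
        split_ifs <;> simp
      have h4 := hasDerivAt_evalAt (f := fun t : ℂ => 1 + t • A) (f' := A) (t := 0)
        (fun i j => by
          simpa using ((hasDerivAt_id (0 : ℂ)).mul_const (A i j)).const_add ((1 : Matrix _ _ ℂ) i j))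
        (genMat m).det
      simp only [det_genMat_evalAt, zero_smul, add_zero] at h4
      rw [evalAt_dirDeriv] at h1
      refine h1.congr_deriv ?_
      rw [← hA, ← h4.unique h2]
      simp
    intro t
    have h5 : (fun t' : ℂ => (NormedSpace.exp (t' • A)).det) =
        fun t' => (NormedSpace.exp (t • A)).det * (NormedSpace.exp ((t' - t) • A)).det := by
      funext t'
      rw [← Matrix.det_mul, ← Matrix.exp_add_of_commute _ _
        (((Commute.refl A).smul_left _).smul_right _), ← add_smul, add_sub_cancel]
    rw [h5]
    have h6 : HasDerivAt (fun t' : ℂ => (NormedSpace.exp ((t' - t) • A)).det) 0 t := by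
      have := HasDerivAt.comp_sub_const t t (by simpa using h0)
      exact this
    simpa using h6.const_mul (NormedSpace.exp (t • A)).det
  have := is_const_of_deriv_eq_zero (fun t => (hd t).differentiableAt) (fun t => (hd t).deriv) 1 0
  simpa using this

end Det

end DrinfeldSokolov

namespace DrinfeldSokolov

/-! ### Exponentials of Lie algebras of nilpotent matrices -/

section NilpotentExp

variable {m : ℕ}

/-- The derivative at `s = 0` of `(A + s W) ^ n`. -/
def powDeriv (A W : Matrix (Fin m) (Fin m) ℂ) : ℕ → Matrix (Fin m) (Fin m) ℂ
  | 0 => 0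
  | n + 1 => powDeriv A W n * A + A ^ n * W

open scoped Matrix.Norms.Operator in
theorem hasDerivAt_pow_add_smul (A W : Matrix (Fin m) (Fin m) ℂ) (n : ℕ) :
    HasDerivAt (fun s : ℂ => (A + s • W) ^ n) (powDeriv A W n) 0 := by
  induction n with
  | zero =>
    simp only [pow_zero, powDeriv]
    exact hasDerivAt_const (0 : ℂ) (1 : Matrix (Fin m) (Fin m) ℂ)
  | succ n ih =>
    have h1 : HasDerivAt (fun s : ℂ => A + s • W) W 0 := by
      have := ((hasDerivAt_id (0 : ℂ)).smul_const W).const_add A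
      rwa [one_smul] at this
    have h2 := ih.mul h1
    simp only [zero_smul, add_zero] at h2
    simp only [pow_succ]
    exact h2

theorem exp_eq_sum_of_pow_eq_zero {A : Matrix (Fin m) (Fin m) ℂ} {N : ℕ} (hA : A ^ N = 0) :
    NormedSpace.exp A = ∑ n ∈ Finset.range N, ((n.factorial : ℂ))⁻¹ • A ^ n := by
  rw [NormedSpace.exp_eq_tsum ℂ]
  refine tsum_eq_sum fun n hn => ?_
  rw [pow_eq_zero_of_le (by simpa using hn) hA, smul_zero]

open scoped Matrix.Norms.Operator in
-- Nilpotency along the whole line A + sW turns the exponential there into a polynomial of fixed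
-- length, which is differentiated term by term.
theorem hasDerivAt_exp_add_smul {A W : Matrix (Fin m) (Fin m) ℂ} {N : ℕ}
    (hN : ∀ s : ℂ, (A + s • W) ^ N = 0) :
    HasDerivAt (fun s : ℂ => NormedSpace.exp (A + s • W))
      (∑ n ∈ Finset.range N, ((n.factorial : ℂ))⁻¹ • powDeriv A W n) 0 := by
  have h1 : HasDerivAt (fun s : ℂ => ∑ n ∈ Finset.range N, ((n.factorial : ℂ))⁻¹ • (A + s • W) ^ n)
      (∑ n ∈ Finset.range N, ((n.factorial : ℂ))⁻¹ • powDeriv A W n) 0 :=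
    HasDerivAt.fun_sum fun n _ => (hasDerivAt_pow_add_smul A W n).fun_const_smul _
  exact (funext fun s : ℂ => exp_eq_sum_of_pow_eq_zero (hN s)) ▸ h1

open scoped Matrix.Norms.Operator in
/-- The logarithmic derivative of the exponential. -/
theorem hasSum_dexp {A W : Matrix (Fin m) (Fin m) ℂ} {N : ℕ} (hA : A ^ N = 0)
    (hN : powDeriv A W N = 0) (ℓ : Matrix (Fin m) (Fin m) ℂ →ₗ[ℂ] ℂ) :
    HasSum (fun n : ℕ => (((n + 1).factorial : ℂ))⁻¹ * ℓ ((adMat A ^ n) W))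
      (ℓ ((∑ n ∈ Finset.range N, ((n.factorial : ℂ))⁻¹ • powDeriv A W n) *
        NormedSpace.exp (-A))) := by
  -- `Dt t` is the derivative at s = 0 of exp(t(A + sW)). It satisfies D' = D A + exp(tA)W, so
  -- D(t)exp(-tA) has derivative exp(tA) W exp(-tA), whose Taylor coefficients are the iterated
  -- commutators of A with W.
  let Dt : ℂ → Matrix (Fin m) (Fin m) ℂ := fun t =>
    ∑ n ∈ Finset.range N, (((n.factorial : ℂ))⁻¹ * t ^ n) • powDeriv A W n
  have hexp : ∀ t : ℂ, NormedSpace.exp (t • A) =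
      ∑ n ∈ Finset.range N, (((n.factorial : ℂ))⁻¹ * t ^ n) • A ^ n := fun t => by
    rw [exp_eq_sum_of_pow_eq_zero (N := N) (by rw [smul_pow, hA, smul_zero])]
    exact Finset.sum_congr rfl fun n _ => by rw [smul_pow, smul_smul]
  have hD : ∀ t, HasDerivAt Dt (Dt t * A + NormedSpace.exp (t • A) * W) t := fun t => by
    have h1 : HasDerivAt Dt (∑ n ∈ Finset.range N,
        (((n.factorial : ℂ))⁻¹ * (n * t ^ (n - 1))) • powDeriv A W n) t :=
      HasDerivAt.fun_sum fun n _ => ((hasDerivAt_pow n t).const_mul _).smul_const _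
    refine h1.congr_deriv ?_
    rw [hexp]
    simp only [Dt, Finset.sum_mul, smul_mul_assoc, ← Finset.sum_add_distrib, ← smul_add]
    cases N with
    | zero => simp
    | succ N =>
      -- The recursion of `powDeriv` shifts the index by one; the surplus top term vanishes by `hN`.
      rw [Finset.sum_range_succ', Finset.sum_range_succ]
      change _ = _ + _ • powDeriv A W (N + 1)
      rw [hN]
      simp only [Nat.cast_zero, zero_mul, mul_zero, zero_smul, smul_zero, add_zero]
      refine Finset.sum_congr rfl fun n _ => ?_
      change _ = _ • powDeriv A W (n + 1)
      congr 1
      rw [Nat.factorial_succ, Nat.add_sub_cancel]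
      push_cast
      have : (n : ℂ) + 1 ≠ 0 := by exact_mod_cast Nat.succ_ne_zero n
      field_simp
  have hK : ∀ t, HasDerivAt (fun t : ℂ => Dt t * NormedSpace.exp (-(t • A)))
      (NormedSpace.exp (t • A) * W * NormedSpace.exp (-(t • A))) t := fun t => by
    have h2 := hasDerivAt_exp_smul_const' (-A) t
    have h3 := (hD t).mul h2
    simp only [smul_neg] at h3
    refine h3.congr_deriv ?_
    noncomm_ring
  -- The chain of derivatives starts one step before the conjugation series. Its zeroth Taylor
  -- coefficient is zero, and this shift produces (n + 1)! in the denominators.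
  let f : ℕ → ℂ → ℂ := fun n => match n with
    | 0 => fun t => ℓ (Dt t * NormedSpace.exp (-(t • A)))
    | n + 1 => fun t => ℓ (NormedSpace.exp (t • A) * ((adMat A ^ n) W) *
        NormedSpace.exp (-(t • A)))
  have h := hasSum_taylor (f := f) fun n t => by
    cases n with
    | zero => simpa [f] using hasDerivAt_linear (hK t) ℓ
    | succ n =>
      have := hasDerivAt_linear (hasDerivAt_exp_conj A ((adMat A ^ n) W) t) ℓ
      simp only [f]
      rwa [pow_succ', Module.End.mul_apply, adMat_apply]
  have h0 : f 0 0 = 0 := by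
    have : Dt 0 = 0 := by
      refine Finset.sum_eq_zero fun n _ => ?_
      cases n with
      | zero => simp [powDeriv]
      | succ n => simp
    simp [f, this]
  have h1 := (hasSum_nat_add_iff' 1).2 h
  simp only [Finset.range_one, Finset.sum_singleton, h0, mul_zero, sub_zero] at h1
  have h2 : f 0 1 = ℓ ((∑ n ∈ Finset.range N, ((n.factorial : ℂ))⁻¹ • powDeriv A W n) *
        NormedSpace.exp (-A)) := by
    simp only [f, Dt, one_pow, mul_one, one_smul]
  rw [← h2]
  have h3 : ∀ n : ℕ, f (n + 1) 0 = ℓ ((adMat A ^ n) W) := fun n => by simp [f]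
  simpa only [h3] using h1

theorem isNilpotent_adMat {A : Matrix (Fin m) (Fin m) ℂ} (hA : IsNilpotent A) :
    IsNilpotent (adMat A) :=
  (LinearMap.commute_mulLeft_right (R := ℂ) A A).isNilpotent_sub
    ((LinearMap.isNilpotent_mulLeft_iff (R := ℂ) A).2 hA) ((LinearMap.isNilpotent_mulRight_iff (R := ℂ) A).2 hA)

/-- Left-invariant vector fields of the unipotent group `exp V` of a Lie algebra `V` of nilpotent
matrices are tangent to it. -/
theorem tangentTo_exp_of_nilpotent {V : Submodule ℂ (Matrix (Fin m) (Fin m) ℂ)}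
    (hV : ∀ A ∈ V, ∀ B ∈ V, A * B - B * A ∈ V) {N : ℕ} (hN : ∀ A ∈ V, A ^ N = 0)
    {B : Matrix (Fin m) (Fin m) ℂ} (hB : B ∈ V) :
    TangentTo {g | ∃ A ∈ V, g = NormedSpace.exp A} B := by
  rintro P hP γ ⟨A, hA, rfl⟩
  have hadV : ∀ W ∈ V, adMat A W ∈ V := fun W hW => hV A hA W hW
  let T : Module.End ℂ V := (adMat A).restrict hadV
  obtain ⟨M, hM⟩ := isNilpotent_adMat ⟨N, hN A hA⟩
  have hTpow : ∀ (n : ℕ) (W : V), ((T ^ n) W : Matrix (Fin m) (Fin m) ℂ) = (adMat A ^ n) W :=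
    fun n W => by
      rw [Module.End.pow_restrict n hadV]; rfl
  have hT : IsNilpotent T := ⟨M, LinearMap.ext fun W => Subtype.ext (by rw [hTpow, hM]; rfl)⟩
  have hTM : T ^ M = 0 := LinearMap.ext fun W => Subtype.ext (by rw [hTpow, hM]; rfl)
  -- This is (eˣ - 1)/x at x = ad A on V, hence 1 plus a nilpotent operator and invertible. Solving
  -- ΦW = B yields a curve exp(A + sW) inside exp V whose velocity at s = 0 is B exp A.
  let Φ : Module.End ℂ V := ∑ n ∈ Finset.range M, (((n + 1).factorial : ℂ))⁻¹ • T ^ n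
  have hΦ : IsUnit Φ := by
    cases M with
    | zero =>
      have : (1 : Module.End ℂ V) = 0 := by simpa using hTM
      have h0 : Φ = 1 := by rw [this, ← mul_one Φ, this, mul_zero]
      rw [h0]; exact isUnit_one
    | succ M =>
      have : Φ = T * (∑ n ∈ Finset.range M, (((n + 2).factorial : ℂ))⁻¹ • T ^ n) + 1 := by
        simp only [Φ, Finset.sum_range_succ', Finset.mul_sum, mul_smul_comm, ← pow_succ']
        simp
      rw [this]
      have hc : Commute T (∑ n ∈ Finset.range M, (((n + 2).factorial : ℂ))⁻¹ • T ^ n) := Commute.sum_right _ _ _ fun n _ => ((Commute.refl T).pow_right n).smul_right _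
      have hn : IsNilpotent (T * ∑ n ∈ Finset.range M, (((n + 2).factorial : ℂ))⁻¹ • T ^ n) :=
        hc.isNilpotent_mul_right hT
      exact @IsNilpotent.isUnit_add_one (Module.End ℂ V) _ _ hn
  obtain ⟨W, hW⟩ := (Module.End.isUnit_iff _ |>.1 hΦ).2 ⟨B, hB⟩
  have hAW : ∀ s : ℂ, A + s • (W : Matrix (Fin m) (Fin m) ℂ) ∈ V := fun s =>
    V.add_mem hA (V.smul_mem s W.2)
  -- Differentiate the identity (A + sW)^N = 0, valid for all s because A + sW stays in V.
  have hpd : powDeriv A W N = 0 := by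
    have := hasDerivAt_pow_add_smul A (W : Matrix (Fin m) (Fin m) ℂ) N
    simp only [fun s => hN _ (hAW s)] at this
    exact Matrix.ext fun i j => (hasDerivAt_entry this i j).unique (hasDerivAt_const _ _)
  have hd := hasDerivAt_exp_add_smul (A := A) (W := (W : Matrix (Fin m) (Fin m) ℂ)) (N := N)
    fun s => hN _ (hAW s)
  set D := ∑ n ∈ Finset.range N, ((n.factorial : ℂ))⁻¹ • powDeriv A (W : Matrix (Fin m) (Fin m) ℂ) n
    with hDdef
  have hDB : D * NormedSpace.exp (-A) = B := by
    refine eq_of_sub_eq_zero ?_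
    by_contra hne
    obtain ⟨ℓ, hℓ, -⟩ := Submodule.exists_le_ker_of_notMem
      (p := (⊥ : Submodule ℂ (Matrix (Fin m) (Fin m) ℂ))) (by simpa using hne)
    refine hℓ ?_
    have h1 := hasSum_dexp (hN A hA) hpd ℓ
    have h2 := hasSum_sum_of_ne_finset_zero (L := SummationFilter.unconditional ℕ) (s := Finset.range M)
      (f := fun n : ℕ => (((n + 1).factorial : ℂ))⁻¹ * ℓ ((adMat A ^ n) W)) fun n hn => by
        rw [pow_eq_zero_of_le (by simpa using hn) hM, LinearMap.zero_apply, map_zero, mul_zero]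
    rw [map_sub, h1.unique h2, sub_eq_zero, show B = ((Φ W : V) : Matrix (Fin m) (Fin m) ℂ) by
      rw [hW]]
    simp only [Φ, LinearMap.sum_apply, LinearMap.smul_apply, Submodule.coe_sum, Submodule.coe_smul,
      hTpow, map_sum, map_smul, smul_eq_mul]
  have hDB' : D = B * NormedSpace.exp A := by
    rw [← hDB, mul_assoc, exp_neg_mul_exp, mul_one]
  have h1 := hasDerivAt_evalAt (fun i j => hasDerivAt_entry hd i j) P
  have h2 : (fun s : ℂ => evalAt (NormedSpace.exp (A + s • (W : Matrix (Fin m) (Fin m) ℂ))) P) =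
      fun _ => 0 := funext fun s => hP _ ⟨_, hAW s, rfl⟩
  rw [h2] at h1
  have h3 := h1.unique (hasDerivAt_const _ _)
  rw [evalAt_dirDeriv, ← h3, hDB']
  simp

end NilpotentExp

end DrinfeldSokolov

namespace DrinfeldSokolov

namespace Setting

open LieAlgebra LieAlgebra.IsKilling

variable {𝔤 : Type*} [LieRing 𝔤] [LieAlgebra ℂ 𝔤] [FiniteDimensional ℂ 𝔤]
  [LieAlgebra.IsSemisimple ℂ 𝔤] {H : LieSubalgebra ℂ 𝔤} [H.IsCartanSubalgebra] {l m : ℕ}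
  (D : Setting 𝔤 H l m)

/-! ### Coweights and heights -/

/-- The fundamental coweights. -/
def coweight (i : Fin l) : H :=
  (Module.evalEquiv ℂ H).symm (D.base.toWeightBasis.coord (D.simple i))

/-- The simple root `αᵢ`. -/
def simpleRoot (i : Fin l) : Module.Dual ℂ H := (rootSystem H).root (D.simple i)

/-- The simple coroot `Hᵢ`. -/
def simpleCoroot (i : Fin l) : H := (rootSystem H).coroot (D.simple i)

theorem simpleRoot_coweight (i j : Fin l) :
    D.simpleRoot j (D.coweight i) = if j = i then 1 else 0 := by
  classical
  have h1 : D.simpleRoot j (D.coweight i) =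
      Module.evalEquiv ℂ H (D.coweight i) (D.simpleRoot j) := rfl
  have h2 : D.simpleRoot j = D.base.toWeightBasis (D.simple j) :=
    (D.base.toWeightBasis_apply _).symm
  rw [h1, h2, coweight, LinearEquiv.apply_symm_apply, Module.Basis.coord_apply,
    Module.Basis.repr_self, Finsupp.single_apply]
  simp [D.simple.injective.eq_iff]

theorem eq_zero_of_simpleRoot_eq_zero {h : H} (hh : ∀ i, D.simpleRoot i h = 0) : h = 0 := by
  refine (Module.forall_dual_apply_eq_zero_iff ℂ h).1 fun f => ?_
  rw [← D.base.toWeightBasis.sum_repr f, LinearMap.sum_apply]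
  refine Finset.sum_eq_zero fun i _ => ?_
  obtain ⟨j, rfl⟩ := D.simple.surjective i
  rw [LinearMap.smul_apply, RootPairing.Base.toWeightBasis_apply]
  exact (congrArg _ (hh j)).trans (smul_zero _)

/-- The fundamental weights. -/
def weight (i : Fin l) : Module.Dual ℂ H := D.base.toCoweightBasis.coord (D.simple i)

theorem weight_simpleCoroot (i j : Fin l) :
    D.weight i (D.simpleCoroot j) = if j = i then 1 else 0 := by
  classical
  have h2 : D.simpleCoroot j = D.base.toCoweightBasis (D.simple j) :=
    (D.base.toCoweightBasis_apply _).symm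
  rw [h2, weight, Module.Basis.coord_apply, Module.Basis.repr_self, Finsupp.single_apply]
  simp [D.simple.injective.eq_iff]

theorem sum_support {M : Type*} [AddCommMonoid M] (f : H.root → M) :
    ∑ j ∈ D.base.support, f j = ∑ i : Fin l, f (D.simple i) := by
  rw [← Finset.sum_coe_sort]
  exact (Equiv.sum_comp D.simple fun j => f j).symm

/-- A root is an integral combination of the simple roots. -/
theorem exists_root_eq_sum (i : H.root) : ∃ f : Fin l → ℤ,
    (rootSystem H).root i = ∑ j, f j • D.simpleRoot j ∧ D.base.height i = ∑ j, f j ∧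
      ((∀ j, 0 ≤ f j) ∨ ∀ j, f j ≤ 0) := by
  obtain ⟨f, -, hf, hsum⟩ := D.base.exists_root_eq_sum_int i
  refine ⟨fun j => f (D.simple j), ?_, ?_, ?_⟩
  · rw [hsum, D.sum_support fun j => f j • (rootSystem H).root j]
    rfl
  · rw [RootPairing.Base.height_eq_sum hsum, D.sum_support f]
  · rcases hf with hf | hf
    · exact Or.inl fun j => hf.le _
    · exact Or.inr fun j => hf.le _

/-- The element `h₀` of the Cartan subalgebra on which the roots take their heights as values. -/
def heightElt : H := ∑ i, D.coweight i

theorem root_heightElt (i : H.root) : (i.1 : H → ℂ) D.heightElt = (D.base.height i : ℂ) := by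
  obtain ⟨f, hf, hht, -⟩ := D.exists_root_eq_sum i
  have h1 : (i.1 : H → ℂ) D.heightElt = (rootSystem H).root i D.heightElt := rfl
  rw [h1, hf, hht, heightElt]
  simp [LinearMap.sum_apply, D.simpleRoot_coweight]

theorem exists_root_coweight (i : H.root) (j : Fin l) :
    ∃ n : ℤ, (rootSystem H).root i (D.coweight j) = n ∧ (D.base.IsPos i → 0 ≤ n) ∧
      (¬ D.base.IsPos i → n ≤ 0) := by
  obtain ⟨f, hf, hht, h⟩ := D.exists_root_eq_sum i
  refine ⟨f j, ?_, fun hp => ?_, fun hp => ?_⟩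
  · rw [hf]
    simp [LinearMap.sum_apply, D.simpleRoot_coweight]
  · rcases h with h | h
    · exact h j
    · have h0 : ∑ j, f j ≤ 0 := Finset.sum_nonpos fun j _ => h j
      rw [RootPairing.Base.isPos_iff, hht] at hp
      omega
  · rcases h with h | h
    · have h0 : 0 ≤ ∑ j, f j := Finset.sum_nonneg fun j _ => h j
      rw [RootPairing.Base.isPos_iff', hht] at hp
      omega
    · exact h j

/-! ### The grading by height and the triangular projections -/

/-- `z` lies in a root space (or in the Cartan subalgebra), in degree `k`. -/
def IsHomog (k : ℤ) (z : 𝔤) : Prop :=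
  ∃ χ : H → ℂ, z ∈ rootSpace H χ ∧ χ D.heightElt = k

theorem mem_rootSpace_zero {h : 𝔤} (hh : h ∈ H) : h ∈ rootSpace H (0 : H → ℂ) := by
  rw [LieAlgebra.rootSpace_zero_eq]
  exact hh

theorem isHomog_of_mem {h : 𝔤} (hh : h ∈ H) : D.IsHomog 0 h :=
  ⟨0, mem_rootSpace_zero hh, by simp⟩

theorem isHomog_of_mem_rootSpace (i : H.root) {z : 𝔤} (hz : z ∈ rootSpace H i.1) :
    D.IsHomog (D.base.height i) z :=
  ⟨i.1, hz, D.root_heightElt i⟩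

theorem IsHomog.lie {D : Setting 𝔤 H l m} {a b : ℤ} {x y : 𝔤} (hx : D.IsHomog a x)
    (hy : D.IsHomog b y) : D.IsHomog (a + b) ⁅x, y⁆ := by
  obtain ⟨χ, hx, hχ⟩ := hx
  obtain ⟨ψ, hy, hψ⟩ := hy
  refine ⟨χ + ψ, lie_mem_genWeightSpace_of_mem_genWeightSpace hx hy, ?_⟩
  rw [Pi.add_apply, hχ, hψ]
  push_cast
  rfl

theorem IsHomog.lie_heightElt {D : Setting 𝔤 H l m} {a : ℤ} {x : 𝔤} (hx : D.IsHomog a x) :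
    ⁅(D.heightElt : 𝔤), x⁆ = (a : ℂ) • x := by
  obtain ⟨χ, hx, hχ⟩ := hx
  have := lie_eq_smul_of_mem_rootSpace hx D.heightElt
  rw [hχ] at this
  exact this

/-- Root vectors and the Cartan subalgebra span `𝔤`. -/
theorem induction_rootSpace {p : 𝔤 → Prop} (h0 : ∀ h ∈ H, p h)
    (hr : ∀ (i : H.root), ∀ z ∈ rootSpace H i.1, p z) (hadd : ∀ x y, p x → p y → p (x + y))
    (x : 𝔤) : p x := by
  have hx : x ∈ H.toLieSubmodule ⊔ ⨆ α : LieModule.Weight ℂ H 𝔤, ⨆ (_ : α.IsNonZero),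
      rootSpace H α := by
    rw [cartan_sup_iSup_rootSpace_eq_top]; trivial
  obtain ⟨y, hy, z, hz, rfl⟩ := (LieSubmodule.mem_sup _ _ _).1 hx
  refine hadd _ _ (h0 y (by simpa using hy)) ?_
  have key : ∀ z ∈ ⨆ α : LieModule.Weight ℂ H 𝔤, ⨆ (_ : α.IsNonZero),
      (rootSpace H α).toSubmodule, p z := by
    intro z hz
    induction hz using Submodule.iSup_induction' with
    | mem α z hz =>
      by_cases hα : α.IsNonZero
      · rw [iSup_pos hα] at hz
        exact hr ⟨α, by simpa using hα⟩ z hz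
      · rw [iSup_neg hα, Submodule.mem_bot] at hz
        rw [hz]
        exact h0 0 H.zero_mem
    | zero => exact h0 0 H.zero_mem
    | add x y _ _ ihx ihy => exact hadd _ _ ihx ihy
  refine key z ?_
  rw [← LieSubmodule.mem_toSubmodule] at hz
  simpa only [LieSubmodule.iSup_toSubmodule] using hz

theorem homog_induction {p : 𝔤 → Prop} (h : ∀ k z, D.IsHomog k z → p z)
    (hadd : ∀ x y, p x → p y → p (x + y)) (x : 𝔤) : p x :=
  induction_rootSpace (fun z hz => h _ z (D.isHomog_of_mem hz))
    (fun i z hz => h _ z (D.isHomog_of_mem_rootSpace i hz)) hadd x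

/-- Identities between linear maps on 𝔤 are checked degree by degree. Since the triangular
projections merely truncate by the sign of the height, such identities become statements about signs
of integers. -/
theorem hom_ext_homog {E : Type*} [AddCommGroup E] [Module ℂ E] {f g : 𝔤 →ₗ[ℂ] E}
    (h : ∀ k z, D.IsHomog k z → f z = g z) : f = g :=
  LinearMap.ext fun x => D.homog_induction (p := fun z => f z = g z) h
    (fun x y hx hy => by rw [map_add, map_add, hx, hy]) x

/-- The projection onto `𝔫̄`. -/
def projNeg : Module.End ℂ 𝔤 := weightProj H (negWeights D.base)

/-- The projection onto `𝔫`. -/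
def projPos : Module.End ℂ 𝔤 := weightProj H (posWeights D.base)

/-- The projection onto the Cartan subalgebra. -/
def projCartan (H : LieSubalgebra ℂ 𝔤) [H.IsCartanSubalgebra] : Module.End ℂ 𝔤 :=
  H.toSubmodule.subtype ∘ₗ cartanProj H

theorem weightProj_of_mem {S : Set (LieModule.Weight ℂ H 𝔤)} {z : 𝔤} (hz : z ∈ weightSum H S) :
    weightProj H S z = z := by
  rw [weightProj, Submodule.projection_apply]
  rw [Submodule.projectionOnto_apply_of_mem_left _ hz]

theorem weightProj_of_mem_compl {S : Set (LieModule.Weight ℂ H 𝔤)} {z : 𝔤}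
    (hz : z ∈ weightSum H Sᶜ) : weightProj H S z = 0 := by
  rw [← LinearMap.mem_ker, weightProj, Submodule.ker_projection]
  exact hz

theorem mem_weightSum {S : Set (LieModule.Weight ℂ H 𝔤)} {χ : LieModule.Weight ℂ H 𝔤} (hχ : χ ∈ S)
    {z : 𝔤} (hz : z ∈ rootSpace H χ) : z ∈ weightSum H S :=
  Submodule.mem_iSup_of_mem χ (Submodule.mem_iSup_of_mem hχ hz)

/-- A homogeneous element is zero, in the Cartan subalgebra, or a root vector. -/
theorem IsHomog.cases {D : Setting 𝔤 H l m} {k : ℤ} {z : 𝔤} (hz : D.IsHomog k z) :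
    (z ∈ H ∧ (z = 0 ∨ k = 0)) ∨ ∃ i : H.root, z ∈ rootSpace H i.1 ∧ k = D.base.height i := by
  obtain ⟨χ, hz, hχ⟩ := hz
  by_cases h0 : z = 0
  · exact Or.inl ⟨h0 ▸ H.zero_mem, Or.inl h0⟩
  by_cases hχ0 : χ = 0
  · subst hχ0
    refine Or.inl ⟨?_, Or.inr ?_⟩
    · rw [LieAlgebra.rootSpace_zero_eq] at hz
      simpa using hz
    · simpa using hχ.symm
  · have hne : LieModule.genWeightSpace 𝔤 χ ≠ ⊥ := fun h => h0 (by
      change z ∈ LieModule.genWeightSpace 𝔤 χ at hz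
      rw [h] at hz; simpa using hz)
    let α : LieModule.Weight ℂ H 𝔤 := ⟨χ, hne⟩
    let i : H.root := ⟨α, by simpa [LieModule.Weight.IsNonZero, LieModule.Weight.IsZero, α] using hχ0⟩
    refine Or.inr ⟨i, hz, ?_⟩
    have := D.root_heightElt i
    have h2 : χ D.heightElt = (D.base.height i : ℂ) := this
    rw [hχ] at h2
    exact_mod_cast h2

theorem weightProj_of_mem_cartan {S : Set (LieModule.Weight ℂ H 𝔤)} (hS : ∀ χ ∈ S, χ.IsNonZero)
    {h : 𝔤} (hh : h ∈ H) : weightProj H S h = 0 := by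
  by_cases h0 : h = 0
  · rw [h0, map_zero]
  have hne : LieModule.genWeightSpace 𝔤 (0 : H → ℂ) ≠ ⊥ := fun hb => h0 (by
    have := mem_rootSpace_zero hh
    change h ∈ LieModule.genWeightSpace 𝔤 (0 : H → ℂ) at this
    rw [hb] at this; simpa using this)
  exact weightProj_of_mem_compl (mem_weightSum (S := Sᶜ) (χ := ⟨0, hne⟩)
    (fun hm => hS _ hm rfl) (mem_rootSpace_zero hh))

theorem projNeg_homog {k : ℤ} {z : 𝔤} (hz : D.IsHomog k z) :
    D.projNeg z = if k < 0 then z else 0 := by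
  rcases hz.cases with ⟨hzH, h⟩ | ⟨i, hi, rfl⟩
  · rw [projNeg, weightProj_of_mem_cartan _ hzH]
    · rcases h with rfl | rfl <;> simp
    · rintro _ ⟨i, -, rfl⟩
      exact H.isNonZero_coe_root i
  · split_ifs with h
    · exact weightProj_of_mem (mem_weightSum (S := negWeights D.base) ⟨i, fun hp => by
        rw [RootPairing.Base.isPos_iff] at hp; omega, rfl⟩ hi)
    · refine weightProj_of_mem_compl (mem_weightSum (S := (negWeights D.base)ᶜ) ?_ hi)
      rintro ⟨j, hj, hij⟩
      have : i = j := Subtype.ext hij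
      subst this
      rw [RootPairing.Base.isPos_iff'] at hj
      omega

theorem projPos_homog {k : ℤ} {z : 𝔤} (hz : D.IsHomog k z) :
    D.projPos z = if 0 < k then z else 0 := by
  rcases hz.cases with ⟨hzH, h⟩ | ⟨i, hi, rfl⟩
  · rw [projPos, weightProj_of_mem_cartan _ hzH]
    · rcases h with rfl | rfl <;> simp
    · rintro _ ⟨i, -, rfl⟩
      exact H.isNonZero_coe_root i
  · split_ifs with h
    · exact weightProj_of_mem (mem_weightSum (S := posWeights D.base) ⟨i, h, rfl⟩ hi)
    · refine weightProj_of_mem_compl (mem_weightSum (S := (posWeights D.base)ᶜ) ?_ hi)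
      rintro ⟨j, hj, hij⟩
      have : i = j := Subtype.ext hij
      subst this
      exact h hj

theorem cartanProj_of_mem {h : 𝔤} (hh : h ∈ H) : cartanProj H h = ⟨h, hh⟩ :=
  Submodule.projectionOnto_apply_of_mem_left _ hh

theorem projCartan_of_mem {h : 𝔤} (hh : h ∈ H) : projCartan H h = h := by
  rw [projCartan, LinearMap.comp_apply, cartanProj_of_mem hh]
  rfl

theorem projCartan_homog {k : ℤ} {z : 𝔤} (hz : D.IsHomog k z) :
    projCartan H z = if k = 0 then z else 0 := by
  rcases hz.cases with ⟨hzH, h⟩ | ⟨i, hi, rfl⟩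
  · rw [projCartan_of_mem hzH]
    rcases h with rfl | rfl <;> simp
  · rw [if_neg (D.base.height_ne_zero i), projCartan, LinearMap.comp_apply,
      show cartanProj H z = 0 from ?_, map_zero]
    rw [cartanProj, Submodule.projectionOnto_apply_eq_zero_iff]
    exact mem_weightSum (H.isNonZero_coe_root i) hi

theorem projCartan_mem (z : 𝔤) : projCartan H z ∈ H := (cartanProj H z).2

end Setting

end DrinfeldSokolov

namespace DrinfeldSokolov

namespace Setting

open LieAlgebra LieAlgebra.IsKilling

variable {𝔤 : Type*} [LieRing 𝔤] [LieAlgebra ℂ 𝔤] [FiniteDimensional ℂ 𝔤]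
  [LieAlgebra.IsSemisimple ℂ 𝔤] {H : LieSubalgebra ℂ 𝔤} [H.IsCartanSubalgebra] {l m : ℕ}
  (D : Setting 𝔤 H l m)

/-! ### Relations between the projections -/

theorem projSum : D.projNeg + projCartan H + D.projPos = 1 := by
  refine D.hom_ext_homog fun k z hz => ?_
  simp only [LinearMap.add_apply, D.projNeg_homog hz, D.projPos_homog hz, D.projCartan_homog hz,
    Module.End.one_apply]
  rcases lt_trichotomy k 0 with h | rfl | h
  · simp [h, h.not_gt, h.ne]
  · simp
  · simp [h, h.not_gt, h.ne']

theorem projNeg_comp_projNeg : D.projNeg ∘ₗ D.projNeg = D.projNeg := by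
  refine D.hom_ext_homog fun k z hz => ?_
  rw [LinearMap.comp_apply, D.projNeg_homog hz]
  split_ifs with h
  · rw [D.projNeg_homog hz, if_pos h]
  · rw [map_zero]

theorem projPos_comp_projPos : D.projPos ∘ₗ D.projPos = D.projPos := by
  refine D.hom_ext_homog fun k z hz => ?_
  rw [LinearMap.comp_apply, D.projPos_homog hz]
  split_ifs with h
  · rw [D.projPos_homog hz, if_pos h]
  · rw [map_zero]

theorem projCartan_comp_projCartan : projCartan H ∘ₗ projCartan H = projCartan H :=
  LinearMap.ext fun x => projCartan_of_mem (projCartan_mem x)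

theorem projPos_comp_projNeg : D.projPos ∘ₗ D.projNeg = 0 := by
  refine D.hom_ext_homog fun k z hz => ?_
  rw [LinearMap.comp_apply, D.projNeg_homog hz]
  split_ifs with h
  · rw [D.projPos_homog hz, if_neg h.not_gt, LinearMap.zero_apply]
  · rw [map_zero, LinearMap.zero_apply]

theorem projNeg_comp_projPos : D.projNeg ∘ₗ D.projPos = 0 := by
  refine D.hom_ext_homog fun k z hz => ?_
  rw [LinearMap.comp_apply, D.projPos_homog hz]
  split_ifs with h
  · rw [D.projNeg_homog hz, if_neg h.not_gt, LinearMap.zero_apply]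
  · rw [map_zero, LinearMap.zero_apply]

theorem projCartan_comp_projNeg : projCartan H ∘ₗ D.projNeg = 0 := by
  refine D.hom_ext_homog fun k z hz => ?_
  rw [LinearMap.comp_apply, D.projNeg_homog hz]
  split_ifs with h
  · rw [D.projCartan_homog hz, if_neg h.ne, LinearMap.zero_apply]
  · rw [map_zero, LinearMap.zero_apply]

theorem projCartan_comp_projPos : projCartan H ∘ₗ D.projPos = 0 := by
  refine D.hom_ext_homog fun k z hz => ?_
  rw [LinearMap.comp_apply, D.projPos_homog hz]
  split_ifs with h
  · rw [D.projCartan_homog hz, if_neg h.ne', LinearMap.zero_apply]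
  · rw [map_zero, LinearMap.zero_apply]

theorem projNeg_of_mem_cartan {h : 𝔤} (hh : h ∈ H) : D.projNeg h = 0 := by
  rw [D.projNeg_homog (D.isHomog_of_mem hh), if_neg (lt_irrefl _)]

theorem projPos_of_mem_cartan {h : 𝔤} (hh : h ∈ H) : D.projPos h = 0 := by
  rw [D.projPos_homog (D.isHomog_of_mem hh), if_neg (lt_irrefl _)]

theorem projNeg_comp_projCartan : D.projNeg ∘ₗ projCartan H = 0 :=
  LinearMap.ext fun x => D.projNeg_of_mem_cartan (projCartan_mem x)

theorem projPos_comp_projCartan : D.projPos ∘ₗ projCartan H = 0 :=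
  LinearMap.ext fun x => D.projPos_of_mem_cartan (projCartan_mem x)

theorem mem_nilNeg {x : 𝔤} : x ∈ nilNeg D.base ↔ D.projNeg x = x := by
  refine ⟨fun h => weightProj_of_mem h, fun h => ?_⟩
  rw [← h, projNeg, weightProj, Submodule.projection_apply]
  exact Submodule.coe_mem _

theorem mem_nilPos {x : 𝔤} : x ∈ nilPos D.base ↔ D.projPos x = x := by
  refine ⟨fun h => weightProj_of_mem h, fun h => ?_⟩
  rw [← h, projPos, weightProj, Submodule.projection_apply]
  exact Submodule.coe_mem _

theorem projNeg_mem (x : 𝔤) : D.projNeg x ∈ nilNeg D.base :=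
  D.mem_nilNeg.2 (LinearMap.congr_fun D.projNeg_comp_projNeg x)

theorem projPos_mem (x : 𝔤) : D.projPos x ∈ nilPos D.base :=
  D.mem_nilPos.2 (LinearMap.congr_fun D.projPos_comp_projPos x)

theorem hom_ext_homog₂ {E : Type*} [AddCommGroup E] [Module ℂ E] {f g : 𝔤 →ₗ[ℂ] 𝔤 →ₗ[ℂ] E}
    (h : ∀ a b x y, D.IsHomog a x → D.IsHomog b y → f x y = g x y) : f = g :=
  D.hom_ext_homog fun a x hx => D.hom_ext_homog fun b y hy => h a b x y hx hy

/-- `[𝔫̄, 𝔫̄ + 𝔥] ⊆ 𝔫̄`. -/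
theorem lie_mem_nilNeg {x y : 𝔤} (hx : x ∈ nilNeg D.base) (hy : D.projPos y = 0) :
    ⁅x, y⁆ ∈ nilNeg D.base := by
  have key : ((LieModule.toEnd ℂ 𝔤 𝔤 : 𝔤 →ₗ[ℂ] Module.End ℂ 𝔤).compl₁₂ D.projNeg
        (1 - D.projPos)).compr₂ D.projNeg =
      (LieModule.toEnd ℂ 𝔤 𝔤 : 𝔤 →ₗ[ℂ] Module.End ℂ 𝔤).compl₁₂ D.projNeg (1 - D.projPos) := by
    refine D.hom_ext_homog₂ fun a b x y hx hy => ?_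
    simp only [LinearMap.compr₂_apply, LinearMap.compl₁₂_apply, LieHom.coe_toLinearMap,
      LieModule.toEnd_apply_apply, LinearMap.sub_apply, Module.End.one_apply,
      D.projNeg_homog hx, D.projPos_homog hy]
    split_ifs with h1 h2
    · simp
    · rw [sub_zero, D.projNeg_homog (hx.lie hy), if_pos (by omega)]
    · simp
    · simp
  have := LinearMap.congr_fun₂ key x y
  simp only [LinearMap.compr₂_apply, LinearMap.compl₁₂_apply, LieHom.coe_toLinearMap,
    LieModule.toEnd_apply_apply, LinearMap.sub_apply, Module.End.one_apply,
    D.mem_nilNeg.1 hx, hy, sub_zero] at this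
  exact D.mem_nilNeg.2 this

/-- `[𝔫, 𝔫 + 𝔥] ⊆ 𝔫`. -/
theorem lie_mem_nilPos {x y : 𝔤} (hx : x ∈ nilPos D.base) (hy : D.projNeg y = 0) :
    ⁅x, y⁆ ∈ nilPos D.base := by
  have key : ((LieModule.toEnd ℂ 𝔤 𝔤 : 𝔤 →ₗ[ℂ] Module.End ℂ 𝔤).compl₁₂ D.projPos
        (1 - D.projNeg)).compr₂ D.projPos =
      (LieModule.toEnd ℂ 𝔤 𝔤 : 𝔤 →ₗ[ℂ] Module.End ℂ 𝔤).compl₁₂ D.projPos (1 - D.projNeg) := by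
    refine D.hom_ext_homog₂ fun a b x y hx hy => ?_
    simp only [LinearMap.compr₂_apply, LinearMap.compl₁₂_apply, LieHom.coe_toLinearMap,
      LieModule.toEnd_apply_apply, LinearMap.sub_apply, Module.End.one_apply,
      D.projPos_homog hx, D.projNeg_homog hy]
    split_ifs with h1 h2
    · simp
    · rw [sub_zero, D.projPos_homog (hx.lie hy), if_pos (by omega)]
    · simp
    · simp
  have := LinearMap.congr_fun₂ key x y
  simp only [LinearMap.compr₂_apply, LinearMap.compl₁₂_apply, LieHom.coe_toLinearMap,
    LieModule.toEnd_apply_apply, LinearMap.sub_apply, Module.End.one_apply,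
    D.mem_nilPos.1 hx, hy, sub_zero] at this
  exact D.mem_nilPos.2 this

theorem projPos_of_mem_nilNeg {x : 𝔤} (hx : x ∈ nilNeg D.base) : D.projPos x = 0 := by
  rw [← D.mem_nilNeg.1 hx]
  exact LinearMap.congr_fun D.projPos_comp_projNeg x

theorem projNeg_of_mem_nilPos {x : 𝔤} (hx : x ∈ nilPos D.base) : D.projNeg x = 0 := by
  rw [← D.mem_nilPos.1 hx]
  exact LinearMap.congr_fun D.projNeg_comp_projPos x

/-! ### The invariant form -/

theorem form_comm (x y : 𝔤) : D.form x y = D.form y x := D.form_symm.eq x y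

/-- Invariance of the form under ad h₀ gives (a + b)(x, y) = 0. -/
theorem form_homog {D : Setting 𝔤 H l m} {a b : ℤ} {x y : 𝔤} (hx : D.IsHomog a x)
    (hy : D.IsHomog b y) (hab : a + b ≠ 0) : D.form x y = 0 := by
  have h1 : D.form ⁅(D.heightElt : 𝔤), x⁆ y = -D.form x ⁅(D.heightElt : 𝔤), y⁆ := by
    rw [← lie_skew, map_neg, LinearMap.neg_apply, D.form_invariant]
  rw [hx.lie_heightElt, hy.lie_heightElt, map_smul, map_smul, LinearMap.smul_apply, smul_eq_mul,
    smul_eq_mul] at h1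
  have h2 : ((a + b : ℤ) : ℂ) * D.form x y = 0 := by
    push_cast
    linear_combination h1
  exact (mul_eq_zero.1 h2).resolve_left (by exact_mod_cast hab)

/-- Degree a pairs only with degree -a, so the transpose of truncation to negative degrees is
truncation to positive ones. -/
theorem form_projNeg_left : D.form ∘ₗ D.projNeg = D.form.compl₂ D.projPos := by
  refine D.hom_ext_homog₂ fun a b x y hx hy => ?_
  rw [LinearMap.comp_apply, LinearMap.compl₂_apply, D.projNeg_homog hx, D.projPos_homog hy]
  by_cases hab : a + b = 0
  · obtain rfl : b = -a := by omega
    by_cases h : a < 0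
    · simp [h]
    · simp [h]
  · rw [apply_ite D.form, apply_ite (D.form x)]
    split_ifs <;> simp [form_homog hx hy hab]

theorem form_projCartan_left : D.form ∘ₗ projCartan H = D.form.compl₂ (projCartan H) := by
  refine D.hom_ext_homog₂ fun a b x y hx hy => ?_
  rw [LinearMap.comp_apply, LinearMap.compl₂_apply, D.projCartan_homog hx, D.projCartan_homog hy]
  by_cases hab : a + b = 0
  · obtain rfl : b = -a := by omega
    by_cases h : a = 0 <;> simp [h]
  · rw [apply_ite D.form, apply_ite (D.form x)]
    split_ifs <;> simp [form_homog hx hy hab]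

theorem form_projNeg (x y : 𝔤) : D.form (D.projNeg x) y = D.form x (D.projPos y) :=
  LinearMap.congr_fun₂ D.form_projNeg_left x y

theorem form_projPos (x y : 𝔤) : D.form (D.projPos x) y = D.form x (D.projNeg y) := by
  rw [D.form_comm, ← D.form_projNeg, D.form_comm]

theorem form_projCartan (x y : 𝔤) : D.form (projCartan H x) y = D.form x (projCartan H y) :=
  LinearMap.congr_fun₂ D.form_projCartan_left x y

/-! ### The representation -/

theorem root_isIntegral (i : H.root) : (rootSystem H).root i ∈ AddSubgroup.closure
    {ν : Module.Dual ℂ H | ∃ v : Fin m → ℂ, v ≠ 0 ∧ ∀ h : H, D.ρ (h : 𝔤) *ᵥ v = ν h • v} := by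
  refine D.simply_connected _ fun α => ⟨(rootSystem H).pairingIn ℤ i α, ?_⟩
  exact ((rootSystem H).algebraMap_pairingIn ℤ i α).symm

/-- The kernel of the representation. -/
def kernel : LieIdeal ℂ 𝔤 where
  toSubmodule := LinearMap.ker D.ρ
  lie_mem := by
    intro x y hy
    change D.ρ ⁅x, y⁆ = 0
    have hy' : D.ρ y = 0 := hy
    rw [D.ρ_lie, hy', mul_zero, zero_mul, sub_zero]

/-- All weights of the representation vanish on such an h. Roots are integral weights, so by simple
connectedness they lie in the group generated by the weights of ρ, and they vanish on h too. -/
theorem eq_zero_of_ρ_eq_zero {h : H} (hh : D.ρ (h : 𝔤) = 0) : h = 0 := by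
  refine D.eq_zero_of_simpleRoot_eq_zero fun i => ?_
  have := D.root_isIntegral (D.simple i)
  change D.simpleRoot i ∈ _ at this
  generalize D.simpleRoot i = χ at this
  induction this using AddSubgroup.closure_induction with
  | mem ν hν =>
    obtain ⟨v, hv, hρ⟩ := hν
    have h1 := hρ h
    rw [hh, Matrix.zero_mulVec] at h1
    exact (smul_eq_zero.1 h1.symm).resolve_right hv
  | zero => rfl
  | add x y _ _ hx hy => rw [LinearMap.add_apply, hx, hy, add_zero]
  | neg x _ hx => rw [LinearMap.neg_apply, hx, neg_zero]

/-- An ideal is the sum of its Cartan part and the root spaces it contains. A root space in the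
kernel would bring the corresponding coroot with it, but the kernel meets the Cartan subalgebra in
0. -/
theorem kernel_eq_bot : D.kernel = ⊥ := by
  have h1 : D.kernel.restr H ⊓ H.toLieSubmodule = ⊥ := by
    refine (LieSubmodule.eq_bot_iff _).2 fun x hx => ?_
    have hxH : x ∈ H := by simpa using hx.2
    have := D.eq_zero_of_ρ_eq_zero (h := ⟨x, hxH⟩) hx.1
    exact congrArg Subtype.val this
  have h2 : ∀ α : H.root, ¬ rootSpace H α.1 ≤ D.kernel.restr H := fun α hα => by
    have h3 := D.kernel.corootSubmodule_le hα (coe_coroot_mem_corootSubmodule α.1)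
    have h4 := D.eq_zero_of_ρ_eq_zero (h := coroot α.1) h3
    exact (coroot_eq_zero_iff.not.2 (H.isNonZero_coe_root α)) h4
  have h3 := lieIdeal_eq_inf_cartan_sup_biSup_rootSpace (H := H) D.kernel
  rw [h1, bot_sup_eq] at h3
  refine (LieSubmodule.eq_bot_iff _).2 fun x hx => ?_
  have h4 : x ∈ D.kernel.restr H := hx
  rw [h3] at h4
  simpa [h2] using h4

theorem ρ_injective : Function.Injective D.ρ := by
  rw [← LinearMap.ker_eq_bot]
  have := congrArg (fun I : LieIdeal ℂ 𝔤 => I.toSubmodule) D.kernel_eq_bot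
  exact this

/-- The trace kills brackets. The vector that represents it through the form is therefore central,
and the centre of 𝔤 is trivial. -/
theorem trace_ρ (x : 𝔤) : (D.ρ x).trace = 0 := by
  let τ : Module.Dual ℂ 𝔤 := Matrix.traceLinearMap (Fin m) ℂ ℂ ∘ₗ D.ρ
  have hτ : ∀ x y : 𝔤, τ ⁅x, y⁆ = 0 := fun x y => by
    change (D.ρ ⁅x, y⁆).trace = 0
    rw [D.ρ_lie, Matrix.trace_sub, Matrix.trace_mul_comm, sub_self]
  obtain ⟨z, hz⟩ : ∃ z, D.form z = τ := by
    refine ⟨(D.form.toDual D.form_nondegenerate).symm τ, LinearMap.ext fun y => ?_⟩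
    exact LinearMap.BilinForm.apply_toDual_symm_apply ..
  have hc : z ∈ LieAlgebra.center ℂ 𝔤 := by
    intro y
    refine D.form_nondegenerate.1 _ fun w => ?_
    rw [← lie_skew, map_neg, LinearMap.neg_apply, D.form_invariant, hz, hτ, neg_zero]
  rw [LieAlgebra.center_eq_bot] at hc
  have hz0 : z = 0 := by simpa using hc
  rw [hz0, map_zero] at hz
  exact (LinearMap.congr_fun hz x).symm

end Setting

end DrinfeldSokolov

namespace DrinfeldSokolov

namespace Setting

open LieAlgebra LieAlgebra.IsKilling

variable {𝔤 : Type*} [LieRing 𝔤] [LieAlgebra ℂ 𝔤] [FiniteDimensional ℂ 𝔤]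
  [LieAlgebra.IsSemisimple ℂ 𝔤] {H : LieSubalgebra ℂ 𝔤} [H.IsCartanSubalgebra] {l m : ℕ}
  (D : Setting 𝔤 H l m)

/-! ### The Weyl group -/

/-- The simple reflection `sᵢ` of the Cartan subalgebra. -/
def simpleReflection (i : Fin l) : H ≃ₗ[ℂ] H := (rootSystem H).coreflection (D.simple i)

theorem simpleReflection_apply (i : Fin l) (h : H) :
    D.simpleReflection i h = h - D.simpleRoot i h • D.simpleCoroot i := rfl

/-- The permutation of the roots given by a simple reflection. -/
def simplePerm (i : Fin l) : Equiv.Perm H.root := (rootSystem H).reflectionPerm (D.simple i)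

theorem simplePerm_mul_self (i : Fin l) : D.simplePerm i * D.simplePerm i = 1 := by
  rw [← sq]
  exact (rootSystem H).reflectionPerm_sq _

theorem simpleReflection_mul_self (i : Fin l) :
    D.simpleReflection i * D.simpleReflection i = 1 := by
  rw [← sq]
  exact (rootSystem H).coreflection_sq _

/-- The product of the simple reflections in a list. -/
def word (L : List (Fin l)) : H ≃ₗ[ℂ] H := (L.map D.simpleReflection).prod

/-- The permutation of the roots given by a product of simple reflections. -/
def wordPerm (L : List (Fin l)) : Equiv.Perm H.root := (L.map D.simplePerm).prod

theorem word_cons (i : Fin l) (L : List (Fin l)) :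
    D.word (i :: L) = D.simpleReflection i * D.word L := by simp [word]

theorem word_append (L L' : List (Fin l)) : D.word (L ++ L') = D.word L * D.word L' := by
  simp [word]

theorem wordPerm_cons (i : Fin l) (L : List (Fin l)) :
    D.wordPerm (i :: L) = D.simplePerm i * D.wordPerm L := by simp [wordPerm]

theorem wordPerm_append (L L' : List (Fin l)) :
    D.wordPerm (L ++ L') = D.wordPerm L * D.wordPerm L' := by
  simp [wordPerm]

theorem word_reverse (L : List (Fin l)) : D.word L.reverse * D.word L = 1 := by
  induction L with
  | nil => simp [word]
  | cons i L ih =>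
    rw [List.reverse_cons, word_append, D.word_cons i L,
      show D.word [i] = D.simpleReflection i by simp [word], mul_assoc,
      ← mul_assoc (D.simpleReflection i), simpleReflection_mul_self, one_mul, ih]

theorem word_coroot (L : List (Fin l)) (j : H.root) :
    D.word L ((rootSystem H).coroot j) = (rootSystem H).coroot (D.wordPerm L j) := by
  induction L with
  | nil => rfl
  | cons i L ih =>
    rw [word_cons, wordPerm_cons, LinearEquiv.mul_apply, ih, Equiv.Perm.mul_apply]
    exact ((rootSystem H).coroot_reflectionPerm _ _).symm

theorem root_word (L : List (Fin l)) (j : H.root) (h : H) :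
    (rootSystem H).root (D.wordPerm L j) (D.word L h) = (rootSystem H).root j h := by
  induction L with
  | nil => rfl
  | cons i L ih =>
    rw [word_cons, wordPerm_cons, LinearEquiv.mul_apply, Equiv.Perm.mul_apply, ← ih]
    generalize D.word L h = x
    generalize D.wordPerm L j = k
    rw [simplePerm, RootPairing.root_reflectionPerm, RootPairing.reflection_apply_root,
      simpleReflection, RootPairing.coreflection_apply]
    have h2 : (rootSystem H).root (D.simple i) ((rootSystem H).coroot (D.simple i)) = 2 :=
      (rootSystem H).root_coroot_two _
    have h3 : (rootSystem H).root k ((rootSystem H).coroot (D.simple i)) =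
      (rootSystem H).pairing k (D.simple i) := rfl
    have h4 : (rootSystem H).root' (D.simple i) x = (rootSystem H).root (D.simple i) x := rfl
    rw [h4, LinearMap.sub_apply, LinearMap.smul_apply, map_sub, map_sub, map_smul, map_smul, h2, h3]
    simp only [smul_eq_mul]
    ring

theorem exists_word_of_mem_weylGroup {w : H ≃ₗ[ℂ] H} (hw : w ∈ weylGroup H) :
    ∃ L, w = D.word L := by
  have hmul : ∀ {w w' : H ≃ₗ[ℂ] H}, (∃ L, w = D.word L) → (∃ L, w' = D.word L) →
      ∃ L, w * w' = D.word L := by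
    rintro _ _ ⟨L, rfl⟩ ⟨L', rfl⟩
    exact ⟨L ++ L', (D.word_append _ _).symm⟩
  have hs : ∀ i, ∃ L, D.simpleReflection i = D.word L := fun i => ⟨[i], by simp [word]⟩
  -- Every root is reached from simple ones by simple reflections, and the reflection in a reflected
  -- root is a conjugate.
  have hrefl : ∀ i, ∃ L, (rootSystem H).coreflection i = D.word L := fun i => by
    refine D.base.induction_reflect i (p := fun i => ∃ L, (rootSystem H).coreflection i = D.word L)
      ?_ ?_ ?_
    · rintro i hi
      have : (rootSystem H).coreflection ((rootSystem H).reflectionPerm i i) =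
          (rootSystem H).coreflection i := by
        simp only [RootPairing.coreflection_eq_flip_reflection]
        have := (rootSystem H).flip.reflection_reflectionPerm (i := i) (j := i)
        simp only [RootPairing.flip_reflectionPerm] at this
        rw [this, ← sq, RootPairing.reflection_sq, one_mul]
      rw [this]
      exact hi
    · intro i hi
      obtain ⟨j, hj⟩ := D.simple.surjective ⟨i, hi⟩
      have := hs j
      rw [simpleReflection, hj] at this
      exact this
    · intro i j hi hj
      have : (rootSystem H).coreflection ((rootSystem H).reflectionPerm j i) =
          (rootSystem H).coreflection j * (rootSystem H).coreflection i *
            (rootSystem H).coreflection j := by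
        simp only [RootPairing.coreflection_eq_flip_reflection]
        exact (rootSystem H).flip.reflection_reflectionPerm (i := i) (j := j)
      rw [this]
      obtain ⟨k, hk⟩ := D.simple.surjective ⟨j, hj⟩
      have h2 := hs k
      rw [simpleReflection, hk] at h2
      exact hmul (hmul h2 hi) h2
  induction hw using Subgroup.closure_induction with
  | mem w hw => obtain ⟨i, rfl⟩ := hw; exact hrefl i
  | one => exact ⟨[], rfl⟩
  | mul x y _ _ hx hy => exact hmul hx hy
  | inv x _ hx =>
    obtain ⟨L, rfl⟩ := hx
    exact ⟨L.reverse, (eq_inv_of_mul_eq_one_left (D.word_reverse L)).symm⟩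

/-- The conjugation rule w s_α w⁻¹ = s_{wα}, for the permutations of the roots. -/
theorem reflectionPerm_wordPerm (L : List (Fin l)) (i : H.root) :
    (rootSystem H).reflectionPerm (D.wordPerm L i) * D.wordPerm L =
      D.wordPerm L * (rootSystem H).reflectionPerm i := by
  induction L with
  | nil => rfl
  | cons j L ih =>
    have : ∀ a b : H.root, (rootSystem H).reflectionPerm ((rootSystem H).reflectionPerm a b) =
        (rootSystem H).reflectionPerm a * (rootSystem H).reflectionPerm b *
          (rootSystem H).reflectionPerm a := fun a b => by
      ext1 k
      apply (rootSystem H).root.injective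
      rw [RootPairing.root_reflectionPerm, RootPairing.reflection_reflectionPerm]
      simp only [Equiv.Perm.mul_apply, RootPairing.root_reflectionPerm, LinearEquiv.mul_apply]
    rw [wordPerm_cons, Equiv.Perm.mul_apply, simplePerm, this, mul_assoc _ _ (_ * _),
      ← mul_assoc _ _ (D.wordPerm L)]
    have h2 := (rootSystem H).reflectionPerm_sq (D.simple j)
    rw [sq] at h2
    rw [h2, one_mul, mul_assoc, ih, mul_assoc]

/-- Letters act from the right end of the word, and somewhere a positive root that ends up negative
must pass from positive to negative; j is the letter that does it. -/
theorem exists_split_wordPerm (L : List (Fin l)) {i : H.root} (hi : D.base.IsPos i)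
    (h : ¬ D.base.IsPos (D.wordPerm L i)) : ∃ A j B, L = A ++ j :: B ∧
      D.base.IsPos (D.wordPerm B i) ∧ ¬ D.base.IsPos (D.simplePerm j (D.wordPerm B i)) := by
  induction L with
  | nil => exact absurd hi h
  | cons a t ih =>
    by_cases ht : D.base.IsPos (D.wordPerm t i)
    · refine ⟨[], a, t, rfl, ht, ?_⟩
      rwa [wordPerm_cons] at h
    · obtain ⟨A, j, B, rfl, h1, h2⟩ := ih ht
      exact ⟨a :: A, j, B, rfl, h1, h2⟩

theorem isPos_neg_iff (i : H.root) :
    D.base.IsPos ((rootSystem H).reflectionPerm i i) ↔ ¬ D.base.IsPos i := by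
  have h : D.base.height ((rootSystem H).reflectionPerm i i) = -D.base.height i :=
    D.base.height_reflectionPerm_self i
  rw [RootPairing.Base.isPos_iff, h, RootPairing.Base.isPos_iff']
  omega

theorem wordPerm_neg (L : List (Fin l)) (i : H.root) :
    D.wordPerm L ((rootSystem H).reflectionPerm i i) =
      (rootSystem H).reflectionPerm (D.wordPerm L i) (D.wordPerm L i) := by
  have := DFunLike.congr_fun (D.reflectionPerm_wordPerm L i) i
  exact this.symm

/-- An element of the Weyl group that preserves the positive roots is trivial. -/
theorem wordPerm_eq_one (n : ℕ) : ∀ L : List (Fin l), L.length = n →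
    (∀ i, D.base.IsPos i → D.base.IsPos (D.wordPerm L i)) → D.wordPerm L = 1 := by
  induction n using Nat.strong_induction_on with
  | _ n ih =>
    intro L hL hpos
    rcases L.eq_nil_or_concat with rfl | ⟨L', k, rfl⟩
    · rfl
    · have hk : D.base.IsPos (D.simple k : H.root) :=
        RootPairing.Base.isPos_of_mem_support (D.simple k).2
      -- The final letter sends α_k to -α_k, and the whole word keeps α_k positive.
      have h1 : ¬ D.base.IsPos (D.wordPerm L' (D.simple k)) := by
        have h2 := hpos _ hk
        rw [List.concat_eq_append, wordPerm_append, Equiv.Perm.mul_apply,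
          show D.wordPerm [k] = D.simplePerm k by simp [wordPerm], simplePerm,
          D.wordPerm_neg, D.isPos_neg_iff] at h2
        exact h2
      obtain ⟨A, j, B, rfl, hB, hj⟩ := D.exists_split_wordPerm L' hk h1
      -- A simple reflection turns only one positive root negative, its own simple root.
      have hjB : D.wordPerm B (D.simple k) = D.simple j := by
        by_contra hne
        exact hj (RootPairing.Base.IsPos.reflectionPerm (b := D.base) hB (D.simple j).2 hne)
      have h3 : D.simplePerm j * D.wordPerm B = D.wordPerm B * D.simplePerm k := by
        have := D.reflectionPerm_wordPerm B (D.simple k)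
        rwa [hjB] at this
      -- Exchange: s_j B = B s_k, so the letters j and k cancel and the word becomes shorter by two.
      have h4 : D.wordPerm ((A ++ j :: B).concat k) = D.wordPerm (A ++ B) := by
        rw [List.concat_eq_append, wordPerm_append, wordPerm_append, wordPerm_append, wordPerm_cons,
          show D.wordPerm [k] = D.simplePerm k by simp [wordPerm], h3, mul_assoc, mul_assoc,
          simplePerm_mul_self, mul_one]
      rw [h4] at hpos ⊢
      refine ih (A ++ B).length ?_ _ rfl hpos
      simp at hL ⊢
      omega

theorem word_eq_one {L : List (Fin l)} (h : D.wordPerm L = 1) : D.word L = 1 := by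
  refine LinearEquiv.toLinearMap_injective (LinearMap.ext_on_range
    (v := (rootSystem H).coroot) (RootPairing.IsRootSystem.span_coroot_eq_top) fun j => ?_)
  have := D.word_coroot L j
  rw [h] at this
  exact this

/-- The longest element of the Weyl group is an involution. -/
theorem longest_mul_self {w : H ≃ₗ[ℂ] H} (hw : IsLongest D.base w) : w * w = 1 := by
  obtain ⟨L, rfl⟩ := D.exists_word_of_mem_weylGroup hw.1
  -- The longest element exchanges positive and negative roots, so its square preserves the positive
  -- ones and is trivial by `wordPerm_eq_one`.
  have h1 : ∀ i, D.base.IsPos i → ¬ D.base.IsPos (D.wordPerm L i) := fun i hi => by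
    obtain ⟨j, hj, hij⟩ := hw.2 i hi
    have h2 : (rootSystem H).root (D.wordPerm L i) = -(rootSystem H).root j := by
      refine LinearMap.ext fun h => ?_
      have h3 := D.root_word L i ((D.word L)⁻¹ h)
      rw [show D.word L ((D.word L)⁻¹ h) = h from (D.word L).apply_symm_apply h] at h3
      rw [h3, LinearMap.neg_apply, hij, neg_neg]
    rw [RootPairing.root_eq_neg_iff] at h2
    rw [h2, D.isPos_neg_iff, not_not]
    exact hj
  have h2 : ∀ i, ¬ D.base.IsPos i → D.base.IsPos (D.wordPerm L i) := fun i hi => by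
    have := h1 _ ((D.isPos_neg_iff i).2 hi)
    rwa [wordPerm_neg, isPos_neg_iff, not_not] at this
  rw [← word_append]
  refine D.word_eq_one (D.wordPerm_eq_one _ _ rfl fun i hi => ?_)
  rw [wordPerm_append]
  exact h2 _ (h1 i hi)

end Setting

end DrinfeldSokolov

namespace DrinfeldSokolov

namespace Setting

open LieAlgebra LieAlgebra.IsKilling

variable {𝔤 : Type*} [LieRing 𝔤] [LieAlgebra ℂ 𝔤] [FiniteDimensional ℂ 𝔤]
  [LieAlgebra.IsSemisimple ℂ 𝔤] {H : LieSubalgebra ℂ 𝔤} [H.IsCartanSubalgebra] {l m : ℕ}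
  (D : Setting 𝔤 H l m)

/-! ### The Coxeter element -/

/-- The Coxeter element `s`. -/
def cox : H ≃ₗ[ℂ] H := coxeter D.base D.simple

theorem cox_eq_word : D.cox = D.word (List.finRange l) := by
  rw [cox, coxeter, word, List.ofFn_eq_map]
  rfl

theorem word_pow_coroot (L : List (Fin l)) (n : ℕ) (j : H.root) :
    (D.word L ^ n) ((rootSystem H).coroot j) = (rootSystem H).coroot ((D.wordPerm L ^ n) j) := by
  induction n with
  | zero => rfl
  | succ n ih =>
    rw [pow_succ', pow_succ', LinearEquiv.mul_apply, ih, word_coroot, Equiv.Perm.mul_apply]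

/-- s permutes the finite set of roots, and the coroots span the Cartan subalgebra. -/
theorem exists_cox_pow_eq_one : ∃ n : ℕ, 0 < n ∧ D.cox ^ n = 1 := by
  refine ⟨orderOf (D.wordPerm (List.finRange l)), orderOf_pos _, ?_⟩
  rw [cox_eq_word]
  refine LinearEquiv.toLinearMap_injective (LinearMap.ext_on_range
    (v := (rootSystem H).coroot) (RootPairing.IsRootSystem.span_coroot_eq_top) fun j => ?_)
  have := D.word_pow_coroot (List.finRange l) (orderOf (D.wordPerm (List.finRange l))) j
  rw [pow_orderOf_eq_one] at this
  exact this

/-- A weight is integral if it takes integral values on the coroots. -/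
def IsIntegral (χ : Module.Dual ℂ H) : Prop :=
  ∀ α : H.root, ∃ k : ℤ, χ ((rootSystem H).coroot α) = k

theorem IsIntegral.sub {χ ψ : Module.Dual ℂ H} (h : IsIntegral χ) (h' : IsIntegral ψ) :
    IsIntegral (χ - ψ) := fun α => by
  obtain ⟨a, ha⟩ := h α
  obtain ⟨b, hb⟩ := h' α
  exact ⟨a - b, by rw [LinearMap.sub_apply, ha, hb]; push_cast; rfl⟩

theorem IsIntegral.neg {χ : Module.Dual ℂ H} (h : IsIntegral χ) : IsIntegral (-χ) := fun α => by
  obtain ⟨a, ha⟩ := h α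
  exact ⟨-a, by rw [LinearMap.neg_apply, ha]; push_cast; rfl⟩

theorem IsIntegral.add {χ ψ : Module.Dual ℂ H} (h : IsIntegral χ) (h' : IsIntegral ψ) :
    IsIntegral (χ + ψ) := by
  have := h.sub h'.neg
  rwa [sub_neg_eq_add] at this

theorem isIntegral_zero : IsIntegral (0 : Module.Dual ℂ H) := fun _ => ⟨0, by simp⟩

theorem isIntegral_root (i : H.root) : IsIntegral ((rootSystem H).root i) := fun α =>
  ⟨(rootSystem H).pairingIn ℤ i α, ((rootSystem H).algebraMap_pairingIn ℤ i α).symm⟩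

theorem isIntegral_weight (i : Fin l) : IsIntegral (D.weight i) := fun α => by
  have h := D.base.coroot_mem_span_int α
  rw [← Submodule.mem_toAddSubgroup, Submodule.span_int_eq_addSubgroupClosure] at h
  generalize (rootSystem H).coroot α = x at h ⊢
  induction h using AddSubgroup.closure_induction with
  | mem x hx =>
    obtain ⟨j, hj, rfl⟩ := hx
    obtain ⟨k, hk⟩ := D.simple.surjective ⟨j, hj⟩
    have := D.weight_simpleCoroot i k
    rw [simpleCoroot, hk] at this
    exact ⟨if k = i then 1 else 0, this.trans (by split_ifs <;> simp)⟩
  | zero => exact ⟨0, by simp⟩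
  | add x y _ _ hx hy =>
    obtain ⟨a, ha⟩ := hx
    obtain ⟨b, hb⟩ := hy
    exact ⟨a + b, by rw [map_add, ha, hb]; push_cast; rfl⟩
  | neg x _ hx =>
    obtain ⟨a, ha⟩ := hx
    exact ⟨-a, by rw [map_neg, ha]; push_cast; rfl⟩

theorem comp_simpleReflection (χ : Module.Dual ℂ H) (i : Fin l) :
    χ ∘ₗ (D.simpleReflection i).toLinearMap = χ - χ (D.simpleCoroot i) • D.simpleRoot i := by
  refine LinearMap.ext fun h => ?_
  simp only [LinearMap.comp_apply, LinearEquiv.coe_coe, simpleReflection_apply, map_sub, map_smul,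
    LinearMap.sub_apply, LinearMap.smul_apply, smul_eq_mul]
  ring

/-- Each reflection changes an integral weight by an integer multiple of its simple root and leaves
it integral. -/
theorem comp_word_sub_mem (L : List (Fin l)) : ∀ χ : Module.Dual ℂ H, IsIntegral χ →
    χ ∘ₗ (D.word L).toLinearMap - χ ∈
      AddSubgroup.closure {ψ | ∃ k ∈ L, ψ = D.simpleRoot k} := by
  induction L with
  | nil =>
    intro χ _
    rw [show χ ∘ₗ (D.word []).toLinearMap = χ from rfl, sub_self]
    exact zero_mem _
  | cons i L ih =>
    intro χ hχ
    obtain ⟨n, hn⟩ := hχ (D.simple i)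
    have hn' : χ (D.simpleCoroot i) • D.simpleRoot i = n • D.simpleRoot i := by
      rw [show χ (D.simpleCoroot i) = n from hn, Int.cast_smul_eq_zsmul]
    have h1 : IsIntegral (χ - n • D.simpleRoot i) := by
      rw [← hn', ← comp_simpleReflection]
      intro α
      obtain ⟨k, hk⟩ := hχ ((rootSystem H).reflectionPerm (D.simple i) α)
      refine ⟨k, ?_⟩
      rw [← hk, RootPairing.coroot_reflectionPerm]
      rfl
    have h2 := ih _ h1
    have h3 : χ ∘ₗ (D.word (i :: L)).toLinearMap =
        (χ - n • D.simpleRoot i) ∘ₗ (D.word L).toLinearMap := by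
      rw [← hn', ← comp_simpleReflection, word_cons]
      rfl
    have hsub : {ψ | ∃ k ∈ L, ψ = D.simpleRoot k} ⊆ {ψ | ∃ k ∈ i :: L, ψ = D.simpleRoot k} := by
      rintro _ ⟨k, hk, rfl⟩
      exact ⟨k, List.mem_cons_of_mem _ hk, rfl⟩
    rw [h3, show (χ - n • D.simpleRoot i) ∘ₗ (D.word L).toLinearMap - χ =
      ((χ - n • D.simpleRoot i) ∘ₗ (D.word L).toLinearMap - (χ - n • D.simpleRoot i)) -
        n • D.simpleRoot i by abel]
    exact sub_mem (AddSubgroup.closure_mono hsub h2)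
      (zsmul_mem (AddSubgroup.subset_closure (k := {ψ | ∃ k ∈ i :: L, ψ = D.simpleRoot k})
        ⟨i, List.mem_cons_self, rfl⟩) n)

theorem weight_comp_word {j : Fin l} {L : List (Fin l)} (hj : j ∉ L) :
    D.weight j ∘ₗ (D.word L).toLinearMap = D.weight j := by
  induction L with
  | nil => rfl
  | cons i L ih =>
    have hij : i ≠ j := fun h => hj (h ▸ List.mem_cons_self)
    have h1 : D.weight j ∘ₗ (D.word (i :: L)).toLinearMap =
        (D.weight j ∘ₗ (D.simpleReflection i).toLinearMap) ∘ₗ (D.word L).toLinearMap := by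
      rw [word_cons]; rfl
    rw [h1, comp_simpleReflection, weight_simpleCoroot, if_neg hij, zero_smul, sub_zero,
      ih fun h => hj (List.mem_cons_of_mem _ h)]

/-- The weights of the form `λ - λ ∘ s` with `λ` integral. -/
def coxImage : AddSubgroup (Module.Dual ℂ H) where
  carrier := {ψ | ∃ χ, IsIntegral χ ∧ ψ = χ - χ ∘ₗ D.cox.toLinearMap}
  zero_mem' := ⟨0, isIntegral_zero, by simp⟩
  add_mem' := by
    rintro _ _ ⟨χ, hχ, rfl⟩ ⟨ψ, hψ, rfl⟩
    exact ⟨χ + ψ, hχ.add hψ, by rw [LinearMap.add_comp]; abel⟩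
  neg_mem' := by
    rintro _ ⟨χ, hχ, rfl⟩
    exact ⟨-χ, hχ.neg, by rw [LinearMap.neg_comp]; abel⟩

/-- Write s = A s_j L, where s_j occurs only once. All other letters fix the fundamental weight ω_j,
so ω_j - ω_j∘s = α_j∘L. This differs from α_j by an integral combination of the simple roots
occurring in L, which are already in the image; hence the induction over suffixes. Integrality
matters, because χ has to be a character of the torus later. -/
theorem simpleRoot_mem_coxImage_of_suffix (L : List (Fin l)) :
    ∀ A, List.finRange l = A ++ L → ∀ k ∈ L, D.simpleRoot k ∈ D.coxImage := by
  induction L with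
  | nil => intro _ _ k hk; simp at hk
  | cons j L ih =>
    intro A hA
    have hL := ih (A ++ [j]) (by rw [hA]; simp)
    have hnd := List.nodup_finRange l
    rw [hA, List.nodup_append] at hnd
    have hjA : j ∉ A := fun h => hnd.2.2 j h j List.mem_cons_self rfl
    have hjL : j ∉ L := (List.nodup_cons.1 hnd.2.1).1
    have h1 : D.weight j ∘ₗ D.cox.toLinearMap =
        D.weight j - D.simpleRoot j ∘ₗ (D.word L).toLinearMap := by
      have : D.weight j ∘ₗ D.cox.toLinearMap = ((D.weight j ∘ₗ (D.word A).toLinearMap) ∘ₗ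
          (D.simpleReflection j).toLinearMap) ∘ₗ (D.word L).toLinearMap := by
        rw [cox_eq_word, hA, word_append, word_cons]; rfl
      rw [this, weight_comp_word _ hjA, comp_simpleReflection, weight_simpleCoroot, if_pos rfl,
        one_smul, LinearMap.sub_comp, weight_comp_word _ hjL]
    have h2 : D.simpleRoot j ∘ₗ (D.word L).toLinearMap ∈ D.coxImage :=
      ⟨D.weight j, D.isIntegral_weight j, by rw [h1]; abel⟩
    have h3 := D.comp_word_sub_mem L _ (isIntegral_root (D.simple j))
    have h4 : AddSubgroup.closure {ψ | ∃ k ∈ L, ψ = D.simpleRoot k} ≤ D.coxImage := by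
      rw [AddSubgroup.closure_le]
      rintro _ ⟨k, hk, rfl⟩
      exact hL k hk
    have h5 : D.simpleRoot j ∈ D.coxImage := by
      have := sub_mem h2 (h4 h3)
      rwa [show D.simpleRoot j ∘ₗ (D.word L).toLinearMap -
        ((rootSystem H).root (D.simple j) ∘ₗ (D.word L).toLinearMap -
          (rootSystem H).root (D.simple j)) = D.simpleRoot j by
            rw [simpleRoot]; abel] at this
    intro k hk
    rcases List.mem_cons.1 hk with rfl | hk
    · exact h5
    · exact hL k hk

theorem simpleRoot_mem_coxImage (i : Fin l) : D.simpleRoot i ∈ D.coxImage :=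
  D.simpleRoot_mem_coxImage_of_suffix _ [] rfl i (List.mem_finRange i)

theorem root_mem_coxImage (i : H.root) : (rootSystem H).root i ∈ D.coxImage := by
  obtain ⟨f, hf, -⟩ := D.exists_root_eq_sum i
  rw [hf]
  exact sum_mem fun j _ => zsmul_mem (D.simpleRoot_mem_coxImage j) _

/-- Each simple root is χ - χ∘s and therefore vanishes on fixed vectors of s. -/
theorem eq_zero_of_cox_eq {h : H} (hh : D.cox h = h) : h = 0 := by
  refine D.eq_zero_of_simpleRoot_eq_zero fun i => ?_
  obtain ⟨χ, -, hχ⟩ := D.simpleRoot_mem_coxImage i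
  rw [hχ, LinearMap.sub_apply, LinearMap.comp_apply, LinearEquiv.coe_coe, hh, sub_self]

/-- If p^k s fixes h ≠ 0, iterating up to the order n of s gives p^{kn} = 1. As 0 < |p| < 1 this
forces k = 0, and s has no nonzero fixed vector. Thus the r-matrix is defined on every mode. -/
theorem isUnit_one_sub_theta (k : ℤ) : IsUnit (1 - D.theta k) := by
  rw [LinearMap.isUnit_iff_ker_eq_bot, LinearMap.ker_eq_bot']
  intro h hh
  have h1 : D.p ^ k • D.cox h = h := (sub_eq_zero.1 hh).symm
  by_cases hk : k = 0
  · subst hk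
    exact D.eq_zero_of_cox_eq (by simpa using h1)
  obtain ⟨n, hn, hn1⟩ := D.exists_cox_pow_eq_one
  have h2 : ∀ n : ℕ, (D.p ^ k) ^ n • (D.cox ^ n) h = h := fun n => by
    induction n with
    | zero => simp
    | succ n ih =>
      rw [pow_succ', pow_succ', LinearEquiv.mul_apply, mul_smul, ← map_smul, ih, h1]
  have h3 := h2 n
  rw [hn1, show (1 : H ≃ₗ[ℂ] H) h = h from rfl] at h3
  by_contra h0
  have h4 : (D.p ^ k) ^ n = 1 := by
    have h5 : ((D.p ^ k) ^ n - 1) • h = 0 := by rw [sub_smul, h3, one_smul, sub_self]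
    exact sub_eq_zero.1 ((smul_eq_zero.1 h5).resolve_right h0)
  have h5 : ‖D.p‖ ^ k = 1 := by
    have h6 : (‖D.p‖ ^ k) ^ n = 1 := by rw [← norm_zpow, ← norm_pow, h4, norm_one]
    exact (pow_eq_one_iff_of_nonneg (zpow_nonneg (norm_nonneg _) _) hn.ne').1 h6
  rcases lt_or_gt_of_ne hk with hk | hk
  · exact (one_lt_zpow_of_neg₀ (norm_pos_iff.2 D.p_ne_zero) D.p_norm_lt_one hk).ne' h5
  · exact (zpow_lt_one₀ (norm_pos_iff.2 D.p_ne_zero) D.p_norm_lt_one hk).ne h5 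

/-! ### Invariance of the form under the Weyl group -/

/-- Write the coroot as [x, y] in an 𝔰𝔩₂-triple and move y across by invariance. Since the
functional defined by the coroot is proportional to the root, reflections are orthogonal for the
form. -/
theorem form_coroot_eq (α : H.root) : ∃ c : ℂ, ∀ h : H,
    D.form ((rootSystem H).coroot α : 𝔤) h = c * (rootSystem H).root α h := by
  obtain ⟨h', x, y, ht, hx, hy⟩ := exists_isSl2Triple_of_weight_isNonZero
    (H.isNonZero_coe_root α)
  have hh' := ht.h_eq_coroot (H.isNonZero_coe_root α) hx hy
  refine ⟨D.form x y, fun h => ?_⟩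
  have h1 : ((rootSystem H).coroot α : 𝔤) = ⁅x, y⁆ := by rw [ht.lie_e_f, hh']; rfl
  have h2 : ⁅y, (h : 𝔤)⁆ = (rootSystem H).root α h • y := by
    have := lie_eq_smul_of_mem_rootSpace hy h
    rw [← lie_skew]
    change -⁅h, y⁆ = _
    rw [this, Pi.neg_apply, neg_smul, neg_neg]
    rfl
  rw [h1, D.form_invariant, h2, map_smul, smul_eq_mul, mul_comm]

theorem form_simpleReflection (i : Fin l) (x y : H) :
    D.form (D.simpleReflection i x : 𝔤) (D.simpleReflection i y) = D.form (x : 𝔤) y := by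
  obtain ⟨c, hc⟩ := D.form_coroot_eq (D.simple i)
  have h1 : ∀ h : H, D.form (D.simpleCoroot i : 𝔤) h = c * D.simpleRoot i h := hc
  have h2 : ∀ h : H, D.form (h : 𝔤) (D.simpleCoroot i) = c * D.simpleRoot i h := fun h => by
    rw [form_comm, h1]
  have h3 : D.simpleRoot i (D.simpleCoroot i) = 2 := (rootSystem H).root_coroot_two _
  rw [simpleReflection_apply, simpleReflection_apply]
  push_cast
  simp only [map_sub, map_smul, LinearMap.sub_apply, LinearMap.smul_apply, smul_eq_mul, h1, h2, h3]
  ring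

theorem form_word (L : List (Fin l)) (x y : H) :
    D.form (D.word L x : 𝔤) (D.word L y) = D.form (x : 𝔤) y := by
  induction L with
  | nil => rfl
  | cons i L ih =>
    rw [word_cons, LinearEquiv.mul_apply, LinearEquiv.mul_apply, form_simpleReflection, ih]

theorem form_cox (x y : H) : D.form (D.cox x : 𝔤) (D.cox y) = D.form (x : 𝔤) y := by
  rw [cox_eq_word, form_word]

/-! ### The operators `s` and `1 / (1 - s)` on `𝔤` -/

/-- The operator `s P_𝔥`. -/
def opS : Module.End ℂ 𝔤 := H.toSubmodule.subtype ∘ₗ D.cox.toLinearMap ∘ₗ cartanProj H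

/-- The operator `(1 - s)⁻¹ P_𝔥`. -/
def opU : Module.End ℂ 𝔤 :=
  H.toSubmodule.subtype ∘ₗ Ring.inverse (1 - D.cox.toLinearMap : Module.End ℂ H) ∘ₗ cartanProj H

theorem isUnit_one_sub_cox : IsUnit (1 - D.cox.toLinearMap : Module.End ℂ H) := by
  have := D.isUnit_one_sub_theta 0
  rwa [theta, zpow_zero, one_smul] at this

theorem cartanProj_coe (h : H) : cartanProj H (h : 𝔤) = h := cartanProj_of_mem h.2

theorem opS_mem (x : 𝔤) : D.opS x ∈ H := (D.cox (cartanProj H x)).2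

theorem opU_mem (x : 𝔤) : D.opU x ∈ H :=
  (Ring.inverse (1 - D.cox.toLinearMap : Module.End ℂ H) (cartanProj H x)).2

theorem opU_sub_opS_comp_opU : D.opU - D.opS ∘ₗ D.opU = projCartan H := by
  refine LinearMap.ext fun x => ?_
  have h := LinearMap.congr_fun (Ring.mul_inverse_cancel _ D.isUnit_one_sub_cox) (cartanProj H x)
  simp only [Module.End.mul_apply, LinearMap.sub_apply, Module.End.one_apply] at h
  simp only [opU, opS, projCartan, LinearMap.sub_apply, LinearMap.comp_apply,
    Submodule.subtype_apply, cartanProj_coe]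
  rw [← Submodule.coe_sub]
  exact congrArg Subtype.val h

theorem opU_sub_opU_comp_opS : D.opU - D.opU ∘ₗ D.opS = projCartan H := by
  refine LinearMap.ext fun x => ?_
  have h := LinearMap.congr_fun (Ring.inverse_mul_cancel _ D.isUnit_one_sub_cox) (cartanProj H x)
  simp only [Module.End.mul_apply, LinearMap.sub_apply, Module.End.one_apply, map_sub] at h
  simp only [opU, opS, projCartan, LinearMap.sub_apply, LinearMap.comp_apply,
    Submodule.subtype_apply, cartanProj_coe]
  rw [← Submodule.coe_sub]
  exact congrArg Subtype.val h

theorem form_opS (x y : 𝔤) :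
    D.form (D.opS x) (D.opS y) = D.form (projCartan H x) (projCartan H y) :=
  D.form_cox _ _

theorem opU_comp_projCartan : D.opU ∘ₗ projCartan H = D.opU := by
  refine LinearMap.ext fun x => ?_
  simp [opU, projCartan, cartanProj_coe]

theorem opS_comp_projCartan : D.opS ∘ₗ projCartan H = D.opS := by
  refine LinearMap.ext fun x => ?_
  simp [opS, projCartan, cartanProj_coe]

theorem projCartan_comp_opU : projCartan H ∘ₗ D.opU = D.opU :=
  LinearMap.ext fun x => projCartan_of_mem (D.opU_mem x)

theorem projCartan_comp_opS : projCartan H ∘ₗ D.opS = D.opS :=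
  LinearMap.ext fun x => projCartan_of_mem (D.opS_mem x)

/-- The adjoint of `1 / (1 - s)` is `1 - 1 / (1 - s)`. -/
theorem form_opU (x y : 𝔤) :
    D.form (D.opU x) y + D.form x (D.opU y) = D.form (projCartan H x) y := by
  have e1 : ∀ x, D.opS (D.opU x) = D.opU x - projCartan H x := fun x => by
    rw [← D.opU_sub_opS_comp_opU, LinearMap.sub_apply, LinearMap.comp_apply, sub_sub_cancel]
  -- Substitute sU = U - P_𝔥 into (sUx, sUy) = (Ux, Uy); the quadratic terms in U cancel.
  have h := D.form_opS (D.opU x) (D.opU y)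
  have e2 : ∀ x, projCartan H (D.opU x) = D.opU x := LinearMap.congr_fun D.projCartan_comp_opU
  rw [e1, e1, e2, e2] at h
  simp only [map_sub, LinearMap.sub_apply] at h
  have e3 : D.form (D.opU x) (projCartan H y) = D.form (D.opU x) y := by
    rw [← form_projCartan, e2]
  have e4 : D.form (projCartan H x) (D.opU y) = D.form x (D.opU y) := by
    rw [form_projCartan, e2]
  have e5 : D.form (projCartan H x) (projCartan H y) = D.form (projCartan H x) y := by
    rw [← form_projCartan, projCartan_of_mem (projCartan_mem x)]
  rw [e3, e4, e5] at h
  linear_combination -h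

end Setting

end DrinfeldSokolov

namespace DrinfeldSokolov

/-! ### Bilinear relations between a point and its adjugate -/

section Relations

variable {m : ℕ} {S : Type} [CommRing S] [Algebra ℂ S]

theorem map_adjugate_algebraMap (γ : Matrix (Fin m) (Fin m) ℂ) :
    γ.adjugate.map (algebraMap ℂ S) = (γ.map (algebraMap ℂ S)).adjugate :=
  (algebraMap ℂ S).map_adjugate γ

/-- Points of the closure of `Γ` satisfy the relations, bilinear in the point and its adjugate, that
are valid on `Γ`. -/
theorem bilinear_eq_of_mem_pts {Γ : Set (Matrix (Fin m) (Fin m) ℂ)}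
    {E : Type*} [AddCommGroup E] [Module S E]
    (F : Matrix (Fin m) (Fin m) S →ₗ[S] Matrix (Fin m) (Fin m) S →ₗ[S] E) (e : E)
    (hF : ∀ γ ∈ Γ, F (γ.map (algebraMap ℂ S)) (γ.adjugate.map (algebraMap ℂ S)) = e)
    {g : Matrix (Fin m) (Fin m) S} (hg : g ∈ pts Γ S) : F g g.adjugate = e := by
  classical
  -- All products of an entry of the generic matrix with an entry of its adjugate. Interpolating
  -- them, together with 1, expresses (g, adj g) through pairs (γ, adj γ) as far as bilinear maps
  -- can see.
  let Q : ((Fin m × Fin m) × (Fin m × Fin m)) → MvPolynomial (Fin m × Fin m) ℂ := fun q =>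
    MvPolynomial.X q.1 * (genMat m).adjugate q.2.1 q.2.2
  have hQ : ∀ {S' : Type} [CommRing S'] [Algebra ℂ S'] (g : Matrix (Fin m) (Fin m) S') q,
      evalAt g (Q q) = g q.1.1 q.1.2 * g.adjugate q.2.1 q.2.2 := fun g q => by
    have := congrFun (congrFun (adjugate_genMat_map_evalAt g) q.2.1) q.2.2
    rw [Matrix.map_apply] at this
    simp only [Q, map_mul, evalAt_X, this]
  obtain ⟨c, hc, hcP⟩ := exists_interpolation hg (insert 1 (Finset.univ.image Q))
  have h1 : (1 : S) = c.sum fun γ s => s := by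
    simpa using hcP 1 (Finset.mem_insert_self _ _)
  have hexp : ∀ A B : Matrix (Fin m) (Fin m) S, F A B =
      ∑ q : (Fin m × Fin m) × (Fin m × Fin m), (A q.1.1 q.1.2 * B q.2.1 q.2.2) •
        F (Matrix.single q.1.1 q.1.2 1) (Matrix.single q.2.1 q.2.2 1) := fun A B => by
    have hA : ∀ A : Matrix (Fin m) (Fin m) S, A =
        ∑ ij : Fin m × Fin m, A ij.1 ij.2 • Matrix.single ij.1 ij.2 (1 : S) := fun A => by
      conv_lhs => rw [Matrix.matrix_eq_sum_single A]
      rw [Fintype.sum_prod_type]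
      simp [Matrix.smul_single]
    conv_lhs => rw [hA A, hA B]
    rw [map_sum]
    conv_rhs => rw [Fintype.sum_prod_type_right]
    refine Finset.sum_congr rfl fun q _ => ?_
    rw [map_smul, map_sum, LinearMap.sum_apply, Finset.smul_sum]
    exact Finset.sum_congr rfl fun q' _ => by
      rw [map_smul, LinearMap.smul_apply, smul_smul, mul_comm]
  rw [hexp]
  have h2 : ∀ q : (Fin m × Fin m) × (Fin m × Fin m), g q.1.1 q.1.2 * g.adjugate q.2.1 q.2.2 =
      c.sum fun γ s => s * (algebraMap ℂ S (γ q.1.1 q.1.2) *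
        algebraMap ℂ S (γ.adjugate q.2.1 q.2.2)) := fun q => by
    have := hcP (Q q) (Finset.mem_insert_of_mem (by simp))
    rw [hQ] at this
    rw [this]
    exact Finsupp.sum_congr fun γ _ => by rw [hQ, map_mul]
  simp only [h2, Finsupp.sum, Finset.sum_smul]
  rw [Finset.sum_comm]
  calc _ = ∑ γ ∈ c.support, c γ • e := Finset.sum_congr rfl fun γ hγ => by
          rw [← hF γ (hc γ hγ), hexp, Finset.smul_sum]
          simp only [Matrix.map_apply, mul_smul]
    _ = e := by rw [← Finset.sum_smul, show ∑ γ ∈ c.support, c γ = 1 from h1.symm, one_smul]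

end Relations

namespace Setting

open LieAlgebra LieAlgebra.IsKilling

variable {𝔤 : Type*} [LieRing 𝔤] [LieAlgebra ℂ 𝔤] [FiniteDimensional ℂ 𝔤]
  [LieAlgebra.IsSemisimple ℂ 𝔤] {H : LieSubalgebra ℂ 𝔤} [H.IsCartanSubalgebra] {l m : ℕ}
  (D : Setting 𝔤 H l m)

/-! ### The adjoint action of the complex group -/

/-- A linear left inverse of the representation. -/
def ρInv : Matrix (Fin m) (Fin m) ℂ →ₗ[ℂ] 𝔤 :=
  (LinearMap.exists_leftInverse_of_injective D.ρ
    (LinearMap.ker_eq_bot.2 D.ρ_injective)).choose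

@[simp] theorem ρInv_ρ (x : 𝔤) : D.ρInv (D.ρ x) = x :=
  LinearMap.congr_fun (LinearMap.exists_leftInverse_of_injective D.ρ
    (LinearMap.ker_eq_bot.2 D.ρ_injective)).choose_spec x

/-- The adjoint action of a matrix of the group on `𝔤`. -/
def adC (γ : Matrix (Fin m) (Fin m) ℂ) : Module.End ℂ 𝔤 :=
  D.ρInv ∘ₗ LinearMap.mulLeft ℂ γ ∘ₗ LinearMap.mulRight ℂ γ.adjugate ∘ₗ D.ρ

theorem adC_apply (γ : Matrix (Fin m) (Fin m) ℂ) (x : 𝔤) :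
    D.adC γ x = D.ρInv (γ * D.ρ x * γ.adjugate) := by
  simp [adC, mul_assoc]

theorem det_exp (x : 𝔤) : (NormedSpace.exp (D.ρ x)).det = 1 :=
  det_exp_of_trace_eq_zero (D.trace_ρ x)

theorem adjugate_exp (x : 𝔤) : (NormedSpace.exp (D.ρ x)).adjugate = NormedSpace.exp (-D.ρ x) := by
  have h := Matrix.mul_adjugate (NormedSpace.exp (D.ρ x))
  rw [D.det_exp, one_smul] at h
  calc _ = NormedSpace.exp (-D.ρ x) * NormedSpace.exp (D.ρ x) *
        (NormedSpace.exp (D.ρ x)).adjugate := by rw [exp_neg_mul_exp, one_mul]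
    _ = _ := by rw [mul_assoc, h, mul_one]

theorem exp_conj_mem {W W' : Submodule ℂ 𝔤} (hW' : W' ≤ W) {x : 𝔤} (hx : ∀ y ∈ W, ⁅x, y⁆ ∈ W')
    {y : 𝔤} (hy : y ∈ W) : ∃ z ∈ W', NormedSpace.exp (D.ρ x) * D.ρ y * NormedSpace.exp (-D.ρ x) =
      D.ρ (y + z) := by
  have := exp_conj_sub_mem (D.ρ x) (V := W.map D.ρ) (V' := W'.map D.ρ) (by
    rintro _ ⟨y, hy, rfl⟩
    exact ⟨⁅x, y⁆, hx y hy, D.ρ_lie x y⟩) (Submodule.map_mono hW') (Submodule.mem_map_of_mem hy)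
  obtain ⟨z, hz, h⟩ := this
  exact ⟨z, hz, by rw [map_add, h, add_sub_cancel]⟩

theorem adC_exp_sub_mem {W W' : Submodule ℂ 𝔤} (hW' : W' ≤ W) {x : 𝔤}
    (hx : ∀ y ∈ W, ⁅x, y⁆ ∈ W') {y : 𝔤} (hy : y ∈ W) :
    D.adC (NormedSpace.exp (D.ρ x)) y - y ∈ W' := by
  obtain ⟨z, hz, h⟩ := D.exp_conj_mem hW' hx hy
  rw [adC_apply, adjugate_exp, h, ρInv_ρ, add_sub_cancel_left]
  exact hz

/-- Conjugation by an invertible matrix preserves the Lie algebra and its form. -/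
structure ConjCompat (γ γ' : Matrix (Fin m) (Fin m) ℂ) : Prop where
  exists_left : ∀ x, ∃ z, γ * D.ρ x * γ' = D.ρ z
  exists_right : ∀ x, ∃ z, γ' * D.ρ x * γ = D.ρ z
  form_eq : ∀ x y z w, γ * D.ρ x * γ' = D.ρ z → γ' * D.ρ y * γ = D.ρ w →
    D.form z y = D.form x w

theorem ConjCompat.symm {D : Setting 𝔤 H l m} {γ γ' : Matrix (Fin m) (Fin m) ℂ}
    (h : D.ConjCompat γ γ') : D.ConjCompat γ' γ where
  exists_left := h.exists_right
  exists_right := h.exists_left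
  form_eq x y z w hz hw := by rw [form_comm, D.form_comm x]; exact (h.form_eq _ _ _ _ hw hz).symm

theorem ConjCompat.mul {D : Setting 𝔤 H l m} {γ γ' δ δ' : Matrix (Fin m) (Fin m) ℂ}
    (h : D.ConjCompat γ γ') (h' : D.ConjCompat δ δ') : D.ConjCompat (γ * δ) (δ' * γ') where
  exists_left x := by
    obtain ⟨z, hz⟩ := h'.exists_left x
    obtain ⟨w, hw⟩ := h.exists_left z
    exact ⟨w, by rw [← hw, ← hz]; noncomm_ring⟩
  exists_right x := by
    obtain ⟨z, hz⟩ := h.exists_right x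
    obtain ⟨w, hw⟩ := h'.exists_right z
    exact ⟨w, by rw [← hw, ← hz]; noncomm_ring⟩
  form_eq x y z w hz hw := by
    obtain ⟨a, ha⟩ := h'.exists_left x
    obtain ⟨b, hb⟩ := h.exists_right y
    have h1 := h.form_eq a y z b (by rw [← hz, ← ha]; noncomm_ring) hb
    have h2 := h'.form_eq x b a w ha (by rw [← hw, ← hb]; noncomm_ring)
    rw [h1, h2]

theorem adMat_pow_ρ (x y : 𝔤) (n : ℕ) :
    (adMat (D.ρ x) ^ n) (D.ρ y) = D.ρ ((LieAlgebra.ad ℂ 𝔤 x ^ n) y) := by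
  induction n with
  | zero => rfl
  | succ n ih =>
    rw [pow_succ', pow_succ', Module.End.mul_apply, Module.End.mul_apply, ih, adMat_apply,
      LieAlgebra.ad_apply, D.ρ_lie]

theorem form_ad_pow (x y z : 𝔤) (n : ℕ) :
    D.form ((LieAlgebra.ad ℂ 𝔤 x ^ n) y) z = D.form y ((LieAlgebra.ad ℂ 𝔤 (-x) ^ n) z) := by
  induction n generalizing y with
  | zero => rfl
  | succ n ih =>
    rw [pow_succ, Module.End.mul_apply, ih, pow_succ', Module.End.mul_apply, LieAlgebra.ad_apply,
      LieAlgebra.ad_apply, ← lie_skew, map_neg, LinearMap.neg_apply, D.form_invariant, neg_lie]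
    exact (map_neg _ _).symm

/-- ad x is skew for the invariant form, so the series for the two sides of the form identity agree
term by term. -/
theorem conjCompat_exp (x : 𝔤) :
    D.ConjCompat (NormedSpace.exp (D.ρ x)) (NormedSpace.exp (-D.ρ x)) where
  exists_left y := by
    obtain ⟨z, -, hz⟩ := D.exp_conj_mem (W := ⊤) (W' := ⊤) le_rfl (x := x) (by simp)
      (Submodule.mem_top (x := y))
    exact ⟨_, hz⟩
  exists_right y := by
    obtain ⟨z, -, hz⟩ := D.exp_conj_mem (W := ⊤) (W' := ⊤) le_rfl (x := -x) (by simp)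
      (Submodule.mem_top (x := y))
    rw [map_neg, neg_neg] at hz
    exact ⟨_, hz⟩
  form_eq y z y' z' hy hz := by
    have h1 := hasSum_exp_conj (D.ρ x) (D.ρ y) ((D.form.flip z) ∘ₗ D.ρInv)
    have h2 := hasSum_exp_conj (D.ρ (-x)) (D.ρ z) ((D.form y) ∘ₗ D.ρInv)
    rw [map_neg, neg_neg] at h2
    rw [hy] at h1
    rw [hz] at h2
    simp only [adMat_pow_ρ, ← map_neg, LinearMap.comp_apply, ρInv_ρ,
      LinearMap.BilinForm.flip_apply] at h1 h2
    simp only [form_ad_pow] at h1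
    exact h1.unique h2

/-- The group is generated by exponentials, so properties of pairs (g, g⁻¹) that are stable under
swapping and multiplication need only be checked there. Carrying the inverse along makes the inverse
step trivial. -/
theorem lieGroup_induction {p : Matrix (Fin m) (Fin m) ℂ → Matrix (Fin m) (Fin m) ℂ → Prop}
    (hexp : ∀ x, p (NormedSpace.exp (D.ρ x)) (NormedSpace.exp (-D.ρ x)))
    (hsymm : ∀ γ γ', p γ γ' → p γ' γ)
    (hmul : ∀ γ γ' δ δ', p γ γ' → p δ δ' → p (γ * δ) (δ' * γ'))
    {g : GL (Fin m) ℂ} (hg : g ∈ lieGroup D.ρ) :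
    p g ((g⁻¹ : GL (Fin m) ℂ) : Matrix (Fin m) (Fin m) ℂ) := by
  induction hg using Subgroup.closure_induction with
  | mem g hg =>
    obtain ⟨x, hx⟩ := hg
    have : ((g⁻¹ : GL (Fin m) ℂ) : Matrix (Fin m) (Fin m) ℂ) = NormedSpace.exp (-D.ρ x) := by
      calc _ = ((g⁻¹ : GL (Fin m) ℂ) : Matrix (Fin m) (Fin m) ℂ) *
            (NormedSpace.exp (D.ρ x) * NormedSpace.exp (-D.ρ x)) := by
              rw [exp_mul_exp_neg, mul_one]
        _ = _ := by rw [← hx, ← mul_assoc, Units.inv_mul, one_mul]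
    rw [hx, this]
    exact hexp x
  | one =>
    have := hexp 0
    rwa [map_zero, neg_zero, NormedSpace.exp_zero] at this
  | mul x y _ _ hx hy =>
    rw [mul_inv_rev]
    exact hmul _ _ _ _ hx hy
  | inv x _ hx =>
    rw [inv_inv]
    exact hsymm _ _ hx

theorem det_of_mem_lieGroup {g : GL (Fin m) ℂ} (hg : g ∈ lieGroup D.ρ) :
    (g : Matrix (Fin m) (Fin m) ℂ).det = 1 := by
  have := D.lieGroup_induction (p := fun γ γ' => γ.det = 1 ∧ γ'.det = 1)
    (fun x => ⟨D.det_exp x, by rw [← map_neg, D.det_exp]⟩) (fun _ _ h => h.symm)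
    (fun γ γ' δ δ' h h' => by simp [Matrix.det_mul, h.1, h.2, h'.1, h'.2]) hg
  exact this.1

theorem coe_inv_of_mem_lieGroup {g : GL (Fin m) ℂ} (hg : g ∈ lieGroup D.ρ) :
    ((g⁻¹ : GL (Fin m) ℂ) : Matrix (Fin m) (Fin m) ℂ) =
      (g : Matrix (Fin m) (Fin m) ℂ).adjugate := by
  have h := Matrix.mul_adjugate (g : Matrix (Fin m) (Fin m) ℂ)
  rw [D.det_of_mem_lieGroup hg, one_smul] at h
  calc _ = ((g⁻¹ : GL (Fin m) ℂ) : Matrix (Fin m) (Fin m) ℂ) *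
        ((g : Matrix (Fin m) (Fin m) ℂ) * (g : Matrix (Fin m) (Fin m) ℂ).adjugate) := by
          rw [h, mul_one]
    _ = _ := by rw [← mul_assoc, Units.inv_mul, one_mul]

theorem det_of_mem_lieGroupSet {γ : Matrix (Fin m) (Fin m) ℂ} (hγ : γ ∈ lieGroupSet D.ρ) :
    γ.det = 1 := by
  obtain ⟨g, hg, rfl⟩ := hγ
  exact D.det_of_mem_lieGroup hg

theorem conjCompat_of_mem {γ : Matrix (Fin m) (Fin m) ℂ} (hγ : γ ∈ lieGroupSet D.ρ) :
    D.ConjCompat γ γ.adjugate := by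
  obtain ⟨g, hg, rfl⟩ := hγ
  rw [← D.coe_inv_of_mem_lieGroup hg]
  exact D.lieGroup_induction (p := D.ConjCompat) D.conjCompat_exp (fun _ _ h => h.symm)
    (fun _ _ _ _ h h' => h.mul h') hg

theorem mul_mem_lieGroupSet {γ γ' : Matrix (Fin m) (Fin m) ℂ} (hγ : γ ∈ lieGroupSet D.ρ)
    (hγ' : γ' ∈ lieGroupSet D.ρ) : γ * γ' ∈ lieGroupSet D.ρ := by
  obtain ⟨g, hg, rfl⟩ := hγ
  obtain ⟨g', hg', rfl⟩ := hγ'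
  exact ⟨g * g', mul_mem hg hg', rfl⟩

theorem adjugate_mem_lieGroupSet {γ : Matrix (Fin m) (Fin m) ℂ} (hγ : γ ∈ lieGroupSet D.ρ) :
    γ.adjugate ∈ lieGroupSet D.ρ := by
  obtain ⟨g, hg, rfl⟩ := hγ
  exact ⟨g⁻¹, inv_mem hg, D.coe_inv_of_mem_lieGroup hg⟩

theorem exp_mem_lieGroupSet (x : 𝔤) : NormedSpace.exp (D.ρ x) ∈ lieGroupSet D.ρ := by
  let g : GL (Fin m) ℂ := ⟨NormedSpace.exp (D.ρ x), NormedSpace.exp (-D.ρ x),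
    exp_mul_exp_neg _, exp_neg_mul_exp _⟩
  exact ⟨g, Subgroup.subset_closure ⟨x, rfl⟩, rfl⟩

theorem expSet_subset (W : Submodule ℂ 𝔤) : expSet D.ρ W ⊆ lieGroupSet D.ρ := by
  rintro _ ⟨x, -, rfl⟩
  exact D.exp_mem_lieGroupSet x

/-- `adC` is built with an arbitrary left inverse of ρ. It represents conjugation only because
conjugation by group elements preserves ρ(𝔤). -/
theorem ρ_adC {γ : Matrix (Fin m) (Fin m) ℂ} (hγ : γ ∈ lieGroupSet D.ρ) (x : 𝔤) :
    D.ρ (D.adC γ x) = γ * D.ρ x * γ.adjugate := by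
  obtain ⟨z, hz⟩ := (D.conjCompat_of_mem hγ).exists_left x
  rw [adC_apply, hz, ρInv_ρ]

theorem form_adC {γ : Matrix (Fin m) (Fin m) ℂ} (hγ : γ ∈ lieGroupSet D.ρ) (x y : 𝔤) :
    D.form (D.adC γ x) y = D.form x (D.ρInv (γ.adjugate * D.ρ y * γ)) := by
  obtain ⟨z, hz⟩ := (D.conjCompat_of_mem hγ).exists_left x
  obtain ⟨w, hw⟩ := (D.conjCompat_of_mem hγ).exists_right y
  rw [adC_apply, hz, hw, ρInv_ρ, ρInv_ρ]
  exact (D.conjCompat_of_mem hγ).form_eq _ _ _ _ hz hw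

/-! ### Triangularity of the adjoint action -/

/-- From [𝔫̄, 𝔫̄ + 𝔥] ⊆ 𝔫̄: elements of exp 𝔫̄ move vectors of the opposite Borel subalgebra, the
kernel of P_𝔫, only by elements of 𝔫̄. -/
theorem adC_expNeg {γ : Matrix (Fin m) (Fin m) ℂ} (hγ : γ ∈ expSet D.ρ (nilNeg D.base)) {y : 𝔤}
    (hy : D.projPos y = 0) : D.adC γ y - y ∈ nilNeg D.base := by
  obtain ⟨x, hx, rfl⟩ := hγ
  exact D.adC_exp_sub_mem (W := LinearMap.ker D.projPos)
    (fun z hz => D.projPos_of_mem_nilNeg hz) (fun y hy => D.lie_mem_nilNeg hx hy) hy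

theorem adC_expPos {γ : Matrix (Fin m) (Fin m) ℂ} (hγ : γ ∈ expSet D.ρ (nilPos D.base)) {y : 𝔤}
    (hy : D.projNeg y = 0) : D.adC γ y - y ∈ nilPos D.base := by
  obtain ⟨x, hx, rfl⟩ := hγ
  exact D.adC_exp_sub_mem (W := LinearMap.ker D.projNeg)
    (fun z hz => D.projNeg_of_mem_nilPos hz) (fun y hy => D.lie_mem_nilPos hx hy) hy

theorem lie_cartan {x y : 𝔤} (hx : x ∈ H) (hy : y ∈ H) : ⁅x, y⁆ = 0 := by
  have : ⁅(⟨x, hx⟩ : H), (⟨y, hy⟩ : H)⁆ = 0 := trivial_lie_zero _ _ _ _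
  simpa using congrArg Subtype.val this

theorem adC_expCartan {γ : Matrix (Fin m) (Fin m) ℂ} (hγ : γ ∈ expSet D.ρ H.toSubmodule) {y : 𝔤}
    (hy : y ∈ H) : D.adC γ y = y := by
  obtain ⟨x, hx, rfl⟩ := hγ
  have := D.adC_exp_sub_mem (W := H.toSubmodule) (W' := ⊥) bot_le
    (fun y hy => (Submodule.mem_bot ℂ).2 (lie_cartan hx hy)) hy
  exact sub_eq_zero.1 ((Submodule.mem_bot ℂ).1 this)

theorem lie_cartan_nilNeg {x y : 𝔤} (hx : x ∈ H) (hy : y ∈ nilNeg D.base) :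
    ⁅x, y⁆ ∈ nilNeg D.base := by
  rw [← lie_skew]
  exact neg_mem (D.lie_mem_nilNeg hy (D.projPos_of_mem_cartan hx))

theorem lie_cartan_nilPos {x y : 𝔤} (hx : x ∈ H) (hy : y ∈ nilPos D.base) :
    ⁅x, y⁆ ∈ nilPos D.base := by
  rw [← lie_skew]
  exact neg_mem (D.lie_mem_nilPos hy (D.projNeg_of_mem_cartan hx))

theorem adC_expCartan_mem_nilNeg {γ : Matrix (Fin m) (Fin m) ℂ}
    (hγ : γ ∈ expSet D.ρ H.toSubmodule) {y : 𝔤} (hy : y ∈ nilNeg D.base) :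
    D.adC γ y ∈ nilNeg D.base := by
  obtain ⟨x, hx, rfl⟩ := hγ
  have := D.adC_exp_sub_mem (le_refl (nilNeg D.base)) (fun y hy => D.lie_cartan_nilNeg hx hy) hy
  simpa using add_mem this hy

theorem adC_expCartan_mem_nilPos {γ : Matrix (Fin m) (Fin m) ℂ}
    (hγ : γ ∈ expSet D.ρ H.toSubmodule) {y : 𝔤} (hy : y ∈ nilPos D.base) :
    D.adC γ y ∈ nilPos D.base := by
  obtain ⟨x, hx, rfl⟩ := hγ
  have := D.adC_exp_sub_mem (le_refl (nilPos D.base)) (fun y hy => D.lie_cartan_nilPos hx hy) hy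
  simpa using add_mem this hy

end Setting

end DrinfeldSokolov

namespace DrinfeldSokolov

/-! ### Extension of scalars for linear maps on matrices -/

section Extend

variable {m : ℕ} {S : Type} [CommRing S] [Algebra ℂ S]

/-- The `S`-linear extension of a linear map on complex matrices. -/
def matExtend (S : Type) [CommRing S] [Algebra ℂ S] {V : Type*} [AddCommGroup V] [Module ℂ V]
    (T : Matrix (Fin m) (Fin m) ℂ →ₗ[ℂ] V) : Matrix (Fin m) (Fin m) S →ₗ[S] S ⊗[ℂ] V :=
  ∑ ij : Fin m × Fin m,
    (Matrix.entryLinearMap S S ij.1 ij.2).smulRight (1 ⊗ₜ T (Matrix.single ij.1 ij.2 1))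

theorem matExtend_map {V : Type*} [AddCommGroup V] [Module ℂ V]
    (T : Matrix (Fin m) (Fin m) ℂ →ₗ[ℂ] V) (M : Matrix (Fin m) (Fin m) ℂ) :
    matExtend S T (M.map (algebraMap ℂ S)) = 1 ⊗ₜ T M := by
  have hM : T M = ∑ ij : Fin m × Fin m, M ij.1 ij.2 • T (Matrix.single ij.1 ij.2 1) := by
    conv_lhs => rw [Matrix.matrix_eq_sum_single M]
    simp only [map_sum]
    rw [Fintype.sum_prod_type]
    refine Finset.sum_congr rfl fun i _ => Finset.sum_congr rfl fun j _ => ?_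
    rw [← map_smul, Matrix.smul_single, smul_eq_mul, mul_one]
  rw [hM, TensorProduct.tmul_sum, matExtend, LinearMap.sum_apply]
  refine Finset.sum_congr rfl fun ij _ => ?_
  simp only [LinearMap.smulRight_apply, Matrix.entryLinearMap_apply, Matrix.map_apply,
    TensorProduct.tmul_smul, algebraMap_smul]

/-- The matrix over `S` given by an element of `S ⊗ M_m(ℂ)`. -/
def matOfTensor (S : Type) [CommRing S] [Algebra ℂ S] :
    S ⊗[ℂ] Matrix (Fin m) (Fin m) ℂ →ₗ[S] Matrix (Fin m) (Fin m) S :=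
  LinearMap.liftBaseChange S (Algebra.linearMap ℂ S).mapMatrix

theorem matOfTensor_tmul (s : S) (M : Matrix (Fin m) (Fin m) ℂ) :
    matOfTensor S (s ⊗ₜ M) = s • M.map (algebraMap ℂ S) := by
  rw [matOfTensor, LinearMap.liftBaseChange_tmul]
  rfl

/-- The `S`-span of a space of complex matrices. -/
def matSpan (S : Type) [CommRing S] [Algebra ℂ S] (W : Submodule ℂ (Matrix (Fin m) (Fin m) ℂ)) :
    Submodule S (Matrix (Fin m) (Fin m) S) :=
  Submodule.span S ((fun A : Matrix (Fin m) (Fin m) ℂ => A.map (algebraMap ℂ S)) '' W)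

theorem map_mem_matSpan {W : Submodule ℂ (Matrix (Fin m) (Fin m) ℂ)}
    {A : Matrix (Fin m) (Fin m) ℂ} (hA : A ∈ W) : A.map (algebraMap ℂ S) ∈ matSpan S W :=
  Submodule.subset_span ⟨A, hA, rfl⟩

theorem matSpan_mono {W W' : Submodule ℂ (Matrix (Fin m) (Fin m) ℂ)} (h : W ≤ W') :
    matSpan S W ≤ matSpan S W' := Submodule.span_mono (Set.image_mono h)

theorem sub_mem_matSpan {Γ : Set (Matrix (Fin m) (Fin m) ℂ)}
    {W : Submodule ℂ (Matrix (Fin m) (Fin m) ℂ)} {c : Matrix (Fin m) (Fin m) ℂ}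
    (h : ∀ γ ∈ Γ, γ - c ∈ W) {g : Matrix (Fin m) (Fin m) S} (hg : g ∈ pts Γ S) :
    g - c.map (algebraMap ℂ S) ∈ matSpan S W := by
  rw [← Submodule.Quotient.eq]
  refine linear_eq_of_mem_pts (matSpan S W).mkQ _ (fun γ hγ => ?_) hg
  rw [Submodule.mkQ_apply, Submodule.Quotient.eq]
  have := map_mem_matSpan (S := S) (h γ hγ)
  rwa [Matrix.map_sub _ (fun a b => map_sub (algebraMap ℂ S) a b)] at this

theorem matSpan_mul {W W' W'' : Submodule ℂ (Matrix (Fin m) (Fin m) ℂ)}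
    (h : ∀ A ∈ W, ∀ B ∈ W', A * B ∈ W'') {A B : Matrix (Fin m) (Fin m) S}
    (hA : A ∈ matSpan S W) (hB : B ∈ matSpan S W') : A * B ∈ matSpan S W'' := by
  induction hA using Submodule.span_induction with
  | mem A hA =>
    obtain ⟨a, ha, rfl⟩ := hA
    induction hB using Submodule.span_induction with
    | mem B hB =>
      obtain ⟨b, hb, rfl⟩ := hB
      have := map_mem_matSpan (S := S) (h a ha b hb)
      rwa [Matrix.map_mul] at this
    | zero => rw [mul_zero]; exact zero_mem _
    | add x y _ _ hx hy => rw [mul_add]; exact add_mem hx hy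
    | smul s x _ hx => rw [mul_smul_comm]; exact Submodule.smul_mem _ _ hx
  | zero => rw [zero_mul]; exact zero_mem _
  | add x y _ _ hx hy => rw [add_mul]; exact add_mem hx hy
  | smul s x _ hx => rw [smul_mul_assoc]; exact Submodule.smul_mem _ _ hx

/-- A complex projection that is the identity on W and zero on W' extends S-linearly, and its
extension sends A both to A and to 0. -/
theorem eq_zero_of_mem_matSpan {W W' : Submodule ℂ (Matrix (Fin m) (Fin m) ℂ)}
    (h : Disjoint W W') {A : Matrix (Fin m) (Fin m) S} (hA : A ∈ matSpan S W)
    (hA' : A ∈ matSpan S W') : A = 0 := by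
  obtain ⟨C, hC, hCW⟩ := h.exists_isCompl
  let q : Module.End ℂ (Matrix (Fin m) (Fin m) ℂ) := Submodule.projection _ _ hCW
  have hq : ∀ a ∈ W, q a = a := fun a ha => by
    simp only [q, Submodule.projection_apply]
    rw [Submodule.projectionOnto_apply_of_mem_left _ (hC ha)]
  have hq' : ∀ a ∈ W', q a = 0 := fun a ha => by
    rw [← LinearMap.mem_ker, Submodule.ker_projection]
    exact ha
  let Q : Matrix (Fin m) (Fin m) S →ₗ[S] Matrix (Fin m) (Fin m) S :=
    matOfTensor S ∘ₗ matExtend S q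
  have hQ : ∀ a, Q (a.map (algebraMap ℂ S)) = (q a).map (algebraMap ℂ S) := fun a => by
    simp only [Q, LinearMap.comp_apply, matExtend_map, matOfTensor_tmul, one_smul]
  have h1 : Q A = A := by
    have : matSpan S W ≤ LinearMap.ker (Q - LinearMap.id) := Submodule.span_le.2 (by
      rintro _ ⟨a, ha, rfl⟩
      rw [SetLike.mem_coe, LinearMap.mem_ker, LinearMap.sub_apply, hQ, hq a ha, LinearMap.id_apply,
        sub_self])
    exact sub_eq_zero.1 (this hA)
  have h2 : Q A = 0 := by
    have : matSpan S W' ≤ LinearMap.ker Q := Submodule.span_le.2 (by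
      rintro _ ⟨a, ha, rfl⟩
      rw [SetLike.mem_coe, LinearMap.mem_ker, hQ, hq' a ha]
      ext i j
      simp)
    exact this hA'
  rw [← h1, h2]

end Extend

namespace Setting

open LieAlgebra LieAlgebra.IsKilling

variable {𝔤 : Type*} [LieRing 𝔤] [LieAlgebra ℂ 𝔤] [FiniteDimensional ℂ 𝔤]
  [LieAlgebra.IsSemisimple ℂ 𝔤] {H : LieSubalgebra ℂ 𝔤} [H.IsCartanSubalgebra] {l m : ℕ}
  (D : Setting 𝔤 H l m)

/-! ### The grading of the matrix algebra -/

/-- The sum of the eigenspaces of the height operator on matrices with eigenvalues in `I`. -/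
def grSup (I : Set ℤ) : Submodule ℂ (Matrix (Fin m) (Fin m) ℂ) :=
  ⨆ k ∈ I, Module.End.eigenspace (adMat (D.ρ D.heightElt)) ((k : ℤ) : ℂ)

theorem mem_grSup {I : Set ℤ} {k : ℤ} (hk : k ∈ I) {A : Matrix (Fin m) (Fin m) ℂ}
    (hA : D.ρ D.heightElt * A - A * D.ρ D.heightElt = (k : ℂ) • A) : A ∈ D.grSup I :=
  Submodule.mem_iSup_of_mem k (Submodule.mem_iSup_of_mem hk (Module.End.mem_eigenspace_iff.2 hA))

theorem grSup_mono {I J : Set ℤ} (h : I ⊆ J) : D.grSup I ≤ D.grSup J := biSup_mono h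

theorem grSup_disjoint {I J : Set ℤ} (h : Disjoint I J) : Disjoint (D.grSup I) (D.grSup J) :=
  ((Module.End.eigenspaces_iSupIndep (adMat (D.ρ D.heightElt))).comp
    (Int.cast_injective (α := ℂ))).disjoint_biSup_biSup h

theorem grSup_mul {I J K : Set ℤ} (h : ∀ i ∈ I, ∀ j ∈ J, i + j ∈ K)
    {A B : Matrix (Fin m) (Fin m) ℂ} (hA : A ∈ D.grSup I) (hB : B ∈ D.grSup J) :
    A * B ∈ D.grSup K := by
  suffices hle : D.grSup I ≤ (D.grSup K).comap (LinearMap.mulRight ℂ B) from hle hA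
  refine iSup₂_le fun i hi a ha => ?_
  suffices hle : D.grSup J ≤ (D.grSup K).comap (LinearMap.mulLeft ℂ a) from hle hB
  refine iSup₂_le fun j hj b hb => ?_
  refine D.mem_grSup (h i hi j hj) ?_
  rw [Module.End.mem_eigenspace_iff, adMat_apply] at ha hb
  simp only [LinearMap.mulLeft_apply]
  push_cast
  rw [add_smul]
  calc _ = (D.ρ D.heightElt * a - a * D.ρ D.heightElt) * b +
        a * (D.ρ D.heightElt * b - b * D.ρ D.heightElt) := by noncomm_ring
    _ = _ := by rw [ha, hb, smul_mul_assoc, mul_smul_comm]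

theorem ρ_mem_grSup_of_isHomog {I : Set ℤ} {k : ℤ} (hk : k ∈ I) {z : 𝔤} (hz : D.IsHomog k z) :
    D.ρ z ∈ D.grSup I := by
  refine D.mem_grSup hk ?_
  rw [← D.ρ_lie, hz.lie_heightElt, map_smul]

theorem ρ_mem_grSup_of_mem_nilNeg {x : 𝔤} (hx : x ∈ nilNeg D.base) :
    D.ρ x ∈ D.grSup {k | k < 0} := by
  rw [← D.mem_nilNeg.1 hx]
  refine D.homog_induction (p := fun x => D.ρ (D.projNeg x) ∈ D.grSup {k | k < 0})
    (fun k z hz => ?_) (fun x y hx hy => by rw [map_add, map_add]; exact add_mem hx hy) x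
  rw [D.projNeg_homog hz]
  split_ifs with h
  · exact D.ρ_mem_grSup_of_isHomog (k := k) h hz
  · rw [map_zero]; exact zero_mem _

theorem ρ_mem_grSup_of_mem_nilPos {x : 𝔤} (hx : x ∈ nilPos D.base) :
    D.ρ x ∈ D.grSup {k | 0 < k} := by
  rw [← D.mem_nilPos.1 hx]
  refine D.homog_induction (p := fun x => D.ρ (D.projPos x) ∈ D.grSup {k | 0 < k})
    (fun k z hz => ?_) (fun x y hx hy => by rw [map_add, map_add]; exact add_mem hx hy) x
  rw [D.projPos_homog hz]
  split_ifs with h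
  · exact D.ρ_mem_grSup_of_isHomog (k := k) h hz
  · rw [map_zero]; exact zero_mem _

/-- The commutator with ρ(h₀) has finitely many eigenvalues, so only finitely many degrees occur. -/
theorem exists_grSup_eq_bot : ∃ N : ℕ, D.grSup {k | k ≤ -(N : ℤ)} = ⊥ ∧
    D.grSup {k | (N : ℤ) ≤ k} = ⊥ := by
  have hfin : {k : ℤ | Module.End.HasEigenvalue (adMat (D.ρ D.heightElt)) (k : ℂ)}.Finite :=
    (Module.End.finite_hasEigenvalue (adMat (D.ρ D.heightElt))).preimage
      (Int.cast_injective.injOn)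
  obtain ⟨N, hN⟩ : ∃ N : ℕ, ∀ k ∈ {k : ℤ | Module.End.HasEigenvalue (adMat (D.ρ D.heightElt))
      (k : ℂ)}, |k| < N := by
    obtain ⟨M, hM⟩ := (hfin.image fun k => |k|).bddAbove
    refine ⟨M.toNat + 1, fun k hk => ?_⟩
    have := hM ⟨k, hk, rfl⟩
    simp only at this
    omega
  have key : ∀ I : Set ℤ, (∀ k ∈ I, (N : ℤ) ≤ |k|) → D.grSup I = ⊥ := fun I hI =>
    eq_bot_iff.2 (iSup₂_le fun k hk => by
      by_contra h
      have : Module.End.HasEigenvalue (adMat (D.ρ D.heightElt)) (k : ℂ) := fun hb => h (le_of_eq hb)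
      exact absurd (hN k this) (not_lt.2 (hI k hk)))
  refine ⟨N, key _ fun k hk => ?_, key _ fun k hk => ?_⟩
  · have : k ≤ -(N : ℤ) := hk
    rw [abs_of_nonpos] <;> omega
  · have : (N : ℤ) ≤ k := hk
    rw [abs_of_nonneg] <;> omega

theorem pow_mem_grSup_neg {A : Matrix (Fin m) (Fin m) ℂ} (hA : A ∈ D.grSup {k | k < 0}) (n : ℕ) :
    A ^ (n + 1) ∈ D.grSup {k | k ≤ -((n + 1 : ℕ) : ℤ)} := by
  induction n with
  | zero =>
    rw [zero_add, pow_one]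
    exact D.grSup_mono (fun k hk => by simp at hk ⊢; omega) hA
  | succ n ih =>
    rw [pow_succ]
    refine D.grSup_mul (fun i hi j hj => ?_) ih hA
    simp at hi hj ⊢
    omega

theorem pow_mem_grSup_pos {A : Matrix (Fin m) (Fin m) ℂ} (hA : A ∈ D.grSup {k | 0 < k}) (n : ℕ) :
    A ^ (n + 1) ∈ D.grSup {k | ((n + 1 : ℕ) : ℤ) ≤ k} := by
  induction n with
  | zero =>
    rw [zero_add, pow_one]
    exact D.grSup_mono (fun k hk => by simp at hk ⊢; omega) hA
  | succ n ih =>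
    rw [pow_succ]
    refine D.grSup_mul (fun i hi j hj => ?_) ih hA
    simp at hi hj ⊢
    omega

/-- Powers of a matrix of negative (positive) degree leave the range of occurring degrees. One
exponent serves all such matrices, as required by `tangentTo_exp_of_nilpotent`. -/
theorem exists_pow_eq_zero : ∃ N : ℕ, (∀ A ∈ D.grSup {k | k < 0}, A ^ (N + 1) = 0) ∧
    ∀ A ∈ D.grSup {k | 0 < k}, A ^ (N + 1) = 0 := by
  obtain ⟨N, h1, h2⟩ := D.exists_grSup_eq_bot
  refine ⟨N, fun A hA => ?_, fun A hA => ?_⟩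
  · have h3 := D.grSup_mono (J := {k | k ≤ -(N : ℤ)}) (fun k hk => by simp at hk ⊢; omega)
      (D.pow_mem_grSup_neg hA N)
    rw [h1] at h3
    exact (Submodule.mem_bot ℂ).1 h3
  · have h3 := D.grSup_mono (J := {k | (N : ℤ) ≤ k}) (fun k hk => by simp at hk ⊢; omega)
      (D.pow_mem_grSup_pos hA N)
    rw [h2] at h3
    exact (Submodule.mem_bot ℂ).1 h3

theorem exp_sub_one_mem {A : Matrix (Fin m) (Fin m) ℂ} {N : ℕ} (hA : A ^ (N + 1) = 0)
    {W : Submodule ℂ (Matrix (Fin m) (Fin m) ℂ)} (hW : ∀ n, A ^ (n + 1) ∈ W) :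
    NormedSpace.exp A - 1 ∈ W := by
  rw [exp_eq_sum_of_pow_eq_zero hA, Finset.sum_range_succ']
  simp only [Nat.factorial_zero, Nat.cast_one, inv_one, pow_zero, one_smul, add_sub_cancel_right]
  exact Submodule.sum_mem _ fun n _ => Submodule.smul_mem _ _ (hW n)

theorem expNeg_sub_one_mem {γ : Matrix (Fin m) (Fin m) ℂ} (hγ : γ ∈ expSet D.ρ (nilNeg D.base)) :
    γ - 1 ∈ D.grSup {k | k < 0} := by
  obtain ⟨x, hx, rfl⟩ := hγ
  obtain ⟨N, hN, -⟩ := D.exists_pow_eq_zero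
  have hx' := D.ρ_mem_grSup_of_mem_nilNeg hx
  exact exp_sub_one_mem (hN _ hx') fun n => D.grSup_mono (fun k hk => by
    simp at hk ⊢; omega) (D.pow_mem_grSup_neg hx' n)

theorem expPos_sub_one_mem {γ : Matrix (Fin m) (Fin m) ℂ} (hγ : γ ∈ expSet D.ρ (nilPos D.base)) :
    γ - 1 ∈ D.grSup {k | 0 < k} := by
  obtain ⟨x, hx, rfl⟩ := hγ
  obtain ⟨N, -, hN⟩ := D.exists_pow_eq_zero
  have hx' := D.ρ_mem_grSup_of_mem_nilPos hx
  exact exp_sub_one_mem (hN _ hx') fun n => D.grSup_mono (fun k hk => by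
    simp at hk ⊢; omega) (D.pow_mem_grSup_pos hx' n)

theorem exp_commute_of_lie_eq_zero {x y : 𝔤} (h : ⁅x, y⁆ = 0) :
    NormedSpace.exp (D.ρ x) * D.ρ y = D.ρ y * NormedSpace.exp (D.ρ x) := by
  obtain ⟨z, hz, h1⟩ := D.exp_conj_mem (W := Submodule.span ℂ {y}) (W' := ⊥) bot_le (x := x)
    (fun w hw => by
      obtain ⟨c, rfl⟩ := Submodule.mem_span_singleton.1 hw
      rw [lie_smul, h, smul_zero]
      exact zero_mem _) (Submodule.mem_span_singleton_self y)
  rw [(Submodule.mem_bot ℂ).1 hz, add_zero] at h1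
  calc _ = NormedSpace.exp (D.ρ x) * D.ρ y *
        (NormedSpace.exp (-D.ρ x) * NormedSpace.exp (D.ρ x)) := by rw [exp_neg_mul_exp, mul_one]
    _ = _ := by rw [← mul_assoc, h1]

theorem expCartan_mem {γ : Matrix (Fin m) (Fin m) ℂ} (hγ : γ ∈ expSet D.ρ H.toSubmodule) :
    γ ∈ D.grSup {0} := by
  obtain ⟨x, hx, rfl⟩ := hγ
  refine D.mem_grSup (k := 0) (Set.mem_singleton 0) ?_
  rw [← D.exp_commute_of_lie_eq_zero (lie_cartan hx D.heightElt.2), sub_self]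
  simp

/-! ### Tangent vector fields -/

theorem tangentTo_lieGroupSet (x : 𝔤) : TangentTo (lieGroupSet D.ρ) (D.ρ x) :=
  tangentTo_of_exp_mul_mem fun t γ hγ => by
    rw [← map_smul]
    exact D.mul_mem_lieGroupSet (D.exp_mem_lieGroupSet _) hγ

theorem tangentTo_expCartan {x : 𝔤} (hx : x ∈ H) :
    TangentTo (expSet D.ρ H.toSubmodule) (D.ρ x) :=
  tangentTo_of_exp_mul_mem fun t γ hγ => by
    obtain ⟨y, hy, rfl⟩ := hγ
    refine ⟨t • x + y, H.add_mem (H.smul_mem t hx) hy, ?_⟩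
    rw [← map_smul, map_add, Matrix.exp_add_of_commute]
    have := D.ρ_lie (t • x) y
    rw [lie_cartan (H.smul_mem t hx) hy, map_zero] at this
    exact (sub_eq_zero.1 this.symm)

theorem expSet_eq (W : Submodule ℂ 𝔤) :
    expSet D.ρ W = {g | ∃ A ∈ W.map D.ρ, g = NormedSpace.exp A} := by
  ext g
  constructor
  · rintro ⟨x, hx, rfl⟩
    exact ⟨_, Submodule.mem_map_of_mem hx, rfl⟩
  · rintro ⟨_, ⟨x, hx, rfl⟩, rfl⟩
    exact ⟨x, hx, rfl⟩

theorem tangentTo_expNeg {x : 𝔤} (hx : x ∈ nilNeg D.base) :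
    TangentTo (expSet D.ρ (nilNeg D.base)) (D.ρ x) := by
  obtain ⟨N, hN, -⟩ := D.exists_pow_eq_zero
  rw [expSet_eq]
  refine tangentTo_exp_of_nilpotent (N := N + 1) ?_ ?_ (Submodule.mem_map_of_mem hx)
  · rintro _ ⟨x, hx, rfl⟩ _ ⟨y, hy, rfl⟩
    exact ⟨⁅x, y⁆, D.lie_mem_nilNeg hx (D.projPos_of_mem_nilNeg hy), D.ρ_lie x y⟩
  · rintro _ ⟨x, hx, rfl⟩
    exact hN _ (D.ρ_mem_grSup_of_mem_nilNeg hx)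

theorem tangentTo_expPos {x : 𝔤} (hx : x ∈ nilPos D.base) :
    TangentTo (expSet D.ρ (nilPos D.base)) (D.ρ x) := by
  obtain ⟨N, -, hN⟩ := D.exists_pow_eq_zero
  rw [expSet_eq]
  refine tangentTo_exp_of_nilpotent (N := N + 1) ?_ ?_ (Submodule.mem_map_of_mem hx)
  · rintro _ ⟨x, hx, rfl⟩ _ ⟨y, hy, rfl⟩
    exact ⟨⁅x, y⁆, D.lie_mem_nilPos hx (D.projNeg_of_mem_nilPos hy), D.ρ_lie x y⟩
  · rintro _ ⟨x, hx, rfl⟩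
    exact hN _ (D.ρ_mem_grSup_of_mem_nilPos hx)

end Setting

end DrinfeldSokolov

namespace DrinfeldSokolov

/-! ### Exponentials acting on eigenvectors -/

section Eigen

variable {m : ℕ}

open scoped Matrix.Norms.Operator in
theorem hasDerivAt_exp_mul' (A Y : Matrix (Fin m) (Fin m) ℂ) (t : ℂ) :
    HasDerivAt (fun t : ℂ => NormedSpace.exp (t • A) * Y)
      (NormedSpace.exp (t • A) * (A * Y)) t := by
  have := (hasDerivAt_exp_smul_const A t).mul_const Y
  rwa [mul_assoc] at this

theorem hasSum_exp_mul_const (ν c : ℂ) :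
    HasSum (fun n : ℕ => ((n.factorial : ℂ))⁻¹ * (ν ^ n * c)) (Complex.exp ν * c) := by
  have h := (NormedSpace.expSeries_div_hasSum_exp (𝔸 := ℂ) ν).mul_right c
  rw [← Complex.exp_eq_exp_ℂ] at h
  refine (congrArg (fun f => HasSum f (Complex.exp ν * c)) (funext fun n => ?_)).mp h
  rw [div_eq_mul_inv]
  ring

theorem exp_mul_of_mul_eq_smul {A Y : Matrix (Fin m) (Fin m) ℂ} {ν : ℂ} (h : A * Y = ν • Y) :
    NormedSpace.exp A * Y = Complex.exp ν • Y := by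
  ext i j
  have h1 := hasSum_taylor (f := fun n t => ν ^ n * (NormedSpace.exp (t • A) * Y) i j)
    fun n t => by
      refine ((hasDerivAt_entry (hasDerivAt_exp_mul' A Y t) i j).const_mul (ν ^ n)).congr_deriv ?_
      rw [h, mul_smul_comm, Matrix.smul_apply, smul_eq_mul, pow_succ, mul_assoc]
  simp only [zero_smul, NormedSpace.exp_zero, one_mul, pow_zero, one_smul] at h1
  exact h1.unique (hasSum_exp_mul_const ν (Y i j))

theorem exp_conj_of_lie_eq_smul {A Y : Matrix (Fin m) (Fin m) ℂ} {ν : ℂ}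
    (h : A * Y - Y * A = ν • Y) :
    NormedSpace.exp A * Y * NormedSpace.exp (-A) = Complex.exp ν • Y := by
  have hp : ∀ n : ℕ, (adMat A ^ n) Y = ν ^ n • Y := fun n => by
    induction n with
    | zero => simp
    | succ n ih => rw [pow_succ', Module.End.mul_apply, ih, map_smul, adMat_apply, h, smul_smul,
        pow_succ]
  ext i j
  have h1 := hasSum_exp_conj A Y (Matrix.entryLinearMap ℂ ℂ i j)
  simp only [hp, map_smul, smul_eq_mul, Matrix.entryLinearMap_apply] at h1
  exact h1.unique (hasSum_exp_mul_const ν (Y i j))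

end Eigen

namespace Setting

open LieAlgebra LieAlgebra.IsKilling

variable {𝔤 : Type*} [LieRing 𝔤] [LieAlgebra ℂ 𝔤] [FiniteDimensional ℂ 𝔤]
  [LieAlgebra.IsSemisimple ℂ 𝔤] {H : LieSubalgebra ℂ 𝔤} [H.IsCartanSubalgebra] {l m : ℕ}
  (D : Setting 𝔤 H l m) {S : Type} [CommRing S] [Algebra ℂ S]

/-! ### Characters of the torus -/

theorem adjugate_exp' (x : 𝔤) :
    (NormedSpace.exp (D.ρ x)).adjugate = NormedSpace.exp (D.ρ (-x)) := by
  rw [adjugate_exp, map_neg]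

/-- The character of the torus with an integral differential `χ` is a polynomial function. -/
theorem exists_character {χ : Module.Dual ℂ H} (hχ : IsIntegral χ) :
    ∃ P : MvPolynomial (Fin m × Fin m) ℂ, ∀ h : H,
      evalAt (NormedSpace.exp (D.ρ (h : 𝔤))) P = Complex.exp (χ h) := by
  have := D.simply_connected χ hχ
  clear hχ
  induction this using AddSubgroup.closure_induction with
  | mem ν hν =>
    obtain ⟨v, hv, hρ⟩ := hν
    obtain ⟨i, hi⟩ := Function.ne_iff.1 hv
    -- On a weight vector v with vᵢ ≠ 0, the quotient (gv)ᵢ / vᵢ reads off the eigenvalue of g.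
    refine ⟨MvPolynomial.C (v i)⁻¹ * ∑ j, MvPolynomial.C (v j) * MvPolynomial.X (i, j),
      fun h => ?_⟩
    have h1 : D.ρ (h : 𝔤) * Matrix.of (fun (a _ : Fin m) => v a) =
        ν h • Matrix.of (fun (a _ : Fin m) => v a) := by
      ext a b
      exact congrFun (hρ h) a
    have h2 := congrFun (congrFun (exp_mul_of_mul_eq_smul h1) i) i
    rw [Matrix.mul_apply, Matrix.smul_apply] at h2
    simp only [Matrix.of_apply, smul_eq_mul] at h2
    simp only [map_mul, map_sum, evalAt_C, evalAt_X, Algebra.algebraMap_self, RingHom.id_apply]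
    rw [show ∑ j, v j * NormedSpace.exp (D.ρ (h : 𝔤)) i j = Complex.exp (ν h) * v i by
      rw [← h2]; exact Finset.sum_congr rfl fun j _ => mul_comm _ _]
    have hi' : v i ≠ 0 := hi
    field_simp
  | zero => exact ⟨1, fun h => by simp⟩
  | add x y _ _ hx hy =>
    obtain ⟨P, hP⟩ := hx
    obtain ⟨Q, hQ⟩ := hy
    exact ⟨P * Q, fun h => by rw [map_mul, hP, hQ, LinearMap.add_apply, Complex.exp_add]⟩
  | neg x _ hx =>
    obtain ⟨P, hP⟩ := hx
    refine ⟨substMat (genMat m).adjugate P, fun h => ?_⟩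
    rw [evalAt_substMat, adjugate_genMat_map_evalAt, adjugate_exp', LinearMap.neg_apply, ← map_neg]
    exact hP (-h)

theorem sRep_conj (h : H) : (D.sRep : Matrix (Fin m) (Fin m) ℂ) * D.ρ (h : 𝔤) *
    ((D.sRep⁻¹ : GL (Fin m) ℂ) : Matrix (Fin m) (Fin m) ℂ) = D.ρ (D.cox h : 𝔤) :=
  D.sRep_represents.2 h

theorem sRep_conj_exp (h : H) : (D.sRep : Matrix (Fin m) (Fin m) ℂ) *
    NormedSpace.exp (D.ρ (h : 𝔤)) * ((D.sRep⁻¹ : GL (Fin m) ℂ) : Matrix (Fin m) (Fin m) ℂ) =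
      NormedSpace.exp (D.ρ (D.cox h : 𝔤)) := by
  rw [← sRep_conj, Matrix.exp_units_conj]

/-- Conjugation by the representative of the Coxeter element. -/
def sConj (g : Matrix (Fin m) (Fin m) S) : Matrix (Fin m) (Fin m) S :=
  (D.sRep : Matrix (Fin m) (Fin m) ℂ).map (algebraMap ℂ S) * g *
    ((D.sRep⁻¹ : GL (Fin m) ℂ) : Matrix (Fin m) (Fin m) ℂ).map (algebraMap ℂ S)

/-- The matrix of polynomials giving conjugation by the representative of the Coxeter element. -/
def sConjPoly : Matrix (Fin m) (Fin m) (MvPolynomial (Fin m × Fin m) ℂ) :=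
  (D.sRep : Matrix (Fin m) (Fin m) ℂ).map MvPolynomial.C * genMat m *
    ((D.sRep⁻¹ : GL (Fin m) ℂ) : Matrix (Fin m) (Fin m) ℂ).map MvPolynomial.C

theorem sConjPoly_map_evalAt (g : Matrix (Fin m) (Fin m) S) :
    D.sConjPoly.map (evalAt g) = D.sConj g := by
  have h : ∀ M : Matrix (Fin m) (Fin m) ℂ, (M.map (MvPolynomial.C (σ := Fin m × Fin m))).map
      (evalAt g) = M.map (algebraMap ℂ S) := fun M => by
    ext i j
    simp
  rw [sConjPoly, sConj, Matrix.map_mul, Matrix.map_mul, h, h, genMat_map_evalAt]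

theorem sConj_exp (h : H) : D.sConj (S := ℂ) (NormedSpace.exp (D.ρ (h : 𝔤))) =
    NormedSpace.exp (D.ρ (D.cox h : 𝔤)) := by
  rw [← sRep_conj_exp, sConj]
  simp

theorem sConj_mem_pts {g : Matrix (Fin m) (Fin m) S}
    (hg : g ∈ pts (expSet D.ρ H.toSubmodule) S) :
    D.sConj g ∈ pts (expSet D.ρ H.toSubmodule) S := fun P hP => by
  rw [evalEntries_algebraMap, ← sConjPoly_map_evalAt, ← evalAt_substMat]
  refine hg _ fun γ hγ => ?_
  obtain ⟨x, hx, rfl⟩ := hγ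
  change evalAt _ _ = 0
  rw [evalAt_substMat, sConjPoly_map_evalAt]
  rw [D.sConj_exp ⟨x, hx⟩]
  exact hP _ ⟨_, (D.cox ⟨x, hx⟩).2, rfl⟩

theorem evalAt_eq_of_mem_pts {Γ : Set (Matrix (Fin m) (Fin m) ℂ)}
    {P Q : MvPolynomial (Fin m × Fin m) ℂ} (h : ∀ γ ∈ Γ, evalAt γ P = evalAt γ Q)
    {g : Matrix (Fin m) (Fin m) S} (hg : g ∈ pts Γ S) : evalAt g P = evalAt g Q := by
  have := hg (P - Q) fun γ hγ => by
    change evalAt γ _ = 0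
    rw [map_sub, h γ hγ, sub_self]
  rwa [evalEntries_algebraMap, map_sub, sub_eq_zero] at this

/-- An element `a` of the torus with `s a s⁻¹ = a` commutes with the Lie algebra. -/
theorem commute_of_sConj_eq {a : Matrix (Fin m) (Fin m) S}
    (ha : a ∈ pts (expSet D.ρ H.toSubmodule) S) (hs : D.sConj a = a) (z : 𝔤) :
    a * (D.ρ z).map (algebraMap ℂ S) = (D.ρ z).map (algebraMap ℂ S) * a := by
  have hadd : ∀ x y : 𝔤, (D.ρ (x + y)).map (algebraMap ℂ S) =
      (D.ρ x).map (algebraMap ℂ S) + (D.ρ y).map (algebraMap ℂ S) := fun x y => by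
    rw [map_add, Matrix.map_add _ (fun a b => map_add (algebraMap ℂ S) a b)]
  -- If each complex torus element scales ρ(z) under conjugation by the value of P, then so does
  -- every point of the torus over S.
  have key : ∀ (z : 𝔤) (P : MvPolynomial (Fin m × Fin m) ℂ), (∀ x ∈ H,
      NormedSpace.exp (D.ρ x) * D.ρ z =
        evalAt (NormedSpace.exp (D.ρ x)) P • (D.ρ z * NormedSpace.exp (D.ρ x))) →
      a * (D.ρ z).map (algebraMap ℂ S) = evalAt a P • ((D.ρ z).map (algebraMap ℂ S) * a) := by
    intro z P hP
    ext i k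
    have hl : ∀ {S' : Type} [CommRing S'] [Algebra ℂ S'] (g : Matrix (Fin m) (Fin m) S'),
        evalAt g (∑ j, MvPolynomial.X (i, j) * MvPolynomial.C (D.ρ z j k)) =
          (g * (D.ρ z).map (algebraMap ℂ S')) i k := fun g => by
      simp [Matrix.mul_apply]
    have hr : ∀ {S' : Type} [CommRing S'] [Algebra ℂ S'] (g : Matrix (Fin m) (Fin m) S'),
        evalAt g (P * ∑ j, MvPolynomial.C (D.ρ z i j) * MvPolynomial.X (j, k)) =
          (evalAt g P • ((D.ρ z).map (algebraMap ℂ S') * g)) i k := fun g => by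
      simp [Matrix.mul_apply]
    rw [← hl, ← hr]
    refine evalAt_eq_of_mem_pts (fun γ hγ => ?_) ha
    obtain ⟨x, hx, rfl⟩ := hγ
    rw [hl, hr]
    have := hP x hx
    simpa using congrFun (congrFun this i) k
  refine induction_rootSpace (H := H) (p := fun z => a * (D.ρ z).map (algebraMap ℂ S) =
    (D.ρ z).map (algebraMap ℂ S) * a) (fun z hz => ?_) (fun i z hz => ?_) (fun x y hx hy => ?_) z
  · have := key z 1 (fun x hx => by
      rw [D.exp_commute_of_lie_eq_zero (lie_cartan hx hz), map_one, one_smul])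
    rwa [map_one, one_smul] at this
  -- P, Q, Q' are the characters of α, χ, -χ, where α = χ - χ∘s. Hence Q(a) = P(a) Q(s a s⁻¹) = P(a)
  -- Q(a), and cancelling Q(a) by means of Q'(a) leaves P(a) = 1.
  · obtain ⟨χ, hχ, hi⟩ := D.root_mem_coxImage i
    obtain ⟨P, hP⟩ := D.exists_character (isIntegral_root i)
    obtain ⟨Q, hQ⟩ := D.exists_character hχ
    obtain ⟨Q', hQ'⟩ := D.exists_character hχ.neg
    have h1 : evalAt a Q = evalAt a (P * substMat D.sConjPoly Q) :=
      evalAt_eq_of_mem_pts (fun γ hγ => by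
        obtain ⟨x, hx, rfl⟩ := hγ
        have e1 := hP ⟨x, hx⟩
        have e2 := hQ ⟨x, hx⟩
        have e3 := hQ (D.cox ⟨x, hx⟩)
        rw [map_mul, evalAt_substMat, sConjPoly_map_evalAt]
        have e4 := D.sConj_exp ⟨x, hx⟩
        simp only at e1 e2 e4
        rw [e4, e3, e1, e2, ← Complex.exp_add, hi]
        congr 1
        rw [LinearMap.sub_apply, LinearMap.comp_apply, LinearEquiv.coe_coe, sub_add_cancel]) ha
    have h2 : evalAt a (Q * Q') = evalAt a 1 := evalAt_eq_of_mem_pts (fun γ hγ => by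
        obtain ⟨x, hx, rfl⟩ := hγ
        have e1 := hQ ⟨x, hx⟩
        have e2 := hQ' ⟨x, hx⟩
        simp only at e1 e2
        rw [map_mul, e1, e2, ← Complex.exp_add, LinearMap.neg_apply, add_neg_cancel,
          Complex.exp_zero, map_one]) ha
    rw [map_mul, evalAt_substMat, sConjPoly_map_evalAt, hs] at h1
    rw [map_mul, map_one] at h2
    have h3 : evalAt a P = 1 := by
      linear_combination (-evalAt a Q') * h1 + (1 - evalAt a P) * h2
    have := key z P (fun x hx => by
      have e1 := hP ⟨x, hx⟩
      simp only at e1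
      rw [e1]
      have e2 : D.ρ x * D.ρ z - D.ρ z * D.ρ x = (rootSystem H).root i ⟨x, hx⟩ • D.ρ z := by
        rw [← D.ρ_lie, ← map_smul]
        exact congrArg _ (lie_eq_smul_of_mem_rootSpace hz ⟨x, hx⟩)
      rw [← smul_mul_assoc, ← exp_conj_of_lie_eq_smul e2, mul_assoc _ (NormedSpace.exp (-D.ρ x)),
        exp_neg_mul_exp, mul_one])
    rwa [h3, one_smul] at this
  · rw [hadd, mul_add, add_mul, hx, hy]

/-- Exponentials of elements of 𝔫̄ are polynomials in nilpotent matrices ρ(x), and commuting with a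
is a linear condition, so it passes to points of the closure. -/
theorem commute_expNeg {a : Matrix (Fin m) (Fin m) S}
    (ha : ∀ z, a * (D.ρ z).map (algebraMap ℂ S) = (D.ρ z).map (algebraMap ℂ S) * a)
    {n : Matrix (Fin m) (Fin m) S} (hn : n ∈ pts (expSet D.ρ (nilNeg D.base)) S) :
    a * n = n * a := by
  have := linear_eq_of_mem_pts (LinearMap.mulLeft S a - LinearMap.mulRight S a) 0 (fun γ hγ => ?_) hn
  · simpa [sub_eq_zero] using this
  · obtain ⟨x, hx, rfl⟩ := hγ
    obtain ⟨N, hN, -⟩ := D.exists_pow_eq_zero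
    rw [exp_eq_sum_of_pow_eq_zero (hN _ (D.ρ_mem_grSup_of_mem_nilNeg hx))]
    have hpow : ∀ k : ℕ, Commute a (((D.ρ x) ^ k).map (algebraMap ℂ S)) := fun k => by
      have : ((D.ρ x) ^ k).map (algebraMap ℂ S) = ((D.ρ x).map (algebraMap ℂ S)) ^ k :=
        map_pow (algebraMap ℂ S).mapMatrix _ _
      rw [this]
      exact Commute.pow_right (ha x) k
    have hsum : Commute a ((∑ n ∈ Finset.range (N + 1), ((n.factorial : ℂ))⁻¹ • D.ρ x ^ n).map
        (algebraMap ℂ S)) := by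
      have : (∑ n ∈ Finset.range (N + 1), ((n.factorial : ℂ))⁻¹ • D.ρ x ^ n).map
          (algebraMap ℂ S) = ∑ n ∈ Finset.range (N + 1), algebraMap ℂ S ((n.factorial : ℂ))⁻¹ •
            (D.ρ x ^ n).map (algebraMap ℂ S) := by
        ext i j
        simp only [Matrix.sum_apply, Matrix.map_apply, Matrix.smul_apply, map_sum, smul_eq_mul,
          map_mul]
      rw [this]
      exact Commute.sum_right _ _ _ fun k _ => (hpow k).smul_right _
    simp only [LinearMap.sub_apply, LinearMap.mulLeft_apply, LinearMap.mulRight_apply]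
    rw [hsum.eq, sub_self]

end Setting

end DrinfeldSokolov

/-! ### Adjugates as inverses, the automorphism D_p, and uniqueness of the twisted factorization -/

namespace DrinfeldSokolov

attribute [-instance] HahnSeries.powerSeriesAlgebra

theorem inv_eq_adjugate {m : ℕ} {S : Type} [CommRing S] {g : Matrix (Fin m) (Fin m) S}
    (hg : g.det = 1) : g⁻¹ = g.adjugate := by
  rw [Matrix.inv_def, hg, Ring.inverse_one, one_smul]

theorem mul_adjugate_of_det {m : ℕ} {S : Type} [CommRing S] {g : Matrix (Fin m) (Fin m) S}
    (hg : g.det = 1) : g * g.adjugate = 1 := by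
  rw [Matrix.mul_adjugate, hg, one_smul]

theorem adjugate_mul_of_det {m : ℕ} {S : Type} [CommRing S] {g : Matrix (Fin m) (Fin m) S}
    (hg : g.det = 1) : g.adjugate * g = 1 := by
  rw [Matrix.adjugate_mul, hg, one_smul]

theorem adjugate_eq_of_mul_eq_one {m : ℕ} {S : Type} [CommRing S] {g g' : Matrix (Fin m) (Fin m) S}
    (hg : g.det = 1) (h : g * g' = 1) : g.adjugate = g' := by
  calc g.adjugate = g.adjugate * (g * g') := by rw [h, mul_one]
    _ = g' := by rw [← mul_assoc, adjugate_mul_of_det hg, one_mul]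

theorem det_adjugate_of_det {m : ℕ} {S : Type} [CommRing S] {g : Matrix (Fin m) (Fin m) S}
    (hg : g.det = 1) : g.adjugate.det = 1 := by
  have := congrArg Matrix.det (mul_adjugate_of_det hg)
  rwa [Matrix.det_mul, hg, one_mul, Matrix.det_one] at this

theorem adjugate_adjugate_of_det {m : ℕ} {S : Type} [CommRing S] {g : Matrix (Fin m) (Fin m) S}
    (hg : g.det = 1) : g.adjugate.adjugate = g :=
  adjugate_eq_of_mul_eq_one (det_adjugate_of_det hg) (adjugate_mul_of_det hg)

/-- The substitution `a(z) ↦ a(pz)` as an algebra homomorphism. -/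
def shiftHom {p : ℂ} (hp : p ≠ 0) (R : Type) [CommRing R] [Algebra ℂ R] :
    LaurentSeries R →ₐ[ℂ] LaurentSeries R where
  toFun := shift p
  map_one' := by
    ext k
    change p ^ k • (1 : LaurentSeries R).coeff k = _
    rw [HahnSeries.coeff_one]
    split_ifs with h
    · rw [h, zpow_zero, one_smul]
    · rw [smul_zero]
  map_mul' a b := by
    ext k
    change p ^ k • (a * b).coeff k = (shift p a * shift p b).coeff k
    have hs : ∀ (c : LaurentSeries R) (k : ℤ), (shift p c).coeff k = p ^ k • c.coeff k :=
      fun _ _ => rfl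
    rw [HahnSeries.coeff_mul, HahnSeries.coeff_mul, Finset.smul_sum]
    refine Finset.sum_congr ?_ fun ij hij => ?_
    · ext ij
      simp only [Finset.mem_antidiagonal, HahnSeries.mem_support, hs, ne_eq,
        smul_eq_zero_iff_right (zpow_ne_zero _ hp)]
    · rw [hs, hs, smul_mul_smul_comm, ← zpow_add₀ hp, (Finset.mem_antidiagonal.1 hij).2.2]
  map_zero' := by
    ext k
    change p ^ k • (0 : R) = 0
    rw [smul_zero]
  map_add' a b := by
    ext k
    change p ^ k • (a.coeff k + b.coeff k) = p ^ k • a.coeff k + p ^ k • b.coeff k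
    rw [smul_add]
  commutes' c := by
    ext k
    change p ^ k • (HahnSeries.C (algebraMap ℂ R c)).coeff k =
      (HahnSeries.C (algebraMap ℂ R c)).coeff k
    rw [HahnSeries.C_apply, HahnSeries.coeff_single]
    split_ifs with h
    · rw [h, zpow_zero, one_smul]
    · rw [smul_zero]

theorem shiftHom_coeff {p : ℂ} (hp : p ≠ 0) {R : Type} [CommRing R] [Algebra ℂ R]
    (a : LaurentSeries R) (k : ℤ) : (shiftHom hp R a).coeff k = p ^ k • a.coeff k := rfl

theorem shiftMatrix_eq_map {m : ℕ} {p : ℂ} (hp : p ≠ 0) {R : Type} [CommRing R] [Algebra ℂ R]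
    (g : Matrix (Fin m) (Fin m) (LaurentSeries R)) :
    shiftMatrix p g = g.map (shiftHom hp R) := rfl

theorem shiftHom_injective {p : ℂ} (hp : p ≠ 0) {R : Type} [CommRing R] [Algebra ℂ R] :
    Function.Injective (shiftHom hp R) := fun a b h => by
  ext k
  have := congrArg (fun c => p ^ (-k) • HahnSeries.coeff c k) h
  simp only [shiftHom_coeff, smul_smul, ← zpow_add₀ hp, neg_add_cancel, zpow_zero, one_smul] at this
  exact this

namespace Setting

open LieAlgebra LieAlgebra.IsKilling

variable {𝔤 : Type*} [LieRing 𝔤] [LieAlgebra ℂ 𝔤] [FiniteDimensional ℂ 𝔤]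
  [LieAlgebra.IsSemisimple ℂ 𝔤] {H : LieSubalgebra ℂ 𝔤} [H.IsCartanSubalgebra] {l m : ℕ}
  (D : Setting 𝔤 H l m) (S : Type) [CommRing S] [Algebra ℂ S]

/-! ### Points of the groups -/

/-- The points of `G` over `S`. -/
abbrev GPts : Set (Matrix (Fin m) (Fin m) S) := pts (lieGroupSet D.ρ) S

/-- The points of the torus `exp 𝔥` over `S`. -/
abbrev HPts : Set (Matrix (Fin m) (Fin m) S) := pts (expSet D.ρ H.toSubmodule) S

/-- The points of `N̄` over `S`. -/
abbrev NegPts : Set (Matrix (Fin m) (Fin m) S) := pts (expSet D.ρ (nilNeg D.base)) S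

/-- The points of `N` over `S`. -/
abbrev PosPts : Set (Matrix (Fin m) (Fin m) S) := pts (expSet D.ρ (nilPos D.base)) S

variable {S}

theorem HPts_subset {g : Matrix (Fin m) (Fin m) S} (hg : g ∈ D.HPts S) : g ∈ D.GPts S :=
  pts_mono (D.expSet_subset _) hg

theorem NegPts_subset {g : Matrix (Fin m) (Fin m) S} (hg : g ∈ D.NegPts S) : g ∈ D.GPts S :=
  pts_mono (D.expSet_subset _) hg

theorem PosPts_subset {g : Matrix (Fin m) (Fin m) S} (hg : g ∈ D.PosPts S) : g ∈ D.GPts S :=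
  pts_mono (D.expSet_subset _) hg

theorem det_GPts {g : Matrix (Fin m) (Fin m) S} (hg : g ∈ D.GPts S) : g.det = 1 :=
  det_eq_one_of_mem_pts (fun _ => D.det_of_mem_lieGroupSet) hg

theorem mul_mem_GPts {g g' : Matrix (Fin m) (Fin m) S} (hg : g ∈ D.GPts S) (hg' : g' ∈ D.GPts S) :
    g * g' ∈ D.GPts S :=
  mul_mem_pts (fun _ h _ h' => D.mul_mem_lieGroupSet h h') hg hg'

theorem adjugate_mem_GPts {g : Matrix (Fin m) (Fin m) S} (hg : g ∈ D.GPts S) :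
    g.adjugate ∈ D.GPts S :=
  adjugate_mem_pts (fun _ h => D.adjugate_mem_lieGroupSet h) hg

theorem adjugate_mem_expSet {W : Submodule ℂ 𝔤} {γ : Matrix (Fin m) (Fin m) ℂ}
    (hγ : γ ∈ expSet D.ρ W) : γ.adjugate ∈ expSet D.ρ W := by
  obtain ⟨x, hx, rfl⟩ := hγ
  exact ⟨-x, neg_mem hx, D.adjugate_exp' x⟩

theorem adjugate_mem_HPts {g : Matrix (Fin m) (Fin m) S} (hg : g ∈ D.HPts S) :
    g.adjugate ∈ D.HPts S :=
  adjugate_mem_pts (fun _ h => D.adjugate_mem_expSet h) hg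

theorem adjugate_mem_NegPts {g : Matrix (Fin m) (Fin m) S} (hg : g ∈ D.NegPts S) :
    g.adjugate ∈ D.NegPts S :=
  adjugate_mem_pts (fun _ h => D.adjugate_mem_expSet h) hg

theorem adjugate_mem_PosPts {g : Matrix (Fin m) (Fin m) S} (hg : g ∈ D.PosPts S) :
    g.adjugate ∈ D.PosPts S :=
  adjugate_mem_pts (fun _ h => D.adjugate_mem_expSet h) hg

theorem mul_mem_HPts {g g' : Matrix (Fin m) (Fin m) S} (hg : g ∈ D.HPts S) (hg' : g' ∈ D.HPts S) :
    g * g' ∈ D.HPts S := by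
  refine mul_mem_pts (fun γ h γ' h' => ?_) hg hg'
  obtain ⟨x, hx, rfl⟩ := h
  obtain ⟨y, hy, rfl⟩ := h'
  refine ⟨x + y, add_mem hx hy, ?_⟩
  rw [map_add, Matrix.exp_add_of_commute]
  have := D.ρ_lie x y
  rw [lie_cartan hx hy, map_zero] at this
  exact (sub_eq_zero.1 this.symm)

theorem sRep_mul_map : (D.sRep : Matrix (Fin m) (Fin m) ℂ).map (algebraMap ℂ S) *
    ((D.sRep⁻¹ : GL (Fin m) ℂ) : Matrix (Fin m) (Fin m) ℂ).map (algebraMap ℂ S) = 1 := by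
  rw [← Matrix.map_mul, Units.mul_inv]
  exact (algebraMap ℂ S).mapMatrix.map_one

theorem map_sRep_mul : ((D.sRep⁻¹ : GL (Fin m) ℂ) : Matrix (Fin m) (Fin m) ℂ).map (algebraMap ℂ S) *
    (D.sRep : Matrix (Fin m) (Fin m) ℂ).map (algebraMap ℂ S) = 1 := by
  rw [← Matrix.map_mul, Units.inv_mul]
  exact (algebraMap ℂ S).mapMatrix.map_one

theorem sConj_mul (g g' : Matrix (Fin m) (Fin m) S) :
    D.sConj (g * g') = D.sConj g * D.sConj g' := by
  simp only [sConj]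
  calc _ = (D.sRep : Matrix (Fin m) (Fin m) ℂ).map (algebraMap ℂ S) * g *
        (((D.sRep⁻¹ : GL (Fin m) ℂ) : Matrix (Fin m) (Fin m) ℂ).map (algebraMap ℂ S) *
          (D.sRep : Matrix (Fin m) (Fin m) ℂ).map (algebraMap ℂ S)) * g' *
        ((D.sRep⁻¹ : GL (Fin m) ℂ) : Matrix (Fin m) (Fin m) ℂ).map (algebraMap ℂ S) := by
          rw [map_sRep_mul, mul_one]; noncomm_ring
    _ = _ := by noncomm_ring

theorem sConj_one : D.sConj (1 : Matrix (Fin m) (Fin m) S) = 1 := by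
  rw [sConj, mul_one, sRep_mul_map]

/-! ### Uniqueness of the triangular decomposition -/

/-- The left side is a plus terms of negative degree, the right side is b plus terms of positive
degree, while a and b have degree 0. Separating degrees forces a = b and kills both remainders. -/
theorem eq_of_triangular {a b x y x' y' : Matrix (Fin m) (Fin m) S} (ha : a ∈ D.HPts S)
    (hb : b ∈ D.HPts S) (hx : x ∈ D.NegPts S) (hy : y ∈ D.NegPts S) (hx' : x' ∈ D.PosPts S)
    (hy' : y' ∈ D.PosPts S) (h : x * a * y = x' * b * y') : a = b ∧ x * a * y = a := by
  have hone : (1 : Matrix (Fin m) (Fin m) ℂ).map (algebraMap ℂ S) = 1 :=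
    (algebraMap ℂ S).mapMatrix.map_one
  have hcar : ∀ {c}, c ∈ D.HPts S → c ∈ matSpan S (D.grSup {0}) := fun {c} hc => by
    have := sub_mem_matSpan (c := 0) (fun γ hγ => by
      rw [sub_zero]; exact D.expCartan_mem hγ) hc
    simpa using this
  have hneg : ∀ {n}, n ∈ D.NegPts S → n - 1 ∈ matSpan S (D.grSup {k | k < 0}) := fun {n} hn => by
    have := sub_mem_matSpan (fun γ hγ => D.expNeg_sub_one_mem hγ) hn
    rwa [hone] at this
  have hpos : ∀ {n}, n ∈ D.PosPts S → n - 1 ∈ matSpan S (D.grSup {k | 0 < k}) := fun {n} hn => by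
    have := sub_mem_matSpan (fun γ hγ => D.expPos_sub_one_mem hγ) hn
    rwa [hone] at this
  -- Only closure of the set of degrees under addition matters, so one argument covers the negative
  -- and the positive side.
  have hgen : ∀ (I : Set ℤ), (∀ i ∈ I, ∀ j ∈ I, i + j ∈ I) → ∀ {c x y},
      c ∈ matSpan S (D.grSup {0}) → x - 1 ∈ matSpan S (D.grSup I) →
      y - 1 ∈ matSpan S (D.grSup I) → x * c * y - c ∈ matSpan S (D.grSup I) := by
    intro I hI c x y hc hx hy
    have h1 := matSpan_mul (fun A hA B hB => D.grSup_mul (I := I) (J := {0}) (K := I)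
      (by rintro i hi _ rfl; simpa using hi) hA hB) hx hc
    have h2 := matSpan_mul (fun A hA B hB => D.grSup_mul hI hA hB) h1 hy
    have h3 := matSpan_mul (fun A hA B hB => D.grSup_mul (I := {0}) (J := I) (K := I)
      (by rintro _ rfl i hi; simpa using hi) hA hB) hc hy
    have : x * c * y - c = (x - 1) * c * (y - 1) + (x - 1) * c + c * (y - 1) := by noncomm_ring
    rw [this]
    exact add_mem (add_mem h2 h1) h3
  have h1 := hgen _ (by intro i hi j hj; simp at hi hj ⊢; omega) (hcar ha) (hneg hx) (hneg hy)
  have h2 := hgen _ (by intro i hi j hj; simp at hi hj ⊢; omega) (hcar hb) (hpos hx') (hpos hy')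
  have hab : a = b := by
    rw [← sub_eq_zero]
    refine eq_zero_of_mem_matSpan (D.grSup_disjoint (I := {0}) (J := {k | k ≠ 0}) (by simp))
      (sub_mem (hcar ha) (hcar hb)) ?_
    have h3 := matSpan_mono (S := S) (D.grSup_mono (J := {k | k ≠ 0})
      (fun k (hk : k < 0) => hk.ne)) h1
    have h4 := matSpan_mono (S := S) (D.grSup_mono (J := {k | k ≠ 0})
      (fun k (hk : 0 < k) => hk.ne')) h2
    rw [← h] at h4
    have := sub_mem h4 h3
    rwa [sub_sub_sub_cancel_left] at this
  refine ⟨hab, ?_⟩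
  rw [← h, ← hab] at h2
  rw [← sub_eq_zero]
  refine eq_zero_of_mem_matSpan (D.grSup_disjoint ?_) h1 h2
  rw [Set.disjoint_left]
  intro k (hk : k < 0) (hk' : 0 < k)
  omega

/-- With a = A'⁻¹A the equation becomes N'⁻¹ a N = M'⁻¹ s(a) M. Degree comparison yields a = s(a)
and N'⁻¹ a N = a. Then a commutes with N', so aN = aN' and N = N'. -/
theorem neg_part_unique {A A' N N' M M' : Matrix (Fin m) (Fin m) S} (hA : A ∈ D.HPts S)
    (hA' : A' ∈ D.HPts S) (hN : N ∈ D.NegPts S) (hN' : N' ∈ D.NegPts S) (hM : M ∈ D.PosPts S)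
    (hM' : M' ∈ D.PosPts S)
    (h : A * N * (D.sConj A * M)⁻¹ = A' * N' * (D.sConj A' * M')⁻¹) : N = N' := by
  have dA := D.det_GPts (D.HPts_subset hA)
  have dA' := D.det_GPts (D.HPts_subset hA')
  have dN' := D.det_GPts (D.NegPts_subset hN')
  have dM' := D.det_GPts (D.PosPts_subset hM')
  have hsA := D.sConj_mem_pts hA
  have hsA' := D.sConj_mem_pts hA'
  have hb := D.mul_mem_GPts (D.HPts_subset hsA) (D.PosPts_subset hM)
  have hb' := D.mul_mem_GPts (D.HPts_subset hsA') (D.PosPts_subset hM')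
  rw [inv_eq_adjugate (D.det_GPts hb), inv_eq_adjugate (D.det_GPts hb')] at h
  have h1 : N'.adjugate * (A'.adjugate * A) * N = M'.adjugate * D.sConj (A'.adjugate * A) * M := by
    have e1 : A * N = A' * N' * (D.sConj A' * M').adjugate * (D.sConj A * M) := by
      rw [← h, mul_assoc _ _ (D.sConj A * M), adjugate_mul_of_det (D.det_GPts hb), mul_one]
    have e2 : (D.sConj A').adjugate = D.sConj A'.adjugate := by
      refine adjugate_eq_of_mul_eq_one (D.det_GPts (D.HPts_subset hsA')) ?_
      rw [← sConj_mul, mul_adjugate_of_det dA', sConj_one]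
    calc N'.adjugate * (A'.adjugate * A) * N = N'.adjugate * A'.adjugate * (A * N) := by
          noncomm_ring
      _ = N'.adjugate * (A'.adjugate * A') * N' * (D.sConj A' * M').adjugate *
            (D.sConj A * M) := by rw [e1]; noncomm_ring
      _ = _ := by
          rw [adjugate_mul_of_det dA', mul_one, adjugate_mul_of_det dN', one_mul,
            Matrix.adjugate_mul_distrib, e2, sConj_mul]
          noncomm_ring
  have ha := D.mul_mem_HPts (D.adjugate_mem_HPts hA') hA
  obtain ⟨h2, h3⟩ := D.eq_of_triangular ha (D.sConj_mem_pts ha) (D.adjugate_mem_NegPts hN') hN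
    (D.adjugate_mem_PosPts hM') hM h1
  have hc := D.commute_expNeg (D.commute_of_sConj_eq ha h2.symm) hN'
  set a := A'.adjugate * A with hadef
  have da : a.det = 1 := D.det_GPts (D.HPts_subset ha)
  have h4 : a * N = a * N' := by
    rw [hc]
    calc a * N = N' * N'.adjugate * a * N := by rw [mul_adjugate_of_det dN', one_mul]
      _ = N' * (N'.adjugate * a * N) := by noncomm_ring
      _ = _ := by rw [h3]
  calc N = a.adjugate * (a * N) := by rw [← mul_assoc, adjugate_mul_of_det da, one_mul]
    _ = N' := by rw [h4, ← mul_assoc, adjugate_mul_of_det da, one_mul]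

theorem isFactorization_iff {R : Type} [CommRing R] [Algebra ℂ R]
    {L h n k : Matrix (Fin m) (Fin m) (LaurentSeries R)} :
    D.IsFactorization L h n k ↔ h ∈ D.HPts (LaurentSeries R) ∧ n ∈ D.NegPts (LaurentSeries R) ∧
      k ∈ D.PosPts (LaurentSeries R) ∧ L = h.map (shiftHom D.p_ne_zero R) *
        n.map (shiftHom D.p_ne_zero R) * (D.sConj (h.map (shiftHom D.p_ne_zero R)) * k)⁻¹ := by
  rw [IsFactorization, loopPoints_eq, loopPoints_eq, loopPoints_eq,
    shiftMatrix_eq_map D.p_ne_zero, shiftMatrix_eq_map D.p_ne_zero, Matrix.map_mul]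
  rfl

theorem nPlus_unique {R : Type} [CommRing R] [Algebra ℂ R]
    {L h n k h' n' k' : Matrix (Fin m) (Fin m) (LaurentSeries R)}
    (hL : D.IsFactorization L h n k) (hL' : D.IsFactorization L h' n' k') : n = n' := by
  rw [isFactorization_iff] at hL hL'
  obtain ⟨hh, hn, hk, rfl⟩ := hL
  obtain ⟨hh', hn', hk', he⟩ := hL'
  have := D.neg_part_unique (map_mem_pts _ hh) (map_mem_pts _ hh') (map_mem_pts _ hn)
    (map_mem_pts _ hn') hk hk' he
  ext1 i j
  exact shiftHom_injective D.p_ne_zero (congrFun (congrFun this i) j)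

theorem muN_eq {R : Type} [CommRing R] [Algebra ℂ R] (L : D.GPrime R)
    {h n k : Matrix (Fin m) (Fin m) (LaurentSeries R)} (hL : D.IsFactorization L.1 h n k) :
    D.muN L = n :=
  D.nPlus_unique L.2.2.choose_spec.choose_spec.choose_spec hL

end Setting

end DrinfeldSokolov

namespace DrinfeldSokolov

/-! ### Base change of endomorphisms and bilinear conjugation -/

section BaseChange

variable {V : Type*} [AddCommGroup V] [Module ℂ V] {S : Type} [CommRing S] [Algebra ℂ S]

theorem baseChange_baseChange_apply (T T' : Module.End ℂ V) (X : S ⊗[ℂ] V) :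
    T.baseChange S (T'.baseChange S X) = (T ∘ₗ T').baseChange S X := by
  rw [LinearMap.baseChange_comp, LinearMap.comp_apply]

/-- Two `S`-linear maps on `S ⊗ V` that agree on `1 ⊗ V` are equal. -/
theorem ext_baseChange {E : Type*} [AddCommGroup E] [Module S E] {f g : S ⊗[ℂ] V →ₗ[S] E}
    (h : ∀ v, f (1 ⊗ₜ v) = g (1 ⊗ₜ v)) (X : S ⊗[ℂ] V) : f X = g X := by
  induction X using TensorProduct.induction_on with
  | zero => rw [map_zero, map_zero]
  | add x y hx hy => rw [map_add, map_add, hx, hy]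
  | tmul s v =>
    have : s ⊗ₜ[ℂ] v = s • (1 : S) ⊗ₜ[ℂ] v := by rw [TensorProduct.smul_tmul', smul_eq_mul, mul_one]
    rw [this, map_smul, map_smul, h]

end BaseChange

section Conj

variable {m : ℕ} {S : Type} [CommRing S]

/-- The bilinear map `(A, A') ↦ A M A'`. -/
def mulBil (M : Matrix (Fin m) (Fin m) S) :
    Matrix (Fin m) (Fin m) S →ₗ[S] Matrix (Fin m) (Fin m) S →ₗ[S] Matrix (Fin m) (Fin m) S :=
  LinearMap.mk₂ S (fun A A' => A * M * A') (fun _ _ _ => by simp only [add_mul])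
    (fun _ _ _ => by simp only [smul_mul_assoc]) (fun _ _ _ => by simp only [mul_add])
    (fun _ _ _ => by simp only [mul_smul_comm])

@[simp] theorem mulBil_apply (M A A' : Matrix (Fin m) (Fin m) S) : mulBil M A A' = A * M * A' := rfl

end Conj

namespace Setting

open LieAlgebra LieAlgebra.IsKilling

variable {𝔤 : Type*} [LieRing 𝔤] [LieAlgebra ℂ 𝔤] [FiniteDimensional ℂ 𝔤]
  [LieAlgebra.IsSemisimple ℂ 𝔤] {H : LieSubalgebra ℂ 𝔤} [H.IsCartanSubalgebra] {l m : ℕ}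
  (D : Setting 𝔤 H l m) {S : Type} [CommRing S] [Algebra ℂ S]

/-! ### The adjoint action over a test algebra -/

/-- The matrix of an element of `S ⊗ 𝔤`. -/
def rep (S : Type) [CommRing S] [Algebra ℂ S] : S ⊗[ℂ] 𝔤 →ₗ[S] Matrix (Fin m) (Fin m) S :=
  repMatrixOver D.ρ S

theorem rep_tmul (s : S) (x : 𝔤) : D.rep S (s ⊗ₜ x) = s • (D.ρ x).map (algebraMap ℂ S) := by
  rw [rep, repMatrixOver, LinearMap.liftBaseChange_tmul]
  rfl

theorem rep_one_tmul (x : 𝔤) : D.rep S (1 ⊗ₜ x) = (D.ρ x).map (algebraMap ℂ S) := by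
  rw [rep_tmul, one_smul]

/-- The adjoint action on `S ⊗ 𝔤`. -/
def Ad (g : Matrix (Fin m) (Fin m) S) : S ⊗[ℂ] 𝔤 →ₗ[S] S ⊗[ℂ] 𝔤 :=
  matExtend S D.ρInv ∘ₗ LinearMap.mulLeft S g ∘ₗ LinearMap.mulRight S g.adjugate ∘ₗ D.rep S

theorem Ad_apply (g : Matrix (Fin m) (Fin m) S) (X : S ⊗[ℂ] 𝔤) :
    D.Ad g X = matExtend S D.ρInv (g * D.rep S X * g.adjugate) := by
  simp [Ad, mul_assoc]

theorem matExtend_ρInv_rep (X : S ⊗[ℂ] 𝔤) : matExtend S D.ρInv (D.rep S X) = X :=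
  ext_baseChange (f := matExtend S D.ρInv ∘ₗ D.rep S) (g := LinearMap.id) (fun v => by
    rw [LinearMap.comp_apply, rep_one_tmul, matExtend_map, ρInv_ρ, LinearMap.id_apply]) X

theorem Ad_map (γ : Matrix (Fin m) (Fin m) ℂ) (X : S ⊗[ℂ] 𝔤) :
    D.Ad (γ.map (algebraMap ℂ S)) X = (D.adC γ).baseChange S X :=
  ext_baseChange (fun v => by
    rw [Ad_apply, rep_one_tmul, ← map_adjugate_algebraMap, ← Matrix.map_mul, ← Matrix.map_mul,
      matExtend_map, LinearMap.baseChange_tmul, adC_apply]) X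

/-- Relations for the adjoint action hold at all points of the closure if they hold on `Γ`. -/
theorem Ad_relation {Γ : Set (Matrix (Fin m) (Fin m) ℂ)} {T₁ T₂ T₃ : Module.End ℂ 𝔤}
    (h : ∀ γ ∈ Γ, ∀ y, T₁ (D.adC γ (T₂ y)) = T₃ y) {g : Matrix (Fin m) (Fin m) S}
    (hg : g ∈ pts Γ S) (X : S ⊗[ℂ] 𝔤) :
    T₁.baseChange S (D.Ad g (T₂.baseChange S X)) = T₃.baseChange S X := by
  have := bilinear_eq_of_mem_pts
    ((mulBil (D.rep S (T₂.baseChange S X))).compr₂ (T₁.baseChange S ∘ₗ matExtend S D.ρInv))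
    (T₃.baseChange S X) (fun γ hγ => ?_) hg
  · rw [Ad_apply]
    exact this
  · rw [LinearMap.compr₂_apply, mulBil_apply, LinearMap.comp_apply, map_adjugate_algebraMap,
      ← Ad_apply, Ad_map, baseChange_baseChange_apply, baseChange_baseChange_apply]
    congr 2
    exact LinearMap.ext fun y => h γ hγ y

/-- The S-extension of ρInv inverts `rep` only on its image. That g·rep(X)·adj(g) lies there is a
relation bilinear in g and its adjugate, hence inherited from the complex group. -/
theorem rep_Ad {g : Matrix (Fin m) (Fin m) S} (hg : g ∈ D.GPts S) (X : S ⊗[ℂ] 𝔤) :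
    D.rep S (D.Ad g X) = g * D.rep S X * g.adjugate := by
  have := bilinear_eq_of_mem_pts
    ((mulBil (D.rep S X)).compr₂ (D.rep S ∘ₗ matExtend S D.ρInv - LinearMap.id)) 0
    (fun γ hγ => ?_) hg
  · rw [LinearMap.compr₂_apply, mulBil_apply, LinearMap.sub_apply, LinearMap.comp_apply,
      LinearMap.id_apply, sub_eq_zero] at this
    rw [Ad_apply, this]
  · rw [LinearMap.compr₂_apply, mulBil_apply, LinearMap.sub_apply, LinearMap.comp_apply,
      LinearMap.id_apply, sub_eq_zero, map_adjugate_algebraMap, ← Ad_apply]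
    have := ext_baseChange (f := D.rep S ∘ₗ D.Ad (γ.map (algebraMap ℂ S)))
      (g := LinearMap.mulLeft S (γ.map (algebraMap ℂ S)) ∘ₗ
        LinearMap.mulRight S (γ.adjugate.map (algebraMap ℂ S)) ∘ₗ D.rep S) (fun v => ?_) X
    · simpa [mul_assoc, map_adjugate_algebraMap] using this
    · simp only [LinearMap.comp_apply, LinearMap.mulLeft_apply, LinearMap.mulRight_apply]
      rw [Ad_map, LinearMap.baseChange_tmul, rep_one_tmul, rep_one_tmul, D.ρ_adC hγ,
        Matrix.map_mul, Matrix.map_mul, mul_assoc]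

theorem Ad_mul {g g' : Matrix (Fin m) (Fin m) S} (hg' : g' ∈ D.GPts S) (X : S ⊗[ℂ] 𝔤) :
    D.Ad (g * g') X = D.Ad g (D.Ad g' X) := by
  rw [Ad_apply, Ad_apply D g, D.rep_Ad hg', Matrix.adjugate_mul_distrib]
  congr 1
  noncomm_ring

theorem Ad_one (X : S ⊗[ℂ] 𝔤) : D.Ad 1 X = X := by
  rw [Ad_apply, Matrix.adjugate_one, one_mul, mul_one, matExtend_ρInv_rep]

theorem Ad_adjugate_Ad {g : Matrix (Fin m) (Fin m) S} (hg : g ∈ D.GPts S) (X : S ⊗[ℂ] 𝔤) :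
    D.Ad g.adjugate (D.Ad g X) = X := by
  rw [← D.Ad_mul hg, adjugate_mul_of_det (D.det_GPts hg), Ad_one]

theorem Ad_Ad_adjugate {g : Matrix (Fin m) (Fin m) S} (hg : g ∈ D.GPts S) (X : S ⊗[ℂ] 𝔤) :
    D.Ad g (D.Ad g.adjugate X) = X := by
  rw [← D.Ad_mul (D.adjugate_mem_GPts hg), mul_adjugate_of_det (D.det_GPts hg), Ad_one]

/-! ### The form over a test algebra -/

/-- The `S`-bilinear extension of the form. -/
def formS (S : Type) [CommRing S] [Algebra ℂ S] : LinearMap.BilinForm S (S ⊗[ℂ] 𝔤) :=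
  LinearMap.BilinForm.baseChange S D.form

theorem formS_tmul (s t : S) (x y : 𝔤) :
    D.formS S (s ⊗ₜ x) (t ⊗ₜ y) = s * t * algebraMap ℂ S (D.form x y) := by
  rw [formS, LinearMap.BilinForm.baseChange_tmul]
  rw [Algebra.smul_def, mul_comm]

theorem formS_ext {f g : S ⊗[ℂ] 𝔤 →ₗ[S] S ⊗[ℂ] 𝔤 →ₗ[S] S}
    (h : ∀ x y, f (1 ⊗ₜ x) (1 ⊗ₜ y) = g (1 ⊗ₜ x) (1 ⊗ₜ y)) (X Y : S ⊗[ℂ] 𝔤) : f X Y = g X Y :=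
  LinearMap.congr_fun (ext_baseChange (f := f) (g := g) (fun x => LinearMap.ext fun Y =>
    ext_baseChange (h x) Y) X) Y

theorem formS_comm (X Y : S ⊗[ℂ] 𝔤) : D.formS S X Y = D.formS S Y X :=
  formS_ext (f := D.formS S) (g := (D.formS S).flip) (fun x y => by
    rw [LinearMap.BilinForm.flip_apply, formS_tmul, formS_tmul, form_comm, mul_comm 1]) X Y

/-- Adjoint operators stay adjoint after extension of scalars. -/
theorem formS_baseChange {T T' : Module.End ℂ 𝔤} (h : ∀ x y, D.form (T x) y = D.form x (T' y))
    (X Y : S ⊗[ℂ] 𝔤) :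
    D.formS S (T.baseChange S X) Y = D.formS S X (T'.baseChange S Y) :=
  formS_ext (f := D.formS S ∘ₗ T.baseChange S) (g := (D.formS S).compl₂ (T'.baseChange S))
    (fun x y => by
      simp only [LinearMap.comp_apply, LinearMap.compl₂_apply, LinearMap.baseChange_tmul,
        formS_tmul, h]) X Y

/-- Both sides are bilinear in g and its adjugate, so invariance passes from the complex group to
S-points. -/
theorem formS_Ad {g : Matrix (Fin m) (Fin m) S} (hg : g ∈ D.GPts S) (X Y : S ⊗[ℂ] 𝔤) :
    D.formS S (D.Ad g X) Y = D.formS S X (D.Ad g.adjugate Y) := by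
  have := bilinear_eq_of_mem_pts
    ((mulBil (D.rep S X)).compr₂ ((D.formS S).flip Y ∘ₗ matExtend S D.ρInv) -
      ((mulBil (D.rep S Y)).flip.compr₂ (D.formS S X ∘ₗ matExtend S D.ρInv))) 0
    (fun γ hγ => ?_) hg
  · simp only [LinearMap.sub_apply, LinearMap.compr₂_apply, mulBil_apply, LinearMap.comp_apply,
      LinearMap.flip_apply, LinearMap.BilinForm.flip_apply, sub_eq_zero] at this
    rw [Ad_apply, Ad_apply, adjugate_adjugate_of_det (D.det_GPts hg), this]
  · simp only [LinearMap.sub_apply, LinearMap.compr₂_apply, mulBil_apply, LinearMap.comp_apply,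
      LinearMap.flip_apply, LinearMap.BilinForm.flip_apply, sub_eq_zero]
    have := formS_ext (f := D.formS S ∘ₗ matExtend S D.ρInv ∘ₗ LinearMap.mulLeft S
        (γ.map (algebraMap ℂ S)) ∘ₗ LinearMap.mulRight S (γ.adjugate.map (algebraMap ℂ S)) ∘ₗ
          D.rep S)
      (g := (D.formS S).compl₂ (matExtend S D.ρInv ∘ₗ LinearMap.mulLeft S
        (γ.adjugate.map (algebraMap ℂ S)) ∘ₗ LinearMap.mulRight S (γ.map (algebraMap ℂ S)) ∘ₗ
          D.rep S)) (fun x y => ?_) X Y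
    · simpa [mul_assoc] using this
    · simp only [LinearMap.comp_apply, LinearMap.compl₂_apply, LinearMap.mulLeft_apply,
        LinearMap.mulRight_apply, rep_one_tmul, ← Matrix.map_mul, matExtend_map, formS_tmul]
      rw [← mul_assoc, ← mul_assoc, ← adC_apply, D.form_adC hγ]

theorem formS_Ad_Ad {g : Matrix (Fin m) (Fin m) S} (hg : g ∈ D.GPts S) (X Y : S ⊗[ℂ] 𝔤) :
    D.formS S (D.Ad g X) (D.Ad g Y) = D.formS S X Y := by
  rw [D.formS_Ad hg, D.Ad_adjugate_Ad hg]

end Setting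

end DrinfeldSokolov

namespace DrinfeldSokolov

namespace Setting

open LieAlgebra LieAlgebra.IsKilling

variable {𝔤 : Type*} [LieRing 𝔤] [LieAlgebra ℂ 𝔤] [FiniteDimensional ℂ 𝔤]
  [LieAlgebra.IsSemisimple ℂ 𝔤] {H : LieSubalgebra ℂ 𝔤} [H.IsCartanSubalgebra] {l m : ℕ}
  (D : Setting 𝔤 H l m) {S : Type} [CommRing S] [Algebra ℂ S]

/-! ### The triangular decomposition over a test algebra -/

/-- The projection of `S ⊗ 𝔤` onto `S ⊗ 𝔫̄`. -/
abbrev negS (S : Type) [CommRing S] [Algebra ℂ S] : S ⊗[ℂ] 𝔤 →ₗ[S] S ⊗[ℂ] 𝔤 :=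
  D.projNeg.baseChange S

/-- The projection of `S ⊗ 𝔤` onto `S ⊗ 𝔫`. -/
abbrev posS (S : Type) [CommRing S] [Algebra ℂ S] : S ⊗[ℂ] 𝔤 →ₗ[S] S ⊗[ℂ] 𝔤 :=
  D.projPos.baseChange S

/-- The projection of `S ⊗ 𝔤` onto `S ⊗ 𝔥`. -/
abbrev carS (_ : Setting 𝔤 H l m) (S : Type) [CommRing S] [Algebra ℂ S] :
    S ⊗[ℂ] 𝔤 →ₗ[S] S ⊗[ℂ] 𝔤 := (projCartan H).baseChange S

/-- The `S`-linear extension of `(1 - s)⁻¹ P_𝔥`. -/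
abbrev opUS (S : Type) [CommRing S] [Algebra ℂ S] : S ⊗[ℂ] 𝔤 →ₗ[S] S ⊗[ℂ] 𝔤 :=
  D.opU.baseChange S

/-- The `S`-linear extension of `s P_𝔥`. -/
abbrev opSS (S : Type) [CommRing S] [Algebra ℂ S] : S ⊗[ℂ] 𝔤 →ₗ[S] S ⊗[ℂ] 𝔤 :=
  D.opS.baseChange S

theorem baseChange_eq {T T' T'' : Module.End ℂ 𝔤} (h : T ∘ₗ T' = T'') (X : S ⊗[ℂ] 𝔤) :
    T.baseChange S (T'.baseChange S X) = T''.baseChange S X := by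
  rw [baseChange_baseChange_apply, h]

theorem baseChange_eq_zero {T T' : Module.End ℂ 𝔤} (h : T ∘ₗ T' = 0) (X : S ⊗[ℂ] 𝔤) :
    T.baseChange S (T'.baseChange S X) = 0 := by
  rw [baseChange_baseChange_apply, h, LinearMap.baseChange_zero, LinearMap.zero_apply]

theorem sum_projS (X : S ⊗[ℂ] 𝔤) : D.negS S X + D.carS S X + D.posS S X = X := by
  have := congrArg (LinearMap.baseChange S) D.projSum
  rw [LinearMap.baseChange_add, LinearMap.baseChange_add] at this
  have := LinearMap.congr_fun this X
  rw [Module.End.one_eq_id, LinearMap.baseChange_id] at this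
  exact this

@[simp] theorem negS_negS (X : S ⊗[ℂ] 𝔤) : D.negS S (D.negS S X) = D.negS S X :=
  baseChange_eq D.projNeg_comp_projNeg X
@[simp] theorem negS_carS (X : S ⊗[ℂ] 𝔤) : D.negS S (D.carS S X) = 0 :=
  baseChange_eq_zero D.projNeg_comp_projCartan X
@[simp] theorem negS_posS (X : S ⊗[ℂ] 𝔤) : D.negS S (D.posS S X) = 0 :=
  baseChange_eq_zero D.projNeg_comp_projPos X
@[simp] theorem posS_negS (X : S ⊗[ℂ] 𝔤) : D.posS S (D.negS S X) = 0 :=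
  baseChange_eq_zero D.projPos_comp_projNeg X
@[simp] theorem posS_carS (X : S ⊗[ℂ] 𝔤) : D.posS S (D.carS S X) = 0 :=
  baseChange_eq_zero D.projPos_comp_projCartan X
@[simp] theorem posS_posS (X : S ⊗[ℂ] 𝔤) : D.posS S (D.posS S X) = D.posS S X :=
  baseChange_eq D.projPos_comp_projPos X
@[simp] theorem carS_negS (X : S ⊗[ℂ] 𝔤) : D.carS S (D.negS S X) = 0 :=
  baseChange_eq_zero D.projCartan_comp_projNeg X
@[simp] theorem carS_carS (X : S ⊗[ℂ] 𝔤) : D.carS S (D.carS S X) = D.carS S X :=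
  baseChange_eq projCartan_comp_projCartan X
@[simp] theorem carS_posS (X : S ⊗[ℂ] 𝔤) : D.carS S (D.posS S X) = 0 :=
  baseChange_eq_zero D.projCartan_comp_projPos X
@[simp] theorem carS_opUS (X : S ⊗[ℂ] 𝔤) : D.carS S (D.opUS S X) = D.opUS S X :=
  baseChange_eq D.projCartan_comp_opU X
@[simp] theorem carS_opSS (X : S ⊗[ℂ] 𝔤) : D.carS S (D.opSS S X) = D.opSS S X :=
  baseChange_eq D.projCartan_comp_opS X
@[simp] theorem opSS_carS (X : S ⊗[ℂ] 𝔤) : D.opSS S (D.carS S X) = D.opSS S X :=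
  baseChange_eq D.opS_comp_projCartan X
@[simp] theorem posS_opUS (X : S ⊗[ℂ] 𝔤) : D.posS S (D.opUS S X) = 0 := by
  rw [← carS_opUS, posS_carS]
@[simp] theorem negS_opUS (X : S ⊗[ℂ] 𝔤) : D.negS S (D.opUS S X) = 0 := by
  rw [← carS_opUS, negS_carS]
@[simp] theorem posS_opSS (X : S ⊗[ℂ] 𝔤) : D.posS S (D.opSS S X) = 0 := by
  rw [← carS_opSS, posS_carS]
@[simp] theorem negS_opSS (X : S ⊗[ℂ] 𝔤) : D.negS S (D.opSS S X) = 0 := by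
  rw [← carS_opSS, negS_carS]

theorem opUS_sub (X : S ⊗[ℂ] 𝔤) : D.opUS S X - D.opSS S (D.opUS S X) = D.carS S X := by
  rw [baseChange_baseChange_apply, ← LinearMap.sub_apply, ← LinearMap.baseChange_sub,
    opU_sub_opS_comp_opU]

theorem formS_negS (X Y : S ⊗[ℂ] 𝔤) : D.formS S (D.negS S X) Y = D.formS S X (D.posS S Y) :=
  D.formS_baseChange D.form_projNeg X Y

theorem formS_posS (X Y : S ⊗[ℂ] 𝔤) : D.formS S (D.posS S X) Y = D.formS S X (D.negS S Y) :=
  D.formS_baseChange D.form_projPos X Y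

theorem formS_carS (X Y : S ⊗[ℂ] 𝔤) : D.formS S (D.carS S X) Y = D.formS S X (D.carS S Y) :=
  D.formS_baseChange D.form_projCartan X Y

theorem formS_opUS (X Y : S ⊗[ℂ] 𝔤) :
    D.formS S (D.opUS S X) Y = D.formS S X (D.carS S Y - D.opUS S Y) := by
  rw [← LinearMap.sub_apply, ← LinearMap.baseChange_sub]
  refine D.formS_baseChange (fun x y => ?_) X Y
  rw [LinearMap.sub_apply, map_sub, ← D.form_projCartan, ← D.form_opU, add_sub_cancel_right]

theorem formS_opSS (X Y : S ⊗[ℂ] 𝔤) :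
    D.formS S (D.opSS S X) (D.opSS S Y) = D.formS S (D.carS S X) (D.carS S Y) :=
  formS_ext (f := (D.formS S ∘ₗ D.opSS S).compl₂ (D.opSS S))
    (g := (D.formS S ∘ₗ D.carS S).compl₂ (D.carS S)) (fun x y => by
      simp only [LinearMap.comp_apply, LinearMap.compl₂_apply, LinearMap.baseChange_tmul,
        formS_tmul, form_opS]) X Y

/-- The complementary projections `P_𝔫̄ + (1 - s)⁻¹ P_𝔥` and `P_𝔫 + P_𝔥 - (1 - s)⁻¹ P_𝔥`. -/
def opQ (S : Type) [CommRing S] [Algebra ℂ S] : S ⊗[ℂ] 𝔤 →ₗ[S] S ⊗[ℂ] 𝔤 := D.negS S + D.opUS S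

/-- The operator `P_𝔫 + P_𝔥 - (1 - s)⁻¹ P_𝔥`. -/
def opK (S : Type) [CommRing S] [Algebra ℂ S] : S ⊗[ℂ] 𝔤 →ₗ[S] S ⊗[ℂ] 𝔤 :=
  D.posS S + D.carS S - D.opUS S

theorem opQ_apply (X : S ⊗[ℂ] 𝔤) : D.opQ S X = D.negS S X + D.opUS S X := rfl

theorem opK_apply (X : S ⊗[ℂ] 𝔤) : D.opK S X = D.posS S X + D.carS S X - D.opUS S X := rfl

theorem opQ_add_opK (X : S ⊗[ℂ] 𝔤) : D.opQ S X + D.opK S X = X := by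
  rw [opQ_apply, opK_apply]
  conv_rhs => rw [← D.sum_projS X]
  abel

/-- The transpose of P_𝔫̄ is P_𝔫 and that of U is P_𝔥 - U, so the transpose of Q is K. -/
theorem formS_opQ (X Y : S ⊗[ℂ] 𝔤) : D.formS S X (D.opQ S Y) = D.formS S (D.opK S X) Y := by
  rw [D.formS_comm, D.formS_comm _ Y, opQ_apply, map_add, LinearMap.add_apply, formS_negS,
    formS_opUS, ← map_add, opK_apply, add_sub_assoc]

/-! ### The adjoint action and the triangular decomposition -/

/-- Inserting the projection 1 - P_𝔫 turns the inclusion for the opposite Borel subalgebra into an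
operator identity on all of 𝔤, the form in which `Ad_relation` transfers it. The three lemmas that
follow use the same device. -/
theorem posS_Ad_neg {n : Matrix (Fin m) (Fin m) S} (hn : n ∈ D.NegPts S) {X : S ⊗[ℂ] 𝔤}
    (hX : D.posS S X = 0) : D.posS S (D.Ad n X) = 0 := by
  have := D.Ad_relation (T₁ := D.projPos) (T₂ := 1 - D.projPos) (T₃ := 0) (fun γ hγ y => ?_) hn X
  · simpa [LinearMap.baseChange_sub, Module.End.one_eq_id, hX] using this
  · have h0 : D.projPos ((1 - D.projPos) y) = 0 := by
      have := LinearMap.congr_fun D.projPos_comp_projPos y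
      simp only [LinearMap.comp_apply] at this
      simp [this]
    have := D.projPos_of_mem_nilNeg (D.adC_expNeg hγ h0)
    rw [map_sub, h0, sub_zero] at this
    simpa using this

theorem carS_Ad_neg {n : Matrix (Fin m) (Fin m) S} (hn : n ∈ D.NegPts S) {X : S ⊗[ℂ] 𝔤}
    (hX : D.posS S X = 0) : D.carS S (D.Ad n X) = D.carS S X := by
  have := D.Ad_relation (T₁ := projCartan H) (T₂ := 1 - D.projPos) (T₃ := projCartan H)
    (fun γ hγ y => ?_) hn X
  · simpa [LinearMap.baseChange_sub, Module.End.one_eq_id, hX] using this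
  · have h0 : D.projPos ((1 - D.projPos) y) = 0 := by
      have := LinearMap.congr_fun D.projPos_comp_projPos y
      simp only [LinearMap.comp_apply] at this
      simp [this]
    have := D.mem_nilNeg.1 (D.adC_expNeg hγ h0)
    have h1 := congrArg (projCartan H) this
    rw [← LinearMap.comp_apply, projCartan_comp_projNeg, LinearMap.zero_apply, map_sub] at h1
    have h2 := LinearMap.congr_fun D.projCartan_comp_projPos y
    rw [LinearMap.comp_apply, LinearMap.zero_apply] at h2
    rw [sub_eq_zero.1 h1.symm, LinearMap.sub_apply, map_sub, h2, sub_zero]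
    rfl

theorem negS_Ad_pos {n : Matrix (Fin m) (Fin m) S} (hn : n ∈ D.PosPts S) {X : S ⊗[ℂ] 𝔤}
    (hX : D.negS S X = 0) : D.negS S (D.Ad n X) = 0 := by
  have := D.Ad_relation (T₁ := D.projNeg) (T₂ := 1 - D.projNeg) (T₃ := 0) (fun γ hγ y => ?_) hn X
  · simpa [LinearMap.baseChange_sub, Module.End.one_eq_id, hX] using this
  · have h0 : D.projNeg ((1 - D.projNeg) y) = 0 := by
      have := LinearMap.congr_fun D.projNeg_comp_projNeg y
      simp only [LinearMap.comp_apply] at this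
      simp [this]
    have := D.projNeg_of_mem_nilPos (D.adC_expPos hγ h0)
    rw [map_sub, h0, sub_zero] at this
    simpa using this

theorem carS_Ad_pos {n : Matrix (Fin m) (Fin m) S} (hn : n ∈ D.PosPts S) {X : S ⊗[ℂ] 𝔤}
    (hX : D.negS S X = 0) : D.carS S (D.Ad n X) = D.carS S X := by
  have := D.Ad_relation (T₁ := projCartan H) (T₂ := 1 - D.projNeg) (T₃ := projCartan H)
    (fun γ hγ y => ?_) hn X
  · simpa [LinearMap.baseChange_sub, Module.End.one_eq_id, hX] using this
  · have h0 : D.projNeg ((1 - D.projNeg) y) = 0 := by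
      have := LinearMap.congr_fun D.projNeg_comp_projNeg y
      simp only [LinearMap.comp_apply] at this
      simp [this]
    have := D.mem_nilPos.1 (D.adC_expPos hγ h0)
    have h1 := congrArg (projCartan H) this
    rw [← LinearMap.comp_apply, projCartan_comp_projPos, LinearMap.zero_apply, map_sub] at h1
    have h2 := LinearMap.congr_fun D.projCartan_comp_projNeg y
    rw [LinearMap.comp_apply, LinearMap.zero_apply] at h2
    rw [sub_eq_zero.1 h1.symm, LinearMap.sub_apply, map_sub, h2, sub_zero]
    rfl

theorem Ad_cartan_carS {h : Matrix (Fin m) (Fin m) S} (hh : h ∈ D.HPts S) (X : S ⊗[ℂ] 𝔤) :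
    D.Ad h (D.carS S X) = D.carS S X := by
  have := D.Ad_relation (T₁ := 1) (T₂ := projCartan H) (T₃ := projCartan H)
    (fun γ hγ y => D.adC_expCartan hγ (projCartan_mem y)) hh X
  simpa [Module.End.one_eq_id] using this

theorem negS_Ad_cartan_negS {h : Matrix (Fin m) (Fin m) S} (hh : h ∈ D.HPts S) (X : S ⊗[ℂ] 𝔤) :
    D.negS S (D.Ad h (D.negS S X)) = D.Ad h (D.negS S X) := by
  have := D.Ad_relation (T₁ := 1 - D.projNeg) (T₂ := D.projNeg) (T₃ := 0)
    (fun γ hγ y => ?_) hh X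
  · rw [LinearMap.baseChange_zero, LinearMap.baseChange_sub, Module.End.one_eq_id,
      LinearMap.baseChange_id, LinearMap.zero_apply, LinearMap.sub_apply] at this
    exact (sub_eq_zero.1 this).symm
  · have := D.mem_nilNeg.1 (D.adC_expCartan_mem_nilNeg hγ (D.projNeg_mem y))
    rw [LinearMap.sub_apply, this]
    simp

theorem posS_Ad_cartan_posS {h : Matrix (Fin m) (Fin m) S} (hh : h ∈ D.HPts S) (X : S ⊗[ℂ] 𝔤) :
    D.posS S (D.Ad h (D.posS S X)) = D.Ad h (D.posS S X) := by
  have := D.Ad_relation (T₁ := 1 - D.projPos) (T₂ := D.projPos) (T₃ := 0)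
    (fun γ hγ y => ?_) hh X
  · rw [LinearMap.baseChange_zero, LinearMap.baseChange_sub, Module.End.one_eq_id,
      LinearMap.baseChange_id, LinearMap.zero_apply, LinearMap.sub_apply] at this
    exact (sub_eq_zero.1 this).symm
  · have := D.mem_nilPos.1 (D.adC_expCartan_mem_nilPos hγ (D.projPos_mem y))
    rw [LinearMap.sub_apply, this]
    simp

theorem posS_Ad_cartan {h : Matrix (Fin m) (Fin m) S} (hh : h ∈ D.HPts S) (X : S ⊗[ℂ] 𝔤) :
    D.posS S (D.Ad h X) = D.Ad h (D.posS S X) := by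
  conv_lhs => rw [← D.sum_projS X]
  rw [map_add, map_add, map_add, map_add, D.posS_Ad_cartan_posS hh, D.Ad_cartan_carS hh,
    ← D.negS_Ad_cartan_negS hh, posS_negS, posS_carS, zero_add, zero_add]

theorem negS_Ad_cartan {h : Matrix (Fin m) (Fin m) S} (hh : h ∈ D.HPts S) (X : S ⊗[ℂ] 𝔤) :
    D.negS S (D.Ad h X) = D.Ad h (D.negS S X) := by
  conv_lhs => rw [← D.sum_projS X]
  rw [map_add, map_add, map_add, map_add, D.negS_Ad_cartan_negS hh, D.Ad_cartan_carS hh,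
    ← D.posS_Ad_cartan_posS hh, negS_posS, negS_carS, add_zero, add_zero]

theorem carS_Ad_cartan {h : Matrix (Fin m) (Fin m) S} (hh : h ∈ D.HPts S) (X : S ⊗[ℂ] 𝔤) :
    D.carS S (D.Ad h X) = D.carS S X := by
  conv_lhs => rw [← D.sum_projS X]
  rw [map_add, map_add, map_add, map_add, D.Ad_cartan_carS hh, ← D.negS_Ad_cartan_negS hh,
    ← D.posS_Ad_cartan_posS hh, carS_posS, carS_negS, carS_carS, add_zero, zero_add]

/-! ### Infinitesimal elements -/

/-- The infinitesimal group element `1 + ε X`. -/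
def inf (ε : S) (X : S ⊗[ℂ] 𝔤) : Matrix (Fin m) (Fin m) S := 1 + ε • D.rep S X

theorem inf_mul_inf {ε : S} (hε : ε * ε = 0) (X Y : S ⊗[ℂ] 𝔤) :
    D.inf ε X * D.inf ε Y = D.inf ε (X + Y) := by
  simp only [inf, add_mul, mul_add, one_mul, mul_one, map_add, smul_add, smul_mul_assoc,
    mul_smul_comm, smul_smul, hε, zero_smul, add_zero]
  abel

theorem inf_zero (ε : S) : D.inf ε 0 = 1 := by rw [inf, map_zero, smul_zero, add_zero]

theorem inf_mul_inf_neg {ε : S} (hε : ε * ε = 0) (X : S ⊗[ℂ] 𝔤) :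
    D.inf ε X * D.inf ε (-X) = 1 := by
  rw [D.inf_mul_inf hε, add_neg_cancel, inf_zero]

theorem mul_inf {g : Matrix (Fin m) (Fin m) S} (hg : g ∈ D.GPts S) (ε : S) (X : S ⊗[ℂ] 𝔤) :
    g * D.inf ε X = D.inf ε (D.Ad g X) * g := by
  rw [inf, inf, D.rep_Ad hg, mul_add, add_mul, mul_one, one_mul, mul_smul_comm, smul_mul_assoc,
    mul_assoc, mul_assoc, adjugate_mul_of_det (D.det_GPts hg), mul_one]

theorem rep_baseChange_mem {T : Module.End ℂ 𝔤} {W : Submodule ℂ 𝔤} (h : ∀ x, T x ∈ W)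
    (X : S ⊗[ℂ] 𝔤) : D.rep S (T.baseChange S X) ∈ matSpan S (W.map D.ρ) := by
  induction X using TensorProduct.induction_on with
  | zero => rw [map_zero, map_zero]; exact zero_mem _
  | add x y hx hy => rw [map_add, map_add]; exact add_mem hx hy
  | tmul s v =>
    rw [LinearMap.baseChange_tmul, rep_tmul]
    exact Submodule.smul_mem _ _ (map_mem_matSpan (Submodule.mem_map_of_mem (h v)))

theorem inf_mul_mem_GPts {ε : S} (hε : ε * ε = 0) {g : Matrix (Fin m) (Fin m) S}
    (hg : g ∈ D.GPts S) (X : S ⊗[ℂ] 𝔤) : D.inf ε X * g ∈ D.GPts S := by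
  refine infinitesimal_mul_mem_pts (W := (⊤ : Submodule ℂ 𝔤).map D.ρ) ?_ hε hg ?_
  · rintro _ ⟨x, -, rfl⟩
    exact D.tangentTo_lieGroupSet x
  · have := D.rep_baseChange_mem (T := 1) (W := ⊤) (fun _ => trivial) X
    rwa [Module.End.one_eq_id, LinearMap.baseChange_id] at this

theorem inf_mul_mem_HPts {ε : S} (hε : ε * ε = 0) {g : Matrix (Fin m) (Fin m) S}
    (hg : g ∈ D.HPts S) {X : S ⊗[ℂ] 𝔤} (hX : D.carS S X = X) : D.inf ε X * g ∈ D.HPts S := by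
  refine infinitesimal_mul_mem_pts (W := H.toSubmodule.map D.ρ) ?_ hε hg ?_
  · rintro _ ⟨x, hx, rfl⟩
    exact D.tangentTo_expCartan hx
  · rw [← hX]
    exact D.rep_baseChange_mem (fun x => projCartan_mem x) X

theorem inf_mul_mem_NegPts {ε : S} (hε : ε * ε = 0) {g : Matrix (Fin m) (Fin m) S}
    (hg : g ∈ D.NegPts S) {X : S ⊗[ℂ] 𝔤} (hX : D.negS S X = X) : D.inf ε X * g ∈ D.NegPts S := by
  refine infinitesimal_mul_mem_pts (W := (nilNeg D.base).map D.ρ) ?_ hε hg ?_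
  · rintro _ ⟨x, hx, rfl⟩
    exact D.tangentTo_expNeg hx
  · rw [← hX]
    exact D.rep_baseChange_mem (fun x => D.projNeg_mem x) X

theorem inf_mul_mem_PosPts {ε : S} (hε : ε * ε = 0) {g : Matrix (Fin m) (Fin m) S}
    (hg : g ∈ D.PosPts S) {X : S ⊗[ℂ] 𝔤} (hX : D.posS S X = X) : D.inf ε X * g ∈ D.PosPts S := by
  refine infinitesimal_mul_mem_pts (W := (nilPos D.base).map D.ρ) ?_ hε hg ?_
  · rintro _ ⟨x, hx, rfl⟩
    exact D.tangentTo_expPos hx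
  · rw [← hX]
    exact D.rep_baseChange_mem (fun x => D.projPos_mem x) X

theorem sConj_rep_carS (X : S ⊗[ℂ] 𝔤) :
    D.sConj (D.rep S (D.carS S X)) = D.rep S (D.opSS S X) := by
  have := ext_baseChange (f := LinearMap.mulLeft S
        ((D.sRep : Matrix (Fin m) (Fin m) ℂ).map (algebraMap ℂ S)) ∘ₗ LinearMap.mulRight S
        (((D.sRep⁻¹ : GL (Fin m) ℂ) : Matrix (Fin m) (Fin m) ℂ).map (algebraMap ℂ S)) ∘ₗ
          D.rep S ∘ₗ D.carS S)
    (g := D.rep S ∘ₗ D.opSS S) (fun v => ?_) X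
  · rw [sConj, mul_assoc]
    exact this
  · simp only [LinearMap.comp_apply, LinearMap.mulLeft_apply, LinearMap.mulRight_apply,
      LinearMap.baseChange_tmul, rep_one_tmul, ← Matrix.map_mul]
    rw [← mul_assoc]
    exact congrArg (fun M : Matrix (Fin m) (Fin m) ℂ => M.map (algebraMap ℂ S))
      (D.sRep_conj (cartanProj H v))

theorem sConj_inf (ε : S) {X : S ⊗[ℂ] 𝔤} (hX : D.carS S X = X) :
    D.sConj (D.inf ε X) = D.inf ε (D.opSS S X) := by
  rw [inf, inf, ← sConj_rep_carS, hX]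
  have h1 := D.sConj_one (S := S)
  simp only [sConj] at h1 ⊢
  rw [mul_add, add_mul, h1, mul_smul_comm, smul_mul_assoc]

end Setting

end DrinfeldSokolov

namespace DrinfeldSokolov

/-! ### Compatibility of all constructions with change of the base algebra -/

section MapT

variable {V : Type*} [AddCommGroup V] [Module ℂ V] {S S' : Type} [CommRing S] [Algebra ℂ S]
  [CommRing S'] [Algebra ℂ S'] (φ : S →ₐ[ℂ] S')

/-- Extension of scalars along `φ : S → S'` on `S ⊗ V`. -/
def mapT : S ⊗[ℂ] V →ₗ[ℂ] S' ⊗[ℂ] V := φ.toLinearMap.rTensor V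

@[simp] theorem mapT_tmul (s : S) (v : V) : mapT φ (s ⊗ₜ[ℂ] v) = φ s ⊗ₜ v := rfl

theorem mapT_smul (s : S) (X : S ⊗[ℂ] V) : mapT φ (s • X) = φ s • mapT φ X := by
  induction X using TensorProduct.induction_on with
  | zero => simp
  | add x y hx hy => rw [smul_add, map_add, map_add, smul_add, hx, hy]
  | tmul t v => simp [TensorProduct.smul_tmul']

theorem mapT_baseChange {V' : Type*} [AddCommGroup V'] [Module ℂ V'] (T : V →ₗ[ℂ] V')
    (X : S ⊗[ℂ] V) : mapT φ (T.baseChange S X) = T.baseChange S' (mapT φ X) := by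
  induction X using TensorProduct.induction_on with
  | zero => simp
  | add x y hx hy => simp only [map_add, hx, hy]
  | tmul t v => simp

theorem mapT_matExtend {m : ℕ} (T : Matrix (Fin m) (Fin m) ℂ →ₗ[ℂ] V)
    (M : Matrix (Fin m) (Fin m) S) : mapT φ (matExtend S T M) = matExtend S' T (M.map φ) := by
  simp only [matExtend, LinearMap.sum_apply, LinearMap.smulRight_apply, map_sum, mapT_smul,
    mapT_tmul, map_one, Matrix.entryLinearMap_apply, Matrix.map_apply]

end MapT

namespace Setting

open LieAlgebra LieAlgebra.IsKilling

variable {𝔤 : Type*} [LieRing 𝔤] [LieAlgebra ℂ 𝔤] [FiniteDimensional ℂ 𝔤]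
  [LieAlgebra.IsSemisimple ℂ 𝔤] {H : LieSubalgebra ℂ 𝔤} [H.IsCartanSubalgebra] {l m : ℕ}
  (D : Setting 𝔤 H l m) {S : Type} [CommRing S] [Algebra ℂ S] {S' : Type} [CommRing S']
  [Algebra ℂ S'] (φ : S →ₐ[ℂ] S')

theorem rep_mapT (X : S ⊗[ℂ] 𝔤) : D.rep S' (mapT φ X) = (D.rep S X).map φ := by
  induction X using TensorProduct.induction_on with
  | zero => ext; simp
  | add x y hx hy => rw [map_add, map_add, map_add, hx, hy]; ext; simp
  | tmul t v =>
    ext i j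
    simp [rep_tmul]

theorem map_adjugate_algHom (g : Matrix (Fin m) (Fin m) S) :
    g.adjugate.map φ = (g.map φ).adjugate :=
  RingHom.map_adjugate (φ : S →+* S') g

theorem mapT_Ad (g : Matrix (Fin m) (Fin m) S) (X : S ⊗[ℂ] 𝔤) :
    mapT φ (D.Ad g X) = D.Ad (g.map φ) (mapT φ X) := by
  rw [Ad_apply, Ad_apply, mapT_matExtend, Matrix.map_mul, Matrix.map_mul, rep_mapT,
    map_adjugate_algHom]

theorem formS_mapT (X Y : S ⊗[ℂ] 𝔤) :
    D.formS S' (mapT φ X) (mapT φ Y) = φ (D.formS S X Y) := by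
  induction X using TensorProduct.induction_on with
  | zero => simp
  | add x y hx hy => simp only [map_add, LinearMap.add_apply, hx, hy]
  | tmul s v =>
    induction Y using TensorProduct.induction_on with
    | zero => simp
    | add x y hx hy => simp only [map_add, hx, hy]
    | tmul t w => simp [formS_tmul]

theorem mapT_opK (X : S ⊗[ℂ] 𝔤) : mapT φ (D.opK S X) = D.opK S' (mapT φ X) := by
  rw [opK_apply, opK_apply, map_sub, map_add, mapT_baseChange, mapT_baseChange, mapT_baseChange]

theorem mapT_opQ (X : S ⊗[ℂ] 𝔤) : mapT φ (D.opQ S X) = D.opQ S' (mapT φ X) := by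
  rw [opQ_apply, opQ_apply, map_add, mapT_baseChange, mapT_baseChange]

theorem inf_map (ε : S) (X : S ⊗[ℂ] 𝔤) : (D.inf ε X).map φ = D.inf (φ ε) (mapT φ X) := by
  rw [inf, inf, rep_mapT]
  ext i j
  simp only [Matrix.map_apply, Matrix.add_apply, Matrix.smul_apply, smul_eq_mul, map_add, map_mul,
    Matrix.one_apply, apply_ite φ, map_one, map_zero]

theorem sConj_map (g : Matrix (Fin m) (Fin m) S) : (D.sConj g).map φ = D.sConj (g.map φ) := by
  rw [sConj, sConj, Matrix.map_mul, Matrix.map_mul]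
  have h : ∀ M : Matrix (Fin m) (Fin m) ℂ,
      (M.map (algebraMap ℂ S)).map φ = M.map (algebraMap ℂ S') := fun M => by ext; simp
  rw [h, h]

/-! ### Variation of the twisted factorization -/

theorem sConj_mem_HPts {a : Matrix (Fin m) (Fin m) S} (ha : a ∈ D.HPts S) : D.sConj a ∈ D.HPts S :=
  D.sConj_mem_pts ha

/-- The variation of the factor `n₊`. -/
def varNeg (n : Matrix (Fin m) (Fin m) S) (X : S ⊗[ℂ] 𝔤) : S ⊗[ℂ] 𝔤 :=
  D.Ad n (D.opQ S X) - D.opUS S X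

/-- The variation of the factor `n₋`. -/
def varPos (k : Matrix (Fin m) (Fin m) S) (X : S ⊗[ℂ] 𝔤) : S ⊗[ℂ] 𝔤 :=
  -D.Ad k (D.opK S X) - D.opSS S (D.opUS S X)

/-- Ad(n) changes QX, which has no 𝔫-component, only by elements of the 𝔫̄-part. The Cartan
component of Ad(n)QX is thus still UX, and subtracting UX leaves an element of 𝔫̄. -/
theorem negS_varNeg {n : Matrix (Fin m) (Fin m) S} (hn : n ∈ D.NegPts S) (X : S ⊗[ℂ] 𝔤) :
    D.negS S (D.varNeg n X) = D.varNeg n X := by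
  have h0 : D.posS S (D.opQ S X) = 0 := by rw [opQ_apply, map_add, posS_negS, posS_opUS, add_zero]
  have h1 := D.posS_Ad_neg hn h0
  have h2 := D.carS_Ad_neg hn h0
  have h3 : D.carS S (D.opQ S X) = D.opUS S X := by
    rw [opQ_apply, map_add, carS_negS, carS_opUS, zero_add]
  rw [← D.sum_projS (D.varNeg n X), varNeg]
  simp only [map_sub, h1, h2, h3, carS_opUS, posS_opUS, negS_negS, negS_opUS, sub_self,
    add_zero, map_zero]

/-- The Cartan component of KX is P_𝔥X - UX = -sUX and is unchanged by Ad(k); subtracting sUX from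
-Ad(k)KX therefore removes it. -/
theorem posS_varPos {k : Matrix (Fin m) (Fin m) S} (hk : k ∈ D.PosPts S) (X : S ⊗[ℂ] 𝔤) :
    D.posS S (D.varPos k X) = D.varPos k X := by
  have h0 : D.negS S (D.opK S X) = 0 := by
    rw [opK_apply, map_sub, map_add, negS_posS, negS_carS, negS_opUS, sub_zero, add_zero]
  have h1 := D.negS_Ad_pos hk h0
  have h2 := D.carS_Ad_pos hk h0
  have h3 : D.carS S (D.opK S X) = -D.opSS S (D.opUS S X) := by
    rw [opK_apply, map_sub, map_add, carS_posS, carS_carS, carS_opUS, ← D.opUS_sub X]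
    abel
  rw [← D.sum_projS (D.varPos k X), varPos]
  simp only [map_sub, map_neg, h1, h2, h3, carS_opSS, posS_opSS, posS_posS, negS_opSS,
    sub_self, add_zero, neg_neg, neg_zero, sub_zero, zero_add]

/-- Split X = QX + KX. The first part multiplies the factor ab, the second is moved across and
absorbed by the inverse factor. Changing a by UX changes s(a) by sUX, as the coupling of the two
torus factors demands. -/
theorem infinitesimal_factorization {ε : S} (hε : ε * ε = 0) {a b k : Matrix (Fin m) (Fin m) S}
    (ha : a ∈ D.HPts S) (hb : b ∈ D.NegPts S) (hk : k ∈ D.PosPts S) (X : S ⊗[ℂ] 𝔤) :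
    D.inf ε (D.Ad (a * b) X) * (a * b * (D.sConj a * k)⁻¹) =
      D.inf ε (D.opUS S X) * a * (D.inf ε (D.varNeg b X) * b) *
        (D.sConj (D.inf ε (D.opUS S X) * a) * (D.inf ε (D.varPos k X) * k))⁻¹ := by
  have haG := D.HPts_subset ha
  have hbG := D.NegPts_subset hb
  have hkG := D.PosPts_subset hk
  have ha' := D.sConj_mem_HPts ha
  have haG' := D.HPts_subset ha'
  have habG := D.mul_mem_GPts haG hbG
  have hB := D.mul_mem_GPts haG' hkG
  have hA : D.inf ε (D.opUS S X) * a * (D.inf ε (D.varNeg b X) * b) =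
      D.inf ε (D.Ad (a * b) (D.opQ S X)) * (a * b) := by
    calc _ = D.inf ε (D.opUS S X) * (a * D.inf ε (D.varNeg b X)) * b := by simp only [mul_assoc]
      _ = D.inf ε (D.opUS S X) * D.inf ε (D.Ad a (D.varNeg b X)) * (a * b) := by
        rw [D.mul_inf haG]; simp only [mul_assoc]
      _ = _ := by
        rw [D.inf_mul_inf hε, varNeg, map_sub, ← D.Ad_mul hbG, ← D.carS_opUS, D.Ad_cartan_carS ha,
          add_sub_cancel]
  have hC : D.sConj (D.inf ε (D.opUS S X) * a) * (D.inf ε (D.varPos k X) * k) =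
      D.inf ε (-D.Ad (D.sConj a * k) (D.opK S X)) * (D.sConj a * k) := by
    rw [sConj_mul, D.sConj_inf ε (D.carS_opUS X)]
    calc _ = D.inf ε (D.opSS S (D.opUS S X)) * (D.sConj a * D.inf ε (D.varPos k X)) * k := by
          simp only [mul_assoc]
      _ = D.inf ε (D.opSS S (D.opUS S X)) * D.inf ε (D.Ad (D.sConj a) (D.varPos k X)) *
          (D.sConj a * k) := by
        rw [D.mul_inf haG']; simp only [mul_assoc]
      _ = _ := by
        rw [D.inf_mul_inf hε, varPos, map_sub, map_neg, ← D.Ad_mul hkG, ← D.carS_opSS (D.opUS S X),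
          D.Ad_cartan_carS ha', add_sub_cancel]
  rw [hA, hC]
  generalize D.sConj a * k = B at hB
  rw [inv_eq_adjugate (D.det_GPts hB), inv_eq_adjugate (D.det_GPts
    (D.inf_mul_mem_GPts hε hB _)), Matrix.adjugate_mul_distrib]
  have hinv : (D.inf ε (-D.Ad B (D.opK S X))).adjugate = D.inf ε (D.Ad B (D.opK S X)) := by
    refine adjugate_eq_of_mul_eq_one ?_ ?_
    · have h1 : (1 : Matrix (Fin m) (Fin m) S) ∈ D.GPts S := by
        have := D.mul_mem_GPts hB (D.adjugate_mem_GPts hB)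
        rwa [mul_adjugate_of_det (D.det_GPts hB)] at this
      have := D.det_GPts (D.inf_mul_mem_GPts hε h1 (-D.Ad B (D.opK S X)))
      rwa [mul_one] at this
    · have := D.inf_mul_inf_neg hε (-D.Ad B (D.opK S X))
      rwa [neg_neg] at this
  rw [hinv, D.mul_inf (D.adjugate_mem_GPts hB), D.Ad_adjugate_Ad hB]
  calc _ = D.inf ε (D.Ad (a * b) X) * (a * b) * B.adjugate := (mul_assoc _ _ _).symm
    _ = D.inf ε (D.Ad (a * b) (D.opQ S X)) * (D.inf ε (D.Ad (a * b) (D.opK S X)) * (a * b)) *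
        B.adjugate := by
      rw [← mul_assoc (D.inf ε _) (D.inf ε _), D.inf_mul_inf hε, ← map_add, D.opQ_add_opK]
    _ = _ := by rw [← D.mul_inf habG]; simp only [mul_assoc]

/-! ### The gradient along `𝔫̄` -/

/-- The derivative at `g` of the regular function `P` in the direction `X`. -/
def lieDeriv (P : MvPolynomial (Fin m × Fin m) ℂ) (g : Matrix (Fin m) (Fin m) S) :
    S ⊗[ℂ] 𝔤 →ₗ[S] S :=
  (∑ ij : Fin m × Fin m, evalAt g (MvPolynomial.pderiv ij P) •
    (Matrix.entryLinearMap S S ij.1 ij.2 ∘ₗ LinearMap.mulRight S g)) ∘ₗ D.rep S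

theorem lieDeriv_apply (P : MvPolynomial (Fin m × Fin m) ℂ) (g : Matrix (Fin m) (Fin m) S)
    (X : S ⊗[ℂ] 𝔤) : D.lieDeriv P g X = ∑ ij : Fin m × Fin m,
      (D.rep S X * g) ij.1 ij.2 * evalAt g (MvPolynomial.pderiv ij P) := by
  simp only [lieDeriv, LinearMap.comp_apply, LinearMap.sum_apply, LinearMap.smul_apply,
    LinearMap.mulRight_apply, Matrix.entryLinearMap_apply, smul_eq_mul]
  exact Finset.sum_congr rfl fun ij _ => mul_comm _ _

theorem evalAt_inf_mul {ε : S} (hε : ε * ε = 0) (g : Matrix (Fin m) (Fin m) S) (X : S ⊗[ℂ] 𝔤)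
    (P : MvPolynomial (Fin m × Fin m) ℂ) :
    evalAt (D.inf ε X * g) P = evalAt g P + ε * D.lieDeriv P g X := by
  rw [inf, add_mul, one_mul, smul_mul_assoc, evalAt_add_smul_of_sq_zero hε, lieDeriv_apply]

theorem lieDeriv_mapT (P : MvPolynomial (Fin m × Fin m) ℂ) (g : Matrix (Fin m) (Fin m) S)
    (X : S ⊗[ℂ] 𝔤) : D.lieDeriv P (g.map φ) (mapT φ X) = φ (D.lieDeriv P g X) := by
  simp only [lieDeriv_apply, rep_mapT, ← Matrix.map_mul, map_sum, map_mul, map_evalAt,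
    Matrix.map_apply]

/-- A basis of `𝔤`. -/
def bas (_ : Setting 𝔤 H l m) : Module.Basis (Fin (Module.finrank ℂ 𝔤)) ℂ 𝔤 :=
  Module.finBasis ℂ 𝔤

/-- The dual basis with respect to the form. -/
def dualBas : Module.Basis (Fin (Module.finrank ℂ 𝔤)) ℂ 𝔤 :=
  D.form.dualBasis D.form_nondegenerate D.bas

/-- The gradient along `𝔫̄` of the regular function `P`. -/
def gradNeg (P : MvPolynomial (Fin m × Fin m) ℂ) (g : Matrix (Fin m) (Fin m) S) : S ⊗[ℂ] 𝔤 :=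
  ∑ a, D.lieDeriv P g (1 ⊗ₜ D.bas a) • (1 : S) ⊗ₜ D.projPos (D.dualBas a)

theorem gradNeg_mapT (P : MvPolynomial (Fin m × Fin m) ℂ) (g : Matrix (Fin m) (Fin m) S) :
    mapT φ (D.gradNeg P g) = D.gradNeg P (g.map φ) := by
  simp only [gradNeg, map_sum, mapT_smul, mapT_tmul, map_one, ← lieDeriv_mapT]

theorem posS_gradNeg (P : MvPolynomial (Fin m × Fin m) ℂ) (g : Matrix (Fin m) (Fin m) S) :
    D.posS S (D.gradNeg P g) = D.gradNeg P g := by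
  simp only [gradNeg, map_sum, map_smul, LinearMap.baseChange_tmul]
  refine Finset.sum_congr rfl fun a _ => ?_
  rw [D.mem_nilPos.1 (D.projPos_mem _)]

theorem form_dualBas (a b : Fin (Module.finrank ℂ 𝔤)) :
    D.form (D.dualBas a) (D.bas b) = if b = a then 1 else 0 :=
  LinearMap.BilinForm.apply_dualBasis_left D.form_nondegenerate D.bas a b

theorem form_dualBas_eq_repr (a : Fin (Module.finrank ℂ 𝔤)) (v : 𝔤) :
    D.form (D.dualBas a) v = D.bas.repr v a := by
  conv_lhs => rw [← D.bas.sum_repr v]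
  simp only [map_sum, map_smul, form_dualBas, smul_eq_mul, mul_ite, mul_one, mul_zero,
    Finset.sum_ite_eq', Finset.mem_univ, if_true]

/-- Pairing P_𝔫 of the a-th dual basis vector with X gives the a-th coordinate of P_𝔫̄X, so the sum
reassembles the derivative in the direction P_𝔫̄X. Only directions in 𝔫̄ are tangent to N̄. -/
theorem formS_gradNeg (P : MvPolynomial (Fin m × Fin m) ℂ) (g : Matrix (Fin m) (Fin m) S)
    (X : S ⊗[ℂ] 𝔤) : D.formS S (D.gradNeg P g) X = D.lieDeriv P g (D.negS S X) := by
  refine ext_baseChange (f := D.formS S (D.gradNeg P g)) (g := D.lieDeriv P g ∘ₗ D.negS S)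
    (fun v => ?_) X
  rw [LinearMap.comp_apply, LinearMap.baseChange_tmul]
  conv_rhs => rw [← D.bas.sum_repr (D.projNeg v)]
  simp only [gradNeg, map_sum, LinearMap.sum_apply, map_smul, LinearMap.smul_apply, formS_tmul,
    form_projPos, form_dualBas_eq_repr, TensorProduct.tmul_sum, TensorProduct.tmul_smul,
    smul_eq_mul, one_mul]
  refine Finset.sum_congr rfl fun a _ => ?_
  rw [← algebraMap_smul S, map_smul, smul_eq_mul, mul_comm]

/-- Expansion in the dual basis. -/
theorem sum_formS_dualBas (X : S ⊗[ℂ] 𝔤) :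
    ∑ a, D.formS S X (1 ⊗ₜ D.bas a) • (1 : S) ⊗ₜ[ℂ] D.dualBas a = X := by
  refine Eq.trans ?_ (ext_baseChange (f := ∑ a, ((D.formS S).flip (1 ⊗ₜ D.bas a)).smulRight
    ((1 : S) ⊗ₜ[ℂ] D.dualBas a)) (g := LinearMap.id) (fun v => ?_) X)
  · simp [LinearMap.sum_apply]
  · have hv : ∑ a, D.form v (D.bas a) • D.dualBas a = v := by
      conv_rhs => rw [← D.dualBas.sum_repr v]
      refine Finset.sum_congr rfl fun a _ => ?_
      rw [dualBas, LinearMap.BilinForm.dualBasis_repr_apply]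
    simp only [LinearMap.sum_apply, LinearMap.smulRight_apply, LinearMap.BilinForm.flip_apply,
      formS_tmul, mul_one, one_mul, algebraMap_smul, LinearMap.id_apply]
    conv_rhs => rw [← hv, TensorProduct.tmul_sum]
    exact Finset.sum_congr rfl fun a _ => (TensorProduct.tmul_smul _ _ _).symm

end Setting

end DrinfeldSokolov

namespace DrinfeldSokolov

attribute [-instance] HahnSeries.powerSeriesAlgebra

/-! ### Laurent series: coefficientwise maps and the shift -/

section LaurentMap

variable {R R' : Type} [CommRing R] [Algebra ℂ R] [CommRing R'] [Algebra ℂ R']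

/-- The coefficientwise extension of an algebra homomorphism to Laurent series. -/
def laurentMap (j : R →ₐ[ℂ] R') : LaurentSeries R →ₐ[ℂ] LaurentSeries R' where
  toFun a := HahnSeries.map a j
  map_one' := by
    ext k
    by_cases hk : k = 0 <;> simp [HahnSeries.coeff_one, hk]
  map_mul' a b := HahnSeries.ext (congrArg HahnSeries.coeff
    (HahnSeries.map_mul (j : R →+* R').toNonUnitalRingHom (x := a) (y := b)) :)
  map_zero' := by ext; simp
  map_add' a b := by ext; simp
  commutes' c := by
    change HahnSeries.map (HahnSeries.C (algebraMap ℂ R c)) j = HahnSeries.C (algebraMap ℂ R' c)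
    rw [← j.commutes]
    exact HahnSeries.map_C _ (j : R →+* R')

@[simp] theorem laurentMap_coeff (j : R →ₐ[ℂ] R') (a : LaurentSeries R) (k : ℤ) :
    (laurentMap j a).coeff k = j (a.coeff k) := rfl

theorem extendLoop_eq {m : ℕ} (j : R →ₐ[ℂ] R') (g : Matrix (Fin m) (Fin m) (LaurentSeries R)) :
    extendLoop j g = g.map (laurentMap j) := rfl

theorem shiftHom_laurentMap {p : ℂ} (hp : p ≠ 0) (j : R →ₐ[ℂ] R') (a : LaurentSeries R) :
    shiftHom hp R' (laurentMap j a) = laurentMap j (shiftHom hp R a) := by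
  ext k
  simp [shiftHom_coeff]

theorem shiftHom_comp_inv {p : ℂ} (hp : p ≠ 0) (a : LaurentSeries R) :
    shiftHom hp R (shiftHom (inv_ne_zero hp) R a) = a := by
  ext k
  rw [shiftHom_coeff, shiftHom_coeff, smul_smul, ← mul_zpow, mul_inv_cancel₀ hp, one_zpow, one_smul]

theorem shiftHom_C {p : ℂ} (hp : p ≠ 0) (r : R) :
    shiftHom hp R (HahnSeries.C r) = HahnSeries.C r := by
  ext k
  rw [shiftHom_coeff]
  by_cases hk : k = 0
  · rw [hk, zpow_zero, one_smul]
  · rw [HahnSeries.C_apply, HahnSeries.coeff_single_of_ne hk, smul_zero]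

theorem coeff_C_mul (r : R) (a : LaurentSeries R) (k : ℤ) :
    (HahnSeries.C r * a).coeff k = r * a.coeff k := by
  rw [HahnSeries.C_mul_eq_smul, HahnSeries.coeff_smul, smul_eq_mul]

theorem coeff_single_mul' (k j : ℤ) (a : LaurentSeries R) :
    (HahnSeries.single k 1 * a).coeff j = a.coeff (j - k) := by
  have := HahnSeries.coeff_single_mul_add (r := (1 : R)) (x := a) (a := j - k) (b := k)
  rwa [sub_add_cancel, one_mul] at this

theorem coeff_smul_mul (c : ℂ) (a : LaurentSeries R) (k : ℤ) :
    (c • a).coeff k = c • a.coeff k := rfl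

end LaurentMap

/-! ### Loops as elements of R((z)) ⊗ 𝔤 -/

section ToLoop

variable {𝔤 : Type*} [LieRing 𝔤] [LieAlgebra ℂ 𝔤] {R : Type} [CommRing R] [Algebra ℂ R]

/-- The loop given by an element of `R((z)) ⊗ 𝔤`. -/
def toLoop (R : Type) [CommRing R] [Algebra ℂ R] :
    LaurentSeries R ⊗[ℂ] 𝔤 →ₗ[ℂ] LoopAlg 𝔤 R :=
  TensorProduct.lift (LinearMap.mk₂ ℂ
    (fun (s : LaurentSeries R) (x : 𝔤) => HahnSeries.map s ((TensorProduct.mk ℂ R 𝔤).flip x))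
    (fun s s' x => by ext; simp)
    (fun c s x => by ext; simp [TensorProduct.smul_tmul'])
    (fun s x x' => by ext; simp)
    (fun c s x => by ext; simp))

@[simp] theorem toLoop_tmul_coeff (s : LaurentSeries R) (x : 𝔤) (k : ℤ) :
    (toLoop R (s ⊗ₜ x)).coeff k = s.coeff k ⊗ₜ x := rfl

/-- Take coordinates in a finite basis of 𝔤. Every loop can thus be handled as an element of S ⊗ 𝔤
with S = R((z)), where the previous results apply. -/
theorem toLoop_surjective [FiniteDimensional ℂ 𝔤] : Function.Surjective (toLoop (𝔤 := 𝔤) R) := by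
  intro X
  let b := Module.finBasis ℂ 𝔤
  let c : ∀ a, R ⊗[ℂ] 𝔤 →ₗ[ℂ] R := fun a =>
    (TensorProduct.rid ℂ R).toLinearMap ∘ₗ LinearMap.lTensor R (b.coord a)
  have hc : ∀ Y : R ⊗[ℂ] 𝔤, ∑ a, c a Y ⊗ₜ[ℂ] b a = Y := fun Y => by
    induction Y using TensorProduct.induction_on with
    | zero => simp
    | add x y hx hy =>
      simp only [map_add, TensorProduct.add_tmul, Finset.sum_add_distrib, hx, hy]
    | tmul r v =>
      conv_rhs => rw [← b.sum_repr v, TensorProduct.tmul_sum]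
      refine Finset.sum_congr rfl fun a _ => ?_
      simp [c, TensorProduct.smul_tmul]
  refine ⟨∑ a, HahnSeries.map X (c a) ⊗ₜ b a, ?_⟩
  ext k
  rw [map_sum, HahnSeries.coeff_sum]
  simp only [toLoop_tmul_coeff, HahnSeries.map_coeff]
  exact hc _

theorem modeOp_toLoop (T : Module.End ℂ 𝔤) (X : LaurentSeries R ⊗[ℂ] 𝔤) :
    modeOp (fun _ => T) (toLoop R X) = toLoop R (T.baseChange _ X) := by
  induction X using TensorProduct.induction_on with
  | zero => ext; simp [modeOp]
  | add x y hx hy =>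
    rw [map_add, map_add, map_add, ← hx, ← hy]
    ext
    simp [modeOp]
  | tmul s v => ext; simp [modeOp]

theorem toLoop_baseChange_coeff (T : Module.End ℂ 𝔤) (X : LaurentSeries R ⊗[ℂ] 𝔤) (k : ℤ) :
    (toLoop R (T.baseChange _ X)).coeff k = T.baseChange R ((toLoop R X).coeff k) := by
  rw [← modeOp_toLoop]
  rfl

theorem pairing_add_right (B : LinearMap.BilinForm ℂ 𝔤) (X Y Y' : LoopAlg 𝔤 R) :
    pairing B X (Y + Y') = pairing B X Y + pairing B X Y' := by
  unfold pairing
  rw [← finsum_add_distrib (pairing_support_finite B X Y) (pairing_support_finite B X Y')]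
  exact finsum_congr fun k => by simp only [HahnSeries.coeff_add, map_add]

theorem pairing_smul_right (B : LinearMap.BilinForm ℂ 𝔤) (c : R) (X Y : LoopAlg 𝔤 R) :
    pairing B X (c • Y) = c * pairing B X Y := by
  unfold pairing
  rw [mul_finsum' _ _ (pairing_support_finite B X Y)]
  exact finsum_congr fun k => by simp only [HahnSeries.coeff_smul, map_smul, smul_eq_mul]

theorem pairing_toLoop_tmul (B : LinearMap.BilinForm ℂ 𝔤) (s t : LaurentSeries R) (x y : 𝔤) :
    pairing B (toLoop R (s ⊗ₜ x)) (toLoop R (t ⊗ₜ y)) =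
      (s * t * algebraMap ℂ (LaurentSeries R) (B x y)).coeff 0 := by
  have h1 : s * t * algebraMap ℂ (LaurentSeries R) (B x y) = B x y • (s * t) := by
    rw [Algebra.smul_def, mul_comm]
  rw [h1, coeff_smul_mul, HahnSeries.coeff_mul, pairing]
  simp only [toLoop_tmul_coeff, LinearMap.BilinForm.baseChange_tmul]
  rw [Finset.smul_sum, finsum_eq_sum_of_support_subset
    (s := (Finset.antidiagonal s.isPWO_support t.isPWO_support 0).image Prod.fst)]
  · rw [Finset.sum_image]
    · refine Finset.sum_congr rfl fun ij hij => ?_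
      have := (Finset.mem_antidiagonal.1 hij).2.2
      rw [show -ij.1 = ij.2 by lia, mul_comm]
    · intro a ha b hb hab
      have h1 := (Finset.mem_antidiagonal.1 ha).2.2
      have h2 := (Finset.mem_antidiagonal.1 hb).2.2
      exact Prod.ext hab (by lia)
  · intro k hk
    simp only [Function.mem_support] at hk
    rw [Finset.coe_image]
    refine ⟨(k, -k), Finset.mem_coe.2 (Finset.mem_antidiagonal.2 ⟨?_, ?_, by simp⟩), rfl⟩
    · intro h; exact hk (by simp [h])
    · intro h; exact hk (by simp [h])

end ToLoop

namespace Setting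

open LieAlgebra LieAlgebra.IsKilling

variable {𝔤 : Type*} [LieRing 𝔤] [LieAlgebra ℂ 𝔤] [FiniteDimensional ℂ 𝔤]
  [LieAlgebra.IsSemisimple ℂ 𝔤] {H : LieSubalgebra ℂ 𝔤} [H.IsCartanSubalgebra] {l m : ℕ}
  (D : Setting 𝔤 H l m) {R : Type} [CommRing R] [Algebra ℂ R]

/-- The residue against dz/z is the constant term of the R((z))-bilinear form; this links the loop
pairing to the algebra over S. -/
theorem pairing_toLoop (X Y : LaurentSeries R ⊗[ℂ] 𝔤) :
    pairing D.form (toLoop R X) (toLoop R Y) = (D.formS _ X Y).coeff 0 := by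
  induction X using TensorProduct.induction_on with
  | zero => simp [pairing_zero_left]
  | add x y hx hy =>
    rw [map_add, pairing_add_left, hx, hy, map_add, LinearMap.add_apply, HahnSeries.coeff_add]
  | tmul s v =>
    induction Y using TensorProduct.induction_on with
    | zero => simp [pairing]
    | add x y hx hy =>
      rw [map_add, pairing_add_right, hx, hy, map_add, HahnSeries.coeff_add]
    | tmul t w => rw [pairing_toLoop_tmul, formS_tmul]

/-- The inclusion `R((z)) → R[ε]((z))`. -/
def dualIncl (R : Type) [CommRing R] [Algebra ℂ R] :
    LaurentSeries R →ₐ[ℂ] LaurentSeries (DualNumber R) :=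
  laurentMap (TrivSqZeroExt.inlAlgHom ℂ R R)

/-- The element `ε` of `R[ε]((z))`. -/
def eps (R : Type) [CommRing R] : LaurentSeries (DualNumber R) := HahnSeries.C DualNumber.eps

theorem eps_mul_eps : eps R * eps R = 0 := by
  rw [eps, ← map_mul, DualNumber.eps_mul_eps, map_zero]

theorem coeff_eps_mul_dualIncl (a : LaurentSeries R) (k : ℤ) :
    (eps R * dualIncl R a).coeff k = TrivSqZeroExt.inr (a.coeff k) := by
  rw [eps, coeff_C_mul, dualIncl, laurentMap_coeff, DualNumber.eps]
  ext <;> simp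

/-- The infinitesimal loop over R[ε] is an instance of 1 + εX over S = R[ε]((z)), with ε a constant
series of square zero. -/
theorem infinitesimal_toLoop (X : LaurentSeries R ⊗[ℂ] 𝔤) :
    infinitesimal D.ρ (toLoop R X) = D.inf (eps R) (mapT (dualIncl R) X) := by
  rw [infinitesimal, inf, rep_mapT]
  congr 1
  refine Matrix.ext fun i j => HahnSeries.ext (funext fun k => ?_)
  rw [Matrix.smul_apply, smul_eq_mul, Matrix.map_apply]
  rw [coeff_eps_mul_dualIncl]
  refine congrArg TrivSqZeroExt.inr ?_
  induction X using TensorProduct.induction_on with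
  | zero => simp
  | add x y hx hy => simp only [map_add, Matrix.add_apply, hx, hy,
      HahnSeries.coeff_add]
  | tmul s v =>
    rw [toLoop_tmul_coeff, rep_tmul, repMatrixOver, LinearMap.liftBaseChange_tmul]
    simp only [Matrix.smul_apply, smul_eq_mul, Matrix.map_apply]
    rw [mul_comm s, ← Algebra.smul_def, coeff_smul_mul, Algebra.smul_def, mul_comm]
    rfl

end Setting

end DrinfeldSokolov

namespace DrinfeldSokolov

attribute [-instance] HahnSeries.powerSeriesAlgebra

namespace Setting

open LieAlgebra LieAlgebra.IsKilling

variable {𝔤 : Type*} [LieRing 𝔤] [LieAlgebra ℂ 𝔤] [FiniteDimensional ℂ 𝔤]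
  [LieAlgebra.IsSemisimple ℂ 𝔤] {H : LieSubalgebra ℂ 𝔤} [H.IsCartanSubalgebra] {l m : ℕ}
  (D : Setting 𝔤 H l m)

/-! ### Variations of points of `𝒢'ₚ` -/

section Variation

variable {R : Type} [CommRing R] [Algebra ℂ R]

/-- The automorphism `D_p` of `R((z))`. -/
abbrev sh (R : Type) [CommRing R] [Algebra ℂ R] : LaurentSeries R →ₐ[ℂ] LaurentSeries R :=
  shiftHom D.p_ne_zero R

theorem mapT_sh_dualIncl (X : LaurentSeries R ⊗[ℂ] 𝔤) :
    mapT (D.sh (DualNumber R)) (mapT (dualIncl R) X) = mapT (dualIncl R) (mapT (D.sh R) X) := by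
  induction X using TensorProduct.induction_on with
  | zero => simp
  | add x y hx hy => simp only [map_add, hx, hy]
  | tmul s v => simp only [mapT_tmul, dualIncl, shiftHom_laurentMap]

theorem map_sh_dualIncl (g : Matrix (Fin m) (Fin m) (LaurentSeries R)) :
    (g.map (dualIncl R)).map (D.sh (DualNumber R)) = (g.map (D.sh R)).map (dualIncl R) := by
  ext i j : 2
  simp only [Matrix.map_apply, dualIncl, shiftHom_laurentMap]

theorem exists_mapT_sh (X : LaurentSeries R ⊗[ℂ] 𝔤) : ∃ Y, mapT (D.sh R) Y = X := by
  refine ⟨mapT (shiftHom (inv_ne_zero D.p_ne_zero) R) X, ?_⟩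
  induction X using TensorProduct.induction_on with
  | zero => simp
  | add x y hx hy => simp only [map_add, hx, hy]
  | tmul s v => simp only [mapT_tmul, shiftHom_comp_inv]

/-- D_p multiplies the coefficient of zᵏ by pᵏ and so preserves the constant term: it is orthogonal
for the loop pairing. -/
theorem coeff_zero_formS_mapT_sh (X Y : LaurentSeries R ⊗[ℂ] 𝔤) :
    (D.formS _ (mapT (D.sh R) X) (mapT (D.sh R) Y)).coeff 0 = (D.formS _ X Y).coeff 0 := by
  rw [formS_mapT, shiftHom_coeff, zpow_zero, one_smul]

theorem GPrime_mem (L : D.GPrime R) : L.1 ∈ D.GPts (LaurentSeries R) :=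
  (loopPoints_eq (lieGroupSet D.ρ) R).subset L.2.1

theorem exists_isFactorization (L : D.GPrime R) : ∃ h k, D.IsFactorization L.1 h (D.muN L) k :=
  ⟨_, L.2.2.choose_spec.choose_spec⟩

/-- The unshifted factors are varied by UX, `varNeg` and, for n₋, by `varPos` at D_pX. Since D_p
commutes with all operators involved and fixes ε, the shifted factors satisfy
`infinitesimal_factorization`. -/
theorem isFactorization_variation {L h n k : Matrix (Fin m) (Fin m) (LaurentSeries R)}
    (hL : D.IsFactorization L h n k) (X : LaurentSeries R ⊗[ℂ] 𝔤) :
    ∃ h' k', D.IsFactorization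
      (infinitesimal D.ρ (toLoop R (mapT (D.sh R) (D.Ad (h * n) X))) *
        extendLoop (TrivSqZeroExt.inlAlgHom ℂ R R) L) h'
      (D.inf (eps R) (mapT (dualIncl R) (D.varNeg n X)) * n.map (dualIncl R)) k' := by
  obtain ⟨hh, hn, hk, hL⟩ := D.isFactorization_iff.1 hL
  have hε := eps_mul_eps (R := R)
  have hσε : D.sh (DualNumber R) (eps R) = eps R := shiftHom_C _ _
  have hh' : h.map (dualIncl R) ∈ D.HPts (LaurentSeries (DualNumber R)) := map_mem_pts _ hh
  have hn' : n.map (dualIncl R) ∈ D.NegPts (LaurentSeries (DualNumber R)) := map_mem_pts _ hn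
  have hk' : k.map (dualIncl R) ∈ D.PosPts (LaurentSeries (DualNumber R)) := map_mem_pts _ hk
  have hνn : mapT (dualIncl R) (D.varNeg n X) =
      D.varNeg (n.map (dualIncl R)) (mapT (dualIncl R) X) := by
    rw [varNeg, varNeg, map_sub, mapT_Ad, mapT_opQ, mapT_baseChange]
  refine ⟨D.inf (eps R) (D.opUS _ (mapT (dualIncl R) X)) * h.map (dualIncl R),
    D.inf (eps R) (D.varPos (k.map (dualIncl R)) (mapT (dualIncl R) (mapT (D.sh R) X))) *
      k.map (dualIncl R), D.isFactorization_iff.2 ⟨?_, ?_, ?_, ?_⟩⟩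
  · exact D.inf_mul_mem_HPts hε hh' (D.carS_opUS _)
  · refine D.inf_mul_mem_NegPts hε hn' ?_
    rw [hνn]
    exact D.negS_varNeg hn' _
  · exact D.inf_mul_mem_PosPts hε hk' (D.posS_varPos hk' _)
  · have key := D.infinitesimal_factorization hε
      (map_mem_pts (D.sh _) hh') (map_mem_pts (D.sh _) hn') hk'
      (mapT (dualIncl R) (mapT (D.sh R) X))
    simp only [Matrix.map_mul, inf_map, hσε, hνn, infinitesimal_toLoop, extendLoop_eq]
    have e1 : mapT (D.sh (DualNumber R)) (D.opUS _ (mapT (dualIncl R) X)) =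
        D.opUS _ (mapT (dualIncl R) (mapT (D.sh R) X)) := by
      rw [mapT_baseChange, mapT_sh_dualIncl]
    have e2 : mapT (D.sh (DualNumber R)) (D.varNeg (n.map (dualIncl R)) (mapT (dualIncl R) X)) =
        D.varNeg ((n.map (dualIncl R)).map (D.sh _)) (mapT (dualIncl R) (mapT (D.sh R) X)) := by
      rw [varNeg, varNeg, map_sub, mapT_Ad, mapT_opQ, mapT_baseChange, mapT_sh_dualIncl]
    rw [e1, e2, ← key, mapT_Ad, mapT_Ad, Matrix.map_mul, Matrix.map_mul, map_sh_dualIncl,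
      map_sh_dualIncl, ← sConj_map]
    congr 1
    have hB : D.sConj (h.map (D.sh R)) * k ∈ D.GPts (LaurentSeries R) :=
      D.mul_mem_GPts (D.HPts_subset (D.sConj_mem_HPts (map_mem_pts _ hh))) (D.PosPts_subset hk)
    have hB' : (D.sConj (h.map (D.sh R)) * k).map (dualIncl R) ∈
      D.GPts (LaurentSeries (DualNumber R)) := map_mem_pts _ hB
    have hinv : ((D.sConj (h.map (D.sh R))).map (dualIncl R) * k.map (dualIncl R))⁻¹ =
        (D.sConj (h.map (D.sh R)) * k).adjugate.map (dualIncl R) := by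
      have hadj := map_adjugate_algHom (S := LaurentSeries R)
        (S' := LaurentSeries (DualNumber R)) (dualIncl R) (D.sConj (h.map (D.sh R)) * k)
      rw [hadj, ← inv_eq_adjugate (D.det_GPts hB'), Matrix.map_mul]
    rw [hinv, ← Matrix.map_mul, ← Matrix.map_mul, hL, inv_eq_adjugate (D.det_GPts hB)]
    rfl

/-- D_p and Ad(hn) are invertible, so the parametrized variations exhaust all infinitesimal motions.
-/
theorem exists_surjective_param {h n : Matrix (Fin m) (Fin m) (LaurentSeries R)}
    (hhn : h * n ∈ D.GPts (LaurentSeries R)) (X : LaurentSeries R ⊗[ℂ] 𝔤) :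
    ∃ Y, mapT (D.sh R) (D.Ad (h * n) Y) = X := by
  obtain ⟨Y, rfl⟩ := D.exists_mapT_sh X
  exact ⟨D.Ad (h * n).adjugate Y, by rw [D.Ad_Ad_adjugate hhn]⟩

theorem mul_mem_of_isFactorization {L h n k : Matrix (Fin m) (Fin m) (LaurentSeries R)}
    (hL : D.IsFactorization L h n k) : h * n ∈ D.GPts (LaurentSeries R) := by
  obtain ⟨hh, hn, -, -⟩ := D.isFactorization_iff.1 hL
  exact D.mul_mem_GPts (D.HPts_subset hh) (D.NegPts_subset hn)

/-- `𝒢'ₚ` is infinitesimally open in the loop group. -/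
theorem exists_left_variation (L : D.GPrime R) (ξ : LoopAlg 𝔤 R) :
    ∃ y : D.GPrime (DualNumber R),
      y.1 = infinitesimal D.ρ ξ * extendLoop (TrivSqZeroExt.inlAlgHom ℂ R R) L.1 := by
  obtain ⟨h, k, hL⟩ := D.exists_isFactorization L
  obtain ⟨Ξ, rfl⟩ := toLoop_surjective ξ
  obtain ⟨X, rfl⟩ := D.exists_surjective_param (D.mul_mem_of_isFactorization hL) Ξ
  obtain ⟨h', k', hL'⟩ := D.isFactorization_variation hL X
  have hL₀ : L.1.map (dualIncl R) ∈ D.GPts (LaurentSeries (DualNumber R)) :=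
    map_mem_pts _ (D.GPrime_mem L)
  have hG := D.inf_mul_mem_GPts eps_mul_eps hL₀
    (mapT (dualIncl R) (mapT (D.sh R) (D.Ad (h * D.muN L) X)))
  rw [← infinitesimal_toLoop] at hG
  exact ⟨⟨_, (loopPoints_eq (lieGroupSet D.ρ) (DualNumber R)).superset hG, _, _, _, hL'⟩, rfl⟩

theorem mul_infinitesimal (L : D.GPrime R) (X : LaurentSeries R ⊗[ℂ] 𝔤) :
    extendLoop (TrivSqZeroExt.inlAlgHom ℂ R R) L.1 * infinitesimal D.ρ (toLoop R X) =
      infinitesimal D.ρ (toLoop R (D.Ad L.1 X)) *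
        extendLoop (TrivSqZeroExt.inlAlgHom ℂ R R) L.1 := by
  have hL₀ : L.1.map (dualIncl R) ∈ D.GPts (LaurentSeries (DualNumber R)) :=
    map_mem_pts _ (D.GPrime_mem L)
  rw [infinitesimal_toLoop, infinitesimal_toLoop, mapT_Ad]
  exact D.mul_inf hL₀ _ _

end Variation

/-! ### Gradients -/

/-- Pairing with the loops z⁻ᵏ times basis vectors of 𝔤 recovers every coefficient in the dual
basis. -/
theorem eq_of_forall_pairing_eq {R : Type} [CommRing R] [Algebra ℂ R] {X X' : LoopAlg 𝔤 R}
    (h : ∀ ξ, pairing D.form X ξ = pairing D.form X' ξ) : X = X' := by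
  obtain ⟨A, rfl⟩ := toLoop_surjective X
  obtain ⟨A', rfl⟩ := toLoop_surjective X'
  congr 1
  rw [← D.sum_formS_dualBas A, ← D.sum_formS_dualBas A']
  refine Finset.sum_congr rfl fun a _ => ?_
  congr 1
  ext k
  have := h (toLoop R (HahnSeries.single (-k) (1 : R) ⊗ₜ D.bas a))
  have hs : HahnSeries.single (-k) (1 : R) ⊗ₜ[ℂ] D.bas a =
      HahnSeries.single (-k) (1 : R) • ((1 : LaurentSeries R) ⊗ₜ[ℂ] D.bas a) := by
    rw [TensorProduct.smul_tmul', smul_eq_mul, mul_one]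
  rw [pairing_toLoop, pairing_toLoop, hs, map_smul, map_smul, smul_eq_mul, smul_eq_mul,
    coeff_single_mul', coeff_single_mul', zero_sub, neg_neg] at this
  exact this

variable {D} {R : CommAlgCat.{0} ℂ} {L : D.GPrime R} {φ : D.FunFamily}

/-- A gradient is tested only at varied loops that lie in 𝒢'ₚ. By `exists_left_variation` these are
available for every ξ, so the condition determines X; for the same reason the chosen gradients in
the bracket can be computed. -/
theorem IsLeftGradient.unique {X X' : LoopAlg 𝔤 R} (h : D.IsLeftGradient φ R L X)
    (h' : D.IsLeftGradient φ R L X') : X = X' := by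
  refine D.eq_of_forall_pairing_eq fun ξ => ?_
  obtain ⟨y, hy⟩ := D.exists_left_variation L ξ
  have := (h ξ y hy).symm.trans (h' ξ y hy)
  exact TrivSqZeroExt.inr_injective (add_left_cancel this)

theorem IsRightGradient.unique {X X' : LoopAlg 𝔤 R} (h : D.IsRightGradient φ R L X)
    (h' : D.IsRightGradient φ R L X') : X = X' := by
  refine D.eq_of_forall_pairing_eq fun ξ => ?_
  obtain ⟨Ξ, rfl⟩ := toLoop_surjective ξ
  obtain ⟨y, hy⟩ := D.exists_left_variation L (toLoop R (D.Ad L.1 Ξ))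
  rw [← mul_infinitesimal] at hy
  have := (h _ y hy).symm.trans (h' _ y hy)
  exact TrivSqZeroExt.inr_injective (add_left_cancel this)

theorem IsLeftGradient.eq {X : LoopAlg 𝔤 R} (h : D.IsLeftGradient φ R L X) :
    D.leftGradient φ R L = X :=
  IsLeftGradient.unique (Classical.epsilon_spec (p := D.IsLeftGradient φ R L) ⟨X, h⟩) h

theorem IsRightGradient.eq {X : LoopAlg 𝔤 R} (h : D.IsRightGradient φ R L X) :
    D.rightGradient φ R L = X :=
  IsRightGradient.unique (Classical.epsilon_spec (p := D.IsRightGradient φ R L) ⟨X, h⟩) h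

/-- Moving the infinitesimal factor across L replaces ξ by Ad(L)ξ, and the transpose of Ad(L) is
Ad(L⁻¹). -/
theorem IsLeftGradient.isRightGradient {X : LaurentSeries R ⊗[ℂ] 𝔤}
    (h : D.IsLeftGradient φ R L (toLoop R X)) :
    D.IsRightGradient φ R L (toLoop R (D.Ad L.1.adjugate X)) := by
  intro ξ y hy
  obtain ⟨Ξ, rfl⟩ := toLoop_surjective ξ
  rw [mul_infinitesimal] at hy
  have hG := D.GPrime_mem L
  rw [h _ y hy, pairing_toLoop, pairing_toLoop, D.formS_Ad (D.adjugate_mem_GPts hG),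
    adjugate_adjugate_of_det (D.det_GPts hG)]

end Setting

end DrinfeldSokolov

namespace DrinfeldSokolov

attribute [-instance] HahnSeries.powerSeriesAlgebra

namespace Setting

open LieAlgebra LieAlgebra.IsKilling

variable {𝔤 : Type*} [LieRing 𝔤] [LieAlgebra ℂ 𝔤] [FiniteDimensional ℂ 𝔤]
  [LieAlgebra.IsSemisimple ℂ 𝔤] {H : LieSubalgebra ℂ 𝔤} [H.IsCartanSubalgebra] {l m : ℕ}
  (D : Setting 𝔤 H l m)

/-! ### The matrix coefficients are smooth functions -/

theorem matrixCoeff_apply (P : MvPolynomial (Fin m × Fin m) ℂ) (k : ℤ) (R : CommAlgCat.{0} ℂ)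
    (L : D.GPrime R) : D.matrixCoeff P k R L = (evalAt (D.muN L) P).coeff k := rfl

theorem isFactorization_extendLoop {R R' : Type} [CommRing R] [Algebra ℂ R] [CommRing R']
    [Algebra ℂ R'] (j : R →ₐ[ℂ] R') {L h n k : Matrix (Fin m) (Fin m) (LaurentSeries R)}
    (hL : D.IsFactorization L h n k) :
    D.IsFactorization (extendLoop j L) (extendLoop j h) (extendLoop j n) (extendLoop j k) := by
  obtain ⟨hh, hn, hk, hL⟩ := D.isFactorization_iff.1 hL
  have hh' : h.map (laurentMap j) ∈ D.HPts (LaurentSeries R') := map_mem_pts _ hh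
  have hn' : n.map (laurentMap j) ∈ D.NegPts (LaurentSeries R') := map_mem_pts _ hn
  have hk' : k.map (laurentMap j) ∈ D.PosPts (LaurentSeries R') := map_mem_pts _ hk
  refine D.isFactorization_iff.2 ⟨hh', hn', hk', ?_⟩
  have hB : D.sConj (h.map (D.sh R)) * k ∈ D.GPts (LaurentSeries R) :=
    D.mul_mem_GPts (D.HPts_subset (D.sConj_mem_HPts (map_mem_pts _ hh))) (D.PosPts_subset hk)
  have hB' : (D.sConj (h.map (D.sh R)) * k).map (laurentMap j) ∈ D.GPts (LaurentSeries R') :=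
    map_mem_pts _ hB
  have hcomm : ∀ g : Matrix (Fin m) (Fin m) (LaurentSeries R),
      (extendLoop j g).map (D.sh R') = (g.map (D.sh R)).map (laurentMap j) := fun g => by
    ext i j' : 2
    simp only [extendLoop_eq, Matrix.map_apply, shiftHom_laurentMap]
  have hadj := map_adjugate_algHom (S := LaurentSeries R)
    (S' := LaurentSeries R') (laurentMap j) (D.sConj (h.map (D.sh R)) * k)
  have hinv : ((D.sConj (h.map (D.sh R))).map (laurentMap j) * k.map (laurentMap j))⁻¹ =
      (D.sConj (h.map (D.sh R)) * k).adjugate.map (laurentMap j) := by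
    rw [hadj, ← inv_eq_adjugate (D.det_GPts hB'), Matrix.map_mul]
  rw [hcomm, hcomm, ← sConj_map, extendLoop_eq j k, hinv, ← Matrix.map_mul, ← Matrix.map_mul,
    ← inv_eq_adjugate (D.det_GPts hB), ← hL]
  rfl

theorem muN_extendLoop {R R' : Type} [CommRing R] [Algebra ℂ R] [CommRing R'] [Algebra ℂ R']
    (j : R →ₐ[ℂ] R') {L : D.GPrime R} {L' : D.GPrime R'} (h : L'.1 = extendLoop j L.1) :
    D.muN L' = extendLoop j (D.muN L) := by
  obtain ⟨a, k, hL⟩ := D.exists_isFactorization L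
  have := D.isFactorization_extendLoop j hL
  rw [← h] at this
  exact D.muN_eq L' this

theorem isNatural_matrixCoeff (P : MvPolynomial (Fin m × Fin m) ℂ) (k : ℤ) :
    D.IsNatural (D.matrixCoeff P k) := fun R S j L L' h => by
  rw [matrixCoeff_apply, matrixCoeff_apply, D.muN_extendLoop j h, extendLoop_eq]
  have := map_evalAt (S := LaurentSeries R) (S' := LaurentSeries S) (laurentMap j) (D.muN L) P
  rw [← this, laurentMap_coeff]

section Gradient

variable {R : Type} [CommRing R] [Algebra ℂ R]

/-- The gradient of a matrix coefficient in terms of the factor `n₊`. -/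
def gradCoeff (P : MvPolynomial (Fin m × Fin m) ℂ) (k : ℤ)
    (n : Matrix (Fin m) (Fin m) (LaurentSeries R)) : LaurentSeries R ⊗[ℂ] 𝔤 :=
  HahnSeries.single (-k) (1 : R) • D.gradNeg P n

/-- The gradient of a matrix coefficient, translated to the identity. -/
def gradArg (P : MvPolynomial (Fin m × Fin m) ℂ) (k : ℤ)
    (n : Matrix (Fin m) (Fin m) (LaurentSeries R)) : LaurentSeries R ⊗[ℂ] 𝔤 :=
  D.opK _ (D.Ad n.adjugate (D.gradCoeff P k n))

theorem posS_gradCoeff (P : MvPolynomial (Fin m × Fin m) ℂ) (k : ℤ)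
    (n : Matrix (Fin m) (Fin m) (LaurentSeries R)) :
    D.posS _ (D.gradCoeff P k n) = D.gradCoeff P k n := by
  rw [gradCoeff, map_smul, posS_gradNeg]

/-- The k-th coefficient is the constant term after multiplication by z⁻ᵏ. The gradient takes values
in 𝔫, so the Cartan term UX of the variation drops out; transposing Ad(n) and Q gives Ad(n⁻¹) and K.
-/
theorem coeff_lieDeriv_varNeg (P : MvPolynomial (Fin m × Fin m) ℂ) (k : ℤ)
    {n : Matrix (Fin m) (Fin m) (LaurentSeries R)} (hn : n ∈ D.NegPts (LaurentSeries R))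
    (X : LaurentSeries R ⊗[ℂ] 𝔤) :
    (D.lieDeriv P n (D.varNeg n X)).coeff k = (D.formS _ (D.gradArg P k n) X).coeff 0 := by
  have h1 : (D.lieDeriv P n (D.varNeg n X)).coeff k =
      (D.formS _ (D.gradCoeff P k n) (D.varNeg n X)).coeff 0 := by
    rw [gradCoeff, map_smul, LinearMap.smul_apply, formS_gradNeg, D.negS_varNeg hn, smul_eq_mul,
      coeff_single_mul', zero_sub, neg_neg]
  have hG := D.NegPts_subset hn
  have h2 : D.formS _ (D.gradCoeff P k n) (D.opUS _ X) = 0 := by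
    rw [← posS_gradCoeff, formS_posS, negS_opUS, map_zero]
  have h3 := D.formS_Ad (D.adjugate_mem_GPts hG) (D.gradCoeff P k n) (D.opQ _ X)
  rw [adjugate_adjugate_of_det (D.det_GPts hG)] at h3
  rw [h1, varNeg, map_sub, h2, sub_zero, ← h3, formS_opQ, gradArg]

end Gradient

/-- Parametrize ξ as D_p Ad(hn)X. The first-order change of n₊ is `varNeg`, and orthogonality of D_p
and Ad(hn) turns the resulting pairing with X into a pairing with ξ. -/
theorem isLeftGradient_matrixCoeff (P : MvPolynomial (Fin m × Fin m) ℂ) (k : ℤ)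
    {R : CommAlgCat.{0} ℂ} {L : D.GPrime R} {h n n' : Matrix (Fin m) (Fin m) (LaurentSeries R)}
    (hL : D.IsFactorization L.1 h n n') :
    D.IsLeftGradient (D.matrixCoeff P k) R L
      (toLoop R (mapT (D.sh R) (D.Ad (h * n) (D.gradArg P k n)))) := by
  intro ξ y hy
  obtain ⟨Ξ, rfl⟩ := toLoop_surjective ξ
  have hhn := D.mul_mem_of_isFactorization hL
  obtain ⟨X, rfl⟩ := D.exists_surjective_param hhn Ξ
  obtain ⟨h', k', hL'⟩ := D.isFactorization_variation hL X
  have hn := (D.isFactorization_iff.1 hL).2.1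
  rw [← hy] at hL'
  have hev : evalAt (D.inf (eps R) (mapT (dualIncl R) (D.varNeg n X)) * n.map (dualIncl R)) P =
      dualIncl R (evalAt n P) + eps R * dualIncl R (D.lieDeriv P n (D.varNeg n X)) := by
    rw [D.evalAt_inf_mul eps_mul_eps]
    have e1 := map_evalAt (S := LaurentSeries R) (S' := LaurentSeries (DualNumber R))
      (dualIncl R) n P
    have e2 := D.lieDeriv_mapT (S := LaurentSeries R) (S' := LaurentSeries (DualNumber R))
      (dualIncl R) P n (D.varNeg n X)
    rw [e1, ← e2]
  rw [matrixCoeff_apply, matrixCoeff_apply, D.muN_eq L hL]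
  have hmu : D.muN (R := DualNumber R) y =
    D.inf (eps R) (mapT (dualIncl R) (D.varNeg n X)) * n.map (dualIncl R) := D.muN_eq y hL'
  rw [pairing_toLoop, coeff_zero_formS_mapT_sh, D.formS_Ad_Ad hhn, ← D.coeff_lieDeriv_varNeg P k hn]
  have := congrArg (fun a => HahnSeries.coeff a k) hev
  simp only [HahnSeries.coeff_add, coeff_eps_mul_dualIncl] at this
  rw [← hmu] at this
  exact this

/-- In L = D_p(hn)B⁻¹, with B the inverse of the last factor, Ad(L⁻¹) cancels the shifted Ad(hn) of
the left gradient and leaves Ad(B). -/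
theorem isRightGradient_matrixCoeff (P : MvPolynomial (Fin m × Fin m) ℂ) (k : ℤ)
    {R : CommAlgCat.{0} ℂ} {L : D.GPrime R} {h n n' : Matrix (Fin m) (Fin m) (LaurentSeries R)}
    (hL : D.IsFactorization L.1 h n n') :
    D.IsRightGradient (D.matrixCoeff P k) R L
      (toLoop R (D.Ad (D.sConj (h.map (D.sh R)) * n') (mapT (D.sh R) (D.gradArg P k n)))) := by
  have key := (D.isLeftGradient_matrixCoeff P k hL).isRightGradient
  obtain ⟨hh, hn, hk, hL₁⟩ := D.isFactorization_iff.1 hL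
  have hB : D.sConj (h.map (D.sh R)) * n' ∈ D.GPts (LaurentSeries R) :=
    D.mul_mem_GPts (D.HPts_subset (D.sConj_mem_HPts (map_mem_pts _ hh))) (D.PosPts_subset hk)
  have hA : (h * n).map (D.sh R) ∈ D.GPts (LaurentSeries R) :=
    map_mem_pts _ (D.mul_mem_GPts (D.HPts_subset hh) (D.NegPts_subset hn))
  rw [← Matrix.map_mul, inv_eq_adjugate (D.det_GPts hB)] at hL₁
  rw [hL₁, Matrix.adjugate_mul_distrib, adjugate_adjugate_of_det (D.det_GPts hB),
    D.Ad_mul (D.adjugate_mem_GPts hA), mapT_Ad, D.Ad_adjugate_Ad hA] at key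
  exact key

theorem matrixCoeff_mem_smoothFunctions (P : MvPolynomial (Fin m × Fin m) ℂ) (k : ℤ) :
    D.matrixCoeff P k ∈ D.smoothFunctions := by
  refine ⟨D.isNatural_matrixCoeff P k, fun R L => ?_⟩
  obtain ⟨h, k', hL⟩ := D.exists_isFactorization L
  exact ⟨⟨_, D.isLeftGradient_matrixCoeff P k hL⟩, ⟨_, D.isRightGradient_matrixCoeff P k hL⟩⟩

theorem constraints_le_smoothFunctions : D.constraints ≤ D.smoothFunctions := by
  refine Algebra.adjoin_le ?_
  rintro _ ⟨P, k, rfl⟩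
  exact D.matrixCoeff_mem_smoothFunctions P k

end Setting

end DrinfeldSokolov

namespace DrinfeldSokolov

attribute [-instance] HahnSeries.powerSeriesAlgebra

namespace Setting

open LieAlgebra LieAlgebra.IsKilling

variable {𝔤 : Type*} [LieRing 𝔤] [LieAlgebra ℂ 𝔤] [FiniteDimensional ℂ 𝔤]
  [LieAlgebra.IsSemisimple ℂ 𝔤] {H : LieSubalgebra ℂ 𝔤} [H.IsCartanSubalgebra] {l m : ℕ}
  (D : Setting 𝔤 H l m)

/-! ### The r-matrix on the modes -/

/-- The operator `(1 - θ)⁻¹ P_𝔥` on the coefficient of `zᵏ`. -/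
def opE (k : ℤ) : Module.End ℂ 𝔤 :=
  H.toSubmodule.subtype ∘ₗ Ring.inverse (1 - D.theta k) ∘ₗ cartanProj H

/-- Rewrite (1 + θ)/(1 - θ) as 2/(1 - θ) - 1, so that the only inverse left is E = (1 - θ)⁻¹P_𝔥. -/
theorem rMode_eq (k : ℤ) :
    D.rMode k = D.projNeg - D.projPos - projCartan H + (2 : ℂ) • D.opE k := by
  have h : (1 + D.theta k) * Ring.inverse (1 - D.theta k) =
      (2 : ℂ) • Ring.inverse (1 - D.theta k) - 1 := by
    have : 1 + D.theta k = (2 : ℂ) • 1 - (1 - D.theta k) := by rw [two_smul]; abel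
    rw [this, sub_mul, Ring.mul_inverse_cancel _ (D.isUnit_one_sub_theta k), smul_mul_assoc,
      one_mul]
  rw [rMode, h]
  ext x
  simp only [LinearMap.add_apply, LinearMap.sub_apply, LinearMap.comp_apply, map_sub,
    LinearMap.smul_apply, map_smul, Module.End.one_apply, opE, projCartan, projNeg, projPos]
  abel

theorem opE_sub (k : ℤ) : D.opE k - D.p ^ k • (D.opS ∘ₗ D.opE k) = projCartan H := by
  have h := Ring.mul_inverse_cancel _ (D.isUnit_one_sub_theta k)
  ext x
  have := congrArg (H.toSubmodule.subtype) (LinearMap.congr_fun h (cartanProj H x))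
  simp only [LinearMap.sub_apply, LinearMap.comp_apply, LinearMap.smul_apply, opE, opS,
    projCartan, Submodule.subtype_apply, cartanProj_coe]
  simpa [sub_mul, theta, cox] using this

theorem opS_comp_opE (k : ℤ) : D.opS ∘ₗ D.opE k = D.opE k ∘ₗ D.opS := by
  have h : Commute D.cox.toLinearMap (1 - D.theta k) := by
    refine (Commute.one_right _).sub_right ?_
    exact (Commute.refl _).smul_right _
  have h' : Commute D.cox.toLinearMap (Ring.inverse (1 - D.theta k)) := by
    have hu := D.isUnit_one_sub_theta k
    rw [← hu.unit_spec, Ring.inverse_unit]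
    exact Commute.units_inv_right (by rwa [hu.unit_spec])
  ext x
  have := LinearMap.congr_fun h'.eq (cartanProj H x)
  simp only [LinearMap.comp_apply, opE, opS, Submodule.subtype_apply, cartanProj_coe]
  exact congrArg Subtype.val this

theorem opE_comp_projCartan (k : ℤ) : D.opE k ∘ₗ projCartan H = D.opE k := by
  ext x
  simp only [LinearMap.comp_apply, opE, projCartan, Submodule.subtype_apply, cartanProj_coe]

theorem projCartan_comp_opE (k : ℤ) : projCartan H ∘ₗ D.opE k = D.opE k := by
  ext x
  simp only [LinearMap.comp_apply, opE, projCartan, Submodule.subtype_apply]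
  exact congrArg Subtype.val (cartanProj_coe _)

section Mode

variable {R : Type} [CommRing R] [Algebra ℂ R]

/-- Since U' and V' have no 𝔫̄-component, their 𝔫-components contribute nothing to any pairing with
V', and r₊U' reduces to EU' = sEU. With E - P_𝔥 = pᵏsE and orthogonality of s, every Cartan term
becomes a combination of (EU, V) and (P_𝔥U, V), and these combinations cancel. -/
theorem mode_identity (k : ℤ) {U U' V V' : R ⊗[ℂ] 𝔤} (hU : D.negS R U' = 0)
    (hU' : D.carS R U' = D.opSS R U) (hV : D.negS R V' = 0) (hV' : D.carS R V' = D.opSS R V) :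
    D.formS R ((D.rMode k).baseChange R U) V + D.formS R ((D.rMode k).baseChange R U') V' -
      2 * D.formS R ((D.p ^ k • (1 : Module.End ℂ 𝔤)).baseChange R
        (((2⁻¹ : ℂ) • (D.rMode k + 1)).baseChange R U')) V -
      2 * D.formS R (((2⁻¹ : ℂ) • (D.rMode k - 1)).baseChange R
        ((D.p ^ (-k) • (1 : Module.End ℂ 𝔤)).baseChange R U)) V' =
    D.formS R (D.negS R U) V - D.formS R (D.posS R U) V := by
  have hc : ∀ (c : ℂ) (T : Module.End ℂ 𝔤) (X : R ⊗[ℂ] 𝔤),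
      (c • T).baseChange R X = algebraMap ℂ R c • T.baseChange R X := fun c T X => by
    rw [LinearMap.baseChange_smul, LinearMap.smul_apply, algebraMap_smul]
  have h1 : ∀ X : R ⊗[ℂ] 𝔤, (1 : Module.End ℂ 𝔤).baseChange R X = X := fun X => by
    rw [Module.End.one_eq_id, LinearMap.baseChange_id, LinearMap.id_apply]
  set E := (D.opE k).baseChange R with hE
  set q := algebraMap ℂ R (D.p ^ k) with hq
  set q' := algebraMap ℂ R (D.p ^ (-k)) with hq'
  have hp : q' * q = 1 := by
    rw [hq, hq', ← map_mul, ← zpow_add₀ D.p_ne_zero, neg_add_cancel, zpow_zero, map_one]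
  have h2 : algebraMap ℂ R 2⁻¹ * 2 = 1 := by
    rw [← map_ofNat (algebraMap ℂ R) 2, ← map_mul, inv_mul_cancel₀ two_ne_zero, map_one]
  have hr : ∀ X, (D.rMode k).baseChange R X =
      D.negS R X - D.posS R X - D.carS R X + (2 : R) • E X := fun X => by
    rw [rMode_eq, LinearMap.baseChange_add, LinearMap.add_apply, hc, map_ofNat,
      LinearMap.baseChange_sub, LinearMap.baseChange_sub]
    rfl
  have haux₁ : ∀ a b c e X : R ⊗[ℂ] 𝔤, a + c + b = X →
      a - b - c + (2 : R) • e + X = (2 : R) • (a + e) := by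
    rintro a b c e _ rfl
    module
  have haux₂ : ∀ a b c e X : R ⊗[ℂ] 𝔤, a + c + b = X → a + e - X = e - b - c := by
    rintro a b c e _ rfl
    abel
  have hrp : ∀ X, ((2⁻¹ : ℂ) • (D.rMode k + 1)).baseChange R X = D.negS R X + E X := fun X => by
    have : D.negS R X - D.posS R X - D.carS R X + (2 : R) • E X + X =
        (2 : R) • (D.negS R X + E X) := by
      exact haux₁ _ _ _ _ X (D.sum_projS X)
    rw [hc, LinearMap.baseChange_add, LinearMap.add_apply, h1, hr, this, smul_smul, h2, one_smul]
  have hrm : ∀ X, ((2⁻¹ : ℂ) • (D.rMode k - 1)).baseChange R X =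
      E X - D.posS R X - D.carS R X := fun X => by
    have := hrp X
    rw [show D.rMode k + 1 = (D.rMode k - 1) + (2 : ℂ) • 1 by rw [two_smul]; abel, smul_add,
      LinearMap.baseChange_add, LinearMap.add_apply, smul_smul, inv_mul_cancel₀ two_ne_zero,
      one_smul, h1] at this
    rw [eq_sub_of_add_eq this]
    exact haux₂ _ _ _ _ X (D.sum_projS X)
  have hES : ∀ X, E X - D.carS R X = q • D.opSS R (E X) := fun X => by
    have := congrArg (LinearMap.baseChange R) (D.opE_sub k)
    have := LinearMap.congr_fun this X
    rw [LinearMap.baseChange_sub, LinearMap.sub_apply, hc] at this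
    rw [← hE, ← hq, LinearMap.baseChange_comp, LinearMap.comp_apply] at this
    rw [← this]
    abel
  have hcarE : ∀ X, D.carS R (E X) = E X := fun X => baseChange_eq (D.projCartan_comp_opE k) X
  have hEU' : E U' = D.opSS R (E U) := by
    have e1 : E U' = E (D.carS R U') := (baseChange_eq (D.opE_comp_projCartan k) U').symm
    rw [e1, hU', hE, baseChange_baseChange_apply, baseChange_baseChange_apply, opS_comp_opE]
  have hpos : ∀ X, D.formS R (D.posS R X) V' = 0 := fun X => by rw [formS_posS, hV, map_zero]
  have hSV : ∀ X, D.formS R (D.opSS R X) V' = D.formS R (D.carS R X) V := fun X => by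
    rw [← carS_opSS, formS_carS, hV', formS_opSS, ← formS_carS, carS_carS]
  have hcarU' : D.formS R (D.carS R U') V' = D.formS R (D.carS R U) V := by rw [hU', hSV]
  have hqE : q * D.formS R (D.opSS R (E U)) V = D.formS R (E U) V - D.formS R (D.carS R U) V := by
    rw [← smul_eq_mul, ← LinearMap.smul_apply, ← map_smul, ← hES, map_sub, LinearMap.sub_apply]
  have hqE' : D.formS R (E U) V' - D.formS R (D.carS R U) V' = q * D.formS R (E U) V := by
    rw [← LinearMap.sub_apply, ← map_sub, hES, map_smul, LinearMap.smul_apply, hSV, hcarE,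
      smul_eq_mul]
  rw [hrp, hrm, hr, hr, hc, hc, h1, h1, hU, hEU']
  simp only [map_add, map_sub, map_smul, LinearMap.add_apply, LinearMap.sub_apply,
    LinearMap.smul_apply, smul_eq_mul, hpos, hcarU', hSV, hcarE, map_zero, LinearMap.zero_apply]
  have h3 : q' * D.formS R (E U) V' - q' * D.formS R (D.carS R U) V' = D.formS R (E U) V := by
    rw [← mul_sub, hqE', ← mul_assoc, hp, one_mul]
  linear_combination (-2) * hqE - 2 * h3

/-- All four pairings match mode k with mode -k, so the sum is taken mode by mode; finiteness of
supports permits combining the sums. -/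
theorem bracket_loops {X X' Y Y' : LoopAlg 𝔤 R} (hX : ∀ k, D.negS R (X'.coeff k) = 0)
    (hX' : ∀ k, D.carS R (X'.coeff k) = D.opSS R (X.coeff k))
    (hY : ∀ k, D.negS R (Y'.coeff k) = 0)
    (hY' : ∀ k, D.carS R (Y'.coeff k) = D.opSS R (Y.coeff k)) :
    pairing D.form (D.r X) Y + pairing D.form (D.r X') Y' -
      2 * pairing D.form (D.sigma (D.rPlus X')) Y - 2 * pairing D.form (D.rMinus (D.sigmaInv X)) Y' =
    pairing D.form (modeOp (fun _ => D.projNeg) X) Y -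
      pairing D.form (modeOp (fun _ => D.projPos) X) Y := by
  have hf := fun X Y : LoopAlg 𝔤 R => pairing_support_finite D.form X Y
  have hf2 : ∀ X Y : LoopAlg 𝔤 R, (Function.support fun k : ℤ =>
      2 * LinearMap.BilinForm.baseChange R D.form (X.coeff k) (Y.coeff (-k))).Finite := fun X Y =>
    (hf X Y).subset fun k hk h => hk (by simp only [h, mul_zero])
  have hadd : ∀ {f g : ℤ → R}, (Function.support f).Finite → (Function.support g).Finite →
      (Function.support fun k => f k + g k).Finite := fun hf hg =>
    (hf.union hg).subset (Function.support_add _ _)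
  have hsub : ∀ {f g : ℤ → R}, (Function.support f).Finite → (Function.support g).Finite →
      (Function.support fun k => f k - g k).Finite := fun hf hg =>
    (hf.union hg).subset (Function.support_sub _ _)
  unfold pairing
  rw [mul_finsum' _ _ (hf _ _), mul_finsum' _ _ (hf _ _), ← finsum_add_distrib (hf _ _) (hf _ _),
    ← finsum_sub_distrib (hadd (hf _ _) (hf _ _)) (hf2 _ _),
    ← finsum_sub_distrib (hsub (hadd (hf _ _) (hf _ _)) (hf2 _ _)) (hf2 _ _),
    ← finsum_sub_distrib (hf _ _) (hf _ _)]
  exact finsum_congr fun k => D.mode_identity k (hX k) (hX' k) (hY (-k)) (hY' (-k))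

end Mode

/-! ### The bracket of matrix coefficients -/

section Bracket

variable {S : Type} [CommRing S] [Algebra ℂ S]

theorem negS_opK (X : S ⊗[ℂ] 𝔤) : D.negS S (D.opK S X) = 0 := by
  rw [opK_apply, map_sub, map_add, negS_posS, negS_carS, negS_opUS, sub_zero, add_zero]

theorem carS_opK (X : S ⊗[ℂ] 𝔤) : D.carS S (D.opK S X) = -D.opSS S (D.opUS S X) := by
  rw [opK_apply, map_sub, map_add, carS_posS, carS_carS, carS_opUS, ← D.opUS_sub X]
  abel

/-- For `Z` in the image of `P_𝔫`, the triangular components of `n K n⁻¹ Z`. -/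
theorem Ad_opK_Ad {n : Matrix (Fin m) (Fin m) S} (hn : n ∈ D.NegPts S) {Z : S ⊗[ℂ] 𝔤}
    (hZ : D.posS S Z = Z) :
    D.posS S (D.Ad n (D.opK S (D.Ad n.adjugate Z))) = Z ∧
      D.carS S (D.Ad n (D.opK S (D.Ad n.adjugate Z))) = -D.opUS S (D.Ad n.adjugate Z) := by
  have hG := D.NegPts_subset hn
  set W := D.Ad n.adjugate Z with hW
  have h0 : D.posS S (D.opQ S W) = 0 := by
    rw [opQ_apply, map_add, posS_negS, posS_opUS, add_zero]
  have hK : D.Ad n (D.opK S W) = Z - D.Ad n (D.opQ S W) := by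
    rw [eq_sub_iff_add_eq', ← map_add, D.opQ_add_opK, hW, D.Ad_Ad_adjugate hG]
  rw [hK, map_sub, map_sub, D.posS_Ad_neg hn h0, D.carS_Ad_neg hn h0, hZ, sub_zero, opQ_apply,
    map_add, carS_negS, carS_opUS, zero_add]
  refine ⟨rfl, ?_⟩
  rw [← hZ, carS_posS, zero_sub]

/-- With B = K Ad(n⁻¹)Z and B' likewise for Z', invariance gives (x, y) = (B, B'). Neither has an
𝔫̄-component, so only Cartan parts contribute, and these are s of the Cartan parts of x and y. Hence
(x, y) = (P_𝔥x, y) and (P_𝔫̄x, y) = -(P_𝔫x, y). Finally P_𝔫x = Ad(h)Z, and the torus factor drops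
out. -/
theorem formS_negS_eq {h n : Matrix (Fin m) (Fin m) S} (hh : h ∈ D.HPts S) (hn : n ∈ D.NegPts S)
    {Z Z' : S ⊗[ℂ] 𝔤} (hZ : D.posS S Z = Z) (hZ' : D.posS S Z' = Z') :
    let x := D.Ad (h * n) (D.opK S (D.Ad n.adjugate Z))
    let y := D.Ad (h * n) (D.opK S (D.Ad n.adjugate Z'))
    D.formS S (D.negS S x) y - D.formS S (D.posS S x) y =
      -2 * D.formS S Z (D.Ad n (D.opK S (D.Ad n.adjugate Z'))) := by
  intro x y
  have hhG := D.HPts_subset hh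
  have hnG := D.NegPts_subset hn
  obtain ⟨h1, h2⟩ := D.Ad_opK_Ad hn hZ
  obtain ⟨-, h2'⟩ := D.Ad_opK_Ad hn hZ'
  set B := D.opK S (D.Ad n.adjugate Z) with hB
  set B' := D.opK S (D.Ad n.adjugate Z') with hB'
  have hx : x = D.Ad h (D.Ad n B) := D.Ad_mul hnG _
  have hy : y = D.Ad h (D.Ad n B') := D.Ad_mul hnG _
  have hcx : D.opSS S x = D.carS S B := by
    rw [← opSS_carS, hx, D.carS_Ad_cartan hh, h2, hB, carS_opK, map_neg]
  have hcy : D.opSS S y = D.carS S B' := by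
    rw [← opSS_carS, hy, D.carS_Ad_cartan hh, h2', hB', carS_opK, map_neg]
  have hpx : D.posS S x = D.Ad h Z := by rw [hx, D.posS_Ad_cartan hh, h1]
  have hpy : D.formS S (D.posS S x) y = D.formS S Z (D.Ad n B') := by
    rw [hpx, hy, D.formS_Ad_Ad hhG]
  have hxy : D.formS S x y = D.formS S (D.carS S x) y := by
    calc D.formS S x y = D.formS S B B' := by
          rw [hx, hy, D.formS_Ad_Ad hhG, D.formS_Ad_Ad hnG]
      _ = D.formS S (D.carS S B) (D.carS S B') := by
        conv_lhs => rw [← D.sum_projS B]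
        have e1 : D.negS S B = 0 := D.negS_opK _
        have e2 : D.negS S B' = 0 := D.negS_opK _
        rw [map_add, map_add, LinearMap.add_apply, LinearMap.add_apply, formS_posS, e1, e2,
          map_zero, map_zero, LinearMap.zero_apply, add_zero, zero_add, ← formS_carS, carS_carS]
      _ = D.formS S (D.carS S x) y := by
        rw [← hcx, ← hcy, formS_opSS, ← formS_carS, carS_carS]
  have hsum : D.formS S x y = D.formS S (D.negS S x) y + D.formS S (D.carS S x) y +
      D.formS S (D.posS S x) y := by
    rw [← LinearMap.add_apply, ← LinearMap.add_apply, ← map_add, ← map_add, D.sum_projS]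
  rw [← hpy]
  linear_combination hxy - hsum

end Bracket

/-- The explicit gradients satisfy the two conditions of `bracket_loops`: the right ones are Ad of
an element of HN applied to values of K, and their Cartan parts are s of those of the left ones. The
result no longer involves h₊ or n₋. -/
theorem bracket_matrixCoeff (P Q : MvPolynomial (Fin m × Fin m) ℂ) (k k' : ℤ)
    (R : CommAlgCat.{0} ℂ) (L : D.GPrime R) :
    D.bracket (D.matrixCoeff P k) (D.matrixCoeff Q k') R L =
      -2 * (D.formS _ (D.gradCoeff P k (D.muN L))
        (D.Ad (D.muN L) (D.gradArg Q k' (D.muN L)))).coeff 0 := by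
  obtain ⟨h, n', hL⟩ := D.exists_isFactorization L
  set n := D.muN L
  obtain ⟨hh, hn, hk, -⟩ := D.isFactorization_iff.1 hL
  have hhG := D.HPts_subset hh
  have hnG := D.NegPts_subset hn
  have ha := D.sConj_mem_HPts (map_mem_pts (D.sh R) hh)
  have hneg : ∀ P k j, D.negS R ((toLoop R (D.Ad (D.sConj (h.map (D.sh R)) * n')
      (mapT (D.sh R) (D.gradArg P k n)))).coeff j) = 0 := fun P k j => by
    have h0 : D.negS _ (mapT (D.sh R) (D.gradArg P k n)) = 0 := by
      rw [← mapT_baseChange, gradArg, negS_opK, map_zero]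
    rw [← toLoop_baseChange_coeff, D.Ad_mul (D.PosPts_subset hk), D.negS_Ad_cartan ha,
      D.negS_Ad_pos hk h0, map_zero, map_zero, HahnSeries.coeff_zero]
  have hcar : ∀ P k j, D.carS R ((toLoop R (D.Ad (D.sConj (h.map (D.sh R)) * n')
      (mapT (D.sh R) (D.gradArg P k n)))).coeff j) =
      D.opSS R ((toLoop R (mapT (D.sh R) (D.Ad (h * n) (D.gradArg P k n)))).coeff j) :=
      fun P k j => by
    have h0 : D.negS _ (mapT (D.sh R) (D.gradArg P k n)) = 0 := by
      rw [← mapT_baseChange, gradArg, negS_opK, map_zero]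
    rw [← toLoop_baseChange_coeff, ← toLoop_baseChange_coeff, D.Ad_mul (D.PosPts_subset hk),
      D.carS_Ad_cartan ha, D.carS_Ad_pos hk h0, ← mapT_baseChange, ← mapT_baseChange,
      D.Ad_mul hnG, ← opSS_carS, D.carS_Ad_cartan hh, gradArg,
      (D.Ad_opK_Ad hn (D.posS_gradCoeff P k n)).2, carS_opK]
    simp only [map_neg]
  have key := D.bracket_loops (hneg P k) (hcar P k) (hneg Q k') (hcar Q k')
  rw [bracket, (D.isLeftGradient_matrixCoeff P k hL).eq, (D.isLeftGradient_matrixCoeff Q k' hL).eq,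
    (D.isRightGradient_matrixCoeff P k hL).eq, (D.isRightGradient_matrixCoeff Q k' hL).eq]
  refine key.trans ?_
  have := D.formS_negS_eq hh hn (D.posS_gradCoeff P k n) (D.posS_gradCoeff Q k' n)
  have := congrArg (fun a => HahnSeries.coeff a 0) this
  rw [modeOp_toLoop, modeOp_toLoop, pairing_toLoop, pairing_toLoop, ← mapT_baseChange,
    ← mapT_baseChange, coeff_zero_formS_mapT_sh, coeff_zero_formS_mapT_sh]
  simp only [HahnSeries.coeff_sub] at this
  refine this.trans ?_
  rw [← coeff_C_mul, map_neg, map_ofNat]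
  rfl

/-! ### The bracket of matrix coefficients is a matrix coefficient -/

/-- The regular function that gives the bracket of matrix coefficients. -/
def bracketPoly (P Q : MvPolynomial (Fin m × Fin m) ℂ) : MvPolynomial (Fin m × Fin m) ℂ :=
  -2 * D.formS _ (D.gradNeg P (genMat m))
    (D.Ad (genMat m) (D.opK _ (D.Ad (genMat m).adjugate (D.gradNeg Q (genMat m)))))

/-- The formula is made from the entries of a matrix and of its adjugate, so it makes sense for the
generic matrix, whose determinant is not 1, and commutes with specialization. -/
theorem evalAt_bracketPoly {S : Type} [CommRing S] [Algebra ℂ S]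
    (P Q : MvPolynomial (Fin m × Fin m) ℂ) (g : Matrix (Fin m) (Fin m) S) :
    evalAt g (D.bracketPoly P Q) = -2 * D.formS _ (D.gradNeg P g)
      (D.Ad g (D.opK _ (D.Ad g.adjugate (D.gradNeg Q g)))) := by
  rw [bracketPoly, map_mul, map_neg, map_ofNat, ← formS_mapT, gradNeg_mapT, mapT_Ad, mapT_opK,
    mapT_Ad, gradNeg_mapT, genMat_map_evalAt, adjugate_genMat_map_evalAt]

/-- The scalars z⁻ᵏ and z⁻ᵏ' come out of the two gradients by R((z))-linearity, and the constant
term becomes the coefficient of index k + k'. -/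
theorem bracket_matrixCoeff_eq (P Q : MvPolynomial (Fin m × Fin m) ℂ) (k k' : ℤ) :
    D.bracket (D.matrixCoeff P k) (D.matrixCoeff Q k') =
      D.matrixCoeff (D.bracketPoly P Q) (k + k') := by
  funext R L
  rw [bracket_matrixCoeff, matrixCoeff_apply, evalAt_bracketPoly, gradArg, gradCoeff, gradCoeff]
  simp only [map_smul, LinearMap.smul_apply, smul_eq_mul]
  rw [coeff_single_mul', coeff_single_mul', zero_sub, neg_neg, sub_neg_eq_add]
  have : (-2 : LaurentSeries R) = HahnSeries.C (-2 : R) := by rw [map_neg, map_ofNat]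
  rw [this, coeff_C_mul, add_comm k]

end Setting

end DrinfeldSokolov

namespace DrinfeldSokolov

attribute [-instance] HahnSeries.powerSeriesAlgebra

/-! ### Linearity of mode operators and the Leibniz rule for the bracket -/

section ModeOp

variable {𝔤 : Type*} [LieRing 𝔤] [LieAlgebra ℂ 𝔤] {R : Type} [CommRing R] [Algebra ℂ R]

theorem modeOp_add (T : ℤ → Module.End ℂ 𝔤) (X Y : LoopAlg 𝔤 R) :
    modeOp T (X + Y) = modeOp T X + modeOp T Y := by
  ext k
  exact map_add _ _ _

theorem modeOp_smul (T : ℤ → Module.End ℂ 𝔤) (c : R) (X : LoopAlg 𝔤 R) :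
    modeOp T (c • X) = c • modeOp T X := by
  ext k
  exact LinearMap.map_smul ((T k).baseChange R) c (X.coeff k)

theorem pairing_zero_right (B : LinearMap.BilinForm ℂ 𝔤) (X : LoopAlg 𝔤 R) :
    pairing B X 0 = 0 := by
  unfold pairing
  simp

end ModeOp

namespace Setting

open LieAlgebra LieAlgebra.IsKilling

variable {𝔤 : Type*} [LieRing 𝔤] [LieAlgebra ℂ 𝔤] [FiniteDimensional ℂ 𝔤]
  [LieAlgebra.IsSemisimple ℂ 𝔤] {H : LieSubalgebra ℂ 𝔤} [H.IsCartanSubalgebra] {l m : ℕ}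
  {D : Setting 𝔤 H l m}

/-! ### The bracket is a derivation in each argument -/

section

variable {R : CommAlgCat.{0} ℂ} {L : D.GPrime R} {φ ψ : D.FunFamily} {X Y : LoopAlg 𝔤 R}

theorem IsLeftGradient.add (hX : D.IsLeftGradient φ R L X) (hY : D.IsLeftGradient ψ R L Y) :
    D.IsLeftGradient (φ + ψ) R L (X + Y) := fun ξ y hy => by
  simp only [Pi.add_apply, hX ξ y hy, hY ξ y hy, pairing_add_left]
  ext <;> simp

theorem IsRightGradient.add (hX : D.IsRightGradient φ R L X) (hY : D.IsRightGradient ψ R L Y) :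
    D.IsRightGradient (φ + ψ) R L (X + Y) := fun ξ y hy => by
  simp only [Pi.add_apply, hX ξ y hy, hY ξ y hy, pairing_add_left]
  ext <;> simp

theorem IsLeftGradient.mul (hX : D.IsLeftGradient φ R L X) (hY : D.IsLeftGradient ψ R L Y) :
    D.IsLeftGradient (φ * ψ) R L (φ R L • Y + ψ R L • X) := fun ξ y hy => by
  simp only [Pi.mul_apply, hX ξ y hy, hY ξ y hy, pairing_add_left, pairing_smul_left]
  ext <;> (simp; try ring)

theorem IsRightGradient.mul (hX : D.IsRightGradient φ R L X) (hY : D.IsRightGradient ψ R L Y) :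
    D.IsRightGradient (φ * ψ) R L (φ R L • Y + ψ R L • X) := fun ξ y hy => by
  simp only [Pi.mul_apply, hX ξ y hy, hY ξ y hy, pairing_add_left, pairing_smul_left]
  ext <;> (simp; try ring)

theorem isLeftGradient_algebraMap (c : ℂ) :
    D.IsLeftGradient (algebraMap ℂ D.FunFamily c) R L 0 := fun ξ y hy => by
  rw [pairing_zero_left]
  simp only [Pi.algebraMap_apply]
  ext <;> simp [TrivSqZeroExt.algebraMap_eq_inl']

theorem isRightGradient_algebraMap (c : ℂ) :
    D.IsRightGradient (algebraMap ℂ D.FunFamily c) R L 0 := fun ξ y hy => by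
  rw [pairing_zero_left]
  simp only [Pi.algebraMap_apply]
  ext <;> simp [TrivSqZeroExt.algebraMap_eq_inl']

end

variable {φ φ' ψ : D.FunFamily}

theorem isLeftGradient_leftGradient (hφ : φ ∈ D.smoothFunctions) (R : CommAlgCat.{0} ℂ)
    (L : D.GPrime R) : D.IsLeftGradient φ R L (D.leftGradient φ R L) :=
  Classical.epsilon_spec (p := D.IsLeftGradient φ R L) (hφ.2 R L).1

theorem isRightGradient_rightGradient (hφ : φ ∈ D.smoothFunctions) (R : CommAlgCat.{0} ℂ)
    (L : D.GPrime R) : D.IsRightGradient φ R L (D.rightGradient φ R L) :=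
  Classical.epsilon_spec (p := D.IsRightGradient φ R L) (hφ.2 R L).2

theorem leftGradient_add (hφ : φ ∈ D.smoothFunctions) (hψ : ψ ∈ D.smoothFunctions)
    (R : CommAlgCat.{0} ℂ) (L : D.GPrime R) :
    D.leftGradient (φ + ψ) R L = D.leftGradient φ R L + D.leftGradient ψ R L :=
  ((isLeftGradient_leftGradient hφ R L).add (isLeftGradient_leftGradient hψ R L)).eq

theorem rightGradient_add (hφ : φ ∈ D.smoothFunctions) (hψ : ψ ∈ D.smoothFunctions)
    (R : CommAlgCat.{0} ℂ) (L : D.GPrime R) :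
    D.rightGradient (φ + ψ) R L = D.rightGradient φ R L + D.rightGradient ψ R L :=
  ((isRightGradient_rightGradient hφ R L).add (isRightGradient_rightGradient hψ R L)).eq

theorem leftGradient_mul (hφ : φ ∈ D.smoothFunctions) (hψ : ψ ∈ D.smoothFunctions)
    (R : CommAlgCat.{0} ℂ) (L : D.GPrime R) :
    D.leftGradient (φ * ψ) R L = φ R L • D.leftGradient ψ R L + ψ R L • D.leftGradient φ R L :=
  ((isLeftGradient_leftGradient hφ R L).mul (isLeftGradient_leftGradient hψ R L)).eq

theorem rightGradient_mul (hφ : φ ∈ D.smoothFunctions) (hψ : ψ ∈ D.smoothFunctions)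
    (R : CommAlgCat.{0} ℂ) (L : D.GPrime R) :
    D.rightGradient (φ * ψ) R L = φ R L • D.rightGradient ψ R L + ψ R L • D.rightGradient φ R L :=
  ((isRightGradient_rightGradient hφ R L).mul (isRightGradient_rightGradient hψ R L)).eq

theorem bracket_add_left (hφ : φ ∈ D.smoothFunctions) (hφ' : φ' ∈ D.smoothFunctions) :
    D.bracket (φ + φ') ψ = D.bracket φ ψ + D.bracket φ' ψ := by
  funext R L
  simp only [bracket, Pi.add_apply, leftGradient_add hφ hφ', rightGradient_add hφ hφ', r, rPlus,
    rMinus, sigma, sigmaInv, modeOp_add, pairing_add_left]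
  ring

theorem bracket_add_right (hφ : φ ∈ D.smoothFunctions) (hφ' : φ' ∈ D.smoothFunctions) :
    D.bracket ψ (φ + φ') = D.bracket ψ φ + D.bracket ψ φ' := by
  funext R L
  simp only [bracket, Pi.add_apply, leftGradient_add hφ hφ', rightGradient_add hφ hφ',
    pairing_add_right]
  ring

theorem bracket_mul_left (hφ : φ ∈ D.smoothFunctions) (hφ' : φ' ∈ D.smoothFunctions) :
    D.bracket (φ * φ') ψ = φ * D.bracket φ' ψ + φ' * D.bracket φ ψ := by
  funext R L
  simp only [bracket, Pi.add_apply, Pi.mul_apply, leftGradient_mul hφ hφ',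
    rightGradient_mul hφ hφ', r, rPlus, rMinus, sigma, sigmaInv, modeOp_add, modeOp_smul,
    pairing_add_left, pairing_smul_left]
  ring

theorem bracket_mul_right (hφ : φ ∈ D.smoothFunctions) (hφ' : φ' ∈ D.smoothFunctions) :
    D.bracket ψ (φ * φ') = φ * D.bracket ψ φ' + φ' * D.bracket ψ φ := by
  funext R L
  simp only [bracket, Pi.add_apply, Pi.mul_apply, leftGradient_mul hφ hφ',
    rightGradient_mul hφ hφ', pairing_add_right, pairing_smul_right]
  ring

theorem bracket_algebraMap_right (c : ℂ) : D.bracket ψ (algebraMap ℂ D.FunFamily c) = 0 := by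
  funext R L
  simp only [bracket, (isLeftGradient_algebraMap (R := R) (L := L) c).eq,
    (isRightGradient_algebraMap (R := R) (L := L) c).eq, pairing_zero_right, Pi.zero_apply]
  ring

theorem bracket_algebraMap_left (c : ℂ) : D.bracket (algebraMap ℂ D.FunFamily c) ψ = 0 := by
  funext R L
  have h : ∀ T : ℤ → Module.End ℂ 𝔤, modeOp T (0 : LoopAlg 𝔤 R) = 0 := fun T => by
    ext k
    exact map_zero _
  simp only [bracket, (isLeftGradient_algebraMap (R := R) (L := L) c).eq,
    (isRightGradient_algebraMap (R := R) (L := L) c).eq, r, rPlus, rMinus, sigma, sigmaInv, h,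
    pairing_zero_left, Pi.zero_apply]
  ring

variable (D) in
/-- Induction principle for brackets of constraints. -/
theorem bracket_mem_induction {p : D.FunFamily → Prop}
    (hgen : ∀ P Q k k', p (D.bracket (D.matrixCoeff P k) (D.matrixCoeff Q k'))) (h0 : p 0)
    (hadd : ∀ a b, p a → p b → p (a + b)) (hmul : ∀ φ ∈ D.constraints, ∀ a, p a → p (φ * a))
    {φ ψ : D.FunFamily} (hφ : φ ∈ D.constraints) (hψ : ψ ∈ D.constraints) :
    p (D.bracket φ ψ) := by
  have hs := D.constraints_le_smoothFunctions
  induction hφ using Algebra.adjoin_induction with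
  | algebraMap c => rw [bracket_algebraMap_left]; exact h0
  | add x y hx hy h1 h2 => rw [bracket_add_left (hs hx) (hs hy)]; exact hadd _ _ h1 h2
  | mul x y hx hy h1 h2 =>
    rw [bracket_mul_left (hs hx) (hs hy)]
    exact hadd _ _ (hmul x hx _ h2) (hmul y hy _ h1)
  | mem x hx =>
    obtain ⟨P, k, rfl⟩ := hx
    induction hψ using Algebra.adjoin_induction with
    | algebraMap c => rw [bracket_algebraMap_right]; exact h0
    | add x y hx hy h1 h2 => rw [bracket_add_right (hs hx) (hs hy)]; exact hadd _ _ h1 h2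
    | mul x y hx hy h1 h2 =>
      rw [bracket_mul_right (hs hx) (hs hy)]
      exact hadd _ _ (hmul x hx _ h2) (hmul y hy _ h1)
    | mem x hx =>
      obtain ⟨Q, k', rfl⟩ := hx
      exact hgen P Q k k'

variable (D) in
theorem isPoissonSubalgebra_constraints : D.IsPoissonSubalgebra D.constraints :=
  ⟨D.constraints_le_smoothFunctions, fun _ hφ _ hψ =>
    D.bracket_mem_induction (p := fun a => a ∈ D.constraints)
      (fun P Q k k' => by
        rw [bracket_matrixCoeff_eq]
        exact D.matrixCoeff_mem _ _)
      (zero_mem _) (fun _ _ => add_mem) (fun _ hφ _ => mul_mem hφ) hφ hψ⟩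

end Setting

end DrinfeldSokolov

namespace DrinfeldSokolov

attribute [-instance] HahnSeries.powerSeriesAlgebra

namespace Setting

open LieAlgebra LieAlgebra.IsKilling

variable {𝔤 : Type*} [LieRing 𝔤] [LieAlgebra ℂ 𝔤] [FiniteDimensional ℂ 𝔤]
  [LieAlgebra.IsSemisimple ℂ 𝔤] {H : LieSubalgebra ℂ 𝔤} [H.IsCartanSubalgebra] {l m : ℕ}
  (D : Setting 𝔤 H l m)

/-! ### The adjoint action of the exponential of a simple root vector -/

theorem adC_mul {γ γ' : Matrix (Fin m) (Fin m) ℂ} (hγ' : γ' ∈ lieGroupSet D.ρ) (x : 𝔤) :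
    D.adC (γ * γ') x = D.adC γ (D.adC γ' x) := by
  rw [D.adC_apply γ, D.ρ_adC hγ', D.adC_apply, Matrix.adjugate_mul_distrib]
  simp only [mul_assoc]

/-- The series exp(ad x)y breaks off after the quadratic term; this suffices for strings through a
simple root. -/
theorem adC_exp_eq {x y : 𝔤} (h : ⁅x, ⁅x, ⁅x, y⁆⁆⁆ = 0) :
    D.adC (NormedSpace.exp (D.ρ x)) y = y + ⁅x, y⁆ + (2⁻¹ : ℂ) • ⁅x, ⁅x, y⁆⁆ := by
  refine (Module.forall_dual_apply_eq_zero_iff ℂ _).1 (fun ℓ => ?_) |> sub_eq_zero.1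
  have h1 := hasSum_exp_conj (D.ρ x) (D.ρ y) (ℓ ∘ₗ D.ρInv)
  simp only [adMat_pow_ρ, LinearMap.comp_apply, ρInv_ρ] at h1
  have h2 : HasSum (fun n : ℕ => ((n.factorial : ℂ))⁻¹ * ℓ ((LieAlgebra.ad ℂ 𝔤 x ^ n) y))
      (∑ n ∈ Finset.range 3, ((n.factorial : ℂ))⁻¹ * ℓ ((LieAlgebra.ad ℂ 𝔤 x ^ n) y)) :=
    hasSum_sum_of_ne_finset_zero fun n hn => by
      obtain ⟨k, rfl⟩ := Nat.exists_eq_add_of_le (by simpa using hn : 3 ≤ n)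
      rw [add_comm, pow_add, Module.End.mul_apply]
      simp [pow_succ, h]
  have h3 := h1.unique h2
  rw [← D.adjugate_exp, ← D.adC_apply] at h3
  rw [map_sub, h3]
  simp [Finset.sum_range_succ, pow_succ]

theorem coweight_of_ne {i t : Fin l} (h : i ≠ t) : D.simpleRoot i (D.coweight t) = 0 := by
  rw [D.simpleRoot_coweight, if_neg h]

theorem coweight_self (i : Fin l) : D.simpleRoot i (D.coweight i) = 1 := by
  rw [D.simpleRoot_coweight, if_pos rfl]

theorem simpleRoot_simpleCoroot (i : Fin l) : D.simpleRoot i (D.simpleCoroot i) = 2 :=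
  (rootSystem H).root_coroot_two _

/-- The sum of the weight spaces for the weights that contain a simple root other than `αᵢ` with a
positive coefficient. -/
def upper (i : Fin l) : Submodule ℂ 𝔤 :=
  weightSum H {χ | ∃ t, i ≠ t ∧ ∃ n : ℤ, 0 < n ∧ χ (D.coweight t) = n}

/-- A weight with a positive coefficient on some simple root is nonzero, and all its coefficients
share one sign. -/
theorem upper_le (i : Fin l) : D.upper i ≤ nilPos D.base := by
  refine iSup₂_le ?_
  rintro χ ⟨t, -, n, hn, hχ⟩ z hz
  have hχ0 : χ.IsNonZero := fun h0 => by
    have h1 : (χ : H → ℂ) = 0 := h0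
    rw [h1] at hχ
    have : (n : ℂ) = 0 := hχ.symm
    exact hn.ne' (by exact_mod_cast this)
  let j : H.root := ⟨χ, by simpa using hχ0⟩
  refine mem_weightSum (S := posWeights D.base) ⟨j, ?_, rfl⟩ hz
  by_contra hj
  obtain ⟨n', h1, -, h2⟩ := D.exists_root_coweight j t
  have h3 : (rootSystem H).root j (D.coweight t) = (n : ℂ) := hχ
  rw [h3] at h1
  have : n = n' := by exact_mod_cast h1
  have := h2 hj
  omega

/-- Subtracting αᵢ does not alter the coefficients on the other simple roots, so one of them stays
positive. -/
theorem lie_mem_upper {i : Fin l} {y : 𝔤} (hy : y ∈ rootSpace H (-D.simpleRoot i : H → ℂ))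
    {w : 𝔤} (hw : w ∈ D.upper i) : ⁅y, w⁆ ∈ D.upper i := by
  suffices D.upper i ≤ (D.upper i).comap (LieAlgebra.ad ℂ 𝔤 y : 𝔤 →ₗ[ℂ] 𝔤) from this hw
  refine iSup₂_le ?_
  rintro χ ⟨t, ht, n, hn, hχ⟩ z hz
  have h1 := lie_mem_genWeightSpace_of_mem_genWeightSpace hy hz
  change ⁅y, z⁆ ∈ D.upper i
  by_cases h0 : ⁅y, z⁆ = 0
  · rw [h0]; exact Submodule.zero_mem _
  · have hne : LieModule.genWeightSpace 𝔤 (-D.simpleRoot i + χ : H → ℂ) ≠ ⊥ := fun hb => h0 (by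
      rw [hb] at h1; simpa using h1)
    let ψ : LieModule.Weight ℂ H 𝔤 := ⟨_, hne⟩
    refine mem_weightSum (χ := ψ) (S := {χ | ∃ t, i ≠ t ∧ ∃ n : ℤ, 0 < n ∧
      χ (D.coweight t) = n}) ⟨t, ht, n, hn, ?_⟩ h1
    change -D.simpleRoot i (D.coweight t) + χ (D.coweight t) = n
    rw [D.coweight_of_ne ht, hχ, neg_zero, zero_add]

/-- A positive root with no positive coefficient outside αᵢ is a multiple of αᵢ, hence αᵢ itself. -/
theorem exists_decomposition (i : Fin l) {z : 𝔤} (hz : z ∈ nilPos D.base) :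
    ∃ x ∈ rootSpace H (D.simpleRoot i : H → ℂ), ∃ w ∈ D.upper i, z = x + w := by
  suffices nilPos D.base ≤
      (rootSpace H (D.simpleRoot i : H → ℂ)).toSubmodule ⊔ D.upper i by
    obtain ⟨x, hx, w, hw, h⟩ := Submodule.mem_sup.1 (this hz)
    exact ⟨x, hx, w, hw, h.symm⟩
  refine iSup₂_le ?_
  rintro _ ⟨j, hj, rfl⟩
  by_cases h : ∃ t, i ≠ t ∧ ∃ n : ℤ, 0 < n ∧ (j.1 : H → ℂ) (D.coweight t) = n
  · exact le_sup_of_le_right fun z hz => mem_weightSum h hz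
  · refine le_sup_of_le_left ?_
    obtain ⟨f, hf, hht, -⟩ := D.exists_root_eq_sum j
    have hft : ∀ t, (rootSystem H).root j (D.coweight t) = f t := fun t => by
      rw [hf]
      simp [LinearMap.sum_apply, D.simpleRoot_coweight]
    have h0 : ∀ t, i ≠ t → f t = 0 := fun t ht => by
      obtain ⟨n, h1, h2, -⟩ := D.exists_root_coweight j t
      rw [hft] at h1
      have h3 : f t = n := by exact_mod_cast h1
      by_contra hne
      have := h2 hj
      exact h ⟨t, ht, f t, by omega, hft t⟩
    have h1 : (rootSystem H).root j = f i • D.simpleRoot i := by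
      rw [hf]
      exact Finset.sum_eq_single i (fun t _ ht => by rw [h0 t ht.symm, zero_smul]) (by simp)
    have h2 : D.base.height j = f i := by
      rw [hht]
      exact Finset.sum_eq_single i (fun t _ ht => h0 t ht.symm) (by simp)
    have : IsAddTorsionFree (Module.Dual ℂ H) := .of_isTorsionFree ℂ _
    have : IsAddTorsionFree H := .of_isTorsionFree ℂ _
    -- The only multiples of a simple root that are roots are ±1 times it; positivity excludes -1.
    have h3 := D.base.eq_one_or_neg_one_of_mem_support_of_smul_mem (D.simple i).1 (D.simple i).2
      (f i : ℂ) ⟨j, by rw [h1, Int.cast_smul_eq_zsmul]; rfl⟩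
    have h4 : f i = 1 := by
      rw [RootPairing.Base.isPos_iff, h2] at hj
      rcases h3 with h3 | h3
      · exact_mod_cast h3
      · have : f i = -1 := by exact_mod_cast h3
        omega
    rw [h4, one_smul] at h1
    have h5 : (j.1 : H → ℂ) = D.simpleRoot i :=
      congrArg (fun φ : Module.Dual ℂ H => (φ : H → ℂ)) h1
    rw [h5]

theorem exists_lie_eq_smul {i : Fin l} {x y : 𝔤} (hx : x ∈ rootSpace H (D.simpleRoot i : H → ℂ))
    (hy : y ∈ rootSpace H (-D.simpleRoot i : H → ℂ)) :
    ∃ μ : ℂ, ⁅x, y⁆ = μ • (D.simpleCoroot i : 𝔤) := by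
  have h1 : x ∈ rootSpace H ((D.simple i).1.1 : H → ℂ) := hx
  have h2 : y ∈ rootSpace H (-(D.simple i).1.1 : H → ℂ) := hy
  have hH : ⁅x, y⁆ ∈ H := by
    have := lie_mem_genWeightSpace_of_mem_genWeightSpace h1 h2
    rw [add_neg_cancel] at this
    change _ ∈ rootSpace H (0 : H → ℂ) at this
    rw [LieAlgebra.rootSpace_zero_eq] at this
    exact this
  have h3 : (⟨⁅x, y⁆, hH⟩ : H) ∈ corootSpace ((D.simple i).1.1 : H → ℂ) := by
    rw [mem_corootSpace]
    exact Submodule.subset_span ⟨x, h1, y, h2, rfl⟩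
  rw [← LieSubmodule.mem_toSubmodule, coe_corootSpace_eq_span_singleton,
    Submodule.mem_span_singleton] at h3
  obtain ⟨μ, h3⟩ := h3
  exact ⟨μ, (congrArg Subtype.val h3).symm⟩

theorem lie_coe_of_mem_rootSpace {i : Fin l} {y : 𝔤}
    (hy : y ∈ rootSpace H (-D.simpleRoot i : H → ℂ)) (h : H) :
    ⁅y, (h : 𝔤)⁆ = D.simpleRoot i h • y := by
  have := lie_eq_smul_of_mem_rootSpace hy h
  rw [← lie_skew, ← LieSubalgebra.coe_bracket_of_module, this, Pi.neg_apply, neg_smul, neg_neg]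

theorem adC_exp_coe {i : Fin l} {y : 𝔤} (hy : y ∈ rootSpace H (-D.simpleRoot i : H → ℂ)) (h : H) :
    D.adC (NormedSpace.exp (D.ρ y)) (h : 𝔤) = h + D.simpleRoot i h • y := by
  have h1 := D.lie_coe_of_mem_rootSpace hy h
  rw [D.adC_exp_eq (by simp [h1]), h1]
  simp

/-- Conjugation by the exponential of a root vector for `-αᵢ` acts on suitable elements of the
positive Borel subalgebra like the simple reflection. -/
theorem exists_adC_exp_add_coe {i : Fin l} {y z : 𝔤}
    (hy : y ∈ rootSpace H (-D.simpleRoot i : H → ℂ)) (hz : z ∈ nilPos D.base) :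
    ∃ μ : ℂ, ∀ h : H, D.simpleRoot i h = μ → ∃ w ∈ nilPos D.base,
      D.adC (NormedSpace.exp (D.ρ y)) (z + h) = w + (D.simpleReflection i h : H) := by
  obtain ⟨x, hx, w, hw, rfl⟩ := D.exists_decomposition i hz
  obtain ⟨μ, hμ⟩ := D.exists_lie_eq_smul hx hy
  have h1 : ⁅y, x⁆ = -(μ • (D.simpleCoroot i : 𝔤)) := by rw [← lie_skew, hμ]
  have h2 : ⁅y, ⁅y, x⁆⁆ = (-(2 * μ)) • y := by
    rw [h1, lie_neg, lie_smul, D.lie_coe_of_mem_rootSpace hy, D.simpleRoot_simpleCoroot, smul_smul,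
      neg_smul, mul_comm]
  -- The same exponential sends h to h + αᵢ(h)y. The two multiples of y cancel when αᵢ(h) = μ, and
  -- then h - μHᵢ is the simple reflection of h.
  have h3 : D.adC (NormedSpace.exp (D.ρ y)) x = x - μ • (D.simpleCoroot i : 𝔤) - μ • y := by
    rw [D.adC_exp_eq (by rw [h2, lie_smul, lie_self, smul_zero]), h2, h1]
    module
  have h4 := D.adC_exp_sub_mem (W := D.upper i) le_rfl (fun _ => D.lie_mem_upper hy) hw
  refine ⟨μ, fun h hh => ⟨D.adC (NormedSpace.exp (D.ρ y)) w + x, ?_, ?_⟩⟩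
  · have h5 := Submodule.add_mem _ (D.upper_le i h4) (D.upper_le i hw)
    have h6 := Submodule.sub_mem _ hz (D.upper_le i hw)
    rw [sub_add_cancel] at h5
    rw [add_sub_cancel_right] at h6
    exact Submodule.add_mem _ h5 h6
  · rw [map_add, map_add, h3, D.adC_exp_coe hy, D.simpleReflection_apply, hh]
    push_cast
    module

variable {y : Fin l → 𝔤}

theorem prod_adC_coweight (hy : ∀ i, y i ∈ rootSpace H (-D.simpleRoot i : H → ℂ)) {i : Fin l}
    {L : List (Fin l)} (hi : i ∉ L) :
    (L.map fun j => D.adC (NormedSpace.exp (D.ρ (y j)))).prod (D.coweight i : 𝔤) = D.coweight i := by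
  induction L with
  | nil => rfl
  | cons j L ih =>
    rw [List.mem_cons, not_or] at hi
    rw [List.map_cons, List.prod_cons, Module.End.mul_apply, ih hi.2, D.adC_exp_coe (hy j),
      D.coweight_of_ne (Ne.symm hi.1), zero_smul, add_zero]

theorem word_coweight {i : Fin l} {L : List (Fin l)} (hi : i ∉ L) :
    D.word L (D.coweight i) = D.coweight i := by
  induction L with
  | nil => rfl
  | cons j L ih =>
    rw [List.mem_cons, not_or] at hi
    rw [D.word_cons, LinearEquiv.mul_apply, ih hi.2, D.simpleReflection_apply,
      D.coweight_of_ne (Ne.symm hi.1), zero_smul, sub_zero]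

/-- The correction c is built from the right end of the list. At letter i it must bring αᵢ to the
value demanded by `exists_adC_exp_add_coe`. Adding a multiple of the i-th coweight achieves this
without disturbing earlier letters, since these differ from i and fix that coweight. -/
theorem exists_prod_adC_add_coe (hy : ∀ i, y i ∈ rootSpace H (-D.simpleRoot i : H → ℂ))
    {L : List (Fin l)} (hL : L.Nodup) {z : 𝔤} (hz : z ∈ nilPos D.base) :
    ∃ c : H, ∃ w ∈ nilPos D.base,
      (L.map fun j => D.adC (NormedSpace.exp (D.ρ (y j)))).prod (z + c) = w + (D.word L c : H) := by
  induction L with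
  | nil => exact ⟨0, z, hz, by simp [word]⟩
  | cons i L ih =>
    rw [List.nodup_cons] at hL
    obtain ⟨c, w, hw, h⟩ := ih hL.2
    obtain ⟨μ, hμ⟩ := D.exists_adC_exp_add_coe (hy i) hw
    -- The defect in the condition at letter i; the coweight has value 1 on αᵢ.
    let t := μ - D.simpleRoot i (D.word L c)
    have h1 : D.word L (c + t • D.coweight i) = D.word L c + t • D.coweight i := by
      rw [map_add, map_smul, D.word_coweight hL.1]
    obtain ⟨w', hw', h2⟩ := hμ (D.word L (c + t • D.coweight i)) (by
      rw [h1, map_add, map_smul, D.coweight_self]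
      simp [t])
    refine ⟨c + t • D.coweight i, w', hw', ?_⟩
    rw [D.word_cons, LinearEquiv.mul_apply, ← h2, List.map_cons, List.prod_cons,
      Module.End.mul_apply, h1]
    congr 1
    push_cast
    rw [← add_assoc, map_add, h, map_smul, D.prod_adC_coweight hy hL.1, add_assoc]

theorem prod_adC_coe_sub_mem (hn : ∀ i, y i ∈ nilNeg D.base) (L : List (Fin l)) (c : H) :
    (L.map fun j => D.adC (NormedSpace.exp (D.ρ (y j)))).prod (c : 𝔤) - c ∈ nilNeg D.base := by
  induction L with
  | nil => simp
  | cons i L ih =>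
    rw [List.map_cons, List.prod_cons, Module.End.mul_apply]
    set v := (L.map fun j => D.adC (NormedSpace.exp (D.ρ (y j)))).prod (c : 𝔤)
    have h1 : D.projPos v = 0 := by
      have := D.projPos_of_mem_nilNeg ih
      rwa [map_sub, D.projPos_of_mem_cartan c.2, sub_zero] at this
    have h2 := Submodule.add_mem _ (D.adC_expNeg ⟨y i, hn i, rfl⟩ h1) ih
    rwa [sub_add_sub_cancel] at h2

theorem mem_nilNeg_of_mem_rootSpace {i : Fin l} {x : 𝔤}
    (hx : x ∈ rootSpace H (-D.simpleRoot i : H → ℂ)) : x ∈ nilNeg D.base := by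
  have h : D.IsHomog (-1) x := by
    refine ⟨_, hx, ?_⟩
    simp [heightElt, D.simpleRoot_coweight]
  rw [D.mem_nilNeg, D.projNeg_homog h, if_pos (by norm_num)]

/-- The operator `P₊ + P_𝔥 - 1 / (1 - s)` on `𝔤`. -/
def opKC : Module.End ℂ 𝔤 := D.projPos + projCartan H - D.opU

/-- For a Coxeter product of exponentials of simple negative root vectors, the composition of the
operator `opKC` with conjugations maps the positive nilradical to the positive Borel subalgebra. -/
theorem projNeg_conj_opKC (hy : ∀ i, y i ∈ rootSpace H (-D.simpleRoot i : H → ℂ)) {z : 𝔤}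
    (hz : z ∈ nilPos D.base) {A B : Module.End ℂ 𝔤} (hBA : B * A = 1)
    (hA : A = ((List.finRange l).map fun j => D.adC (NormedSpace.exp (D.ρ (y j)))).prod) :
    D.projNeg (B (D.opKC (A z))) = 0 := by
  obtain ⟨c, w, hw, h⟩ := D.exists_prod_adC_add_coe hy (List.nodup_finRange l) hz
  have h1 := D.prod_adC_coe_sub_mem (fun i => D.mem_nilNeg_of_mem_rootSpace (hy i))
    (List.finRange l) c
  rw [← hA] at h h1
  rw [← D.cox_eq_word, map_add] at h
  -- Subtracting A c = c + ν from A(z + c) = w + sc exhibits the triangular components of A z.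
  obtain ⟨ν, hν, h2⟩ : ∃ ν ∈ nilNeg D.base, A (c : 𝔤) = c + ν := ⟨_, h1, by abel⟩
  have hAz : A z = w + (D.cox c : H) - c - ν := by rw [← h, h2]; abel
  have hS : (D.cox c : 𝔤) = D.opS c := by
    simp [opS, cartanProj_coe]
  have hU : D.opU (c : 𝔤) - D.opU (D.cox c : H) = c := by
    have := LinearMap.congr_fun D.opU_sub_opU_comp_opS (c : 𝔤)
    rwa [LinearMap.sub_apply, LinearMap.comp_apply, ← hS, projCartan_of_mem c.2] at this
  have hν0 : projCartan H ν = 0 := by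
    have := LinearMap.congr_fun D.projCartan_comp_projNeg ν
    rwa [LinearMap.comp_apply, D.mem_nilNeg.1 hν] at this
  have hw0 : projCartan H w = 0 := by
    have := LinearMap.congr_fun D.projCartan_comp_projPos w
    rwa [LinearMap.comp_apply, D.mem_nilPos.1 hw] at this
  have hUν : D.opU ν = 0 := by rw [← D.opU_comp_projCartan, LinearMap.comp_apply, hν0, map_zero]
  have hUw : D.opU w = 0 := by rw [← D.opU_comp_projCartan, LinearMap.comp_apply, hw0, map_zero]
  -- K deletes -ν, keeps w, and sends sc - c to sc - c + Uc - U(sc), which equals sc because Uc -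
  -- U(sc) = c.
  have hK : D.opKC (A z) = A (z + c) := by
    rw [map_add, h, hAz, opKC]
    simp only [LinearMap.sub_apply, LinearMap.add_apply, map_sub, map_add,
      D.projPos_of_mem_nilNeg hν, D.mem_nilPos.1 hw, D.projPos_of_mem_cartan (Subtype.prop _), hν0,
      hw0, hUν, hUw, projCartan_of_mem (Subtype.prop _)]
    rw [sub_eq_iff_eq_add.1 hU]
    abel
  have hB : B (A (z + c)) = z + c := LinearMap.congr_fun hBA (z + c)
  rw [hK, hB, map_add, D.projNeg_of_mem_nilPos hz, D.projNeg_of_mem_cartan c.2, add_zero]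

end Setting

end DrinfeldSokolov

namespace DrinfeldSokolov

attribute [-instance] HahnSeries.powerSeriesAlgebra

/-! ### Products over lists -/

theorem units_mul_list_prod_mul {M : Type*} [Monoid M] (u : Mˣ) (L : List M) :
    u * L.prod * ((u⁻¹ : Mˣ) : M) = (L.map fun a => u * a * ((u⁻¹ : Mˣ) : M)).prod := by
  induction L with
  | nil => simp
  | cons a L ih =>
    rw [List.prod_cons, List.map_cons, List.prod_cons, ← ih]
    simp [mul_assoc]

theorem list_reverse_prod_mul_prod {M ι : Type*} [Monoid M] {a b : ι → M}
    (h : ∀ i, a i * b i = 1) (L : List ι) : (L.map a).reverse.prod * (L.map b).prod = 1 := by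
  induction L with
  | nil => simp
  | cons i L ih =>
    rw [List.map_cons, List.map_cons, List.reverse_cons, List.prod_append, List.prod_singleton,
      List.prod_cons, mul_assoc, ← mul_assoc (a i), h, one_mul, ih]

namespace Setting

open LieAlgebra LieAlgebra.IsKilling

variable {𝔤 : Type*} [LieRing 𝔤] [LieAlgebra ℂ 𝔤] [FiniteDimensional ℂ 𝔤]
  [LieAlgebra.IsSemisimple ℂ 𝔤] {H : LieSubalgebra ℂ 𝔤} [H.IsCartanSubalgebra] {l m : ℕ}
  (D : Setting 𝔤 H l m)

/-! ### The base point -/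

theorem list_prod_exp_mem_lieGroupSet {ι : Type*} (y : ι → 𝔤) (L : List ι) :
    (L.map fun i => NormedSpace.exp (D.ρ (y i))).prod ∈ lieGroupSet D.ρ := by
  induction L with
  | nil =>
    have := D.exp_mem_lieGroupSet 0
    rwa [map_zero, NormedSpace.exp_zero] at this
  | cons i L ih =>
    rw [List.map_cons, List.prod_cons]
    exact D.mul_mem_lieGroupSet (D.exp_mem_lieGroupSet _) ih

theorem adC_one : D.adC 1 = 1 :=
  LinearMap.ext fun x => by rw [adC_apply, Matrix.adjugate_one, one_mul, mul_one, ρInv_ρ]; rfl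

theorem adC_list_prod {ι : Type*} (y : ι → 𝔤) (L : List ι) :
    D.adC (L.map fun i => NormedSpace.exp (D.ρ (y i))).prod =
      (L.map fun i => D.adC (NormedSpace.exp (D.ρ (y i)))).prod := by
  induction L with
  | nil => exact D.adC_one
  | cons i L ih =>
    rw [List.map_cons, List.map_cons, List.prod_cons, List.prod_cons, ← ih]
    exact LinearMap.ext fun x => D.adC_mul (D.list_prod_exp_mem_lieGroupSet y L) x

/-- If P vanishes on exp 𝔫̄, then so does γ ↦ P(exp(x)γ), by tangency. Peeling off factors this way
places products of exponentials in the Zariski closure of exp 𝔫̄ without a Baker–Campbell–Hausdorff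
formula. -/
theorem evalAt_list_prod_exp {L : List 𝔤} (hL : ∀ x ∈ L, x ∈ nilNeg D.base)
    (P : MvPolynomial (Fin m × Fin m) ℂ) (hP : VanishesOn (expSet D.ρ (nilNeg D.base)) P) :
    evalAt (L.map fun x => NormedSpace.exp (D.ρ x)).prod P = 0 := by
  induction L generalizing P with
  | nil => exact hP _ ⟨0, Submodule.zero_mem _, by simp⟩
  | cons x L ih =>
    rw [List.forall_mem_cons] at hL
    rw [List.map_cons, List.prod_cons]
    have h : ∀ γ : Matrix (Fin m) (Fin m) ℂ,
        evalAt γ (substMat ((NormedSpace.exp (D.ρ x)).map MvPolynomial.C * genMat m) P) =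
          evalAt (NormedSpace.exp (D.ρ x) * γ) P := fun γ => by
      have h1 : ((NormedSpace.exp (D.ρ x)).map (MvPolynomial.C (σ := Fin m × Fin m))).map
          (evalAt γ) = NormedSpace.exp (D.ρ x) := by
        ext i j
        simp
      rw [evalAt_substMat, Matrix.map_mul, h1, genMat_map_evalAt]
    rw [← h]
    exact ih hL.2 _ fun γ hγ => by
      rw [h]
      exact (D.tangentTo_expNeg hL.1).vanishesOn_exp_mul hP hγ

theorem adC_mem_rootSpace {w : H ≃ₗ[ℂ] H} {g : GL (Fin m) ℂ} (hg : Represents D.ρ g w)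
    {χ : H → ℂ} {x : 𝔤} (hx : x ∈ rootSpace H χ) :
    D.adC (g : Matrix (Fin m) (Fin m) ℂ) x ∈ rootSpace H (fun h => χ (w⁻¹ h)) := by
  refine LieModule.weightSpace_le_genWeightSpace 𝔤 _
    ((LieModule.mem_weightSpace _ _).2 fun h => ?_)
  have hG : (g : Matrix (Fin m) (Fin m) ℂ) ∈ lieGroupSet D.ρ := ⟨g, hg.1, rfl⟩
  have h1 : D.ρ (h : 𝔤) = (g : Matrix (Fin m) (Fin m) ℂ) * D.ρ ((w⁻¹ h : H) : 𝔤) *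
      ((g⁻¹ : GL (Fin m) ℂ) : Matrix (Fin m) (Fin m) ℂ) := by
    rw [hg.2, show w (w⁻¹ h) = h from w.apply_symm_apply h]
  have h2 : ⁅((w⁻¹ h : H) : 𝔤), x⁆ = χ (w⁻¹ h) • x := lie_eq_smul_of_mem_rootSpace hx (w⁻¹ h)
  apply D.ρ_injective
  have h3 := congrArg D.ρ h2
  rw [D.ρ_lie, map_smul] at h3
  change D.ρ ⁅(h : 𝔤), D.adC g x⁆ = _
  rw [D.ρ_lie, map_smul, D.ρ_adC hG, h1, ← D.coe_inv_of_mem_lieGroup hg.1, ← smul_mul_assoc,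
    ← mul_smul_comm, ← h3]
  have e : ((g⁻¹ : GL (Fin m) ℂ) : Matrix (Fin m) (Fin m) ℂ) * g = 1 := Units.inv_mul g
  generalize ((g⁻¹ : GL (Fin m) ℂ) : Matrix (Fin m) (Fin m) ℂ) = g' at e ⊢
  generalize D.ρ x = X
  generalize D.ρ ((w⁻¹ h : H) : 𝔤) = Y
  generalize (g : Matrix (Fin m) (Fin m) ℂ) = G at e ⊢
  have e1 : G * Y * g' * (G * X * g') = G * Y * (g' * G) * X * g' := by noncomm_ring
  have e2 : G * X * g' * (G * Y * g') = G * X * (g' * G) * Y * g' := by noncomm_ring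
  rw [e1, e2, e]
  noncomm_ring

/-- Conjugation by the representative of w₀ moves a root vector for -w₀(αᵢ) to the root -w₀²(αᵢ) =
-αᵢ, since w₀ is an involution, and it commutes with exponentials. -/
theorem IsBasePoint.exists_rootVectors {D : Setting 𝔤 H l m} {f : Matrix (Fin m) (Fin m) ℂ}
    (hf : D.IsBasePoint f) : ∃ y : Fin l → 𝔤,
      (∀ i, y i ∈ rootSpace H (-D.simpleRoot i : H → ℂ)) ∧
        f = ((List.finRange l).map fun i => NormedSpace.exp (D.ρ (y i))).reverse.prod := by
  obtain ⟨w, g, x, hw, hg, hx, rfl⟩ := hf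
  have hG : (g : Matrix (Fin m) (Fin m) ℂ) ∈ lieGroupSet D.ρ := ⟨g, hg.1, rfl⟩
  refine ⟨fun i => D.adC g (x i), fun i => ?_, ?_⟩
  · have h1 := D.adC_mem_rootSpace hg (hx i).2
    have h2 : (fun h => -(rootSystem H).root (D.simple i) (w⁻¹ (w⁻¹ h))) =
        (-D.simpleRoot i : H → ℂ) := funext fun h => by
      have h3 : w⁻¹ (w⁻¹ h) = h := by
        have := D.longest_mul_self hw
        rw [← LinearEquiv.mul_apply, ← mul_inv_rev, this, inv_one]
        rfl
      rw [h3]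
      rfl
    rwa [h2] at h1
  · rw [units_mul_list_prod_mul, List.map_reverse, List.ofFn_eq_map, List.map_map]
    congr 3
    funext i
    rw [Function.comp_apply, D.ρ_adC hG, ← D.coe_inv_of_mem_lieGroup hg.1, Matrix.exp_units_conj]

section

variable {D} {f : Matrix (Fin m) (Fin m) ℂ}

theorem IsBasePoint.mem_NegPts (hf : D.IsBasePoint f) (S : Type) [CommRing S] [Algebra ℂ S] :
    f.map (algebraMap ℂ S) ∈ D.NegPts S := by
  obtain ⟨y, hy, rfl⟩ := hf.exists_rootVectors
  refine map_algebraMap_mem_pts_of_mem_closure fun P hP => ?_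
  have := D.evalAt_list_prod_exp (L := ((List.finRange l).map y).reverse) (fun x hx => by
    obtain ⟨i, -, rfl⟩ := List.mem_map.1 (List.mem_reverse.1 hx)
    exact D.mem_nilNeg_of_mem_rootSpace (hy i)) P hP
  rwa [List.map_reverse, List.map_map] at this

/-- The factors of f occur in decreasing order, so f⁻¹ is the product of the exp(-yᵢ) in increasing
order, the order of the reflections in s = s₁⋯s_l. This match lets `projNeg_conj_opKC` apply with A
= Ad(f⁻¹). -/
theorem IsBasePoint.projNeg_adC (hf : D.IsBasePoint f) {z : 𝔤} (hz : z ∈ nilPos D.base) :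
    D.projNeg (D.adC f (D.opKC (D.adC f.adjugate z))) = 0 := by
  obtain ⟨y, hy, hfy⟩ := hf.exists_rootVectors
  have h1 : f * ((List.finRange l).map fun i => NormedSpace.exp (D.ρ (-y i))).prod = 1 := by
    rw [hfy]
    exact list_reverse_prod_mul_prod (fun i => by rw [map_neg, exp_mul_exp_neg]) _
  have hdet : f.det = 1 := by
    have := D.det_GPts (D.NegPts_subset (hf.mem_NegPts ℂ))
    simpa using this
  have h2 := adjugate_eq_of_mul_eq_one hdet h1
  refine D.projNeg_conj_opKC (y := fun i => -y i) (fun i => neg_mem (hy i)) hz ?_ ?_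
  · refine LinearMap.ext fun x => ?_
    have h3 : f.adjugate ∈ lieGroupSet D.ρ := by
      rw [h2]; exact D.list_prod_exp_mem_lieGroupSet (fun i => -y i) _
    rw [Module.End.mul_apply, ← D.adC_mul h3, Matrix.mul_adjugate, hdet, one_smul, adC_one]
  · rw [h2]
    exact D.adC_list_prod (fun i => -y i) _

/-- The constant loop `f` as a point of `𝒢'ₚ`. -/
theorem IsBasePoint.isFactorization (hf : D.IsBasePoint f) (R : Type) [CommRing R] [Algebra ℂ R] :
    D.IsFactorization (constLoop R f) 1 (constLoop R f) 1 := by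
  have h1 : ∀ Γ : Set (Matrix (Fin m) (Fin m) ℂ), 1 ∈ Γ →
      (1 : Matrix (Fin m) (Fin m) (LaurentSeries R)) ∈ pts Γ (LaurentSeries R) := fun Γ hΓ => by
    have := map_algebraMap_mem_pts_of_mem_closure (S := LaurentSeries R) fun P hP => hP 1 hΓ
    simpa using this
  have h2 : (1 : Matrix (Fin m) (Fin m) (LaurentSeries R)).map (shiftHom D.p_ne_zero R) = 1 := by
    simp
  have h3 : (constLoop R f).map (shiftHom D.p_ne_zero R) = constLoop R f := by
    ext1 i j
    exact (shiftHom D.p_ne_zero R).commutes (f i j)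
  refine D.isFactorization_iff.2 ⟨h1 _ ⟨0, Submodule.zero_mem _, by simp⟩, hf.mem_NegPts _,
    h1 _ ⟨0, Submodule.zero_mem _, by simp⟩, ?_⟩
  rw [h2, h3, D.sConj_one, one_mul, mul_one, inv_one, mul_one]

/-- The point of `𝒢'ₚ` given by the constant loop `f`. -/
def IsBasePoint.loop (hf : D.IsBasePoint f) (R : Type) [CommRing R] [Algebra ℂ R] : D.GPrime R :=
  ⟨constLoop R f, by
    rw [loopPoints_eq]
    exact D.NegPts_subset (hf.mem_NegPts _), 1, constLoop R f, 1, hf.isFactorization R⟩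

theorem IsBasePoint.muN_loop (hf : D.IsBasePoint f) (R : Type) [CommRing R] [Algebra ℂ R] :
    D.muN (hf.loop R) = constLoop R f :=
  D.muN_eq _ (hf.isFactorization R)

/-- The second argument has no 𝔫̄-component, and the first lies in S ⊗ 𝔫, which pairs only with S ⊗
𝔫̄. The complex operator identity extends to S because f is a constant matrix. -/
theorem IsBasePoint.formS_eq_zero (hf : D.IsBasePoint f) {S : Type} [CommRing S] [Algebra ℂ S]
    {X Y : S ⊗[ℂ] 𝔤} (hX : D.posS S X = X) (hY : D.posS S Y = Y) :
    D.formS S X (D.Ad (f.map (algebraMap ℂ S))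
      (D.opK S (D.Ad (f.map (algebraMap ℂ S)).adjugate Y))) = 0 := by
  have hK : ∀ Z, D.opK S Z = D.opKC.baseChange S Z := fun Z => by
    rw [opK_apply, opKC, LinearMap.baseChange_sub, LinearMap.baseChange_add]
    rfl
  have h0 : (((D.projNeg ∘ₗ D.adC f) ∘ₗ D.opKC) ∘ₗ D.adC f.adjugate) ∘ₗ D.projPos = 0 :=
    LinearMap.ext fun z => hf.projNeg_adC (D.projPos_mem z)
  have h1 : D.negS S (D.Ad (f.map (algebraMap ℂ S))
      (D.opK S (D.Ad (f.map (algebraMap ℂ S)).adjugate (D.posS S Y)))) = 0 := by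
    rw [hK, ← map_adjugate_algebraMap, D.Ad_map, D.Ad_map, baseChange_baseChange_apply,
      baseChange_baseChange_apply, baseChange_baseChange_apply, baseChange_baseChange_apply, h0,
      LinearMap.baseChange_zero, LinearMap.zero_apply]
  rw [← hX, D.formS_posS, ← hY, h1, map_zero]

/-- On generators the bracket at the loop f is -2 times a constant term that vanishes by
`formS_eq_zero`; vanishing at a point is stable under sums and under multiplication by constraints,
so the induction principle applies. -/
theorem IsBasePoint.bracket_eq_zero (hf : D.IsBasePoint f) (R : CommAlgCat.{0} ℂ)
    {φ ψ : D.FunFamily} (hφ : φ ∈ D.constraints) (hψ : ψ ∈ D.constraints) :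
    D.bracket φ ψ R (hf.loop R) = 0 := by
  refine D.bracket_mem_induction (p := fun a => a R (hf.loop R) = 0) (fun P Q k k' => ?_) rfl
    (fun a b ha hb => by rw [Pi.add_apply, Pi.add_apply, ha, hb, add_zero])
    (fun φ _ a ha => by rw [Pi.mul_apply, Pi.mul_apply, ha, mul_zero]) hφ hψ
  have h := hf.formS_eq_zero (S := LaurentSeries R)
    (D.posS_gradCoeff P k (D.muN (hf.loop R))) (D.posS_gradCoeff Q k' (D.muN (hf.loop R)))
  have hc : f.map (algebraMap ℂ (LaurentSeries R)) = D.muN (hf.loop R) := (hf.muN_loop R).symm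
  rw [hc] at h
  rw [D.bracket_matrixCoeff, gradArg, h, HahnSeries.coeff_zero, mul_zero]

variable (D) in
/-- The evaluation of the functions of the algebra `F` at a complex point of `𝒢'ₚ`. -/
def evalConstraints (L : D.GPrime ℂ) : D.constraints →ₐ[ℂ] ℂ :=
  ((Pi.evalAlgHom ℂ (fun _ : D.GPrime ℂ => ℂ) L).comp
    (Pi.evalAlgHom ℂ (fun R : CommAlgCat.{0} ℂ => D.GPrime R → R) (.of ℂ ℂ))).comp
      D.constraints.val

theorem constraints_algHom_ext {χ χ' : D.constraints →ₐ[ℂ] ℂ}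
    (h : ∀ P k, χ ⟨D.matrixCoeff P k, D.matrixCoeff_mem P k⟩ =
      χ' ⟨D.matrixCoeff P k, D.matrixCoeff_mem P k⟩) : χ = χ' := by
  refine AlgHom.adjoin_ext ?_
  rintro _ ⟨P, k, rfl⟩
  exact h P k

end

end Setting

end DrinfeldSokolov

end

/-! ### The system of first-class constraints -/

theorem theorem16 {𝔤 : Type*} [LieRing 𝔤] [LieAlgebra ℂ 𝔤] [FiniteDimensional ℂ 𝔤]
    [LieAlgebra.IsSemisimple ℂ 𝔤] (H : LieSubalgebra ℂ 𝔤) [H.IsCartanSubalgebra] (l m : ℕ)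
    (D : DrinfeldSokolov.Setting 𝔤 H l m) :
    (∀ (R : CommAlgCat.{0} ℂ) (L : D.GPrime R)
        (hPlus nPlus nMinus : Matrix (Fin m) (Fin m) (LaurentSeries R)),
        D.IsFactorization L.1 hPlus nPlus nMinus → D.muN L = nPlus) ∧
    D.IsPoissonSubalgebra D.constraints ∧
    ∀ f : Matrix (Fin m) (Fin m) ℂ, D.IsBasePoint f →
      ∃ χ : D.constraints →ₐ[ℂ] ℂ,
        (∀ (χ' : D.constraints →ₐ[ℂ] ℂ), χ' = χ ↔
          ∀ (P : MvPolynomial (Fin m × Fin m) ℂ) (k : ℤ),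
            χ' ⟨D.matrixCoeff P k, D.matrixCoeff_mem P k⟩ =
              (DrinfeldSokolov.evalEntries (DrinfeldSokolov.constHom ℂ)
                (DrinfeldSokolov.constLoop ℂ f) P).coeff k) ∧
        D.IsFirstClassSystem D.constraints χ := by
  refine ⟨fun R L _ _ _ hL => D.muN_eq L hL, D.isPoissonSubalgebra_constraints, fun f hf => ?_⟩
  have hval : ∀ P k, D.evalConstraints (hf.loop ℂ) ⟨D.matrixCoeff P k, D.matrixCoeff_mem P k⟩ =
      (DrinfeldSokolov.evalEntries (DrinfeldSokolov.constHom ℂ)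
        (DrinfeldSokolov.constLoop ℂ f) P).coeff k := fun P k =>
    congrArg (fun g => HahnSeries.coeff
      (DrinfeldSokolov.evalEntries (DrinfeldSokolov.constHom ℂ) g P) k) (hf.muN_loop ℂ)
  -- χ_f is evaluation at the constant loop f over ℂ. Uniqueness holds because the matrix
  -- coefficients generate F; the character property is the vanishing of brackets at that point.
  refine ⟨D.evalConstraints (hf.loop ℂ), fun χ' => ⟨?_, fun h => ?_⟩,
    D.isPoissonSubalgebra_constraints, fun φ ψ _ => hf.bracket_eq_zero (.of ℂ ℂ) φ.2 ψ.2⟩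
  · rintro rfl
    exact hval
  · exact DrinfeldSokolov.Setting.constraints_algHom_ext fun P k => (h P k).trans (hval P k).symm
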